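/- Let $0<\alpha\le 2$, let $d>\alpha$ be an integer, and let $p\ge 2$ be a real number; if $\alpha<2$, assume that $p=2^n$ for some $n\in\mathbb{N}$. For $h<d/2$ let $S_h(\mathbb{R}^d)$ be the constant of the Sobolev embedding $\dot H^h(\mathbb{R}^d)\subset L^{2d/(d-2h)}(\mathbb{R}^d)$, i.e. $$S_h(\mathbb{R}^d)^{-1}=\sup\Big\{\|f\|_{L^{2d/(d-2h)}}^2\;;\; f\in\dot H^h(\mathbb{R}^d),\ \int_{\mathbb{R}^d}|(-\Delta)^{h/2}f|^2=1\Big\},$$ where $(-\Delta)^{h/2}$ is the Fourier multiplier by $|\xi|^h$. Let $I=[0,T]$ with $0\le T<\infty$ or $I=[0,\infty)$, and consider on $I\times\mathbb{R}^d$ the Cauchy problem $$\partial_s\psi+(-\Delta)^{\alpha/2}\psi=-\operatorname{div}(\mathbf{v}\psi),\qquad \psi(0)=\psi_0. \tag{1}$$ *Setting.* Let $r,r'\in[1,\infty]$ with $\frac1r+\frac1{r'}=1$. Here $L^1_{loc}(I;X)$ means integrability in time on $[0,t]$ for every $t\in I$ (similarly for $L^\infty_{loc}$). The field satisfies $\mathbf{v}\in(1+|x|)\cdot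 L^1_{loc}(I;L^\infty+L^{r'})$ and has a weak divergence $\operatorname{div}\mathbf{v}\in L^1_{loc}(I;L^{r'}_{loc})$. A solution of (1) is a function $\psi\in L^\infty_{loc}(I;L^1\cap L^r)$, with a bound valid at every time, such that for every $\varphi\in C_c^\infty(\mathbb{R}^d)$ and every $s\in I$ $$\int\psi(s)\varphi\,dx=\int\psi_0\varphi\,dx+\int_0^s\!\!\int\psi(\tau)\big(\mathbf{v}(\tau)\cdot\nabla\varphi-(-\Delta)^{\alpha/2}\varphi\big)\,dx\,d\tau,$$ and for which at least one of the following holds: (a) the field is Sobolev: $\nabla\mathbf{v}\in L^1_{loc}(I;L^{r'}_{loc})$; (b) the solution is regular at positive times: $\nabla\psi$ is bounded in $L^r(B_R)$ on $[s_0,t]$ for all $R>0$, $s_0>0$ and $t\in I$ (for instance, $\psi$ is smooth there), and $\psi(s)\to\psi_0$ in $L^1$ as $s\to0$. **Statement.** Write $(\cdot)_-$ for the negative part and suppose that $$(p-1)\,\|(\operatorname{div}\mathbf{v})_-\|_{L^\infty(I;L^{d/\alpha})}\le S_{\alpha/2}(\mathbb{R}^d).$$ Then every solution $\psi$ of (1)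 with $\psi_0\in L^1\cap L^p$ satisfies, for all $s\in I$, $$\|\psi(s)\|_{L^p}^p+S_{\alpha/2}(\mathbb{R}^d)\int_0^s\|\psi(\tau)\|_{L^\sigma}^p\,d\tau\le\|\psi_0\|_{L^p}^p,\qquad \sigma=\frac{dp}{d-\alpha},$$ and $\|\psi(s)\|_{L^q}\le\|\psi_0\|_{L^q}$ for every $q\in[1,p]$. If moreover $\operatorname{div}\mathbf{v}\ge0$, then $\|\psi(s)\|_{L^q}\le\|\psi_0\|_{L^q}$ for every $q\in[1,\infty]$ and $s\in I$ (the right-hand side may be $+\infty$). -/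

import Mathlib

open MeasureTheory Set Filter Topology
open scoped ENNReal NNReal FourierTransform SchwartzMap

noncomputable section

/-- The tempered distribution `u` is (integration against) the function `f`. -/
def IsFunctionRep {d : ℕ} (u : 𝓢'(EuclideanSpace ℝ (Fin d), ℂ))
    (f : EuclideanSpace ℝ (Fin d) → ℂ) : Prop :=
  LocallyIntegrable f volume ∧
    ∀ φ : 𝓢(EuclideanSpace ℝ (Fin d), ℂ),
      Integrable (fun x => φ x * f x) volume ∧ u φ = ∫ x, φ x * f x

/-- `∫ (2π|ξ|)^{2h} |g(ξ)|² dξ`. When `g` is the Fourier transform of `f`, in Mathlib's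
normalization `g(ξ) = ∫ f(x) exp(-2πi x·ξ) dx`, the Fourier multiplier of `(-Δ)^{h/2}` is
`(2π|ξ|)^h` and, by Plancherel, this is `∫ |(-Δ)^{h/2} f|²`. -/
def sobolevEnergy {d : ℕ} (h : ℝ) (g : EuclideanSpace ℝ (Fin d) → ℂ) : ℝ≥0∞ :=
  ∫⁻ ξ, ENNReal.ofReal ((2 * Real.pi * ‖ξ‖) ^ (2 * h) * ‖g ξ‖ ^ 2)

/-- `f` belongs to the homogeneous Sobolev space `Ḣ^h(ℝ^d)` and has Fourier transform `g`:
`f` is a tempered distribution given by a real function, its Fourier transform is a locally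
integrable function `g`, and `∫ |(-Δ)^{h/2} f|² < ∞`. -/
def IsHomSobolev {d : ℕ} (h : ℝ) (f : EuclideanSpace ℝ (Fin d) → ℝ)
    (g : EuclideanSpace ℝ (Fin d) → ℂ) : Prop :=
  (∃ u : 𝓢'(EuclideanSpace ℝ (Fin d), ℂ),
    IsFunctionRep u (fun x => (f x : ℂ)) ∧ IsFunctionRep (𝓕 u) g) ∧
  sobolevEnergy h g < ∞

/-- The Sobolev constant `S_h(ℝ^d)`, defined by
`S_h⁻¹ = sup { ‖f‖²_{L^{2d/(d-2h)}} ; f ∈ Ḣ^h, ∫ |(-Δ)^{h/2} f|² = 1 }`. -/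
def sobolevConst (d : ℕ) (h : ℝ) : ℝ≥0∞ :=
  (⨆ (f : EuclideanSpace ℝ (Fin d) → ℝ) (g : EuclideanSpace ℝ (Fin d) → ℂ)
    (_ : IsHomSobolev h f g) (_ : sobolevEnergy h g = 1),
    eLpNorm f (ENNReal.ofReal (2 * d / (d - 2 * h))) volume ^ 2)⁻¹

/-- `(-Δ)^{α/2} φ` for a test function `φ`: the Fourier multiplier `|ξ|^α`, which reads
`(2π|ξ|)^α` in Mathlib's normalization. The result is real since `φ` is real and the symbol
is even. -/
def fracLaplacian {d : ℕ} (α : ℝ) (φ : EuclideanSpace ℝ (Fin d) → ℝ)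
    (x : EuclideanSpace ℝ (Fin d)) : ℝ :=
  (𝓕⁻ (fun ξ : EuclideanSpace ℝ (Fin d) =>
    (((2 * Real.pi * ‖ξ‖) ^ α : ℝ) : ℂ) *
      𝓕 (fun y : EuclideanSpace ℝ (Fin d) => (φ y : ℂ)) ξ) x).re

/-- `φ ∈ C_c^∞(ℝ^d)`. -/
def IsTestFun {d : ℕ} (φ : EuclideanSpace ℝ (Fin d) → ℝ) : Prop :=
  ContDiff ℝ (⊤ : ℕ∞) φ ∧ HasCompactSupport φ

/-- `Du` is the weak derivative of `u` on `ℝ^d`. -/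
def HasWeakDeriv {d : ℕ} {F : Type*} [NormedAddCommGroup F] [NormedSpace ℝ F]
    (u : EuclideanSpace ℝ (Fin d) → F)
    (Du : EuclideanSpace ℝ (Fin d) → EuclideanSpace ℝ (Fin d) →L[ℝ] F) : Prop :=
  LocallyIntegrable u volume ∧ LocallyIntegrable Du volume ∧
    ∀ φ : EuclideanSpace ℝ (Fin d) → ℝ, IsTestFun φ → ∀ w : EuclideanSpace ℝ (Fin d),
      ∫ x, fderiv ℝ φ x w • u x = - ∫ x, φ x • Du x w

/-- `δ` is the weak divergence of the vector field `u` on `ℝ^d`. -/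
def HasWeakDiv {d : ℕ} (u : EuclideanSpace ℝ (Fin d) → EuclideanSpace ℝ (Fin d))
    (δ : EuclideanSpace ℝ (Fin d) → ℝ) : Prop :=
  LocallyIntegrable u volume ∧ LocallyIntegrable δ volume ∧
    ∀ φ : EuclideanSpace ℝ (Fin d) → ℝ, IsTestFun φ →
      ∫ x, fderiv ℝ φ x (u x) = - ∫ x, φ x * δ x

/-- The time interval of the problem: `[0, T]` if `T < ∞`, and `[0, ∞)` if `T = ∞`. -/
def timeInterval (T : ℝ≥0∞) : Set ℝ := {s | 0 ≤ s ∧ ENNReal.ofReal s ≤ T}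

/-- Lebesgue measure on `timeInterval T × ℝ^d`. -/
def spaceTime (d : ℕ) (T : ℝ≥0∞) : Measure (ℝ × EuclideanSpace ℝ (Fin d)) :=
  ((volume : Measure ℝ).restrict (timeInterval T)).prod volume

/-- `w ∈ L^1_loc(I; L^m_loc(ℝ^d))`, where `I` is the time interval. -/
def MemL1Loc {d : ℕ} {F : Type*} [NormedAddCommGroup F] (T m : ℝ≥0∞)
    (w : ℝ → EuclideanSpace ℝ (Fin d) → F) : Prop :=
  AEStronglyMeasurable (Function.uncurry w) (spaceTime d T) ∧
    ∀ t ∈ timeInterval T, ∀ R : ℝ,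
      ∫⁻ s in Ioc 0 t, eLpNorm (w s) m (volume.restrict (Metric.ball 0 R)) < ∞

/-- `w ∈ L^1_loc(I; L^m(ℝ^d))`, where `I` is the time interval. -/
def MemL1 {d : ℕ} {F : Type*} [NormedAddCommGroup F] (T m : ℝ≥0∞)
    (w : ℝ → EuclideanSpace ℝ (Fin d) → F) : Prop :=
  AEStronglyMeasurable (Function.uncurry w) (spaceTime d T) ∧
    ∀ t ∈ timeInterval T, ∫⁻ s in Ioc 0 t, eLpNorm (w s) m volume < ∞

/-- `v` is a transport field with divergence `δ`: `v ∈ (1 + |x|) · L^1_loc(I; L^∞ + L^m)` and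
`δ = div v ∈ L^1_loc(I; L^m_loc)`. -/
structure IsTransportField {d : ℕ} (T m : ℝ≥0∞)
    (v : ℝ → EuclideanSpace ℝ (Fin d) → EuclideanSpace ℝ (Fin d))
    (δ : ℝ → EuclideanSpace ℝ (Fin d) → ℝ) : Prop where
  measurable : AEStronglyMeasurable (Function.uncurry v) (spaceTime d T)
  growth : ∃ a b : ℝ → EuclideanSpace ℝ (Fin d) → EuclideanSpace ℝ (Fin d),
    MemL1 T ∞ a ∧ MemL1 T m b ∧
      ∀ᵐ z ∂(spaceTime d T), v z.1 z.2 = (1 + ‖z.2‖) • (a z.1 z.2 + b z.1 z.2)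
  div_mem : MemL1Loc T m δ
  weakDiv : ∀ᵐ s ∂((volume : Measure ℝ).restrict (timeInterval T)), HasWeakDiv (v s) (δ s)

/-- `v ∈ L^1_loc(I; W^{1,m}_loc(ℝ^d))`, expressed on the derivative in space. -/
def IsSobolevField {d : ℕ} (T m : ℝ≥0∞)
    (v : ℝ → EuclideanSpace ℝ (Fin d) → EuclideanSpace ℝ (Fin d)) : Prop :=
  ∃ Dv : ℝ → EuclideanSpace ℝ (Fin d) →
      EuclideanSpace ℝ (Fin d) →L[ℝ] EuclideanSpace ℝ (Fin d),
    MemL1Loc T m Dv ∧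
      ∀ᵐ s ∂((volume : Measure ℝ).restrict (timeInterval T)), HasWeakDeriv (v s) (Dv s)

/-- `ψ` is a distributional solution in `L^∞_loc(I; L^1 ∩ L^r)` of
`∂_s ψ + (-Δ)^{α/2} ψ = - div (v ψ)`, `ψ(0) = ψ₀`. -/
structure IsWeakSolution {d : ℕ} (α : ℝ) (T r : ℝ≥0∞)
    (v : ℝ → EuclideanSpace ℝ (Fin d) → EuclideanSpace ℝ (Fin d))
    (ψ₀ : EuclideanSpace ℝ (Fin d) → ℝ) (ψ : ℝ → EuclideanSpace ℝ (Fin d) → ℝ) : Prop where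
  measurable : AEStronglyMeasurable (Function.uncurry ψ) (spaceTime d T)
  measurable_slice : ∀ s ∈ timeInterval T, AEStronglyMeasurable (ψ s) volume
  bounded : ∀ t ∈ timeInterval T, ∃ C : ℝ≥0, ∀ s ∈ Icc 0 t,
    eLpNorm (ψ s) 1 volume ≤ C ∧ eLpNorm (ψ s) r volume ≤ C
  equation : ∀ φ : EuclideanSpace ℝ (Fin d) → ℝ, IsTestFun φ → ∀ s ∈ timeInterval T,
    ∫ x, ψ s x * φ x = (∫ x, ψ₀ x * φ x) +
      ∫ τ in (0 : ℝ)..s, ∫ x, ψ τ x * (fderiv ℝ φ x (v τ x) - fracLaplacian α φ x)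

/-- `ψ` is regular at positive times, `∇ψ ∈ L^∞_loc((0, T]; L^r_loc(ℝ^d))` (for example `ψ` is
smooth there), and `ψ(s) → ψ₀` in `L^1(ℝ^d)` as `s → 0`. -/
def IsRegularSolution {d : ℕ} (T r : ℝ≥0∞) (ψ₀ : EuclideanSpace ℝ (Fin d) → ℝ)
    (ψ : ℝ → EuclideanSpace ℝ (Fin d) → ℝ) : Prop :=
  (∃ Dψ : ℝ → EuclideanSpace ℝ (Fin d) → EuclideanSpace ℝ (Fin d) →L[ℝ] ℝ,
    AEStronglyMeasurable (Function.uncurry Dψ) (spaceTime d T) ∧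
    (∀ᵐ s ∂((volume : Measure ℝ).restrict (timeInterval T)), HasWeakDeriv (ψ s) (Dψ s)) ∧
    ∀ s₀ > 0, ∀ t ∈ timeInterval T, ∀ R : ℝ, ∃ C : ℝ≥0,
      ∀ᵐ s ∂((volume : Measure ℝ).restrict (Icc s₀ t)),
        eLpNorm (Dψ s) r (volume.restrict (Metric.ball 0 R)) ≤ C) ∧
  Tendsto (fun s => eLpNorm (fun x => ψ s x - ψ₀ x) 1 volume) (𝓝[timeInterval T] 0) (𝓝 0)

end

/-!
The `L^q` bounds are entropy estimates. Write `Λ = (-Δ)^{α/2}`, and let `β` be a convex entropy with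
derivative `b`. Formally

`d/ds ∫ β(ψ) + ∫ b(ψ) Λψ = ∫ (ψ b(ψ) - β(ψ)) (- div v)`.

For `β = |u|^q` with `q ≥ 2`, put `F = |u|^{q/2}`. Then `ψ b(ψ) - β(ψ) = (q - 1) F(ψ)²`. On the other
side `2 (F u - F w)² ≤ (b u - b w) (u - w)`, and since `Λ` is a superposition of symmetric jumps this
gives `∫ b(ψ) Λψ ≥ 2 ∫ |Λ^{1/2} F(ψ)|² ≥ 2 S ‖F(ψ)‖²`, with `S` the Sobolev constant and the norm
that of `L^{2d/(d-α)}`. By Hölder's inequality the right-hand side is at most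
`(q - 1) ‖(div v)₋‖_{L^{d/α}} ‖F(ψ)‖² ≤ S ‖F(ψ)‖²`. Half of the dissipation absorbs the divergence, and
the other half is the integral term of the conclusion, because `‖F(ψ)‖² = ‖ψ‖^q` with the norm of
`L^{dq/(d-α)}` on the right.

A weak solution has too little regularity for this computation. It is justified as follows.

* *Renormalization.* The mollified solution satisfies an equation which is absolutely continuous in
  time, with a source measured by the commutator of transport and mollification. As in the theory of
  DiPerna and Lions, adding `ψ div v` to the commutator gives a quantity which tends to zero in
  `L^1_loc`, whether the field or the solution is the one which has a weak derivative
  (`commutator_sobolev`, `commutator_regular`); therefore the contribution of the transport to the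
  entropy balance converges (`tendsto_integral_mul_mollifiedTransport`).
* *Nonlocal dissipation.* Subordination of Gaussians gives finite symmetric measures whose symbols
  stay below that of `Λ` and tend to it (`exists_isLevyApprox`), so that `Λ` is a limit of bounded
  jump operators. For these, the inequality between `F` and `b` is a pointwise statement, which
  also holds with a cutoff in space (`IsEntropy.localized_sq_sub_le`). Plancherel's theorem, Fatou's
  lemma and the Sobolev inequality (`sobolevConst_mul_le`) turn it into the lower bound
  `IsEntropy.two_mul_sobolevConst_mul_le` for the dissipation. The divergence is bounded by
  `ofReal_neg_integral_defect_le`.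
* *The cutoff.* The growth condition `v ∈ (1 + |x|) (L^∞ + L^{r'})` bounds the transport through a
  cutoff at the scale `1 / l` by the values of the solution at `|x| ≥ 1 / l`, and the nonlocal errors
  are of order `l^α`. Letting `l → 0` gives `IsRenormalizable.entropy_le`, and letting the initial
  time tend to zero for regular solutions gives `IsWeakSolution.entropy_le`.
* *Entropies.* The estimate is applied to `|u|^q`, continued linearly outside `[-k, k]`, so that only
  the `L^1` norm of the solution is needed. The inequality for `F` and the constant `q - 1` survive
  the truncation (`isEntropy_truncPow`), and `k → ∞` gives `IsWeakSolution.eLpNorm_rpow_le`.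

For `1 ≤ q < 2` the truncated squares suffice: if `1 < q`, `|u|^q` is a superposition of them in `k`,
and `|u|` is the limit of the truncated square divided by `2 k` as `k → 0`
(`lintegral_enorm_rpow_le_of_truncPow`, `lintegral_enorm_le_of_truncPow`). When `div v ≥ 0` the
smallness condition holds for every `q`, and `q = ∞` is reached through the integers
(`eLpNorm_top_le_of_forall_nat`).
-/

open MeasureTheory Set Filter Topology
open scoped ENNReal NNReal FourierTransform SchwartzMap

noncomputable section

variable {d : ℕ}

/-! ### Translations in Lebesgue spaces -/

section Translations

variable {F G : Type*} [NormedAddCommGroup F] [NormedAddCommGroup G]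

lemma measurePreserving_sub_const (z : EuclideanSpace ℝ (Fin d)) :
    MeasurePreserving (fun x : EuclideanSpace ℝ (Fin d) => x - z) volume volume :=
  measurePreserving_sub_right volume z

lemma eLpNorm_comp_sub_const {f : EuclideanSpace ℝ (Fin d) → F}
    (hf : AEStronglyMeasurable f volume) (p : ℝ≥0∞) (z : EuclideanSpace ℝ (Fin d)) :
    eLpNorm (fun x => f (x - z)) p volume = eLpNorm f p volume :=
  eLpNorm_comp_measurePreserving hf (measurePreserving_sub_const z)

lemma aestronglyMeasurable_comp_sub_const {f : EuclideanSpace ℝ (Fin d) → F}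
    (hf : AEStronglyMeasurable f volume) (z : EuclideanSpace ℝ (Fin d)) :
    AEStronglyMeasurable (fun x => f (x - z)) volume :=
  hf.comp_measurePreserving (measurePreserving_sub_const z)

/-- Continuity of translations in `L^p`, `p < ∞`. -/
lemma tendsto_eLpNorm_translate_sub {p : ℝ≥0∞} (hp1 : 1 ≤ p) (hp : p ≠ ∞)
    {f : EuclideanSpace ℝ (Fin d) → F} (hf : MemLp f p volume) :
    Tendsto (fun z => eLpNorm (fun x => f (x - z) - f x) p volume) (𝓝 0) (𝓝 0) := by
  have : Fact (1 ≤ p) := ⟨hp1⟩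
  let g : C(EuclideanSpace ℝ (Fin d), C(EuclideanSpace ℝ (Fin d), EuclideanSpace ℝ (Fin d))) :=
    ContinuousMap.curry ⟨fun a => a.2 - a.1, by fun_prop⟩
  have hg : ∀ z, MeasurePreserving (g z) volume volume := fun z => measurePreserving_sub_const z
  have h := Filter.Tendsto.compMeasurePreservingLp (p := p)
    (tendsto_const_nhds (x := hf.toLp f) (f := 𝓝 (0 : EuclideanSpace ℝ (Fin d))))
    (g.continuous.tendsto 0) hg (hg 0) hp
  have h0 : Lp.compMeasurePreserving (g 0) (hg 0) (hf.toLp f) = hf.toLp f := by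
    rw [Lp.toLp_compMeasurePreserving]
    congr 1
    funext x
    simp [g]
  rw [h0] at h
  exact (Lp.tendsto_Lp_iff_tendsto_eLpNorm''
    (fun z => (fun x => f (x - z))) (fun z => hf.comp_measurePreserving (hg z)) f hf).1 h

lemma lintegral_enorm_mul_enorm_le {α : Type*} [MeasurableSpace α] {μ : Measure α}
    {r r' : ℝ≥0∞} (hr : r⁻¹ + r'⁻¹ = 1) {f : α → F} {g : α → G}
    (hf : AEStronglyMeasurable f μ) (hg : AEStronglyMeasurable g μ) :
    ∫⁻ x, ‖f x‖ₑ * ‖g x‖ₑ ∂μ ≤ eLpNorm f r μ * eLpNorm g r' μ := by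
  have : ENNReal.HolderConjugate r r' := ENNReal.holderConjugate_iff.2 hr
  have h := eLpNorm_smul_le_mul_eLpNorm (p := r) (q := r') (r := 1) (μ := μ)
    (f := fun x => ‖g x‖) hg.norm (φ := fun x => ‖f x‖) hf.norm
  simpa [eLpNorm_one_eq_lintegral_enorm, enorm_mul] using h

lemma lintegral_translate_mul_le {r r' : ℝ≥0∞} (hr : r⁻¹ + r'⁻¹ = 1)
    {f : EuclideanSpace ℝ (Fin d) → F} {g : EuclideanSpace ℝ (Fin d) → G}
    (hf : AEStronglyMeasurable f volume) (hg : AEStronglyMeasurable g volume)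
    (y z : EuclideanSpace ℝ (Fin d)) :
    ∫⁻ x, ‖f (x - y)‖ₑ * ‖g (x - z)‖ₑ ≤ eLpNorm f r volume * eLpNorm g r' volume := by
  refine (lintegral_enorm_mul_enorm_le hr (aestronglyMeasurable_comp_sub_const hf y)
    (aestronglyMeasurable_comp_sub_const hg z)).trans_eq ?_
  rw [eLpNorm_comp_sub_const hf, eLpNorm_comp_sub_const hg]

lemma tendsto_lintegral_translate_sub {f : EuclideanSpace ℝ (Fin d) → F}
    (hf : MemLp f 1 volume) :
    Tendsto (fun z => ∫⁻ x, ‖f (x - z) - f x‖ₑ) (𝓝 0) (𝓝 0) := by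
  simpa [eLpNorm_one_eq_lintegral_enorm] using
    tendsto_eLpNorm_translate_sub le_rfl ENNReal.one_ne_top hf

lemma memLp_one_smul_of_conjugate [NormedSpace ℝ F] {α : Type*} [MeasurableSpace α] {μ : Measure α}
    {r r' : ℝ≥0∞} (hr : r⁻¹ + r'⁻¹ = 1)
    {f : α → ℝ} {g : α → F} (hf : MemLp f r μ) (hg : MemLp g r' μ) :
    MemLp (fun x => f x • g x) 1 μ := by
  have : ENNReal.HolderConjugate r r' := ENNReal.holderConjugate_iff.2 hr
  exact hg.smul hf

/-- If `f ∈ L^r` and `g ∈ L^{r'}` with conjugate exponents, then `(τ_z f - f) g → 0` in `L^1` as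
`z → 0`. For `r = ∞`, where translations are not continuous in `L^r`, the difference is moved to
`f g` and to `g`, which both lie in `L^1`. -/
lemma tendsto_lintegral_translate_sub_mul {r r' : ℝ≥0∞} (hr : r⁻¹ + r'⁻¹ = 1) [NormedSpace ℝ F]
    {f : EuclideanSpace ℝ (Fin d) → F} {g : EuclideanSpace ℝ (Fin d) → G}
    (hf : MemLp f r volume) (hg : MemLp g r' volume) :
    Tendsto (fun z => ∫⁻ x, ‖f (x - z) - f x‖ₑ * ‖g x‖ₑ) (𝓝 0) (𝓝 0) := by
  by_cases hrt : r = ∞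
  · subst hrt
    obtain rfl : r' = 1 := by simpa using hr
    have hfg : MemLp (fun x => ‖g x‖ • f x) 1 volume :=
      memLp_one_smul_of_conjugate (by simp) hg.norm hf
    have h1 := tendsto_lintegral_translate_sub hfg
    have h2 := ENNReal.Tendsto.const_mul (a := eLpNorm f ∞ volume)
      (tendsto_lintegral_translate_sub hg) (Or.inr hf.2.ne)
    have h3 := h1.add h2
    simp only [mul_zero, add_zero] at h3
    refine tendsto_of_tendsto_of_tendsto_of_le_of_le tendsto_const_nhds h3 (fun _ => zero_le) ?_
    intro z
    have hfz := aestronglyMeasurable_comp_sub_const hf.1 z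
    have hgz := aestronglyMeasurable_comp_sub_const hg.1 z
    have h4 := lintegral_enorm_mul_enorm_le (r := ∞) (r' := 1) (by simp) hfz (hgz.sub hg.1)
    rw [eLpNorm_comp_sub_const hf.1, eLpNorm_one_eq_lintegral_enorm] at h4
    refine le_trans ?_ (add_le_add le_rfl h4)
    rw [← lintegral_add_left']
    · refine lintegral_mono fun x => ?_
      have : ‖g x‖ • (f (x - z) - f x) =
          (‖g (x - z)‖ • f (x - z) - ‖g x‖ • f x) - (‖g (x - z)‖ - ‖g x‖) • f (x - z) := by
        module
      have e : ‖f (x - z) - f x‖ₑ * ‖g x‖ₑ = ‖‖g x‖ • (f (x - z) - f x)‖ₑ := by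
        rw [enorm_smul, enorm_norm, mul_comm]
      rw [e, this]
      refine (enorm_sub_le).trans (add_le_add le_rfl ?_)
      rw [enorm_smul, mul_comm]
      gcongr
      rw [← ofReal_norm, ← ofReal_norm]
      exact ENNReal.ofReal_le_ofReal (by simpa using abs_norm_sub_norm_le (g (x - z)) (g x))
    · exact (((hgz.norm.smul hfz).sub hfg.1).enorm)
  · have h1r : 1 ≤ r := by
      rw [← ENNReal.inv_le_one, ← hr]; exact le_self_add
    have h2 := ENNReal.Tendsto.mul_const (b := eLpNorm g r' volume)
      (tendsto_eLpNorm_translate_sub h1r hrt hf) (Or.inr hg.2.ne)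
    rw [zero_mul] at h2
    exact tendsto_of_tendsto_of_tendsto_of_le_of_le tendsto_const_nhds h2 (fun _ => zero_le)
      (fun z => lintegral_enorm_mul_enorm_le hr
        ((aestronglyMeasurable_comp_sub_const hf.1 z).sub hf.1) hg.1)

/-- For conjugate exponents, translating the factors of a product `f g ∈ L^1` by two independent
vectors that tend to `0` is continuous in `L^1`. -/
lemma tendsto_lintegral_translate_smul_sub {r r' : ℝ≥0∞} (hr : r⁻¹ + r'⁻¹ = 1) [NormedSpace ℝ F]
    {f : EuclideanSpace ℝ (Fin d) → ℝ} {g : EuclideanSpace ℝ (Fin d) → F}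
    (hf : MemLp f r volume) (hg : MemLp g r' volume) :
    Tendsto (fun z : EuclideanSpace ℝ (Fin d) × EuclideanSpace ℝ (Fin d) =>
      ∫⁻ x, ‖f (x - z.1) • g (x - z.2) - f x • g x‖ₑ) (𝓝 (0, 0)) (𝓝 0) := by
  have h1 := tendsto_lintegral_translate_sub (memLp_one_smul_of_conjugate hr hf hg)
  have h2 := tendsto_lintegral_translate_sub_mul hr hf hg
  have h1' : Tendsto (fun z : EuclideanSpace ℝ (Fin d) × EuclideanSpace ℝ (Fin d) => z.2)
      (𝓝 (0, 0)) (𝓝 0) := continuous_snd.tendsto _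
  have h2' : Tendsto (fun z : EuclideanSpace ℝ (Fin d) × EuclideanSpace ℝ (Fin d) => z.1 - z.2)
      (𝓝 (0, 0)) (𝓝 0) := Continuous.tendsto' (by fun_prop) _ _ (by simp)
  have h3 := (h2.comp h2').add (h1.comp h1')
  simp only [add_zero] at h3
  refine tendsto_of_tendsto_of_tendsto_of_le_of_le tendsto_const_nhds h3 (fun _ => zero_le) ?_
  rintro ⟨y, z⟩
  simp only [Function.comp]
  have e : ∫⁻ x, ‖f (x - (y - z)) - f x‖ₑ * ‖g x‖ₑ =
      ∫⁻ x, ‖f (x - y) - f (x - z)‖ₑ * ‖g (x - z)‖ₑ := by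
    rw [← lintegral_sub_right_eq_self _ z]
    refine lintegral_congr fun x => ?_
    rw [show x - z - (y - z) = x - y by abel]
  rw [e, ← lintegral_add_left']
  · refine lintegral_mono fun x => ?_
    have : f (x - y) • g (x - z) - f x • g x = (f (x - y) - f (x - z)) • g (x - z) +
      (f (x - z) • g (x - z) - f x • g x) := by module
    rw [this]
    refine (enorm_add_le _ _).trans ?_
    rw [enorm_smul]
  · exact ((aestronglyMeasurable_comp_sub_const hf.1 y).sub
      (aestronglyMeasurable_comp_sub_const hf.1 z)).enorm.mul
      (aestronglyMeasurable_comp_sub_const hg.1 z).enorm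

end Translations

/-! ### Mollifiers -/

section Mollifiers

variable {F G : Type*} [NormedAddCommGroup F] [NormedAddCommGroup G]

/-- A mollifier at scale `ε`: a nonnegative test function with integral one, supported in the
ball of radius `ε`. The moment bound by `M` is what makes the commutator estimates uniform along a
family with `ε → 0`. -/
structure IsMollifier (ρ : EuclideanSpace ℝ (Fin d) → ℝ) (ε : ℝ) (M : ℝ≥0) : Prop where
  testFun : IsTestFun ρ
  nonneg : ∀ x, 0 ≤ ρ x
  integral_eq : ∫ x, ρ x = 1
  tsupport_subset : tsupport ρ ⊆ Metric.closedBall 0 ε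
  moment : ∫⁻ z, ‖fderiv ℝ ρ z‖ₑ * ‖z‖ₑ ≤ M

/-- The bump function with radii `1 / (2 (n + 1))` and `1 / (n + 1)`. -/
def shrinkingBump (d n : ℕ) : ContDiffBump (0 : EuclideanSpace ℝ (Fin d)) where
  rIn := (2 : ℝ)⁻¹ * ((n : ℝ) + 1)⁻¹
  rOut := ((n : ℝ) + 1)⁻¹
  rIn_pos := by positivity
  rIn_lt_rOut := by
    have : (0 : ℝ) < ((n : ℝ) + 1)⁻¹ := by positivity
    linarith

/-- A sequence of mollifiers at scales `1 / (n + 1)`. -/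
def mollifier (d n : ℕ) : EuclideanSpace ℝ (Fin d) → ℝ := (shrinkingBump d n).normed volume

lemma shrinkingBump_apply (n : ℕ) (x : EuclideanSpace ℝ (Fin d)) :
    shrinkingBump d n x = shrinkingBump d 0 (((n : ℝ) + 1) • x) := by
  have h : ((n : ℝ) + 1) ≠ 0 := by positivity
  rw [ContDiffBump.apply, ContDiffBump.apply]
  simp only [shrinkingBump, sub_zero]
  have e1 : ((n : ℝ) + 1)⁻¹ / (2⁻¹ * ((n : ℝ) + 1)⁻¹) = 2 := by field_simp
  have e2 : ((((0 : ℕ) : ℝ) + 1)⁻¹ / (2⁻¹ * (((0 : ℕ) : ℝ) + 1)⁻¹)) = 2 := by norm_num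
  rw [e1, e2, smul_smul]
  congr 2
  push_cast
  rw [mul_inv, inv_inv, inv_inv]
  ring

lemma mollifier_apply (n : ℕ) (x : EuclideanSpace ℝ (Fin d)) :
    mollifier d n x = ((n : ℝ) + 1) ^ d * mollifier d 0 (((n : ℝ) + 1) • x) := by
  have h : (0 : ℝ) < ((n : ℝ) + 1) := by positivity
  have h2 : ∫ x, shrinkingBump d n x = (((n : ℝ) + 1) ^ d)⁻¹ * ∫ x, shrinkingBump d 0 x := by
    simp_rw [shrinkingBump_apply n]
    rw [Measure.integral_comp_smul]
    simp [abs_of_pos h]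
  simp only [mollifier, ContDiffBump.normed_def, h2, shrinkingBump_apply n x]
  rw [div_eq_mul_inv, mul_inv, inv_inv]
  ring

/-- The bound of the first moment of the gradient is uniform in `n`, by scaling. -/
lemma exists_isMollifier (d : ℕ) :
    ∃ M : ℝ≥0, ∀ n, IsMollifier (mollifier d n) (((n : ℝ) + 1)⁻¹) M := by
  have hsm : ∀ n, ContDiff ℝ (⊤ : ℕ∞) (mollifier d n) := fun n =>
    (shrinkingBump d n).contDiff_normed
  have hcs : ∀ n, HasCompactSupport (mollifier d n) := fun n =>
    (shrinkingBump d n).hasCompactSupport_normed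
  have hts : ∀ n, tsupport (mollifier d n) ⊆ Metric.closedBall 0 (((n : ℝ) + 1)⁻¹) := fun n =>
    (shrinkingBump d n).tsupport_normed_eq.subset
  obtain ⟨C, hC⟩ : ∃ C, ∀ x, ‖fderiv ℝ (mollifier d 0) x‖ ≤ C :=
    ((hcs 0).fderiv ℝ).exists_bound_of_continuous ((hsm 0).continuous_fderiv (by simp))
  have hC0 : 0 ≤ C := (norm_nonneg _).trans (hC 0)
  refine ⟨(ENNReal.ofReal C * volume (Metric.closedBall (0 : EuclideanSpace ℝ (Fin d)) 1)).toNNReal,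
    fun n => ⟨⟨hsm n, hcs n⟩, fun x => (shrinkingBump d n).nonneg_normed x,
      (shrinkingBump d n).integral_normed, hts n, ?_⟩⟩
  have hn : (0 : ℝ) < (n : ℝ) + 1 := by positivity
  rw [ENNReal.coe_toNNReal (ENNReal.mul_ne_top ENNReal.ofReal_ne_top
    (isCompact_closedBall _ _).measure_lt_top.ne)]
  have hfd : ∀ x, ‖fderiv ℝ (mollifier d n) x‖ ≤ ((n : ℝ) + 1) ^ (d + 1) * C := by
    intro x
    have h1 : HasFDerivAt (mollifier d n) (((n : ℝ) + 1) ^ d •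
        (fderiv ℝ (mollifier d 0) (((n : ℝ) + 1) • x)).comp
          (((n : ℝ) + 1) • ContinuousLinearMap.id ℝ (EuclideanSpace ℝ (Fin d)))) x := by
      have h2 := ((hsm 0).differentiable (by simp) (((n : ℝ) + 1) • x)).hasFDerivAt
      have h3 : HasFDerivAt (fun x : EuclideanSpace ℝ (Fin d) => ((n : ℝ) + 1) • x)
          (((n : ℝ) + 1) • ContinuousLinearMap.id ℝ (EuclideanSpace ℝ (Fin d))) x :=
        (hasFDerivAt_id x).fun_const_smul _
      have h4 := (h2.comp x h3).const_smul (((n : ℝ) + 1) ^ d)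
      refine h4.congr_of_eventuallyEq (Eventually.of_forall fun y => ?_)
      simp [mollifier_apply n y]
    rw [h1.fderiv, norm_smul, ContinuousLinearMap.comp_smul, norm_smul,
      ContinuousLinearMap.comp_id, Real.norm_of_nonneg (by positivity),
      Real.norm_of_nonneg hn.le, pow_succ]
    have := hC (((n : ℝ) + 1) • x)
    rw [mul_assoc]
    gcongr
  -- on the support `‖z‖ ≤ (n + 1)⁻¹`, which compensates one power of `n + 1`; the volume of the
  -- ball compensates the others
  have hle : ∀ z, ‖fderiv ℝ (mollifier d n) z‖ₑ * ‖z‖ₑ ≤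
      (Metric.closedBall (0 : EuclideanSpace ℝ (Fin d)) ((n : ℝ) + 1)⁻¹).indicator
        (fun _ => ENNReal.ofReal (((n : ℝ) + 1) ^ d * C)) z := by
    intro z
    by_cases hz : z ∈ Metric.closedBall (0 : EuclideanSpace ℝ (Fin d)) ((n : ℝ) + 1)⁻¹
    · rw [indicator_of_mem hz, ← ofReal_norm, ← ofReal_norm,
        ← ENNReal.ofReal_mul (norm_nonneg _)]
      refine ENNReal.ofReal_le_ofReal ?_
      rw [mem_closedBall_zero_iff] at hz
      calc _ ≤ (((n : ℝ) + 1) ^ (d + 1) * C) * ((n : ℝ) + 1)⁻¹ := by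
            gcongr
            exact hfd z
        _ = _ := by field_simp; ring
    · have : fderiv ℝ (mollifier d n) z = 0 := by
        by_contra h
        exact hz (hts n (support_fderiv_subset ℝ h))
      rw [show ‖fderiv ℝ (mollifier d n) z‖ₑ = 0 by
        rw [← ofReal_norm, this, norm_zero, ENNReal.ofReal_zero], zero_mul]
      exact zero_le
  refine (lintegral_mono hle).trans ?_
  rw [lintegral_indicator measurableSet_closedBall, lintegral_const,
    Measure.restrict_apply_univ, Measure.addHaar_closedBall _ _ (by positivity),
    Measure.addHaar_closedBall _ _ zero_le_one, ← mul_assoc, ← mul_assoc]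
  rw [← ENNReal.ofReal_mul (by positivity), ← ENNReal.ofReal_mul hC0]
  refine mul_le_mul_left (ENNReal.ofReal_le_ofReal ?_) _
  rw [finrank_euclideanSpace_fin, one_pow, mul_one, inv_pow]
  field_simp
  exact le_rfl

namespace IsMollifier

variable {ρ : EuclideanSpace ℝ (Fin d) → ℝ} {ε : ℝ} {M : ℝ≥0}

lemma continuous (h : IsMollifier ρ ε M) : Continuous ρ := h.testFun.1.continuous

lemma eq_zero (h : IsMollifier ρ ε M) {z : EuclideanSpace ℝ (Fin d)} (hz : ε < ‖z‖) :
    ρ z = 0 := by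
  by_contra h0
  have := h.tsupport_subset (subset_tsupport _ h0)
  rw [mem_closedBall_zero_iff] at this
  exact absurd hz this.not_gt

lemma fderiv_eq_zero (h : IsMollifier ρ ε M) {z : EuclideanSpace ℝ (Fin d)} (hz : ε < ‖z‖) :
    fderiv ℝ ρ z = 0 := by
  by_contra h0
  have := h.tsupport_subset (support_fderiv_subset ℝ h0)
  rw [mem_closedBall_zero_iff] at this
  exact absurd hz this.not_gt

lemma integrable (h : IsMollifier ρ ε M) : Integrable ρ volume :=
  h.continuous.integrable_of_hasCompactSupport h.testFun.2

lemma lintegral_enorm (h : IsMollifier ρ ε M) : ∫⁻ z, ‖ρ z‖ₑ = 1 := by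
  have e : ∀ z, ‖ρ z‖ₑ = ENNReal.ofReal (ρ z) := fun z => Real.enorm_of_nonneg (h.nonneg z)
  simp_rw [e]
  rw [← ofReal_integral_eq_lintegral_ofReal h.integrable (Eventually.of_forall h.nonneg),
    h.integral_eq, ENNReal.ofReal_one]

lemma lintegral_mul_le (h : IsMollifier ρ ε M) {A : EuclideanSpace ℝ (Fin d) → ℝ≥0∞} {c : ℝ≥0∞}
    (hA : ∀ z, ‖z‖ ≤ ε → A z ≤ c) : ∫⁻ z, ‖ρ z‖ₑ * A z ≤ c := by
  calc ∫⁻ z, ‖ρ z‖ₑ * A z ≤ ∫⁻ z, ‖ρ z‖ₑ * c := by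
        refine lintegral_mono fun z => ?_
        by_cases hz : ‖z‖ ≤ ε
        · exact mul_le_mul_right (hA z hz) _
        · simp [h.eq_zero (not_le.1 hz)]
    _ = c := by
        rw [lintegral_mul_const'' _ h.continuous.aestronglyMeasurable.enorm, h.lintegral_enorm,
          one_mul]

lemma lintegral_moment_mul_le (h : IsMollifier ρ ε M) {A : EuclideanSpace ℝ (Fin d) → ℝ≥0∞}
    {c : ℝ≥0∞} (hA : ∀ z, ‖z‖ ≤ ε → A z ≤ c) :
    ∫⁻ z, ‖fderiv ℝ ρ z‖ₑ * ‖z‖ₑ * A z ≤ M * c := by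
  calc ∫⁻ z, ‖fderiv ℝ ρ z‖ₑ * ‖z‖ₑ * A z ≤ ∫⁻ z, ‖fderiv ℝ ρ z‖ₑ * ‖z‖ₑ * c := by
        refine lintegral_mono fun z => ?_
        by_cases hz : ‖z‖ ≤ ε
        · exact mul_le_mul_right (hA z hz) _
        · have h0 : ‖fderiv ℝ ρ z‖ₑ = 0 := by
            rw [← ofReal_norm, h.fderiv_eq_zero (not_le.1 hz), norm_zero, ENNReal.ofReal_zero]
          rw [h0, zero_mul, zero_mul, zero_mul]
    _ = (∫⁻ z, ‖fderiv ℝ ρ z‖ₑ * ‖z‖ₑ) * c := by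
        refine lintegral_mul_const'' _ ?_
        exact ((h.testFun.1.continuous_fderiv (by simp)).aestronglyMeasurable.enorm.mul
          continuous_id.aestronglyMeasurable.enorm)
    _ ≤ M * c := mul_le_mul_left h.moment _

end IsMollifier

lemma aestronglyMeasurable_sub_prod {f : EuclideanSpace ℝ (Fin d) → F}
    (hf : AEStronglyMeasurable f volume) (ν : Measure (EuclideanSpace ℝ (Fin d))) [SFinite ν] :
    AEStronglyMeasurable
      (fun p : EuclideanSpace ℝ (Fin d) × EuclideanSpace ℝ (Fin d) => f (p.1 - p.2))
      ((volume : Measure (EuclideanSpace ℝ (Fin d))).prod ν) := by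
  refine hf.comp_quasiMeasurePreserving (QuasiMeasurePreserving.prod_of_left (by fun_prop) ?_)
  exact Eventually.of_forall fun z => (measurePreserving_sub_const z).quasiMeasurePreserving

lemma lintegral_enorm_integral_mul_le {X Z : Type*} [MeasurableSpace X] [MeasurableSpace Z]
    {μ : Measure X} {ν : Measure Z} [SFinite μ] [SFinite ν] [NormedSpace ℝ F] {Φ : X → Z → F}
    {g : X → ℝ≥0∞} (hΦ : AEStronglyMeasurable (Function.uncurry Φ) (μ.prod ν))
    (hg : AEMeasurable g μ) :
    ∫⁻ x, ‖∫ z, Φ x z ∂ν‖ₑ * g x ∂μ ≤ ∫⁻ z, ∫⁻ x, ‖Φ x z‖ₑ * g x ∂μ ∂ν := by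
  have hm : AEMeasurable (Function.uncurry fun x z => ‖Φ x z‖ₑ * g x) (μ.prod ν) :=
    hΦ.enorm.mul hg.comp_fst
  rw [← lintegral_lintegral_swap hm]
  refine lintegral_mono_ae ?_
  filter_upwards [hΦ.prodMk_left] with x hx
  calc ‖∫ z, Φ x z ∂ν‖ₑ * g x ≤ (∫⁻ z, ‖Φ x z‖ₑ ∂ν) * g x := by
        gcongr
        exact enorm_integral_le_lintegral_enorm _
    _ = _ := (lintegral_mul_const'' _ hx.enorm).symm

variable [NormedSpace ℝ F]

/-- The mollification `ρ * f`. -/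
def mollify (ρ : EuclideanSpace ℝ (Fin d) → ℝ) (f : EuclideanSpace ℝ (Fin d) → F)
    (x : EuclideanSpace ℝ (Fin d)) : F :=
  ∫ z, ρ z • f (x - z)

lemma mollify_eq_integral_sub (ρ : EuclideanSpace ℝ (Fin d) → ℝ)
    (f : EuclideanSpace ℝ (Fin d) → F) (x : EuclideanSpace ℝ (Fin d)) :
    mollify ρ f x = ∫ y, ρ (x - y) • f y := by
  rw [mollify, ← integral_sub_left_eq_self _ volume x]
  simp

namespace IsMollifier

variable {ρ : EuclideanSpace ℝ (Fin d) → ℝ} {ε : ℝ} {M : ℝ≥0}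

lemma integrable_smul_translate (h : IsMollifier ρ ε M) {f : EuclideanSpace ℝ (Fin d) → F}
    (hf : LocallyIntegrable f volume) (x : EuclideanSpace ℝ (Fin d)) :
    Integrable (fun z => ρ z • f (x - z)) volume :=
  (h.testFun.2.convolutionExists_left (ContinuousLinearMap.lsmul ℝ ℝ) h.continuous hf x)

lemma contDiff_mollify (h : IsMollifier ρ ε M) {f : EuclideanSpace ℝ (Fin d) → F}
    (hf : LocallyIntegrable f volume) : ContDiff ℝ (⊤ : ℕ∞) (mollify ρ f) :=
  h.testFun.2.contDiff_convolution_left (ContinuousLinearMap.lsmul ℝ ℝ) h.testFun.1 hf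

lemma mollify_sub_self (h : IsMollifier ρ ε M) {f : EuclideanSpace ℝ (Fin d) → F}
    (hf : LocallyIntegrable f volume) [CompleteSpace F] (x : EuclideanSpace ℝ (Fin d)) :
    mollify ρ f x - f x = ∫ z, ρ z • (f (x - z) - f x) := by
  simp_rw [smul_sub]
  rw [integral_sub (h.integrable_smul_translate hf x) (h.integrable.smul_const _),
    integral_smul_const, h.integral_eq, one_smul, mollify]

lemma lintegral_mollify_sub_mul_le (h : IsMollifier ρ ε M) [CompleteSpace F]
    {f : EuclideanSpace ℝ (Fin d) → F} (hf : LocallyIntegrable f volume)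
    {g : EuclideanSpace ℝ (Fin d) → ℝ≥0∞} (hg : AEMeasurable g volume) {c : ℝ≥0∞}
    (hc : ∀ z, ‖z‖ ≤ ε → ∫⁻ x, ‖f (x - z) - f x‖ₑ * g x ≤ c) :
    ∫⁻ x, ‖mollify ρ f x - f x‖ₑ * g x ≤ c := by
  simp_rw [h.mollify_sub_self hf]
  have hfm := hf.aestronglyMeasurable
  refine (lintegral_enorm_integral_mul_le (Φ := fun x z => ρ z • (f (x - z) - f x)) ?_ hg).trans ?_
  · exact (h.continuous.aestronglyMeasurable.comp_snd).smul
      ((aestronglyMeasurable_sub_prod hfm volume).sub hfm.comp_fst)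
  · simp_rw [enorm_smul, mul_assoc]
    refine le_trans (lintegral_mono fun z => ?_) (h.lintegral_mul_le hc)
    rw [lintegral_const_mul' _ _ enorm_ne_top]

lemma lintegral_mollify_mul_le (h : IsMollifier ρ ε M) {f : EuclideanSpace ℝ (Fin d) → F}
    (hf : AEStronglyMeasurable f volume)
    {g : EuclideanSpace ℝ (Fin d) → ℝ≥0∞} (hg : AEMeasurable g volume) {c : ℝ≥0∞}
    (hc : ∀ z, ‖z‖ ≤ ε → ∫⁻ x, ‖f (x - z)‖ₑ * g x ≤ c) :
    ∫⁻ x, ‖mollify ρ f x‖ₑ * g x ≤ c := by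
  refine (lintegral_enorm_integral_mul_le (Φ := fun x z => ρ z • f (x - z)) ?_ hg).trans ?_
  · exact (h.continuous.aestronglyMeasurable.comp_snd).smul (aestronglyMeasurable_sub_prod hf volume)
  · simp_rw [enorm_smul, mul_assoc]
    refine le_trans (lintegral_mono fun z => ?_) (h.lintegral_mul_le hc)
    rw [lintegral_const_mul' _ _ enorm_ne_top]

lemma lintegral_mollify_mul_enorm_le (h : IsMollifier ρ ε M) {r r' : ℝ≥0∞} (hr : r⁻¹ + r'⁻¹ = 1)
    {f : EuclideanSpace ℝ (Fin d) → F} {g : EuclideanSpace ℝ (Fin d) → G}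
    (hf : AEStronglyMeasurable f volume) (hg : AEStronglyMeasurable g volume) :
    ∫⁻ x, ‖mollify ρ f x‖ₑ * ‖g x‖ₑ ≤ eLpNorm f r volume * eLpNorm g r' volume :=
  h.lintegral_mollify_mul_le hf hg.enorm fun z _ => by
    simpa using lintegral_translate_mul_le hr hf hg z 0

lemma lintegral_mollify_le (h : IsMollifier ρ ε M) {f : EuclideanSpace ℝ (Fin d) → F}
    (hf : AEStronglyMeasurable f volume) :
    ∫⁻ x, ‖mollify ρ f x‖ₑ ≤ ∫⁻ x, ‖f x‖ₑ := by
  simpa using h.lintegral_mollify_mul_le hf (g := fun _ => 1) aemeasurable_const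
    (c := ∫⁻ x, ‖f x‖ₑ) fun z _ => by
      simpa using (lintegral_sub_right_eq_self (fun x => ‖f x‖ₑ) z).le

lemma integrable_mollify (h : IsMollifier ρ ε M) {f : EuclideanSpace ℝ (Fin d) → F}
    (hf : Integrable f volume) : Integrable (mollify ρ f) volume :=
  ⟨(h.contDiff_mollify hf.locallyIntegrable).continuous.aestronglyMeasurable,
    (h.lintegral_mollify_le hf.1).trans_lt hf.2⟩

end IsMollifier

lemma tendsto_scale : Tendsto (fun n : ℕ => ((n : ℝ) + 1)⁻¹) atTop (𝓝 0) := by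
  simpa [one_div] using tendsto_one_div_add_atTop_nhds_zero_nat (𝕜 := ℝ)

/-- A quantity that tends to zero with the shift is eventually small on the supports of the
mollifiers. -/
lemma eventually_forall_norm_le_scale {A : EuclideanSpace ℝ (Fin d) → ℝ≥0∞}
    (hA : Tendsto A (𝓝 0) (𝓝 0)) {c : ℝ≥0∞} (hc : 0 < c) :
    ∀ᶠ n : ℕ in atTop, ∀ z, ‖z‖ ≤ ((n : ℝ) + 1)⁻¹ → A z ≤ c := by
  have h1 := ENNReal.tendsto_nhds_zero.1 hA c hc
  obtain ⟨η, hη, h2⟩ := Metric.eventually_nhds_iff.1 h1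
  filter_upwards [(tendsto_order.1 tendsto_scale).2 η hη] with n hn z hz
  exact h2 (by simpa using hz.trans_lt hn)

lemma tendsto_lintegral_mollify_sub_mul [CompleteSpace F] {r r' : ℝ≥0∞} (hr : r⁻¹ + r'⁻¹ = 1)
    {f : EuclideanSpace ℝ (Fin d) → F} {g : EuclideanSpace ℝ (Fin d) → G}
    (hf : MemLp f r volume) (hg : MemLp g r' volume) :
    Tendsto (fun n => ∫⁻ x, ‖mollify (mollifier d n) f x - f x‖ₑ * ‖g x‖ₑ) atTop (𝓝 0) := by
  have h1r : 1 ≤ r := by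
    rw [← ENNReal.inv_le_one, ← hr]; exact le_self_add
  obtain ⟨M, hM⟩ := exists_isMollifier d
  refine ENNReal.tendsto_nhds_zero.2 fun c hc => ?_
  filter_upwards [eventually_forall_norm_le_scale
    (tendsto_lintegral_translate_sub_mul hr hf hg) hc] with n hn
  exact (hM n).lintegral_mollify_sub_mul_le (hf.locallyIntegrable h1r) hg.1.enorm hn

lemma tendsto_lintegral_mollify_sub [CompleteSpace F]
    {f : EuclideanSpace ℝ (Fin d) → F} (hf : MemLp f 1 volume) :
    Tendsto (fun n => ∫⁻ x, ‖mollify (mollifier d n) f x - f x‖ₑ) atTop (𝓝 0) := by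
  simpa using tendsto_lintegral_mollify_sub_mul (r := 1) (r' := ∞) (by simp) hf
    (g := fun _ => (1 : ℝ)) (memLp_top_const 1)

lemma ae_tendsto_mollify [CompleteSpace F] {f : EuclideanSpace ℝ (Fin d) → F}
    (hf : LocallyIntegrable f volume) :
    ∀ᵐ x, Tendsto (fun n => mollify (mollifier d n) f x) atTop (𝓝 (f x)) := by
  refine ContDiffBump.ae_convolution_tendsto_right_of_locallyIntegrable (K := 2)
    (φ := fun n => shrinkingBump d n) tendsto_scale (Eventually.of_forall fun n => ?_) hf
  simp [shrinkingBump]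

lemma tendsto_mollify_of_continuous [CompleteSpace F] {f : EuclideanSpace ℝ (Fin d) → F}
    (hf : Continuous f) (x : EuclideanSpace ℝ (Fin d)) :
    Tendsto (fun n => mollify (mollifier d n) f x) atTop (𝓝 (f x)) :=
  ContDiffBump.convolution_tendsto_right_of_continuous
    (φ := fun n => shrinkingBump d n) tendsto_scale hf x

end Mollifiers

/-! ### The mollified transport equation -/

section WeakDerivatives

variable {F : Type*} [NormedAddCommGroup F] [NormedSpace ℝ F]

lemma IsMollifier.norm_mollify_le {ρ : EuclideanSpace ℝ (Fin d) → ℝ} {ε : ℝ} {M : ℝ≥0}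
    (h : IsMollifier ρ ε M) {f : EuclideanSpace ℝ (Fin d) → F} {C : ℝ}
    (hC : ∀ x, ‖f x‖ ≤ C) (x : EuclideanSpace ℝ (Fin d)) : ‖mollify ρ f x‖ ≤ C := by
  have h1 : ‖mollify ρ f x‖ ≤ ∫ z, ρ z * C := by
    refine norm_integral_le_of_norm_le (h.integrable.mul_const C) (Eventually.of_forall fun z => ?_)
    rw [norm_smul, Real.norm_of_nonneg (h.nonneg z)]
    exact mul_le_mul_of_nonneg_left (hC _) (h.nonneg z)
  rwa [integral_mul_const, h.integral_eq, one_mul] at h1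

lemma IsMollifier.mollify_eq_zero {ρ : EuclideanSpace ℝ (Fin d) → ℝ} {ε : ℝ} {M : ℝ≥0}
    (h : IsMollifier ρ ε M) {f : EuclideanSpace ℝ (Fin d) → F} {R : ℝ}
    (hf : ∀ x, R < ‖x‖ → f x = 0) {x : EuclideanSpace ℝ (Fin d)} (hx : R + ε < ‖x‖) :
    mollify ρ f x = 0 := by
  refine integral_eq_zero_of_ae (Eventually.of_forall fun z => ?_)
  by_cases hz : ε < ‖z‖
  · simp [h.eq_zero hz]
  · have : ‖x‖ ≤ ‖x - z‖ + ‖z‖ := by simpa using norm_add_le (x - z) z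
    simp [hf (x - z) (by linarith [not_lt.1 hz])]

lemma IsTestFun.comp_sub_left {φ : EuclideanSpace ℝ (Fin d) → ℝ} (h : IsTestFun φ)
    (x : EuclideanSpace ℝ (Fin d)) : IsTestFun (fun y => φ (x - y)) :=
  ⟨h.1.comp (contDiff_const.sub contDiff_id), h.2.comp_homeomorph (Homeomorph.subLeft x)⟩

lemma fderiv_comp_sub_left {φ : EuclideanSpace ℝ (Fin d) → ℝ} (h : IsTestFun φ)
    (x y w : EuclideanSpace ℝ (Fin d)) :
    fderiv ℝ (fun y => φ (x - y)) y w = - fderiv ℝ φ (x - y) w := by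
  have h1 := ((h.1.differentiable (by simp)) (x - y)).hasFDerivAt
  have h2 : HasFDerivAt (fun y => x - y)
      (-ContinuousLinearMap.id ℝ (EuclideanSpace ℝ (Fin d))) y :=
    (hasFDerivAt_id y).const_sub x
  have h3 := (h1.comp y h2).fderiv
  rw [Function.comp_def] at h3
  rw [h3]
  simp

lemma exists_forall_lt_norm_eq_zero {H : Type*} [Zero H] {φ : EuclideanSpace ℝ (Fin d) → H}
    (h : HasCompactSupport φ) : ∃ R : ℝ, 0 < R ∧ ∀ x, R < ‖x‖ → φ x = 0 := by
  obtain ⟨R, hR⟩ := h.isCompact.isBounded.subset_closedBall 0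
  refine ⟨max R 1, by positivity, fun x hx => ?_⟩
  by_contra h0
  have := hR (subset_tsupport _ h0)
  rw [mem_closedBall_zero_iff] at this
  exact absurd (lt_of_le_of_lt (le_max_left R 1) hx) this.not_gt

lemma hasFDerivAt_mollify {φ : EuclideanSpace ℝ (Fin d) → ℝ} (h : IsTestFun φ)
    {u : EuclideanSpace ℝ (Fin d) → F} (hu : LocallyIntegrable u volume)
    (x : EuclideanSpace ℝ (Fin d)) :
    HasFDerivAt (mollify φ u) (convolution (fderiv ℝ φ) u
      ((ContinuousLinearMap.lsmul ℝ ℝ).precompL (EuclideanSpace ℝ (Fin d))) volume x) x :=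
  h.2.hasFDerivAt_convolution_left (ContinuousLinearMap.lsmul ℝ ℝ) (h.1.of_le (by simp)) hu x

lemma fderiv_mollify_apply {φ : EuclideanSpace ℝ (Fin d) → ℝ} (h : IsTestFun φ)
    {u : EuclideanSpace ℝ (Fin d) → F} (hu : LocallyIntegrable u volume)
    (x w : EuclideanSpace ℝ (Fin d)) :
    fderiv ℝ (mollify φ u) x w = ∫ z, fderiv ℝ φ z w • u (x - z) := by
  rw [(hasFDerivAt_mollify h hu x).fderiv, convolution, ContinuousLinearMap.integral_apply]
  · simp
  · exact (h.2.fderiv ℝ).convolutionExists_left _ (h.1.continuous_fderiv (by simp)) hu x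

/-- Mollification commutes with weak derivatives. -/
lemma HasWeakDeriv.fderiv_mollify {φ : EuclideanSpace ℝ (Fin d) → ℝ} (h : IsTestFun φ)
    {u : EuclideanSpace ℝ (Fin d) → F}
    {Du : EuclideanSpace ℝ (Fin d) → EuclideanSpace ℝ (Fin d) →L[ℝ] F} (hu : HasWeakDeriv u Du)
    (x w : EuclideanSpace ℝ (Fin d)) :
    fderiv ℝ (mollify φ u) x w = mollify φ (fun y => Du y w) x := by
  rw [fderiv_mollify_apply h hu.1, mollify_eq_integral_sub,
    ← integral_sub_left_eq_self _ volume x]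
  have := hu.2.2 _ (h.comp_sub_left x) w
  simp_rw [fderiv_comp_sub_left h, neg_smul, integral_neg, neg_inj] at this
  simpa using this

lemma LocallyIntegrable.clm_apply_const {H : Type*} [NormedAddCommGroup H] [NormedSpace ℝ H]
    {Du : EuclideanSpace ℝ (Fin d) → H →L[ℝ] F} (hu : LocallyIntegrable Du volume) (w : H) :
    LocallyIntegrable (fun y => Du y w) volume := fun x =>
  (hu x).imp fun _ hs => ⟨hs.1, (ContinuousLinearMap.apply ℝ F w).integrable_comp hs.2⟩

lemma fderiv_mollify_of_contDiff {ρ : EuclideanSpace ℝ (Fin d) → ℝ} {ε : ℝ} {M : ℝ≥0}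
    (h : IsMollifier ρ ε M) {φ : EuclideanSpace ℝ (Fin d) → ℝ} (hφ : ContDiff ℝ 1 φ)
    (hc : HasCompactSupport φ) (x : EuclideanSpace ℝ (Fin d)) :
    fderiv ℝ (mollify ρ φ) x = mollify ρ (fderiv ℝ φ) x := by
  have := hc.hasFDerivAt_convolution_right (ContinuousLinearMap.lsmul ℝ ℝ)
    (h.continuous.locallyIntegrable (μ := volume)) hφ x
  refine (this.fderiv).trans ?_
  rw [mollify, convolution]
  congr 1

lemma locallyIntegrable_norm {H : Type*} [NormedAddCommGroup H]
    {V : EuclideanSpace ℝ (Fin d) → H} (hV : LocallyIntegrable V volume) :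
    LocallyIntegrable (fun x => ‖V x‖) volume := fun x =>
  (hV x).imp fun _ hs => ⟨hs.1, hs.2.norm⟩

lemma integrable_bilin_of_hasCompactSupport {G H : Type*} [NormedAddCommGroup G] [NormedSpace ℝ G]
    [NormedAddCommGroup H] [NormedSpace ℝ H] (L : G →L[ℝ] H →L[ℝ] F)
    {Φ : EuclideanSpace ℝ (Fin d) → G} (hΦ : Continuous Φ) (hc : HasCompactSupport Φ)
    {V : EuclideanSpace ℝ (Fin d) → H} (hV : LocallyIntegrable V volume) :
    Integrable (fun x => L (Φ x) (V x)) volume := by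
  have h1 : Integrable (fun x => ‖L‖ * (‖Φ x‖ * ‖V x‖)) volume :=
    ((locallyIntegrable_norm hV).integrable_smul_left_of_hasCompactSupport hΦ.norm
      hc.norm).const_mul _
  refine h1.mono' (L.aestronglyMeasurable_comp₂ hΦ.aestronglyMeasurable hV.aestronglyMeasurable)
    (Eventually.of_forall fun x => ?_)
  rw [← mul_assoc]
  exact L.le_opNorm₂ _ _

lemma tendsto_integral_mollify_bilin {G H : Type*} [NormedAddCommGroup G] [NormedSpace ℝ G]
    [CompleteSpace G] [NormedAddCommGroup H] [NormedSpace ℝ H] (L : G →L[ℝ] H →L[ℝ] F)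
    {Φ : EuclideanSpace ℝ (Fin d) → G} (hΦ : Continuous Φ) (hc : HasCompactSupport Φ)
    {V : EuclideanSpace ℝ (Fin d) → H} (hV : LocallyIntegrable V volume) :
    Tendsto (fun n => ∫ x, L (mollify (mollifier d n) Φ x) (V x)) atTop
      (𝓝 (∫ x, L (Φ x) (V x))) := by
  obtain ⟨M, hM⟩ := exists_isMollifier d
  obtain ⟨R, hR0, hR⟩ := exists_forall_lt_norm_eq_zero hc
  obtain ⟨C, hC⟩ := hc.exists_bound_of_continuous hΦ
  have hC0 : 0 ≤ C := (norm_nonneg _).trans (hC 0)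
  have hs : ∀ n : ℕ, ((n : ℝ) + 1)⁻¹ ≤ 1 := fun n => inv_le_one_of_one_le₀ (by simp)
  have hloc : LocallyIntegrable Φ volume := hΦ.locallyIntegrable
  refine tendsto_integral_of_dominated_convergence
    ((Metric.closedBall 0 (R + 1)).indicator fun x => ‖L‖ * C * ‖V x‖) (fun n => ?_) ?_
    (fun n => ?_) ?_
  · exact L.aestronglyMeasurable_comp₂
      ((hM n).contDiff_mollify hloc).continuous.aestronglyMeasurable hV.aestronglyMeasurable
  · exact IntegrableOn.integrable_indicator
      ((hV.integrableOn_isCompact (isCompact_closedBall _ _)).norm.const_mul _)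
      measurableSet_closedBall
  · refine Eventually.of_forall fun x => ?_
    by_cases hx : x ∈ Metric.closedBall (0 : EuclideanSpace ℝ (Fin d)) (R + 1)
    · rw [indicator_of_mem hx]
      refine (L.le_opNorm₂ _ _).trans ?_
      gcongr
      exact (hM n).norm_mollify_le hC x
    · rw [mem_closedBall_zero_iff, not_le] at hx
      rw [(hM n).mollify_eq_zero hR (by linarith [hs n]), map_zero, zero_apply, norm_zero]
      exact indicator_nonneg (fun y _ => by positivity) _
  · refine Eventually.of_forall fun x => ?_
    exact ((L.flip (V x)).continuous.tendsto _).comp (tendsto_mollify_of_continuous hΦ x)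

/-- The weak divergence may be tested with compactly supported functions of class `C^1`. -/
lemma HasWeakDiv.integral_fderiv {v : EuclideanSpace ℝ (Fin d) → EuclideanSpace ℝ (Fin d)}
    {δ : EuclideanSpace ℝ (Fin d) → ℝ} (hv : HasWeakDiv v δ)
    {φ : EuclideanSpace ℝ (Fin d) → ℝ} (hφ : ContDiff ℝ 1 φ) (hc : HasCompactSupport φ) :
    ∫ x, fderiv ℝ φ x (v x) = - ∫ x, φ x * δ x := by
  obtain ⟨M, hM⟩ := exists_isMollifier d
  have htest : ∀ n, IsTestFun (mollify (mollifier d n) φ) := fun n =>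
    ⟨(hM n).contDiff_mollify hφ.continuous.locallyIntegrable,
      (hM n).testFun.2.convolution (ContinuousLinearMap.lsmul ℝ ℝ) hc⟩
  have h0 := fun n => hv.2.2 _ (htest n)
  simp_rw [fun n x => fderiv_mollify_of_contDiff (hM n) hφ hc x] at h0
  have l1 := tendsto_integral_mollify_bilin
    (ContinuousLinearMap.id ℝ (EuclideanSpace ℝ (Fin d) →L[ℝ] ℝ))
    (hφ.continuous_fderiv (by simp)) (hc.fderiv ℝ) hv.1
  have l2 := (tendsto_integral_mollify_bilin (ContinuousLinearMap.mul ℝ ℝ)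
    hφ.continuous hc hv.2.1).neg
  simp only [ContinuousLinearMap.id_apply, ContinuousLinearMap.mul_apply'] at l1 l2
  simp_rw [h0] at l1
  exact tendsto_nhds_unique l1 l2

/-- The commutator `v · ∇(ρ * w) - ρ * (div (w v))` of transport and mollification, written with the
derivative on `ρ`. -/
def transportCommutator (ρ w : EuclideanSpace ℝ (Fin d) → ℝ)
    (v : EuclideanSpace ℝ (Fin d) → EuclideanSpace ℝ (Fin d)) (x : EuclideanSpace ℝ (Fin d)) : ℝ :=
  ∫ z, w (x - z) * fderiv ℝ ρ z (v x - v (x - z))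

/-- The mollified transport term `- ρ * (div (w v))`, written with the derivative on `ρ`. -/
def mollifiedTransport (ρ w : EuclideanSpace ℝ (Fin d) → ℝ)
    (v : EuclideanSpace ℝ (Fin d) → EuclideanSpace ℝ (Fin d)) (x : EuclideanSpace ℝ (Fin d)) : ℝ :=
  - ∫ z, w (x - z) * fderiv ℝ ρ z (v (x - z))

section Transport

variable {ρ w : EuclideanSpace ℝ (Fin d) → ℝ}
  {v : EuclideanSpace ℝ (Fin d) → EuclideanSpace ℝ (Fin d)}

lemma mollifiedTransport_eq_convolution (ρ w : EuclideanSpace ℝ (Fin d) → ℝ)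
    (v : EuclideanSpace ℝ (Fin d) → EuclideanSpace ℝ (Fin d)) :
    mollifiedTransport ρ w v = fun x => - convolution (fderiv ℝ ρ) (fun y => w y • v y)
      (ContinuousLinearMap.id ℝ (EuclideanSpace ℝ (Fin d) →L[ℝ] ℝ)) volume x := by
  funext x
  simp [mollifiedTransport, convolution]

lemma integrable_mollifiedTransport (hρ : IsTestFun ρ)
    (hwv : LocallyIntegrable (fun x => w x • v x) volume) (x : EuclideanSpace ℝ (Fin d)) :
    Integrable (fun z => w (x - z) * fderiv ℝ ρ z (v (x - z))) volume := by
  have := (hρ.2.fderiv ℝ).convolutionExists_left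
    (ContinuousLinearMap.id ℝ (EuclideanSpace ℝ (Fin d) →L[ℝ] ℝ))
    (hρ.1.continuous_fderiv (by simp)) hwv x
  refine this.congr (Eventually.of_forall fun z => ?_)
  simp

lemma continuous_mollifiedTransport (hρ : IsTestFun ρ)
    (hwv : LocallyIntegrable (fun x => w x • v x) volume) :
    Continuous (mollifiedTransport ρ w v) := by
  rw [mollifiedTransport_eq_convolution]
  exact ((hρ.2.fderiv ℝ).continuous_convolution_left _
    (hρ.1.continuous_fderiv (by simp)) hwv).neg

lemma integrable_fderiv_mul (hρ : IsTestFun ρ) (hw : LocallyIntegrable w volume)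
    (x h : EuclideanSpace ℝ (Fin d)) :
    Integrable (fun z => w (x - z) * fderiv ℝ ρ z h) volume := by
  have := ((hρ.2.fderiv_apply (𝕜 := ℝ) h)).convolutionExists_left
    (ContinuousLinearMap.lsmul ℝ ℝ)
    ((hρ.1.continuous_fderiv (by simp)).clm_apply continuous_const) hw x
  refine this.congr (Eventually.of_forall fun z => ?_)
  simp [mul_comm]

lemma transportCommutator_eq (hρ : IsTestFun ρ) (hw : LocallyIntegrable w volume)
    (hwv : LocallyIntegrable (fun x => w x • v x) volume) (x : EuclideanSpace ℝ (Fin d)) :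
    transportCommutator ρ w v x = mollifiedTransport ρ w v x + fderiv ℝ (mollify ρ w) x (v x) := by
  rw [fderiv_mollify_apply hρ hw, transportCommutator, mollifiedTransport]
  simp_rw [map_sub, mul_sub]
  rw [integral_sub (integrable_fderiv_mul hρ hw x _) (integrable_mollifiedTransport hρ hwv x)]
  simp_rw [smul_eq_mul, mul_comm (w _)]
  ring

/-- The renormalised transport term: with `u = ρ * w`,
`∫ χ β'(u) (- ρ * div (w v)) = ∫ β(u) (v · ∇χ + χ div v) + ∫ χ β'(u) r` with the commutator `r`. -/
lemma integral_mul_mollifiedTransport (hρ : IsTestFun ρ) (hw : LocallyIntegrable w volume)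
    (hwv : LocallyIntegrable (fun x => w x • v x) volume) {δ : EuclideanSpace ℝ (Fin d) → ℝ}
    (hv : HasWeakDiv v δ) {χ : EuclideanSpace ℝ (Fin d) → ℝ} (hχ : IsTestFun χ)
    {β b : ℝ → ℝ} (hβ : ∀ u, HasDerivAt β (b u) u) (hb : Continuous b) :
    ∫ x, χ x * b (mollify ρ w x) * mollifiedTransport ρ w v x =
      (∫ x, β (mollify ρ w x) * (fderiv ℝ χ x (v x) + χ x * δ x)) +
        ∫ x, χ x * b (mollify ρ w x) * transportCommutator ρ w v x := by
  set u := mollify ρ w with hu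
  have hus : ContDiff ℝ 1 u :=
    (hρ.2.contDiff_convolution_left (ContinuousLinearMap.lsmul ℝ ℝ) hρ.1 hw).of_le (by simp)
  have hβ1 : ContDiff ℝ 1 β := by
    rw [contDiff_one_iff_deriv]
    refine ⟨fun x => (hβ x).differentiableAt, ?_⟩
    rwa [show deriv β = b from funext fun x => (hβ x).deriv]
  have hχ1 : ContDiff ℝ 1 χ := hχ.1.of_le (by simp)
  have hβc : Continuous β := hβ1.continuous
  have hT := continuous_mollifiedTransport hρ hwv
  have htest : ContDiff ℝ 1 (fun x => χ x * β (u x)) := hχ1.mul (hβ1.comp hus)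
  have htc : HasCompactSupport (fun x => χ x * β (u x)) := hχ.2.mul_right
  have hfd : ∀ x y, fderiv ℝ (fun x => χ x * β (u x)) x y =
      χ x * b (u x) * fderiv ℝ u x y + β (u x) * fderiv ℝ χ x y := by
    intro x y
    have h1 := (hus.differentiable (by simp) x).hasFDerivAt
    have h2 := (hχ1.differentiable (by simp) x).hasFDerivAt
    have h3 := h2.mul ((hβ (u x)).comp_hasFDerivAt x h1)
    have h4 : fderiv ℝ (fun x => χ x * β (u x)) x = _ := h3.fderiv
    rw [h4]
    simp only [add_apply, smul_apply, smul_eq_mul, Function.comp]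
    ring
  have key := hv.integral_fderiv htest htc
  have hχb : Continuous fun x => χ x * b (u x) := hχ.1.continuous.mul (hb.comp hus.continuous)
  have hc1 : HasCompactSupport (fun x => (χ x * b (u x)) • fderiv ℝ u x) := by
    refine hχ.2.mono fun x hx h0 => hx ?_
    simp only [h0, zero_mul, zero_smul]
  have hc2 : HasCompactSupport (fun x => β (u x) • fderiv ℝ χ x) := by
    refine (hχ.2.fderiv ℝ).mono fun x hx h0 => hx ?_
    simp only [h0, smul_zero]
  have hA : Integrable (fun x => (χ x * b (u x)) * fderiv ℝ u x (v x)) volume := by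
    have := integrable_bilin_of_hasCompactSupport
      (ContinuousLinearMap.id ℝ (EuclideanSpace ℝ (Fin d) →L[ℝ] ℝ))
      (Φ := fun x => (χ x * b (u x)) • fderiv ℝ u x) (hχb.smul (hus.continuous_fderiv (by simp)))
      hc1 hv.1
    simpa using this
  have hB : Integrable (fun x => β (u x) * fderiv ℝ χ x (v x)) volume := by
    have := integrable_bilin_of_hasCompactSupport
      (ContinuousLinearMap.id ℝ (EuclideanSpace ℝ (Fin d) →L[ℝ] ℝ))
      (Φ := fun x => β (u x) • fderiv ℝ χ x)
      ((hβc.comp hus.continuous).smul (hχ1.continuous_fderiv (by simp)))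
      hc2 hv.1
    simpa using this
  have hD : Integrable (fun x => β (u x) * (χ x * δ x)) volume := by
    have := integrable_bilin_of_hasCompactSupport (ContinuousLinearMap.mul ℝ ℝ)
      (Φ := fun x => χ x * β (u x)) htest.continuous htc hv.2.1
    refine this.congr (Eventually.of_forall fun x => ?_)
    simp only [ContinuousLinearMap.mul_apply']
    ring
  have hE : Integrable (fun x => χ x * b (u x) * mollifiedTransport ρ w v x) volume :=
    (hχb.mul hT).integrable_of_hasCompactSupport (hχ.2.mul_right.mul_right)
  simp_rw [hfd] at key
  rw [integral_add hA hB] at key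
  have e1 : ∫ x, χ x * b (u x) * transportCommutator ρ w v x =
      (∫ x, χ x * b (u x) * mollifiedTransport ρ w v x) +
        ∫ x, χ x * b (u x) * fderiv ℝ u x (v x) := by
    rw [← integral_add hE hA]
    refine integral_congr_ae (Eventually.of_forall fun x => ?_)
    simp only [transportCommutator_eq hρ hw hwv x]
    ring
  have e2 : ∫ x, β (u x) * (fderiv ℝ χ x (v x) + χ x * δ x) =
      (∫ x, β (u x) * fderiv ℝ χ x (v x)) + ∫ x, (χ x * β (u x)) * δ x := by
    simp_rw [mul_add]
    rw [integral_add hB hD]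
    congr 1
    refine integral_congr_ae (Eventually.of_forall fun x => ?_)
    ring
  rw [e1, e2]
  linarith

end Transport

end WeakDerivatives

/-! ### Weak derivatives and difference quotients -/

section Commutators

variable {F : Type*} [NormedAddCommGroup F] [NormedSpace ℝ F]

/-- A smooth cutoff that equals one on the ball of radius `n + 1`. -/
lemma exists_cutoff_eq_one (d n : ℕ) : ∃ g : EuclideanSpace ℝ (Fin d) → ℝ,
    IsTestFun g ∧ (∀ x, ‖x‖ ≤ n + 1 → g x = 1) := by
  let f : ContDiffBump (0 : EuclideanSpace ℝ (Fin d)) :=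
    ⟨n + 1, n + 2, by positivity, by linarith⟩
  exact ⟨f, ⟨f.contDiff, f.hasCompactSupport⟩, fun x hx =>
    f.one_of_mem_closedBall (by simpa using hx)⟩

lemma aestronglyMeasurable_sub_smul_prod {H : Type*} [NormedAddCommGroup H]
    {f : EuclideanSpace ℝ (Fin d) → H}
    (hf : AEStronglyMeasurable f volume) (z : EuclideanSpace ℝ (Fin d)) (ν : Measure ℝ) [SFinite ν] :
    AEStronglyMeasurable (fun p : EuclideanSpace ℝ (Fin d) × ℝ => f (p.1 - p.2 • z))
      ((volume : Measure (EuclideanSpace ℝ (Fin d))).prod ν) := by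
  refine hf.comp_quasiMeasurePreserving (QuasiMeasurePreserving.prod_of_left (by fun_prop) ?_)
  exact Eventually.of_forall fun t => (measurePreserving_sub_const (t • z)).quasiMeasurePreserving

lemma integrable_smul_sub_smul_prod {f : EuclideanSpace ℝ (Fin d) → F}
    (hf : LocallyIntegrable f volume) {g : EuclideanSpace ℝ (Fin d) → ℝ} (hg : Continuous g)
    (hc : HasCompactSupport g) (z : EuclideanSpace ℝ (Fin d)) :
    Integrable (fun p : EuclideanSpace ℝ (Fin d) × ℝ => g p.1 • f (p.1 - p.2 • z))
      ((volume : Measure (EuclideanSpace ℝ (Fin d))).prod (volume.restrict (Ioc 0 1))) := by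
  obtain ⟨R, hR0, hR⟩ := exists_forall_lt_norm_eq_zero hc
  obtain ⟨C, hC⟩ := hc.exists_bound_of_continuous hg
  have hm : AEStronglyMeasurable
      (fun p : EuclideanSpace ℝ (Fin d) × ℝ => g p.1 • f (p.1 - p.2 • z))
      ((volume : Measure (EuclideanSpace ℝ (Fin d))).prod (volume.restrict (Ioc 0 1))) :=
    (hg.aestronglyMeasurable.comp_fst).smul
      (aestronglyMeasurable_sub_smul_prod hf.aestronglyMeasurable z _)
  refine ⟨hm, ?_⟩
  have hfin : ∫⁻ x in Metric.closedBall 0 (R + ‖z‖), ‖f x‖ₑ < ∞ :=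
    (hf.integrableOn_isCompact (isCompact_closedBall _ _)).2
  rw [HasFiniteIntegral, lintegral_prod_symm _ hm.enorm]
  calc _ ≤ ∫⁻ t in Ioc (0 : ℝ) 1,
        ENNReal.ofReal C * ∫⁻ x in Metric.closedBall 0 (R + ‖z‖), ‖f x‖ₑ := by
        refine setLIntegral_mono' measurableSet_Ioc fun t ht => ?_
        rw [← lintegral_indicator measurableSet_closedBall,
          ← lintegral_sub_right_eq_self ((Metric.closedBall 0 (R + ‖z‖)).indicator
            fun x => ‖f x‖ₑ) (t • z), ← lintegral_const_mul' _ _ ENNReal.ofReal_ne_top]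
        refine lintegral_mono fun x => ?_
        by_cases hx : R < ‖x‖
        · simp [hR x hx]
        · have : x - t • z ∈ Metric.closedBall (0 : EuclideanSpace ℝ (Fin d)) (R + ‖z‖) := by
            rw [mem_closedBall_zero_iff]
            refine (norm_sub_le _ _).trans (add_le_add (not_lt.1 hx) ?_)
            rw [norm_smul, Real.norm_of_nonneg ht.1.le]
            exact mul_le_of_le_one_left (norm_nonneg _) ht.2
          rw [indicator_of_mem this, enorm_smul]
          gcongr
          rw [← ofReal_norm]
          exact ENNReal.ofReal_le_ofReal (hC x)
    _ < ∞ := by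
        rw [setLIntegral_const]
        exact ENNReal.mul_lt_top (ENNReal.mul_lt_top ENNReal.ofReal_lt_top hfin) (by simp)

lemma ae_integrable_sub_smul {f : EuclideanSpace ℝ (Fin d) → F}
    (hf : LocallyIntegrable f volume) (z : EuclideanSpace ℝ (Fin d)) :
    ∀ᵐ x, Integrable (fun t : ℝ => f (x - t • z)) (volume.restrict (Ioc 0 1)) := by
  have h : ∀ n : ℕ, ∀ᵐ x : EuclideanSpace ℝ (Fin d), ‖x‖ ≤ n + 1 →
      Integrable (fun t : ℝ => f (x - t • z)) (volume.restrict (Ioc 0 1)) := by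
    intro n
    obtain ⟨g, hg, hg1⟩ := exists_cutoff_eq_one d n
    filter_upwards [(integrable_smul_sub_smul_prod hf hg.1.continuous hg.2 z).prod_right_ae]
      with x hx hxn
    simpa [hg1 x hxn] using hx
  filter_upwards [ae_all_iff.2 h] with x hx
  obtain ⟨n, hn⟩ := exists_nat_ge ‖x‖
  exact hx n (by linarith)

lemma locallyIntegrable_integral_sub_smul {f : EuclideanSpace ℝ (Fin d) → F}
    (hf : LocallyIntegrable f volume) (z : EuclideanSpace ℝ (Fin d)) :
    LocallyIntegrable (fun x => ∫ t in Ioc (0 : ℝ) 1, f (x - t • z)) volume := by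
  rw [locallyIntegrable_iff]
  intro K hK
  obtain ⟨R, hR⟩ := hK.isBounded.subset_closedBall 0
  obtain ⟨n, hn⟩ := exists_nat_ge R
  obtain ⟨g, hg, hg1⟩ := exists_cutoff_eq_one d n
  have h := (integrable_smul_sub_smul_prod hf hg.1.continuous hg.2 z).integral_prod_left
  refine (h.integrableOn (s := K)).congr_fun_ae ?_
  filter_upwards [ae_restrict_mem hK.measurableSet] with x hx
  have : ‖x‖ ≤ n + 1 := by
    have := hR hx
    rw [mem_closedBall_zero_iff] at this
    linarith
  simp [hg1 x this]

/-- Difference quotients of a function with a weak derivative. -/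
lemma HasWeakDeriv.ae_sub_eq [CompleteSpace F] {u : EuclideanSpace ℝ (Fin d) → F}
    {Du : EuclideanSpace ℝ (Fin d) → EuclideanSpace ℝ (Fin d) →L[ℝ] F} (hu : HasWeakDeriv u Du)
    (z : EuclideanSpace ℝ (Fin d)) :
    ∀ᵐ x, u x - u (x - z) = ∫ t in Ioc (0 : ℝ) 1, Du (x - t • z) z := by
  have hDz : LocallyIntegrable (fun y => Du y z) volume :=
    LocallyIntegrable.clm_apply_const hu.2.1 z
  have hloc : LocallyIntegrable (fun x => u (x - z)) volume := by
    rw [locallyIntegrable_iff]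
    intro K hK
    have h1 : IntegrableOn u ((fun x => x - z) '' K) volume :=
      hu.1.integrableOn_isCompact (hK.image (by fun_prop))
    have h2 := ((measurePreserving_sub_const z).integrableOn_comp_preimage
      (Homeomorph.subRight z).measurableEmbedding).2 h1
    exact h2.mono_set (subset_preimage_image _ _)
  refine ae_eq_of_integral_contDiff_smul_eq (hu.1.sub hloc)
    (locallyIntegrable_integral_sub_smul hDz z) fun g hg hgc => ?_
  -- both sides are increments of `t ↦ (ǧ * u)(- t z)`, where `ǧ(y) = g(- y)`
  have hφ : IsTestFun (fun y => g (0 - y)) := IsTestFun.comp_sub_left ⟨hg, hgc⟩ 0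
  set φ : EuclideanSpace ℝ (Fin d) → ℝ := fun y => g (0 - y) with hφd
  have e0 : ∀ (H : Type _) [NormedAddCommGroup H] [NormedSpace ℝ H]
      (f : EuclideanSpace ℝ (Fin d) → H) (y : EuclideanSpace ℝ (Fin d)),
      mollify φ f (-y) = ∫ x, g x • f (x - y) := by
    intro H _ _ f y
    rw [mollify, ← integral_neg_eq_self]
    refine integral_congr_ae (Eventually.of_forall fun x => ?_)
    simp only [hφd]
    congr 2
    · abel
    · abel
  have hcd : ContDiff ℝ (⊤ : ℕ∞) (mollify φ u) :=
    hφ.2.contDiff_convolution_left (ContinuousLinearMap.lsmul ℝ ℝ) hφ.1 hu.1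
  have hcd2 : Continuous (mollify φ (fun y => Du y z)) :=
    (hφ.2.contDiff_convolution_left (n := 0) (ContinuousLinearMap.lsmul ℝ ℝ)
      (hφ.1.of_le (by simp)) hDz).continuous
  have hder : ∀ t : ℝ, HasDerivAt (fun t : ℝ => mollify φ u (-(t • z)))
      (- mollify φ (fun y => Du y z) (-(t • z))) t := by
    intro t
    have h1 := (hcd.differentiable (by simp) (-(t • z))).hasFDerivAt
    have h2 : HasDerivAt (fun t : ℝ => -(t • z)) (-((1 : ℝ) • z)) t :=
      ((hasDerivAt_id t).smul_const z).neg
    have h3 := h1.comp_hasDerivAt t h2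
    rw [map_neg, one_smul, hu.fderiv_mollify hφ] at h3
    exact h3
  have hint := intervalIntegral.integral_eq_sub_of_hasDerivAt (a := 0) (b := 1)
    (fun t _ => hder t) (Continuous.intervalIntegrable
      (hcd2.comp (by fun_prop : Continuous fun t : ℝ => -(t • z))).neg _ _)
  rw [intervalIntegral.integral_of_le zero_le_one, integral_neg] at hint
  have e1 : ∫ x, g x • (u x - u (x - z)) = mollify φ u (-0) - mollify φ u (-z) := by
    rw [e0, e0, ← integral_sub]
    · simp [smul_sub]
    · simpa using hu.1.integrable_smul_left_of_hasCompactSupport hg.continuous hgc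
    · exact hloc.integrable_smul_left_of_hasCompactSupport hg.continuous hgc
  have e2 : ∫ x, g x • ∫ t in Ioc (0 : ℝ) 1, Du (x - t • z) z =
      ∫ t in Ioc (0 : ℝ) 1, mollify φ (fun y => Du y z) (-(t • z)) := by
    simp_rw [e0, ← integral_smul]
    exact integral_integral_swap (integrable_smul_sub_smul_prod hDz hg.continuous hgc z)
  have e3 := e1.trans (show _ = ∫ t in Ioc (0 : ℝ) 1, mollify φ (fun y => Du y z) (-(t • z)) by
    have : ∫ t in Ioc (0 : ℝ) 1, mollify φ (fun y => Du y z) (-(t • z)) =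
        -(mollify φ u (-((1 : ℝ) • z)) - mollify φ u (-((0 : ℝ) • z))) := by
      rw [← hint, neg_neg]
    rw [this]
    simp)
  rw [e2, ← e3]

lemma integrable_coord {α : Type*} [MeasurableSpace α] {μ : Measure α}
    {f : α → EuclideanSpace ℝ (Fin d)} (hf : Integrable f μ) (i : Fin d) :
    Integrable (fun x => f x i) μ :=
  (EuclideanSpace.proj (𝕜 := ℝ) i : EuclideanSpace ℝ (Fin d) →L[ℝ] ℝ).integrable_comp hf

/-- If the field has a weak derivative, the weak divergence is its trace. -/
lemma HasWeakDiv.ae_eq_trace {v : EuclideanSpace ℝ (Fin d) → EuclideanSpace ℝ (Fin d)}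
    {δ : EuclideanSpace ℝ (Fin d) → ℝ}
    {Dv : EuclideanSpace ℝ (Fin d) → EuclideanSpace ℝ (Fin d) →L[ℝ] EuclideanSpace ℝ (Fin d)}
    (hv : HasWeakDiv v δ) (hD : HasWeakDeriv v Dv) :
    ∀ᵐ x, δ x = ∑ i, Dv x (EuclideanSpace.single i 1) i := by
  have hloc : ∀ i : Fin d,
      LocallyIntegrable (fun x => Dv x (EuclideanSpace.single i 1) i) volume := by
    intro i x
    exact (LocallyIntegrable.clm_apply_const hD.2.1 (EuclideanSpace.single i 1) x).imp
      fun _ hs => ⟨hs.1, integrable_coord hs.2 i⟩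
  refine ae_eq_of_integral_contDiff_smul_eq hv.2.1
    (locallyIntegrable_finsetSum _ fun i _ => hloc i) fun g hg hc => ?_
  have h1 := hv.2.2 g ⟨hg, hc⟩
  have hfd : Continuous (fderiv ℝ g) := hg.continuous_fderiv (by simp)
  have e1 : ∀ x, fderiv ℝ g x (v x) =
      ∑ i, (fderiv ℝ g x (EuclideanSpace.single i 1) • v x) i := by
    intro x
    conv_lhs => rw [← (EuclideanSpace.basisFun (Fin d) ℝ).sum_repr (v x)]
    simp [mul_comm]
  have hint : ∀ i : Fin d, Integrable
      (fun x => fderiv ℝ g x (EuclideanSpace.single i 1) • v x) volume := fun i =>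
    hv.1.integrable_smul_left_of_hasCompactSupport (hfd.clm_apply continuous_const)
      (hc.fderiv_apply (𝕜 := ℝ) _)
  have hint2 : ∀ i : Fin d, Integrable
      (fun x => g x • Dv x (EuclideanSpace.single i 1)) volume := fun i =>
    (LocallyIntegrable.clm_apply_const hD.2.1 _).integrable_smul_left_of_hasCompactSupport
      hg.continuous hc
  have e2 : ∀ i : Fin d, ∫ x, (fderiv ℝ g x (EuclideanSpace.single i 1) • v x) i =
      - ∫ x, g x • Dv x (EuclideanSpace.single i 1) i := by
    intro i
    have h2 := hD.2.2 g ⟨hg, hc⟩ (EuclideanSpace.single i 1)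
    have h3 := congrArg (EuclideanSpace.proj (𝕜 := ℝ) i) h2
    rw [map_neg, ← ContinuousLinearMap.integral_comp_comm _ (hint i),
      ← ContinuousLinearMap.integral_comp_comm _ (hint2 i)] at h3
    simpa using h3
  simp_rw [e1] at h1
  rw [integral_finsetSum _ fun i _ => integrable_coord (hint i) i] at h1
  simp_rw [e2] at h1
  rw [Finset.sum_neg_distrib, neg_inj] at h1
  simp_rw [Finset.smul_sum]
  rw [integral_finsetSum]
  · simpa using h1.symm
  · intro i _
    have := integrable_coord (hint2 i) i
    simpa using this

/-- Integration by parts: `∫ ∇ρ(z) · A z dz = - tr A`. In the limit of the commutator this is where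
the divergence comes from. -/
lemma IsMollifier.integral_fderiv_apply {ρ : EuclideanSpace ℝ (Fin d) → ℝ} {ε : ℝ} {M : ℝ≥0}
    (h : IsMollifier ρ ε M)
    (A : EuclideanSpace ℝ (Fin d) →L[ℝ] EuclideanSpace ℝ (Fin d)) :
    ∫ z, fderiv ℝ ρ z (A z) = - ∑ i, A (EuclideanSpace.single i 1) i := by
  have hfd : Continuous (fderiv ℝ ρ) := h.testFun.1.continuous_fderiv (by simp)
  have e1 : ∀ z, fderiv ℝ ρ z (A z) =
      ∑ i, A z i * fderiv ℝ ρ z (EuclideanSpace.single i 1) := by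
    intro z
    conv_lhs => rw [← (EuclideanSpace.basisFun (Fin d) ℝ).sum_repr (A z)]
    simp
  have hA : ∀ i : Fin d, ∀ z, HasFDerivAt (fun z => A z i)
      ((EuclideanSpace.proj (𝕜 := ℝ) i).comp A) z := fun i z =>
    ((EuclideanSpace.proj (𝕜 := ℝ) i).comp A).hasFDerivAt
  have hAc : ∀ i : Fin d, Continuous fun z => A z i := fun i =>
    ((EuclideanSpace.proj (𝕜 := ℝ) i).comp A).continuous
  have hi1 : ∀ i : Fin d, Integrable
      (fun z => A z i * fderiv ℝ ρ z (EuclideanSpace.single i 1)) volume := fun i =>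
    ((hAc i).mul (hfd.clm_apply continuous_const)).integrable_of_hasCompactSupport
      ((h.testFun.2.fderiv_apply (𝕜 := ℝ) _).mul_left)
  have e2 : ∀ i : Fin d, ∫ z, A z i * fderiv ℝ ρ z (EuclideanSpace.single i 1) =
      - A (EuclideanSpace.single i 1) i := by
    intro i
    rw [integral_mul_fderiv_eq_neg_fderiv_mul_of_integrable _ (hi1 i)]
    · simp_rw [(hA i _).fderiv]
      simp [integral_const_mul, h.integral_eq]
    · exact ((hAc i).mul h.continuous).integrable_of_hasCompactSupport h.testFun.2.mul_left
    · exact fun z _ => (hA i z).differentiableAt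
    · exact fun z _ => h.testFun.1.differentiable (by simp) z
    · simp_rw [(hA i _).fderiv]
      exact h.integrable.const_mul _
  simp_rw [e1]
  rw [integral_finsetSum _ fun i _ => hi1 i]
  simp_rw [e2]
  rw [Finset.sum_neg_distrib]

end Commutators

/-! ### The commutator for a Sobolev field -/

section CommutatorEstimates

variable {ρ w δ : EuclideanSpace ℝ (Fin d) → ℝ} {ε R : ℝ} {M : ℝ≥0}
  {v : EuclideanSpace ℝ (Fin d) → EuclideanSpace ℝ (Fin d)}
  {Dv : EuclideanSpace ℝ (Fin d) → EuclideanSpace ℝ (Fin d) →L[ℝ] EuclideanSpace ℝ (Fin d)}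

lemma aestronglyMeasurable_clm_apply {α G H : Type*} [MeasurableSpace α] {μ : Measure α}
    [NormedAddCommGroup G] [NormedSpace ℝ G] [NormedAddCommGroup H] [NormedSpace ℝ H]
    {A : α → G →L[ℝ] H} {f : α → G} (hA : AEStronglyMeasurable A μ)
    (hf : AEStronglyMeasurable f μ) : AEStronglyMeasurable (fun x => A x (f x)) μ :=
  (ContinuousLinearMap.id ℝ (G →L[ℝ] H)).aestronglyMeasurable_comp₂ hA hf

lemma lintegral_translate_smul_sub_zero_le {H : Type*} [NormedAddCommGroup H] [NormedSpace ℝ H]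
    {r r' : ℝ≥0∞} (hr : r⁻¹ + r'⁻¹ = 1)
    {f : EuclideanSpace ℝ (Fin d) → ℝ} {g : EuclideanSpace ℝ (Fin d) → H}
    (hf : AEStronglyMeasurable f volume) (hg : AEStronglyMeasurable g volume)
    (y z : EuclideanSpace ℝ (Fin d)) :
    ∫⁻ x, ‖f (x - y) • g (x - z) - (0 : ℝ) • f x • g x‖ₑ ≤
      eLpNorm f r volume * eLpNorm g r' volume := by
  simp_rw [zero_smul, sub_zero, enorm_smul]
  exact lintegral_translate_mul_le hr hf hg y z

lemma enorm_smul_integral_sub_le {H : Type*} [NormedAddCommGroup H] [NormedSpace ℝ H]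
    [CompleteSpace H] {A : ℝ → H}
    (hA : Integrable A (volume.restrict (Ioc 0 1))) (a : ℝ) (B : H) :
    ‖a • (∫ t in Ioc (0 : ℝ) 1, A t) - B‖ₑ ≤ ∫⁻ t in Ioc (0 : ℝ) 1, ‖a • A t - B‖ₑ := by
  have e : a • (∫ t in Ioc (0 : ℝ) 1, A t) - B = ∫ t in Ioc (0 : ℝ) 1, (a • A t - B) := by
    rw [integral_sub (hA.fun_smul a) (integrable_const _), integral_smul, integral_const]
    simp
  rw [e]
  exact enorm_integral_le_lintegral_enorm _

lemma eLpNorm_indicator_ball {H : Type*} [NormedAddCommGroup H] (p : ℝ≥0∞) (R : ℝ)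
    (f : EuclideanSpace ℝ (Fin d) → H) :
    eLpNorm ((Metric.ball 0 R).indicator f) p volume =
      eLpNorm f p (volume.restrict (Metric.ball 0 R)) :=
  eLpNorm_indicator_eq_eLpNorm_restrict Metric.isOpen_ball.measurableSet

lemma HasWeakDeriv.ae_sub_eq_indicator (hD : HasWeakDeriv v Dv) {z : EuclideanSpace ℝ (Fin d)}
    (hz : ‖z‖ ≤ 1) : ∀ᵐ x, x ∈ Metric.ball (0 : EuclideanSpace ℝ (Fin d)) R →
      Integrable (fun t : ℝ => (Metric.ball 0 (R + 1)).indicator Dv (x - t • z))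
        (volume.restrict (Ioc 0 1)) ∧
      v x - v (x - z) =
        (∫ t in Ioc (0 : ℝ) 1, (Metric.ball 0 (R + 1)).indicator Dv (x - t • z)) z := by
  filter_upwards [hD.ae_sub_eq z, ae_integrable_sub_smul hD.2.1 z] with x hx1 hx2 hx
  have he : ∀ᵐ t ∂(volume.restrict (Ioc (0 : ℝ) 1)),
      Dv (x - t • z) = (Metric.ball 0 (R + 1)).indicator Dv (x - t • z) := by
    filter_upwards [ae_restrict_mem measurableSet_Ioc] with t ht
    rw [indicator_of_mem]
    rw [mem_ball_zero_iff] at hx ⊢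
    refine (norm_sub_le _ _).trans_lt (add_lt_add_of_lt_of_le hx ?_)
    rw [norm_smul, Real.norm_of_nonneg ht.1.le]
    exact mul_le_one₀ ht.2 (norm_nonneg _) hz
  refine ⟨hx2.congr he, ?_⟩
  rw [hx1, ← integral_congr_ae he, ContinuousLinearMap.integral_apply hx2]

/-- Commutator estimate for a Sobolev field. The parameter `κ` is `0` for the uniform bound and `1`
for the convergence of the commutator to `- w div v`. -/
lemma lintegral_commutator_sobolev_le (h : IsMollifier ρ ε M) (hε : ε ≤ 1)
    (hw : LocallyIntegrable w volume) (hwv : LocallyIntegrable (fun x => w x • v x) volume)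
    (hv : HasWeakDiv v δ) (hD : HasWeakDeriv v Dv) (κ : ℝ) {c : ℝ≥0∞}
    (hc : ∀ z₁ z₂ : EuclideanSpace ℝ (Fin d), ‖z₁‖ ≤ ε → ‖z₂‖ ≤ ε →
      ∫⁻ x, ‖w (x - z₁) • (Metric.ball 0 (R + 1)).indicator Dv (x - z₂) -
        κ • w x • (Metric.ball 0 (R + 1)).indicator Dv x‖ₑ ≤ c) :
    ∫⁻ x in Metric.ball 0 R, ‖transportCommutator ρ w v x + κ * (w x * δ x)‖ₑ ≤ M * c := by
  set D' := (Metric.ball 0 (R + 1)).indicator Dv with hD'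
  have hwm := hw.aestronglyMeasurable
  have hvm := hv.1.aestronglyMeasurable
  have hDm : AEStronglyMeasurable D' volume :=
    hD.2.1.aestronglyMeasurable.indicator Metric.isOpen_ball.measurableSet
  have hfd : Continuous (fderiv ℝ ρ) := h.testFun.1.continuous_fderiv (by simp)
  -- as `∫ ∇ρ(z) · (Dv(x) z) dz = - div v(x)`, the commutator plus `κ w div v` is `∫ Φ x z dz`
  set Φ : EuclideanSpace ℝ (Fin d) → EuclideanSpace ℝ (Fin d) → ℝ := fun x z =>
    w (x - z) * fderiv ℝ ρ z (v x - v (x - z)) - κ * w x * fderiv ℝ ρ z (D' x z) with hΦ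
  have hΦm : AEStronglyMeasurable (Function.uncurry Φ)
      ((volume : Measure (EuclideanSpace ℝ (Fin d))).prod volume) := by
    have h1 := hfd.aestronglyMeasurable (μ := volume).comp_snd
      (μ := (volume : Measure (EuclideanSpace ℝ (Fin d))))
    refine AEStronglyMeasurable.sub ?_ ?_
    · exact (aestronglyMeasurable_sub_prod hwm volume).mul
        (aestronglyMeasurable_clm_apply h1
          (hvm.comp_fst.sub (aestronglyMeasurable_sub_prod hvm volume)))
    · exact (hwm.comp_fst.const_mul κ).mul
        (aestronglyMeasurable_clm_apply h1
          (aestronglyMeasurable_clm_apply hDm.comp_fst aestronglyMeasurable_id.comp_snd))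
  have hrep : ∀ᵐ x, x ∈ Metric.ball (0 : EuclideanSpace ℝ (Fin d)) R →
      transportCommutator ρ w v x + κ * (w x * δ x) = ∫ z, Φ x z := by
    filter_upwards [hv.ae_eq_trace hD] with x hx hxR
    have hxR' : x ∈ Metric.ball (0 : EuclideanSpace ℝ (Fin d)) (R + 1) :=
      Metric.ball_subset_ball (by linarith) hxR
    have hi1 : Integrable (fun z => w (x - z) * fderiv ℝ ρ z (v x - v (x - z))) volume := by
      simp_rw [map_sub, mul_sub]
      exact (integrable_fderiv_mul h.testFun hw x _).sub
        (integrable_mollifiedTransport h.testFun hwv x)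
    have hi2 : Integrable (fun z => κ * w x * fderiv ℝ ρ z (D' x z)) volume := by
      refine Integrable.const_mul ?_ _
      refine (hfd.clm_apply (D' x).continuous).integrable_of_hasCompactSupport ?_
      refine (h.testFun.2.fderiv ℝ).mono fun z hz h0 => hz ?_
      simp only [h0, zero_apply]
    rw [integral_sub hi1 hi2, integral_const_mul, h.integral_fderiv_apply, hD',
      indicator_of_mem hxR', ← hx, transportCommutator]
    ring
  -- the increment `v x - v (x - z)` is the mean of `Dv (x - t z) z` over `t`, which gives the factor
  -- `‖z‖` to be paired with `∇ρ`
  set A : EuclideanSpace ℝ (Fin d) → ℝ≥0∞ := fun z =>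
    ∫⁻ x, ∫⁻ t in Ioc (0 : ℝ) 1, ‖w (x - z) • D' (x - t • z) - κ • w x • D' x‖ₑ with hA
  have hAc : ∀ z, ‖z‖ ≤ ε → A z ≤ c := by
    intro z hz
    simp only [hA]
    rw [lintegral_lintegral_swap]
    · calc _ ≤ ∫⁻ t in Ioc (0 : ℝ) 1, c := by
            refine setLIntegral_mono' measurableSet_Ioc fun t ht => hc z (t • z) hz ?_
            rw [norm_smul, Real.norm_of_nonneg ht.1.le]
            exact (mul_le_of_le_one_left (norm_nonneg _) ht.2).trans hz
        _ = c := by simp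
    · refine (AEStronglyMeasurable.sub ?_ ?_).enorm
      · exact ((aestronglyMeasurable_comp_sub_const hwm z).comp_fst).smul
          (aestronglyMeasurable_sub_smul_prod hDm z _)
      · exact ((hwm.smul hDm).const_smul κ).comp_fst
  have hB : ∀ z, ∫⁻ x, ‖Φ x z‖ₑ * (Metric.ball 0 R).indicator 1 x ≤
      ‖fderiv ℝ ρ z‖ₑ * ‖z‖ₑ * A z := by
    intro z
    by_cases hz : ε < ‖z‖
    · have : ∀ x, Φ x z = 0 := fun x => by
        simp only [hΦ, h.fderiv_eq_zero hz, zero_apply, mul_zero, sub_zero]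
      simp [this]
    · rw [not_lt] at hz
      simp only [hA]
      rw [← lintegral_const_mul' _ _ (ENNReal.mul_ne_top enorm_ne_top enorm_ne_top)]
      refine lintegral_mono_ae ?_
      filter_upwards [hD.ae_sub_eq_indicator (R := R) (hz.trans hε)] with x hx
      by_cases hxR : x ∈ Metric.ball (0 : EuclideanSpace ℝ (Fin d)) R
      · obtain ⟨hx1, hx2⟩ := hx hxR
        rw [indicator_of_mem hxR, Pi.one_apply, mul_one]
        have e : Φ x z = fderiv ℝ ρ z ((w (x - z) • (∫ t in Ioc (0 : ℝ) 1, D' (x - t • z)) -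
            κ • w x • D' x) z) := by
          simp only [hΦ]
          rw [hx2]
          simp only [hD', sub_apply, smul_apply, map_sub, map_smul, smul_eq_mul, mul_assoc]
        rw [e]
        refine (ContinuousLinearMap.le_opENorm _ _).trans ?_
        rw [mul_assoc]
        refine mul_le_mul_right ((ContinuousLinearMap.le_opENorm _ _).trans ?_) _
        rw [mul_comm]
        exact mul_le_mul_right (enorm_smul_integral_sub_le hx1 _ _) _
      · simp [indicator_of_notMem hxR]
  calc ∫⁻ x in Metric.ball 0 R, ‖transportCommutator ρ w v x + κ * (w x * δ x)‖ₑ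
      = ∫⁻ x, ‖∫ z, Φ x z‖ₑ * (Metric.ball 0 R).indicator 1 x := by
        rw [← lintegral_indicator Metric.isOpen_ball.measurableSet]
        refine lintegral_congr_ae ?_
        filter_upwards [hrep] with x hx
        by_cases hxR : x ∈ Metric.ball (0 : EuclideanSpace ℝ (Fin d)) R
        · simp [indicator_of_mem hxR, hx hxR]
        · simp [indicator_of_notMem hxR]
    _ ≤ ∫⁻ z, ∫⁻ x, ‖Φ x z‖ₑ * (Metric.ball 0 R).indicator 1 x :=
        lintegral_enorm_integral_mul_le hΦm
          (aemeasurable_const.indicator Metric.isOpen_ball.measurableSet)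
    _ ≤ ∫⁻ z, ‖fderiv ℝ ρ z‖ₑ * ‖z‖ₑ * A z := lintegral_mono hB
    _ ≤ M * c := h.lintegral_moment_mul_le hAc

lemma memLp_indicator_ball {H : Type*} [NormedAddCommGroup H] {p : ℝ≥0∞}
    {f : EuclideanSpace ℝ (Fin d) → H}
    (hf : MemLp f p (volume.restrict (Metric.ball 0 R))) :
    MemLp ((Metric.ball 0 R).indicator f) p volume :=
  (memLp_indicator_iff_restrict Metric.isOpen_ball.measurableSet).2 hf

lemma locallyIntegrable_of_memLp_ball {H : Type*} [NormedAddCommGroup H] {p : ℝ≥0∞} (hp : 1 ≤ p)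
    {f : EuclideanSpace ℝ (Fin d) → H}
    (hf : ∀ R, MemLp f p (volume.restrict (Metric.ball 0 R))) : LocallyIntegrable f volume := by
  rw [locallyIntegrable_iff]
  intro K hK
  obtain ⟨R, hR⟩ := hK.isBounded.subset_ball 0
  have : IsFiniteMeasure (volume.restrict (Metric.ball (0 : EuclideanSpace ℝ (Fin d)) R)) :=
    ⟨by simpa using Metric.isBounded_ball.measure_lt_top⟩
  exact IntegrableOn.mono_set ((hf R).integrable hp) hR

lemma one_le_of_inv_add_inv {r r' : ℝ≥0∞} (hr : r⁻¹ + r'⁻¹ = 1) : 1 ≤ r := by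
  rw [← ENNReal.inv_le_one, ← hr]; exact le_self_add

lemma locallyIntegrable_smul_of_conjugate {H : Type*} [NormedAddCommGroup H] [NormedSpace ℝ H]
    {r r' : ℝ≥0∞} (hr : r⁻¹ + r'⁻¹ = 1)
    (hw : MemLp w r volume) {f : EuclideanSpace ℝ (Fin d) → H}
    (hf : ∀ R, MemLp f r' (volume.restrict (Metric.ball 0 R))) :
    LocallyIntegrable (fun x => w x • f x) volume :=
  locallyIntegrable_of_memLp_ball le_rfl fun R =>
    memLp_one_smul_of_conjugate hr (hw.restrict _) (hf R)

lemma eventually_forall_norm_le_scale_prod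
    {A : EuclideanSpace ℝ (Fin d) × EuclideanSpace ℝ (Fin d) → ℝ≥0∞}
    (hA : Tendsto A (𝓝 (0, 0)) (𝓝 0)) {c : ℝ≥0∞} (hc : 0 < c) :
    ∀ᶠ n : ℕ in atTop, ∀ z₁ z₂, ‖z₁‖ ≤ ((n : ℝ) + 1)⁻¹ → ‖z₂‖ ≤ ((n : ℝ) + 1)⁻¹ →
      A (z₁, z₂) ≤ c := by
  have h1 := ENNReal.tendsto_nhds_zero.1 hA c hc
  obtain ⟨η, hη, h2⟩ := Metric.eventually_nhds_iff.1 h1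
  filter_upwards [(tendsto_order.1 tendsto_scale).2 η hη] with n hn z₁ z₂ h₁ h₂
  refine h2 ?_
  rw [Prod.dist_eq]
  refine max_lt ?_ ?_
  · simpa using h₁.trans_lt hn
  · simpa using h₂.trans_lt hn

/-- The commutator with a Sobolev field converges to `- w div v` in `L^1_loc`, and is bounded there
uniformly in the mollification parameter. -/
lemma commutator_sobolev {r r' : ℝ≥0∞} (hr : r⁻¹ + r'⁻¹ = 1)
    (hM : ∀ n, IsMollifier (mollifier d n) (((n : ℝ) + 1)⁻¹) M)
    (hw : MemLp w r volume) (hv : HasWeakDiv v δ) (hD : HasWeakDeriv v Dv)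
    (hvL : ∀ R, MemLp v r' (volume.restrict (Metric.ball 0 R)))
    (hDL : ∀ R, MemLp Dv r' (volume.restrict (Metric.ball 0 R))) (R : ℝ) :
    Tendsto (fun n => ∫⁻ x in Metric.ball 0 R,
      ‖transportCommutator (mollifier d n) w v x + w x * δ x‖ₑ) atTop (𝓝 0) ∧
    ∀ n, ∫⁻ x in Metric.ball 0 R, ‖transportCommutator (mollifier d n) w v x‖ₑ ≤
      M * (eLpNorm w r volume * eLpNorm Dv r' (volume.restrict (Metric.ball 0 (R + 1)))) := by
  have hs : ∀ n : ℕ, ((n : ℝ) + 1)⁻¹ ≤ 1 := fun n => inv_le_one_of_one_le₀ (by simp)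
  have hwl : LocallyIntegrable w volume := hw.locallyIntegrable (one_le_of_inv_add_inv hr)
  have hwv := locallyIntegrable_smul_of_conjugate hr hw hvL
  have hD' := memLp_indicator_ball (hDL (R + 1))
  constructor
  · refine ENNReal.tendsto_nhds_zero.2 fun c hc => ?_
    have hc' : 0 < c / (M + 1) := ENNReal.div_pos hc.ne' (by finiteness)
    filter_upwards [eventually_forall_norm_le_scale_prod
      (tendsto_lintegral_translate_smul_sub hr hw hD') hc'] with n hn
    have h3 : ∀ z₁ z₂ : EuclideanSpace ℝ (Fin d), ‖z₁‖ ≤ ((n : ℝ) + 1)⁻¹ →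
        ‖z₂‖ ≤ ((n : ℝ) + 1)⁻¹ →
        ∫⁻ x, ‖w (x - z₁) • (Metric.ball 0 (R + 1)).indicator Dv (x - z₂) -
          (1 : ℝ) • w x • (Metric.ball 0 (R + 1)).indicator Dv x‖ₑ ≤ c / (M + 1) := by
      intro z₁ z₂ h₁ h₂
      simp_rw [one_smul]
      exact hn z₁ z₂ h₁ h₂
    have := lintegral_commutator_sobolev_le (hM n) (hs n) hwl hwv hv hD 1 h3
    simp only [one_mul] at this
    refine this.trans ?_
    calc (M : ℝ≥0∞) * (c / (M + 1)) ≤ (M + 1) * (c / (M + 1)) := by gcongr; exact le_self_add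
      _ ≤ c := ENNReal.mul_div_le
  · intro n
    have h3 : ∀ z₁ z₂ : EuclideanSpace ℝ (Fin d), ‖z₁‖ ≤ ((n : ℝ) + 1)⁻¹ →
        ‖z₂‖ ≤ ((n : ℝ) + 1)⁻¹ →
        ∫⁻ x, ‖w (x - z₁) • (Metric.ball 0 (R + 1)).indicator Dv (x - z₂) -
          (0 : ℝ) • w x • (Metric.ball 0 (R + 1)).indicator Dv x‖ₑ ≤
        eLpNorm w r volume * eLpNorm Dv r' (volume.restrict (Metric.ball 0 (R + 1))) := by
      intro z₁ z₂ _ _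
      rw [← eLpNorm_indicator_ball]
      exact lintegral_translate_smul_sub_zero_le hr hw.1 hD'.1 z₁ z₂
    have := lintegral_commutator_sobolev_le (hM n) (hs n) hwl hwv hv hD 0 h3
    simpa only [zero_mul, add_zero] using this

end CommutatorEstimates

/-! ### The commutator for a weakly differentiable solution -/

section RegularSolutions

variable {ρ w δ : EuclideanSpace ℝ (Fin d) → ℝ} {ε R : ℝ} {M : ℝ≥0}
  {v : EuclideanSpace ℝ (Fin d) → EuclideanSpace ℝ (Fin d)}
  {Dw : EuclideanSpace ℝ (Fin d) → EuclideanSpace ℝ (Fin d) →L[ℝ] ℝ}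

lemma memLp_smul_of_hasCompactSupport {H : Type*} [NormedAddCommGroup H] [NormedSpace ℝ H]
    {p : ℝ≥0∞} {φ : EuclideanSpace ℝ (Fin d) → ℝ} (hφ : Continuous φ) (hc : HasCompactSupport φ)
    {f : EuclideanSpace ℝ (Fin d) → H}
    (hf : ∀ R, MemLp f p (volume.restrict (Metric.ball 0 R))) :
    MemLp (fun x => φ x • f x) p volume := by
  obtain ⟨R, hR0, hR⟩ := exists_forall_lt_norm_eq_zero hc
  have h1 := memLp_indicator_ball (hf (R + 1))
  have h2 : MemLp (fun x => φ x • (Metric.ball 0 (R + 1)).indicator f x) p volume :=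
    h1.smul (hφ.memLp_top_of_hasCompactSupport hc volume)
  refine h2.ae_eq (Eventually.of_forall fun x => ?_)
  by_cases hx : x ∈ Metric.ball (0 : EuclideanSpace ℝ (Fin d)) (R + 1)
  · simp [indicator_of_mem hx]
  · rw [mem_ball_zero_iff, not_lt] at hx
    simp [hR x (by linarith)]

lemma IsMollifier.mollify_indicator {H : Type*} [NormedAddCommGroup H] [NormedSpace ℝ H]
    (h : IsMollifier ρ ε M) (hε : ε ≤ 1) (f : EuclideanSpace ℝ (Fin d) → H)
    {x : EuclideanSpace ℝ (Fin d)} (hx : x ∈ Metric.ball (0 : EuclideanSpace ℝ (Fin d)) R) :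
    mollify ρ ((Metric.ball 0 (R + 1)).indicator f) x = mollify ρ f x := by
  refine integral_congr_ae (Eventually.of_forall fun z => ?_)
  by_cases hz : ε < ‖z‖
  · simp [h.eq_zero hz]
  · have : x - z ∈ Metric.ball (0 : EuclideanSpace ℝ (Fin d)) (R + 1) := by
      rw [mem_ball_zero_iff] at hx ⊢
      exact (norm_sub_le _ _).trans_lt (add_lt_add_of_lt_of_le hx ((not_lt.1 hz).trans hε))
    simp [indicator_of_mem this]

lemma IsMollifier.fderiv_mollify_eq (h : IsMollifier ρ ε M) (hD : HasWeakDeriv w Dw)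
    (x : EuclideanSpace ℝ (Fin d)) : fderiv ℝ (mollify ρ w) x = mollify ρ Dw x := by
  ext y
  rw [hD.fderiv_mollify h.testFun, mollify, mollify,
    ContinuousLinearMap.integral_apply (h.integrable_smul_translate hD.2.1 x)]
  rfl

lemma locallyIntegrable_clm_apply {r r' : ℝ≥0∞} (hr : r⁻¹ + r'⁻¹ = 1)
    (hDL : ∀ R, MemLp Dw r (volume.restrict (Metric.ball 0 R)))
    (hvL : ∀ R, MemLp v r' (volume.restrict (Metric.ball 0 R))) (R : ℝ) :
    MemLp (fun x => Dw x (v x)) 1 (volume.restrict (Metric.ball 0 R)) := by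
  refine (memLp_one_smul_of_conjugate hr (hDL R).norm (hvL R)).mono
    (aestronglyMeasurable_clm_apply (hDL R).1 (hvL R).1) (Eventually.of_forall fun x => ?_)
  rw [norm_smul, norm_norm]
  exact (Dw x).le_opNorm _

/-- The product rule for the divergence of `w v`, for conjugate integrability exponents. -/
lemma HasWeakDiv.integral_mul_fderiv {r r' : ℝ≥0∞} (hr : r⁻¹ + r'⁻¹ = 1)
    (hw : MemLp w r volume) (hD : HasWeakDeriv w Dw) (hv : HasWeakDiv v δ)
    (hvL : ∀ R, MemLp v r' (volume.restrict (Metric.ball 0 R)))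
    (hδL : ∀ R, MemLp δ r' (volume.restrict (Metric.ball 0 R)))
    (hDL : ∀ R, MemLp Dw r (volume.restrict (Metric.ball 0 R)))
    {φ : EuclideanSpace ℝ (Fin d) → ℝ} (hφ : IsTestFun φ) :
    ∫ x, w x * fderiv ℝ φ x (v x) = - ∫ x, φ x * (Dw x (v x) + w x * δ x) := by
  obtain ⟨M, hM⟩ := exists_isMollifier d
  have hs : ∀ n : ℕ, ((n : ℝ) + 1)⁻¹ ≤ 1 := fun n => inv_le_one_of_one_le₀ (by simp)
  have hr1 : 1 ≤ r := one_le_of_inv_add_inv hr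
  have hwl : LocallyIntegrable w volume := hw.locallyIntegrable hr1
  obtain ⟨R, hR0, hR⟩ := exists_forall_lt_norm_eq_zero hφ.2
  have hfd : Continuous (fderiv ℝ φ) := hφ.1.continuous_fderiv (by simp)
  have hw' : ∀ n, ContDiff ℝ (⊤ : ℕ∞) (mollify (mollifier d n) w) := fun n =>
    (hM n).contDiff_mollify hwl
  have htest : ∀ n, IsTestFun (fun x => φ x * mollify (mollifier d n) w x) := fun n =>
    ⟨hφ.1.mul (hw' n), hφ.2.mul_right⟩
  have hg1 : MemLp (fun x => fderiv ℝ φ x (v x)) r' volume := by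
    refine (memLp_smul_of_hasCompactSupport hfd.norm (hφ.2.fderiv ℝ).norm hvL).mono
      (aestronglyMeasurable_clm_apply hfd.aestronglyMeasurable hv.1.aestronglyMeasurable)
      (Eventually.of_forall fun x => ?_)
    rw [norm_smul, norm_norm]
    exact (fderiv ℝ φ x).le_opNorm _
  have hg2 : MemLp (fun x => φ x • v x) r' volume :=
    memLp_smul_of_hasCompactSupport hφ.1.continuous hφ.2 hvL
  have hg3 : MemLp (fun x => φ x • δ x) r' volume :=
    memLp_smul_of_hasCompactSupport hφ.1.continuous hφ.2 hδL
  have hD' := memLp_indicator_ball (hDL (R + 2))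
  have hDvl : LocallyIntegrable (fun x => Dw x (v x)) volume :=
    locallyIntegrable_of_memLp_ball le_rfl (locallyIntegrable_clm_apply hr hDL hvL)
  have i1 : Integrable (fun x => w x * fderiv ℝ φ x (v x)) volume :=
    memLp_one_iff_integrable.1 (memLp_one_smul_of_conjugate hr hw hg1)
  have i2 : Integrable (fun x => φ x * Dw x (v x)) volume :=
    hDvl.integrable_smul_left_of_hasCompactSupport hφ.1.continuous hφ.2
  have i3 : Integrable (fun x => φ x * (w x * δ x)) volume :=
    (locallyIntegrable_smul_of_conjugate hr hw hδL).integrable_smul_left_of_hasCompactSupport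
      hφ.1.continuous hφ.2
  have j1 : ∀ n, Integrable
      (fun x => mollify (mollifier d n) w x * fderiv ℝ φ x (v x)) volume := by
    intro n
    have := integrable_bilin_of_hasCompactSupport
      (ContinuousLinearMap.id ℝ (EuclideanSpace ℝ (Fin d) →L[ℝ] ℝ))
      (Φ := fun x => mollify (mollifier d n) w x • fderiv ℝ φ x)
      ((hw' n).continuous.smul hfd) ((hφ.2.fderiv ℝ).mono fun x hx h0 => hx (by
        simp only [h0, smul_zero])) hv.1
    simpa using this
  have j2 : ∀ n, Integrable
      (fun x => φ x * fderiv ℝ (mollify (mollifier d n) w) x (v x)) volume := by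
    intro n
    have := integrable_bilin_of_hasCompactSupport
      (ContinuousLinearMap.id ℝ (EuclideanSpace ℝ (Fin d) →L[ℝ] ℝ))
      (Φ := fun x => φ x • fderiv ℝ (mollify (mollifier d n) w) x)
      (hφ.1.continuous.smul ((hw' n).continuous_fderiv (by simp)))
      (hφ.2.mono fun x hx h0 => hx (by simp only [h0, zero_smul])) hv.1
    simpa using this
  have j3 : ∀ n, Integrable
      (fun x => φ x * (mollify (mollifier d n) w x * δ x)) volume := by
    intro n
    have := hv.2.1.integrable_smul_left_of_hasCompactSupport (htest n).1.continuous (htest n).2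
    simpa [mul_assoc] using this
  have key : ∀ n, (∫ x, mollify (mollifier d n) w x * fderiv ℝ φ x (v x)) +
      ∫ x, φ x * fderiv ℝ (mollify (mollifier d n) w) x (v x) =
      - ∫ x, φ x * (mollify (mollifier d n) w x * δ x) := by
    intro n
    have h1 := hv.2.2 _ (htest n)
    have h2 : ∀ x y, fderiv ℝ (fun x => φ x * mollify (mollifier d n) w x) x y =
        mollify (mollifier d n) w x * fderiv ℝ φ x y +
          φ x * fderiv ℝ (mollify (mollifier d n) w) x y := by
      intro x y
      have h3 := (((hφ.1.differentiable (by simp) x).hasFDerivAt).mul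
        (((hw' n).differentiable (by simp) x).hasFDerivAt))
      have h4 : fderiv ℝ (fun x => φ x * mollify (mollifier d n) w x) x = _ := h3.fderiv
      rw [h4]
      simp only [add_apply, smul_apply, smul_eq_mul]
      ring
    simp_rw [h2] at h1
    rw [integral_add (j1 n) (j2 n)] at h1
    simpa [mul_assoc] using h1
  have l1 : Tendsto (fun n => ∫ x, mollify (mollifier d n) w x * fderiv ℝ φ x (v x)) atTop
      (𝓝 (∫ x, w x * fderiv ℝ φ x (v x))) := by
    refine tendsto_integral_of_L1 _ i1.1 (Eventually.of_forall j1) ?_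
    refine (tendsto_lintegral_mollify_sub_mul hr hw hg1).congr fun n => ?_
    refine lintegral_congr fun x => ?_
    rw [← enorm_mul, sub_mul]
  have l3 : Tendsto (fun n => ∫ x, φ x * (mollify (mollifier d n) w x * δ x)) atTop
      (𝓝 (∫ x, φ x * (w x * δ x))) := by
    refine tendsto_integral_of_L1 _ i3.1 (Eventually.of_forall j3) ?_
    refine (tendsto_lintegral_mollify_sub_mul hr hw hg3).congr fun n => ?_
    refine lintegral_congr fun x => ?_
    rw [← enorm_mul, smul_eq_mul]
    congr 1
    ring
  have l2 : Tendsto (fun n => ∫ x, φ x * fderiv ℝ (mollify (mollifier d n) w) x (v x)) atTop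
      (𝓝 (∫ x, φ x * Dw x (v x))) := by
    refine tendsto_integral_of_L1 _ i2.1 (Eventually.of_forall j2) ?_
    refine tendsto_of_tendsto_of_tendsto_of_le_of_le tendsto_const_nhds
      (tendsto_lintegral_mollify_sub_mul hr hD' hg2) (fun _ => zero_le) fun n => ?_
    refine lintegral_mono fun x => ?_
    by_cases hx : R < ‖x‖
    · simp [hR x hx]
    · have hx1 : x ∈ Metric.ball (0 : EuclideanSpace ℝ (Fin d)) (R + 1) := by
        rw [mem_ball_zero_iff]; linarith
      have hx2 : x ∈ Metric.ball (0 : EuclideanSpace ℝ (Fin d)) (R + 2) := by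
        rw [mem_ball_zero_iff]; linarith
      have e := (hM n).mollify_indicator (hs n) Dw hx1
      rw [show R + 1 + 1 = R + 2 by ring] at e
      rw [(hM n).fderiv_mollify_eq hD]
      have e2 : φ x * (mollify (mollifier d n) Dw x) (v x) - φ x * Dw x (v x) =
          (mollify (mollifier d n) ((Metric.ball 0 (R + 2)).indicator Dw) x -
            (Metric.ball 0 (R + 2)).indicator Dw x) (φ x • v x) := by
        rw [e, indicator_of_mem hx2, map_smul, sub_apply, smul_eq_mul, mul_sub]
      rw [e2]
      exact ContinuousLinearMap.le_opENorm _ _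
  have hlim := tendsto_nhds_unique (l1.add l2) (l3.neg.congr fun n => (key n).symm)
  have e : ∫ x, φ x * (Dw x (v x) + w x * δ x) =
      (∫ x, φ x * Dw x (v x)) + ∫ x, φ x * (w x * δ x) := by
    simp_rw [mul_add]
    exact integral_add i2 i3
  rw [e]
  linarith

lemma lintegral_add_add_eq {X : Type*} [MeasurableSpace X] {μ : Measure X} {f g : X → ℝ≥0∞}
    (hf : AEMeasurable f μ) (hg : AEMeasurable g μ) (h : X → ℝ≥0∞) :
    (∫⁻ x, f x ∂μ) + (∫⁻ x, g x ∂μ) + ∫⁻ x, h x ∂μ = ∫⁻ x, (f x + g x + h x) ∂μ := by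
  rw [← lintegral_add_left' hf]
  exact (lintegral_add_left' (hf.add hg) h).symm

/-- For a solution with a weak derivative the mollified product rule gives the commutator as a
difference of mollifications. -/
lemma transportCommutator_eq_mollify {r r' : ℝ≥0∞} (hr : r⁻¹ + r'⁻¹ = 1)
    (h : IsMollifier ρ ε M)
    (hw : MemLp w r volume) (hD : HasWeakDeriv w Dw) (hv : HasWeakDiv v δ)
    (hvL : ∀ R, MemLp v r' (volume.restrict (Metric.ball 0 R)))
    (hδL : ∀ R, MemLp δ r' (volume.restrict (Metric.ball 0 R)))
    (hDL : ∀ R, MemLp Dw r (volume.restrict (Metric.ball 0 R)))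
    (x : EuclideanSpace ℝ (Fin d)) :
    transportCommutator ρ w v x = mollify ρ Dw x (v x) - mollify ρ (fun y => Dw y (v y)) x -
      mollify ρ (fun y => w y * δ y) x := by
  have hwl : LocallyIntegrable w volume := hw.locallyIntegrable (one_le_of_inv_add_inv hr)
  have hDvl : LocallyIntegrable (fun x => Dw x (v x)) volume :=
    locallyIntegrable_of_memLp_ball le_rfl (locallyIntegrable_clm_apply hr hDL hvL)
  have hwδ : LocallyIntegrable (fun x => w x * δ x) volume :=
    locallyIntegrable_smul_of_conjugate hr hw hδL
  rw [transportCommutator_eq h.testFun hwl (locallyIntegrable_smul_of_conjugate hr hw hvL),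
    h.fderiv_mollify_eq hD]
  have h1 := hv.integral_mul_fderiv hr hw hD hvL hδL hDL (h.testFun.comp_sub_left x)
  simp_rw [fderiv_comp_sub_left h.testFun] at h1
  have e1 : mollifiedTransport ρ w v x = ∫ y, w y * -(fderiv ℝ ρ (x - y)) (v y) := by
    rw [mollifiedTransport, ← integral_sub_left_eq_self _ volume x, ← integral_neg]
    simp
  have i1 := h.integrable_smul_translate hDvl x
  have i2 := h.integrable_smul_translate hwδ x
  have e2 : ∫ y, ρ (x - y) * (Dw y (v y) + w y * δ y) =
      mollify ρ (fun y => Dw y (v y)) x + mollify ρ (fun y => w y * δ y) x := by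
    rw [mollify, mollify, ← integral_add i1 i2, ← integral_sub_left_eq_self _ volume x]
    simp [mul_add]
  rw [e1, h1, e2]
  ring

/-- The commutator of a weakly differentiable solution converges to `- w div v` in `L^1_loc`, and is
bounded there uniformly in the mollification parameter. -/
lemma commutator_regular {r r' : ℝ≥0∞} (hr : r⁻¹ + r'⁻¹ = 1)
    (hM : ∀ n, IsMollifier (mollifier d n) (((n : ℝ) + 1)⁻¹) M)
    (hw : MemLp w r volume) (hD : HasWeakDeriv w Dw) (hv : HasWeakDiv v δ)
    (hvL : ∀ R, MemLp v r' (volume.restrict (Metric.ball 0 R)))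
    (hδL : ∀ R, MemLp δ r' (volume.restrict (Metric.ball 0 R)))
    (hDL : ∀ R, MemLp Dw r (volume.restrict (Metric.ball 0 R))) (R : ℝ) :
    Tendsto (fun n => ∫⁻ x in Metric.ball 0 R,
      ‖transportCommutator (mollifier d n) w v x + w x * δ x‖ₑ) atTop (𝓝 0) ∧
    ∀ n, ∫⁻ x in Metric.ball 0 R, ‖transportCommutator (mollifier d n) w v x‖ₑ ≤
      2 * (eLpNorm Dw r (volume.restrict (Metric.ball 0 (R + 1))) *
        eLpNorm v r' (volume.restrict (Metric.ball 0 (R + 1)))) +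
      eLpNorm w r volume * eLpNorm δ r' (volume.restrict (Metric.ball 0 (R + 1))) := by
  have hs : ∀ n : ℕ, ((n : ℝ) + 1)⁻¹ ≤ 1 := fun n => inv_le_one_of_one_le₀ (by simp)
  have hr' : r'⁻¹ + r⁻¹ = 1 := by rw [add_comm]; exact hr
  set B := Metric.ball (0 : EuclideanSpace ℝ (Fin d)) (R + 1) with hB
  have hBm : MeasurableSet B := Metric.isOpen_ball.measurableSet
  have hRB : Metric.ball (0 : EuclideanSpace ℝ (Fin d)) R ⊆ B :=
    Metric.ball_subset_ball (by linarith)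
  have hD' := memLp_indicator_ball (hDL (R + 1))
  have hv' := memLp_indicator_ball (hvL (R + 1))
  have hδ' := memLp_indicator_ball (hδL (R + 1))
  have hp1 := memLp_indicator_ball (locallyIntegrable_clm_apply hr hDL hvL (R + 1))
  have hp2 : MemLp (B.indicator fun x => w x * δ x) 1 volume :=
    memLp_indicator_ball (memLp_one_smul_of_conjugate hr (hw.restrict _) (hδL (R + 1)))
  have hD'l := hD'.locallyIntegrable (one_le_of_inv_add_inv hr)
  have hp1l := hp1.locallyIntegrable le_rfl
  have hp2l := hp2.locallyIntegrable le_rfl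
  have hm1 : ∀ n, Continuous (mollify (mollifier d n) (B.indicator Dw)) := fun n =>
    ((hM n).contDiff_mollify hD'l).continuous
  have hm2 : ∀ n, Continuous (mollify (mollifier d n) (B.indicator fun y => Dw y (v y))) :=
    fun n => ((hM n).contDiff_mollify hp1l).continuous
  have hm3 : ∀ n, Continuous (mollify (mollifier d n) (B.indicator fun y => w y * δ y)) :=
    fun n => ((hM n).contDiff_mollify hp2l).continuous
  have hrep : ∀ n, ∀ x ∈ Metric.ball (0 : EuclideanSpace ℝ (Fin d)) R,
      transportCommutator (mollifier d n) w v x =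
        mollify (mollifier d n) (B.indicator Dw) x (B.indicator v x) -
        mollify (mollifier d n) (B.indicator fun y => Dw y (v y)) x -
        mollify (mollifier d n) (B.indicator fun y => w y * δ y) x := by
    intro n x hx
    rw [transportCommutator_eq_mollify hr (hM n) hw hD hv hvL hδL hDL x,
      (hM n).mollify_indicator (hs n) Dw hx, (hM n).mollify_indicator (hs n) _ hx,
      (hM n).mollify_indicator (hs n) _ hx, indicator_of_mem (hRB hx)]
  constructor
  · have l1 := tendsto_lintegral_mollify_sub_mul hr hD' hv'
    have l2 := tendsto_lintegral_mollify_sub hp1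
    have l3 := tendsto_lintegral_mollify_sub hp2
    have l := (l1.add l2).add l3
    simp only [add_zero] at l
    refine tendsto_of_tendsto_of_tendsto_of_le_of_le tendsto_const_nhds l (fun _ => zero_le)
      fun n => ?_
    have hc1 : AEMeasurable (fun x => ‖mollify (mollifier d n) (B.indicator Dw) x -
        B.indicator Dw x‖ₑ * ‖B.indicator v x‖ₑ) volume :=
      ((hm1 n).aestronglyMeasurable.sub hD'.1).enorm.mul hv'.1.enorm
    have hc2 : AEMeasurable (fun x => ‖mollify (mollifier d n) (B.indicator fun y => Dw y (v y)) x -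
        B.indicator (fun y => Dw y (v y)) x‖ₑ) volume :=
      ((hm2 n).aestronglyMeasurable.sub hp1.1).enorm
    simp only
    refine le_trans ?_ (lintegral_add_add_eq hc1 hc2 _).ge
    rw [← lintegral_indicator Metric.isOpen_ball.measurableSet]
    refine lintegral_mono fun x => ?_
    by_cases hx : x ∈ Metric.ball (0 : EuclideanSpace ℝ (Fin d)) R
    · rw [indicator_of_mem hx, hrep n x hx]
      have e : mollify (mollifier d n) (B.indicator Dw) x (B.indicator v x) -
          mollify (mollifier d n) (B.indicator fun y => Dw y (v y)) x -
          mollify (mollifier d n) (B.indicator fun y => w y * δ y) x + w x * δ x =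
          (mollify (mollifier d n) (B.indicator Dw) x - B.indicator Dw x) (B.indicator v x) -
          (mollify (mollifier d n) (B.indicator fun y => Dw y (v y)) x -
            B.indicator (fun y => Dw y (v y)) x) -
          (mollify (mollifier d n) (B.indicator fun y => w y * δ y) x -
            B.indicator (fun y => w y * δ y) x) := by
        simp only [indicator_of_mem (hRB hx), sub_apply]
        ring
      rw [e]
      refine enorm_sub_le.trans (add_le_add (enorm_sub_le.trans (add_le_add ?_ le_rfl)) le_rfl)
      exact ContinuousLinearMap.le_opENorm _ _
    · rw [indicator_of_notMem hx]
      exact zero_le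
  · intro n
    have b1 := (hM n).lintegral_mollify_mul_enorm_le hr hD'.1 hv'.1
    have b2 := (hM n).lintegral_mollify_le hp1.1
    have b3 := (hM n).lintegral_mollify_le hp2.1
    have c2 : ∫⁻ x, ‖B.indicator (fun y => Dw y (v y)) x‖ₑ ≤
        eLpNorm (B.indicator Dw) r volume * eLpNorm (B.indicator v) r' volume := by
      refine le_trans (lintegral_mono fun x => ?_) (lintegral_enorm_mul_enorm_le hr hD'.1 hv'.1)
      by_cases hx : x ∈ B
      · simp only [indicator_of_mem hx]
        exact ContinuousLinearMap.le_opENorm _ _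
      · simp [indicator_of_notMem hx]
    have c3 : ∫⁻ x, ‖B.indicator (fun y => w y * δ y) x‖ₑ ≤
        eLpNorm w r volume * eLpNorm (B.indicator δ) r' volume := by
      refine le_trans (lintegral_mono fun x => ?_) (lintegral_enorm_mul_enorm_le hr hw.1 hδ'.1)
      by_cases hx : x ∈ B
      · simp [indicator_of_mem hx]
      · simp [indicator_of_notMem hx]
    have hc1 : AEMeasurable (fun x => ‖mollify (mollifier d n) (B.indicator Dw) x‖ₑ *
        ‖B.indicator v x‖ₑ) volume := (hm1 n).aestronglyMeasurable.enorm.mul hv'.1.enorm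
    have hc2 : AEMeasurable (fun x =>
        ‖mollify (mollifier d n) (B.indicator fun y => Dw y (v y)) x‖ₑ) volume :=
      (hm2 n).aestronglyMeasurable.enorm
    rw [← eLpNorm_indicator_ball r, ← eLpNorm_indicator_ball r', ← eLpNorm_indicator_ball r',
      two_mul]
    refine le_trans ?_ (add_le_add (add_le_add b1 (b2.trans c2)) (b3.trans c3))
    refine le_trans ?_ (lintegral_add_add_eq hc1 hc2 _).ge
    rw [← lintegral_indicator Metric.isOpen_ball.measurableSet]
    refine lintegral_mono fun x => ?_
    by_cases hx : x ∈ Metric.ball (0 : EuclideanSpace ℝ (Fin d)) R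
    · rw [indicator_of_mem hx, hrep n x hx]
      refine enorm_sub_le.trans (add_le_add (enorm_sub_le.trans (add_le_add ?_ le_rfl)) le_rfl)
      exact ContinuousLinearMap.le_opENorm _ _
    · rw [indicator_of_notMem hx]
      exact zero_le

end RegularSolutions

/-! ### Approximation of the fractional Laplacian by finite Lévy measures -/

section LevyMeasures

open ProbabilityTheory

/-- The Fourier symbol `∫ (1 - cos (2π ξ·y)) dμ(y)` of the jump operator with the symmetric Lévy
measure `μ`. -/
def levySymbol (μ : Measure (EuclideanSpace ℝ (Fin d))) (ξ : EuclideanSpace ℝ (Fin d)) : ℝ :=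
  ∫ y, (1 - Real.cos (2 * Real.pi * inner ℝ ξ y)) ∂μ

/-- A sequence of finite symmetric jump measures whose symbols approach the symbol of
`(-Δ)^{α/2}` from below. -/
structure IsLevyApprox (α : ℝ) (μ : ℕ → Measure (EuclideanSpace ℝ (Fin d))) : Prop where
  finite : ∀ m, IsFiniteMeasure (μ m)
  neg : ∀ m, (μ m).map (fun y => -y) = μ m
  symbol_le : ∀ m ξ, levySymbol (μ m) ξ ≤ (2 * Real.pi * ‖ξ‖) ^ α
  symbol_tendsto : ∀ ξ, Tendsto (fun m => levySymbol (μ m) ξ) atTop (𝓝 ((2 * Real.pi * ‖ξ‖) ^ α))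

lemma one_sub_cos_nonneg (x : ℝ) : 0 ≤ 1 - Real.cos x := by
  linarith [Real.cos_le_one x]

lemma integrable_of_norm_le_const {X : Type*} [MeasurableSpace X] {μ : Measure X}
    [IsFiniteMeasure μ] {f : X → ℝ} (hf : AEStronglyMeasurable f μ) {C : ℝ}
    (h : ∀ x, |f x| ≤ C) : Integrable f μ :=
  Integrable.of_bound hf C (Eventually.of_forall h)

lemma continuous_one_sub_cos_inner (ξ : EuclideanSpace ℝ (Fin d)) :
    Continuous fun y : EuclideanSpace ℝ (Fin d) => 1 - Real.cos (2 * Real.pi * inner ℝ ξ y) := by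
  fun_prop

lemma abs_one_sub_cos_le (x : ℝ) : |1 - Real.cos x| ≤ 2 := by
  rw [abs_of_nonneg (one_sub_cos_nonneg x)]
  linarith [Real.neg_one_le_cos x]

lemma levySymbol_nonneg (μ : Measure (EuclideanSpace ℝ (Fin d))) (ξ : EuclideanSpace ℝ (Fin d)) :
    0 ≤ levySymbol μ ξ :=
  integral_nonneg fun _ => one_sub_cos_nonneg _

lemma integral_one_sub_cos_stdGaussian (ξ : EuclideanSpace ℝ (Fin d)) :
    ∫ z, (1 - Real.cos (inner ℝ ξ z)) ∂(stdGaussian (EuclideanSpace ℝ (Fin d))) =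
      1 - Real.exp (-(‖ξ‖ ^ 2 / 2)) := by
  have h := charFun_stdGaussian (E := EuclideanSpace ℝ (Fin d)) ξ
  rw [charFun_apply] at h
  have h2 := congrArg Complex.re h
  have hi : Integrable (fun z => Complex.exp ((inner ℝ z ξ : ℝ) * Complex.I))
      (stdGaussian (EuclideanSpace ℝ (Fin d))) := by
    refine Integrable.of_bound (Continuous.aestronglyMeasurable (by fun_prop)) 1
      (Eventually.of_forall fun z => ?_)
    rw [Complex.norm_exp_ofReal_mul_I]
  have h3 : (∫ z, Complex.exp ((inner ℝ z ξ : ℝ) * Complex.I)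
      ∂(stdGaussian (EuclideanSpace ℝ (Fin d)))).re =
      ∫ z, Real.cos (inner ℝ ξ z) ∂(stdGaussian (EuclideanSpace ℝ (Fin d))) := by
    have := (integral_re hi).symm
    simp only [RCLike.re_to_complex] at this
    rw [this]
    refine integral_congr_ae (Eventually.of_forall fun z => ?_)
    simp only [Complex.exp_ofReal_mul_I_re, real_inner_comm]
  rw [h3] at h2
  rw [integral_sub (integrable_const _)
    (integrable_of_norm_le_const (Continuous.aestronglyMeasurable (by fun_prop))
      (fun z => Real.abs_cos_le_one _)), h2]
  have e : -((‖ξ‖ : ℂ) ^ 2) / 2 = ((-(‖ξ‖ ^ 2 / 2) : ℝ) : ℂ) := by push_cast; ring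
  have e' : -(‖ξ‖ : ℂ) ^ 2 / 2 = ((-(‖ξ‖ ^ 2 / 2) : ℝ) : ℂ) := by push_cast; ring
  simp only [e', integral_const, smul_eq_mul, mul_one, probReal_univ]
  rw [Complex.exp_ofReal_re]

/-- The law of `√(2t) Z`, where `t` is distributed according to `ν` and `Z` is an independent
standard Gaussian vector. -/
def gaussianMixture (d : ℕ) (ν : Measure ℝ) : Measure (EuclideanSpace ℝ (Fin d)) :=
  (ν.prod (stdGaussian (EuclideanSpace ℝ (Fin d)))).map fun z => √(2 * z.1) • z.2

lemma measurable_sqrt_smul :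
    Measurable fun z : ℝ × EuclideanSpace ℝ (Fin d) => √(2 * z.1) • z.2 :=
  Continuous.measurable (by fun_prop)

/-- Gaussian vectors with random variance realize all symbols `∫ (1 - exp (-t (2π|ξ|)²)) dν(t)`. -/
lemma levySymbol_gaussianMixture (ν : Measure ℝ) [IsFiniteMeasure ν] (hν : ∀ᵐ t ∂ν, 0 ≤ t)
    (ξ : EuclideanSpace ℝ (Fin d)) :
    levySymbol (gaussianMixture d ν) ξ =
      ∫ t, (1 - Real.exp (-(t * (2 * Real.pi * ‖ξ‖) ^ 2))) ∂ν := by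
  rw [levySymbol, gaussianMixture, integral_map measurable_sqrt_smul.aemeasurable
    (continuous_one_sub_cos_inner ξ).aestronglyMeasurable, integral_prod]
  · refine integral_congr_ae ?_
    filter_upwards [hν] with t ht
    have h := integral_one_sub_cos_stdGaussian ((2 * Real.pi * √(2 * t)) • ξ)
    rw [norm_smul, mul_pow, Real.norm_of_nonneg (by positivity), mul_pow,
      Real.sq_sqrt (by positivity)] at h
    rw [show t * (2 * Real.pi * ‖ξ‖) ^ 2 = (2 * Real.pi) ^ 2 * (2 * t) * ‖ξ‖ ^ 2 / 2 by ring, ← h]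
    refine integral_congr_ae (Eventually.of_forall fun z => ?_)
    simp only [inner_smul_left, inner_smul_right, conj_trivial]
    ring_nf
  · exact integrable_of_norm_le_const
      (Continuous.aestronglyMeasurable (by fun_prop)) (fun z => abs_one_sub_cos_le _)

lemma map_neg_gaussianMixture (ν : Measure ℝ) [IsFiniteMeasure ν] :
    (gaussianMixture d ν).map (fun y => -y) = gaussianMixture d ν := by
  have h1 : (stdGaussian (EuclideanSpace ℝ (Fin d))).map (fun y => -y) =
      stdGaussian (EuclideanSpace ℝ (Fin d)) :=
    stdGaussian_map (LinearIsometryEquiv.neg ℝ)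
  have h2 : ν.prod (stdGaussian (EuclideanSpace ℝ (Fin d))) =
      (ν.prod (stdGaussian (EuclideanSpace ℝ (Fin d)))).map (Prod.map id (fun y => -y)) := by
    rw [← Measure.map_prod_map _ _ measurable_id measurable_neg, h1, Measure.map_id]
  rw [gaussianMixture, Measure.map_map measurable_neg measurable_sqrt_smul]
  conv_rhs => rw [h2, Measure.map_map measurable_sqrt_smul (measurable_id.prodMap measurable_neg)]
  congr 1
  ext z
  simp

lemma hasDerivAt_one_sub_exp (x : ℝ) :
    HasDerivAt (fun s : ℝ => 1 - Real.exp (-(s * x))) x 0 := by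
  have h := (((hasDerivAt_id (0 : ℝ)).mul_const x).neg.exp).const_sub 1
  simpa using h

lemma one_sub_exp_neg_le (x : ℝ) : 1 - Real.exp (-x) ≤ x := by
  linarith [Real.add_one_le_exp (-x)]

lemma one_sub_exp_neg_nonneg {x : ℝ} (hx : 0 ≤ x) : 0 ≤ 1 - Real.exp (-x) := by
  linarith [Real.exp_le_one_iff.2 (neg_nonpos.2 hx)]

/-- The density `t ^ (-1 - a)` of the Lévy measure of the `a`-stable subordinator, integrated
against `1 - exp (-t)`. -/
lemma integrableOn_one_sub_exp_mul_rpow {a : ℝ} (ha : 0 < a) (ha1 : a < 1) :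
    IntegrableOn (fun t : ℝ => (1 - Real.exp (-t)) * t ^ (-1 - a)) (Ioi 0) := by
  have hm : ∀ s : Set ℝ, MeasurableSet s → s ⊆ Ioi 0 → AEStronglyMeasurable
      (fun t : ℝ => (1 - Real.exp (-t)) * t ^ (-1 - a)) (volume.restrict s) := by
    intro s hs hs0
    refine ContinuousOn.aestronglyMeasurable (fun t ht => ContinuousAt.continuousWithinAt ?_) hs
    exact (by fun_prop : ContinuousAt (fun t : ℝ => 1 - Real.exp (-t)) t).mul
      (Real.continuousAt_rpow_const _ _ (Or.inl (hs0 ht).ne'))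
  rw [← Ioc_union_Ioi_eq_Ioi zero_le_one]
  refine IntegrableOn.union ?_ ?_
  · have h1 : IntegrableOn (fun t : ℝ => t ^ (-a)) (Ioc 0 1) := by
      rw [← intervalIntegrable_iff_integrableOn_Ioc_of_le zero_le_one]
      exact intervalIntegral.intervalIntegrable_rpow' (by linarith)
    refine Integrable.mono' h1 (hm _ measurableSet_Ioc fun t ht => ht.1) ?_
    filter_upwards [ae_restrict_mem measurableSet_Ioc] with t ht
    rw [Real.norm_of_nonneg (mul_nonneg (one_sub_exp_neg_nonneg ht.1.le)
      (Real.rpow_nonneg ht.1.le _))]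
    calc (1 - Real.exp (-t)) * t ^ (-1 - a) ≤ t * t ^ (-1 - a) := by
          gcongr
          · exact Real.rpow_nonneg ht.1.le _
          · exact one_sub_exp_neg_le t
      _ = t ^ (-a) := by
          nth_rewrite 1 [← Real.rpow_one t]
          rw [← Real.rpow_add ht.1]
          congr 1
          ring
  · have h1 : IntegrableOn (fun t : ℝ => t ^ (-1 - a)) (Ioi 1) :=
      integrableOn_Ioi_rpow_of_lt (by linarith) one_pos
    refine Integrable.mono' h1 (hm _ measurableSet_Ioi fun t ht =>
      mem_Ioi.2 (one_pos.trans (mem_Ioi.1 ht))) ?_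
    filter_upwards [ae_restrict_mem measurableSet_Ioi] with t ht
    have ht0 : 0 < t := one_pos.trans ht
    rw [Real.norm_of_nonneg (mul_nonneg (one_sub_exp_neg_nonneg ht0.le)
      (Real.rpow_nonneg ht0.le _))]
    refine mul_le_of_le_one_left (Real.rpow_nonneg ht0.le _) ?_
    linarith [Real.exp_pos (-t)]

lemma integral_one_sub_exp_mul_rpow {a : ℝ} {x : ℝ} (hx : 0 < x) :
    ∫ t in Ioi (0 : ℝ), (1 - Real.exp (-(t * x))) * t ^ (-1 - a) =
      x ^ a * ∫ t in Ioi (0 : ℝ), (1 - Real.exp (-t)) * t ^ (-1 - a) := by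
  have h := integral_comp_mul_left_Ioi
    (fun t : ℝ => (1 - Real.exp (-t)) * t ^ (-1 - a)) 0 hx
  rw [mul_zero] at h
  have e : ∀ t ∈ Ioi (0 : ℝ), (1 - Real.exp (-(t * x))) * t ^ (-1 - a) =
      x ^ (1 + a) * ((1 - Real.exp (-(x * t))) * (x * t) ^ (-1 - a)) := by
    intro t ht
    rw [Real.mul_rpow hx.le (le_of_lt ht), mul_comm t x]
    have : x ^ (1 + a) * x ^ (-1 - a) = 1 := by
      rw [← Real.rpow_add hx]; simp
    linear_combination (-(1 - Real.exp (-(x * t))) * t ^ (-1 - a)) * this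
  rw [setIntegral_congr_fun measurableSet_Ioi e, integral_const_mul, h, smul_eq_mul, ← mul_assoc]
  congr 1
  rw [← Real.rpow_neg_one, ← Real.rpow_add hx]
  congr 1
  ring

/-- The function `x ^ a`, `0 < a ≤ 1`, is a limit from below of functions `∫ (1 - exp (-t x)) dν(t)`
with finite measures `ν`. For `a = 1` these are the difference quotients `(1 - exp (-ε x)) / ε`,
with `ν` a point mass; for `a < 1` the measures are truncations near `t = 0` of the normalized Lévy
measure of the `a`-stable subordinator. -/
lemma exists_bernstein_approx {a : ℝ} (ha : 0 < a) (ha1 : a ≤ 1) :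
    ∃ ν : ℕ → Measure ℝ, (∀ m, IsFiniteMeasure (ν m)) ∧ (∀ m, ∀ᵐ t ∂(ν m), 0 ≤ t) ∧
      ∀ x : ℝ, 0 ≤ x → (∀ m, ∫ t, (1 - Real.exp (-(t * x))) ∂(ν m) ≤ x ^ a) ∧
        Tendsto (fun m => ∫ t, (1 - Real.exp (-(t * x))) ∂(ν m)) atTop (𝓝 (x ^ a)) := by
  rcases ha1.eq_or_lt with rfl | ha1
  · refine ⟨fun m => ((m : ℝ≥0∞) + 1) • Measure.dirac (((m : ℝ) + 1)⁻¹), fun m => ?_, fun m => ?_,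
      fun x hx => ?_⟩
    · exact Measure.smul_finite _ (show (m : ℝ≥0∞) + 1 ≠ ∞ by finiteness)
    · refine Measure.ae_smul_measure ?_ _
      rw [ae_dirac_eq]
      change (0 : ℝ) ≤ ((m : ℝ) + 1)⁻¹
      positivity
    · have e : ∀ m : ℕ, ∫ t, (1 - Real.exp (-(t * x)))
          ∂(((m : ℝ≥0∞) + 1) • Measure.dirac (((m : ℝ) + 1)⁻¹)) =
          ((m : ℝ) + 1) * (1 - Real.exp (-(((m : ℝ) + 1)⁻¹ * x))) := by
        intro m
        rw [integral_smul_measure, integral_dirac, smul_eq_mul]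
        congr 1
      simp_rw [e, Real.rpow_one]
      constructor
      · intro m
        have := one_sub_exp_neg_le (((m : ℝ) + 1)⁻¹ * x)
        have hm : (0 : ℝ) < m + 1 := by positivity
        calc ((m : ℝ) + 1) * (1 - Real.exp (-(((m : ℝ) + 1)⁻¹ * x))) ≤
            (m + 1) * (((m : ℝ) + 1)⁻¹ * x) := by gcongr
          _ = x := by field_simp
      · have h1 := (hasDerivAt_one_sub_exp x).tendsto_slope_zero
        have h2 : Tendsto (fun m : ℕ => ((m : ℝ) + 1)⁻¹) atTop (𝓝[≠] 0) := by
          refine tendsto_nhdsWithin_iff.2 ⟨?_, Eventually.of_forall fun m => ?_⟩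
          · simpa [one_div] using tendsto_one_div_add_atTop_nhds_zero_nat (𝕜 := ℝ)
          · have hm : (0 : ℝ) < m + 1 := by positivity
            exact (inv_pos.2 hm).ne'
        refine (h1.comp h2).congr fun m => ?_
        simp
  · set I := ∫ t in Ioi (0 : ℝ), (1 - Real.exp (-t)) * t ^ (-1 - a) with hI
    have hint := integrableOn_one_sub_exp_mul_rpow ha ha1
    have hIpos : 0 < I := by
      rw [hI, setIntegral_pos_iff_support_of_nonneg_ae]
      · refine lt_of_lt_of_le ?_ (measure_mono (s := Ioc 0 1) fun t ht => ⟨?_, ht.1⟩)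
        · simp
        · have h1 : Real.exp (-t) < 1 := by
            rw [← Real.exp_zero]
            exact Real.exp_lt_exp.2 (by linarith [ht.1])
          exact (mul_pos (by linarith) (Real.rpow_pos_of_pos ht.1 _)).ne'
      · filter_upwards [ae_restrict_mem measurableSet_Ioi] with t ht
        exact mul_nonneg (one_sub_exp_neg_nonneg (le_of_lt ht)) (Real.rpow_nonneg (le_of_lt ht) _)
      · exact hint
    have hc : ∀ m : ℕ, (0 : ℝ) < ((m : ℝ) + 1)⁻¹ := fun m => by positivity
    have hdm : Measurable fun t : ℝ => ENNReal.ofReal (t ^ (-1 - a) / I) := by fun_prop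
    have hdm' : Measurable fun t : ℝ => Real.toNNReal (t ^ (-1 - a) / I) := by fun_prop
    refine ⟨fun m => (volume.restrict (Ioi ((m : ℝ) + 1)⁻¹)).withDensity
      fun t => ENNReal.ofReal (t ^ (-1 - a) / I), fun m => ?_, fun m => ?_, fun x hx => ?_⟩
    · refine isFiniteMeasure_withDensity_ofReal ?_
      have := ((integrableOn_Ioi_rpow_of_lt (by linarith : -1 - a < -1) (hc m)).div_const I)
      exact this.2
    · refine (withDensity_absolutelyContinuous _ _).ae_le ?_
      filter_upwards [ae_restrict_mem measurableSet_Ioi] with t ht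
      exact (hc m).le.trans (le_of_lt ht)
    · have e : ∀ m : ℕ, ∫ t, (1 - Real.exp (-(t * x)))
          ∂((volume.restrict (Ioi ((m : ℝ) + 1)⁻¹)).withDensity
            fun t => ENNReal.ofReal (t ^ (-1 - a) / I)) =
          I⁻¹ * ∫ t in Ioi ((m : ℝ) + 1)⁻¹, (1 - Real.exp (-(t * x))) * t ^ (-1 - a) := by
        intro m
        have := integral_withDensity_eq_integral_smul
          (μ := volume.restrict (Ioi ((m : ℝ) + 1)⁻¹)) hdm' (fun t => 1 - Real.exp (-(t * x)))
        refine this.trans ?_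
        rw [← integral_const_mul]
        refine setIntegral_congr_fun measurableSet_Ioi fun t ht => ?_
        have ht0 : 0 < t := (hc m).trans ht
        simp only [NNReal.smul_def, smul_eq_mul]
        rw [Real.coe_toNNReal _ (by positivity)]
        ring
      simp_rw [e]
      rcases hx.eq_or_lt with rfl | hx
      · simp [Real.zero_rpow ha.ne']
      -- otherwise the integral would have the value `0` in the scaling identity
      have hint2 : IntegrableOn (fun t : ℝ => (1 - Real.exp (-(t * x))) * t ^ (-1 - a))
          (Ioi 0) := by
        by_contra hcon
        have h0 := integral_one_sub_exp_mul_rpow (a := a) hx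
        rw [integral_undef hcon] at h0
        have : 0 < x ^ a * I := by positivity
        exact this.ne h0
      have hval : I⁻¹ * ∫ t in Ioi (0 : ℝ), (1 - Real.exp (-(t * x))) * t ^ (-1 - a) = x ^ a := by
        rw [integral_one_sub_exp_mul_rpow hx, ← hI]
        field_simp
      have hsub : ∀ m : ℕ, Ioi ((m : ℝ) + 1)⁻¹ ⊆ Ioi (0 : ℝ) := fun m =>
        Ioi_subset_Ioi (hc m).le
      constructor
      · intro m
        rw [← hval]
        gcongr
        · filter_upwards [ae_restrict_mem measurableSet_Ioi] with t ht
          exact mul_nonneg (one_sub_exp_neg_nonneg (mul_nonneg (le_of_lt ht) hx.le))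
            (Real.rpow_nonneg (le_of_lt ht) _)
        · exact hc m |>.le
      · rw [← hval]
        refine Tendsto.const_mul _ ?_
        have hU : (⋃ m : ℕ, Ioi ((m : ℝ) + 1)⁻¹) = Ioi 0 := by
          refine Subset.antisymm (iUnion_subset hsub) fun t ht => ?_
          obtain ⟨m, hm⟩ := exists_nat_one_div_lt (show (0 : ℝ) < t from ht)
          exact mem_iUnion.2 ⟨m, by simpa [one_div] using hm⟩
        rw [← hU]
        refine tendsto_setIntegral_of_monotone (fun m => measurableSet_Ioi) ?_ (hU ▸ hint2)
        intro m n hmn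
        refine Ioi_subset_Ioi (inv_anti₀ (by positivity) ?_)
        have : (m : ℝ) ≤ n := by exact_mod_cast hmn
        linarith

/-- Subordination: the symbol `(2π|ξ|)^α` is the power `α / 2 ≤ 1` of the symbol `(2π|ξ|)²` of
Brownian motion, so Gaussian mixtures approach it. -/
lemma exists_isLevyApprox (d : ℕ) {α : ℝ} (hα : 0 < α) (hα2 : α ≤ 2) :
    ∃ μ : ℕ → Measure (EuclideanSpace ℝ (Fin d)), IsLevyApprox α μ := by
  obtain ⟨ν, hf, h0, hν⟩ := exists_bernstein_approx (a := α / 2) (by linarith) (by linarith)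
  have e : ∀ ξ : EuclideanSpace ℝ (Fin d),
      ((2 * Real.pi * ‖ξ‖) ^ 2) ^ (α / 2) = (2 * Real.pi * ‖ξ‖) ^ α := by
    intro ξ
    rw [← Real.rpow_natCast_mul (by positivity)]
    congr 1
    push_cast
    ring
  refine ⟨fun m => gaussianMixture d (ν m), fun m => ?_, fun m => ?_, fun m ξ => ?_, fun ξ => ?_⟩
  · have := hf m
    exact Measure.isFiniteMeasure_map _ _
  · have := hf m
    exact map_neg_gaussianMixture _
  · have := hf m
    rw [levySymbol_gaussianMixture _ (h0 m), ← e]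
    exact (hν _ (by positivity)).1 m
  · have h1 : ∀ m, levySymbol (gaussianMixture d (ν m)) ξ =
        ∫ t, (1 - Real.exp (-(t * (2 * Real.pi * ‖ξ‖) ^ 2))) ∂(ν m) := fun m => by
      have := hf m
      exact levySymbol_gaussianMixture _ (h0 m) ξ
    simp_rw [h1, ← e]
    exact (hν _ (by positivity)).2

lemma min_one_sq_le (x : ℝ) : min 1 (x ^ 2) ≤ 3 * (1 - Real.exp (-(x ^ 2 / 2))) := by
  have h1 : Real.exp (-(x ^ 2 / 2)) ≤ (1 + x ^ 2 / 2)⁻¹ := by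
    rw [Real.exp_neg]
    exact inv_anti₀ (by positivity) (by linarith [Real.add_one_le_exp (x ^ 2 / 2)])
  have h2 : min 1 (x ^ 2) ≤ 3 * (1 - (1 + x ^ 2 / 2)⁻¹) := by
    have h3 : 0 < 1 + x ^ 2 / 2 := by positivity
    rw [show 3 * (1 - (1 + x ^ 2 / 2)⁻¹) = (3 * x ^ 2 / 2) / (1 + x ^ 2 / 2) by field_simp; ring,
      le_div_iff₀ h3]
    rcases le_total 1 (x ^ 2) with h | h
    · rw [min_eq_left h]; linarith
    · rw [min_eq_right h]; nlinarith [sq_nonneg x]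
  linarith

/-- Averaging the bound on the symbols over a Gaussian frequency bounds the truncated second moments
of the jump measures, uniformly along the approximation and with the scaling of `|ξ|^α`. -/
lemma IsLevyApprox.exists_moment_le {α : ℝ} (hα : 0 < α) (hα2 : α ≤ 2)
    {μ : ℕ → Measure (EuclideanSpace ℝ (Fin d))} (h : IsLevyApprox α μ) :
    ∃ C : ℝ≥0, ∀ m, ∀ l : ℝ, 0 < l →
      ∫⁻ y, ENNReal.ofReal (min 1 ((l * ‖y‖) ^ 2)) ∂(μ m) ≤ C * ENNReal.ofReal (l ^ α) := by
  set γ := stdGaussian (EuclideanSpace ℝ (Fin d)) with hγ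
  have hfin : ∫⁻ z, ENNReal.ofReal (‖z‖ ^ α) ∂γ < ∞ := by
    have h2 : Integrable (fun z : EuclideanSpace ℝ (Fin d) => 1 + ‖z‖ ^ 2) γ := by
      refine (integrable_const _).add ?_
      have := (IsGaussian.memLp_id γ 2 (by simp)).integrable_norm_pow (by simp)
      simpa using this
    refine lt_of_le_of_lt (lintegral_mono fun z => ENNReal.ofReal_le_ofReal ?_)
      h2.lintegral_lt_top
    rcases le_total ‖z‖ 1 with h1 | h1
    · have := Real.rpow_le_one (norm_nonneg z) h1 hα.le
      nlinarith [sq_nonneg ‖z‖]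
    · have := Real.rpow_le_rpow_of_exponent_le h1 hα2
      rw [Real.rpow_two] at this
      linarith
  refine ⟨3 * (∫⁻ z, ENNReal.ofReal (‖z‖ ^ α) ∂γ).toNNReal, fun m l hl => ?_⟩
  have := h.finite m
  have hcont : Continuous fun q : EuclideanSpace ℝ (Fin d) × EuclideanSpace ℝ (Fin d) =>
      1 - Real.cos (inner ℝ (l • q.1) q.2) := by fun_prop
  have e1 : ∀ y : EuclideanSpace ℝ (Fin d), ENNReal.ofReal (1 - Real.exp (-((l * ‖y‖) ^ 2 / 2))) =
      ∫⁻ z, ENNReal.ofReal (1 - Real.cos (inner ℝ (l • y) z)) ∂γ := by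
    intro y
    rw [← ofReal_integral_eq_lintegral_ofReal (integrable_of_norm_le_const
        (Continuous.aestronglyMeasurable (by fun_prop)) fun z => abs_one_sub_cos_le _)
        (Eventually.of_forall fun z => one_sub_cos_nonneg _),
      integral_one_sub_cos_stdGaussian, norm_smul, Real.norm_of_nonneg hl.le]
  have e2 : ∀ z : EuclideanSpace ℝ (Fin d),
      ∫⁻ y, ENNReal.ofReal (1 - Real.cos (inner ℝ (l • y) z)) ∂(μ m) ≤
        ENNReal.ofReal (l ^ α) * ENNReal.ofReal (‖z‖ ^ α) := by
    intro z
    have hs := h.symbol_le m ((l / (2 * Real.pi)) • z)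
    have hpi := Real.pi_pos
    rw [norm_smul, Real.norm_of_nonneg (by positivity),
      show 2 * Real.pi * (l / (2 * Real.pi) * ‖z‖) = l * ‖z‖ by field_simp,
      Real.mul_rpow hl.le (norm_nonneg z)] at hs
    rw [← ENNReal.ofReal_mul (Real.rpow_nonneg hl.le _),
      ← ofReal_integral_eq_lintegral_ofReal (integrable_of_norm_le_const
        (Continuous.aestronglyMeasurable (by fun_prop)) fun z => abs_one_sub_cos_le _)
        (Eventually.of_forall fun z => one_sub_cos_nonneg _)]
    refine ENNReal.ofReal_le_ofReal (le_trans (le_of_eq ?_) hs)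
    refine integral_congr_ae (Eventually.of_forall fun y => ?_)
    simp only [inner_smul_left, conj_trivial, real_inner_comm]
    congr 2
    field_simp
  calc ∫⁻ y, ENNReal.ofReal (min 1 ((l * ‖y‖) ^ 2)) ∂(μ m)
      ≤ ∫⁻ y, 3 * ∫⁻ z, ENNReal.ofReal (1 - Real.cos (inner ℝ (l • y) z)) ∂γ ∂(μ m) := by
        refine lintegral_mono fun y => ?_
        rw [← e1, show (3 : ℝ≥0∞) = ENNReal.ofReal 3 by simp, ← ENNReal.ofReal_mul (by norm_num)]
        exact ENNReal.ofReal_le_ofReal (min_one_sq_le _)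
    _ = 3 * ∫⁻ z, ∫⁻ y, ENNReal.ofReal (1 - Real.cos (inner ℝ (l • y) z)) ∂(μ m) ∂γ := by
        rw [lintegral_const_mul', lintegral_lintegral_swap]
        · exact (hcont.measurable.ennreal_ofReal).aemeasurable
        · simp
    _ ≤ 3 * ∫⁻ z, ENNReal.ofReal (l ^ α) * ENNReal.ofReal (‖z‖ ^ α) ∂γ := by
        gcongr with z
        exact e2 z
    _ = _ := by
        rw [lintegral_const_mul' _ _ (by simp)]
        push_cast
        rw [ENNReal.coe_toNNReal hfin.ne]
        ring

end LevyMeasures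

/-! ### Jump operators and the fractional Laplacian -/

section JumpOperators

/-- The jump operator `φ ↦ ∫ (φ(x) - φ(x + y)) dμ(y)` with the finite Lévy measure `μ`. -/
def levyOp (μ : Measure (EuclideanSpace ℝ (Fin d))) (φ : EuclideanSpace ℝ (Fin d) → ℝ)
    (x : EuclideanSpace ℝ (Fin d)) : ℝ :=
  ∫ y, (φ x - φ (x + y)) ∂μ

variable {φ : EuclideanSpace ℝ (Fin d) → ℝ} {α : ℝ}
  {μ : ℕ → Measure (EuclideanSpace ℝ (Fin d))}

lemma IsTestFun.exists_schwartz (hφ : IsTestFun φ) :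
    ∃ f : 𝓢(EuclideanSpace ℝ (Fin d), ℂ), ⇑f = fun x => (φ x : ℂ) := by
  have h1 : HasCompactSupport fun x => (φ x : ℂ) :=
    hφ.2.comp_left (g := fun x : ℝ => (x : ℂ)) (by simp)
  have h2 : ContDiff ℝ (⊤ : ℕ∞) fun x => (φ x : ℂ) := Complex.ofRealCLM.contDiff.comp hφ.1
  exact ⟨h1.toSchwartzMap h2, rfl⟩

lemma IsTestFun.continuous_fourier (hφ : IsTestFun φ) :
    Continuous (𝓕 fun y : EuclideanSpace ℝ (Fin d) => (φ y : ℂ)) := by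
  obtain ⟨f, hf⟩ := hφ.exists_schwartz
  rw [← hf, ← SchwartzMap.fourier_coe]
  exact (𝓕 f).continuous

lemma IsTestFun.integrable_pow_mul_fourier (hφ : IsTestFun φ) (k : ℕ) :
    Integrable fun ξ : EuclideanSpace ℝ (Fin d) =>
      ‖ξ‖ ^ k * ‖𝓕 (fun y : EuclideanSpace ℝ (Fin d) => (φ y : ℂ)) ξ‖ := by
  obtain ⟨f, hf⟩ := hφ.exists_schwartz
  rw [← hf, ← SchwartzMap.fourier_coe]
  exact (𝓕 f).integrable_pow_mul volume k

lemma IsTestFun.integrable_fourier (hφ : IsTestFun φ) :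
    Integrable (𝓕 fun y : EuclideanSpace ℝ (Fin d) => (φ y : ℂ)) := by
  obtain ⟨f, hf⟩ := hφ.exists_schwartz
  rw [← hf, ← SchwartzMap.fourier_coe]
  exact (𝓕 f).integrable

lemma IsTestFun.fourier_inversion (hφ : IsTestFun φ) (x : EuclideanSpace ℝ (Fin d)) :
    ((φ x : ℝ) : ℂ) = ∫ ξ, Complex.exp ((2 * Real.pi * inner ℝ ξ x : ℝ) * Complex.I) *
      𝓕 (fun y : EuclideanSpace ℝ (Fin d) => (φ y : ℂ)) ξ := by
  have hc : Continuous fun y : EuclideanSpace ℝ (Fin d) => (φ y : ℂ) :=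
    Complex.continuous_ofReal.comp hφ.1.continuous
  have hi : Integrable fun y : EuclideanSpace ℝ (Fin d) => (φ y : ℂ) :=
    (hφ.1.continuous.integrable_of_hasCompactSupport hφ.2).ofReal
  have h := congrFun (hc.fourierInv_fourier_eq hi hφ.integrable_fourier) x
  rw [← h, Real.fourierInv_eq']
  rfl

lemma rpow_le_one_add_sq {α : ℝ} (hα : 0 < α) (hα2 : α ≤ 2) {s : ℝ} (hs : 0 ≤ s) :
    s ^ α ≤ 1 + s ^ 2 := by
  rcases le_total s 1 with h1 | h1
  · have := Real.rpow_le_one hs h1 hα.le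
    nlinarith [sq_nonneg s]
  · have := Real.rpow_le_rpow_of_exponent_le h1 hα2
    rw [Real.rpow_two] at this
    linarith

lemma IsTestFun.integrable_symbol_mul_fourier (hφ : IsTestFun φ) (hα : 0 < α) (hα2 : α ≤ 2) :
    Integrable fun ξ : EuclideanSpace ℝ (Fin d) => (2 * Real.pi * ‖ξ‖) ^ α *
      ‖𝓕 (fun y : EuclideanSpace ℝ (Fin d) => (φ y : ℂ)) ξ‖ := by
  have h1 := (hφ.integrable_pow_mul_fourier 0).add
    ((hφ.integrable_pow_mul_fourier 2).const_mul ((2 * Real.pi) ^ 2))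
  refine h1.mono' ?_ (Eventually.of_forall fun ξ => ?_)
  · refine (Continuous.mul ?_ hφ.continuous_fourier.norm).aestronglyMeasurable
    exact Continuous.rpow_const (by fun_prop) fun _ => Or.inr hα.le
  · rw [Real.norm_of_nonneg (by positivity)]
    have := rpow_le_one_add_sq hα hα2 (s := 2 * Real.pi * ‖ξ‖) (by positivity)
    calc _ ≤ (1 + (2 * Real.pi * ‖ξ‖) ^ 2) *
        ‖𝓕 (fun y : EuclideanSpace ℝ (Fin d) => (φ y : ℂ)) ξ‖ := by gcongr
      _ = _ := by simp only [Pi.add_apply]; ring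

lemma integral_comp_neg_of_map_neg {F : Type*} [NormedAddCommGroup F] [NormedSpace ℝ F]
    {μ : Measure (EuclideanSpace ℝ (Fin d))} (hμ : μ.map (fun y => -y) = μ)
    (g : EuclideanSpace ℝ (Fin d) → F) : ∫ y, g (-y) ∂μ = ∫ y, g y ∂μ := by
  conv_rhs => rw [← hμ]
  exact ((MeasurableEquiv.neg _).measurableEmbedding.integral_map g).symm

lemma integral_one_sub_exp_eq_levySymbol {μ : Measure (EuclideanSpace ℝ (Fin d))}
    [IsFiniteMeasure μ] (hμ : μ.map (fun y => -y) = μ) (ξ : EuclideanSpace ℝ (Fin d)) :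
    ∫ y, (1 - Complex.exp ((2 * Real.pi * inner ℝ ξ y : ℝ) * Complex.I)) ∂μ =
      (levySymbol μ ξ : ℂ) := by
  set g : EuclideanSpace ℝ (Fin d) → ℂ := fun y =>
    1 - Complex.exp ((2 * Real.pi * inner ℝ ξ y : ℝ) * Complex.I) with hg
  have hgi : Integrable g μ := by
    refine (integrable_const _).sub (Integrable.of_bound
      (Continuous.aestronglyMeasurable (by fun_prop)) 1 (Eventually.of_forall fun z => ?_))
    rw [Complex.norm_exp_ofReal_mul_I]
  have hgi' : Integrable (fun y => g (-y)) μ := by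
    have : Integrable g (μ.map (fun y => -y)) := by rwa [hμ]
    exact this.comp_measurable measurable_neg
  have h1 := integral_comp_neg_of_map_neg hμ g
  have h2 : (∫ y, g y ∂μ) + ∫ y, g (-y) ∂μ = ((2 * levySymbol μ ξ : ℝ) : ℂ) := by
    rw [← integral_add hgi hgi', levySymbol, ← integral_const_mul, ← integral_complex_ofReal]
    refine integral_congr_ae (Eventually.of_forall fun y => ?_)
    have e : ∀ θ : ℝ, (1 - Complex.exp ((θ : ℝ) * Complex.I)) +
        (1 - Complex.exp ((-θ : ℝ) * Complex.I)) = ((2 * (1 - Real.cos θ) : ℝ) : ℂ) := by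
      intro θ
      rw [Complex.exp_mul_I, Complex.exp_mul_I]
      push_cast
      rw [Complex.cos_neg, Complex.sin_neg]
      ring
    simp only [hg, inner_neg_right, mul_neg]
    exact e _
  rw [h1] at h2
  push_cast at h2
  linear_combination h2 / 2

/-- The jump operator is the Fourier multiplier by the symbol of its Lévy measure. -/
lemma levyOp_eq_re (hφ : IsTestFun φ) {μ : Measure (EuclideanSpace ℝ (Fin d))}
    [IsFiniteMeasure μ] (hμ : μ.map (fun y => -y) = μ) (x : EuclideanSpace ℝ (Fin d)) :
    levyOp μ φ x = (∫ ξ, Complex.exp ((2 * Real.pi * inner ℝ ξ x : ℝ) * Complex.I) *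
      ((levySymbol μ ξ : ℂ) * 𝓕 (fun y : EuclideanSpace ℝ (Fin d) => (φ y : ℂ)) ξ)).re := by
  set Φ := 𝓕 (fun y : EuclideanSpace ℝ (Fin d) => (φ y : ℂ)) with hΦ
  have hΦc : Continuous Φ := hφ.continuous_fourier
  have hΦi : Integrable Φ := hφ.integrable_fourier
  have hexp : ∀ z : EuclideanSpace ℝ (Fin d), Integrable fun ξ =>
      Complex.exp ((2 * Real.pi * inner ℝ ξ z : ℝ) * Complex.I) * Φ ξ := by
    intro z
    refine hΦi.mono (Continuous.aestronglyMeasurable (by fun_prop))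
      (Eventually.of_forall fun ξ => ?_)
    rw [norm_mul, Complex.norm_exp_ofReal_mul_I, one_mul]
  have key : ((levyOp μ φ x : ℝ) : ℂ) =
      ∫ ξ, Complex.exp ((2 * Real.pi * inner ℝ ξ x : ℝ) * Complex.I) *
      ((levySymbol μ ξ : ℂ) * Φ ξ) := by
    rw [levyOp, ← integral_complex_ofReal]
    have e1 : ∀ y : EuclideanSpace ℝ (Fin d), ((φ x - φ (x + y) : ℝ) : ℂ) =
        ∫ ξ, Complex.exp ((2 * Real.pi * inner ℝ ξ x : ℝ) * Complex.I) *
          ((1 - Complex.exp ((2 * Real.pi * inner ℝ ξ y : ℝ) * Complex.I)) * Φ ξ) := by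
      intro y
      rw [Complex.ofReal_sub, hφ.fourier_inversion x, hφ.fourier_inversion (x + y),
        ← integral_sub (hexp _) (hexp _)]
      refine integral_congr_ae (Eventually.of_forall fun ξ => ?_)
      simp only [inner_add_right]
      rw [show ((2 * Real.pi * (inner ℝ ξ x + inner ℝ ξ y) : ℝ) : ℂ) * Complex.I =
        (2 * Real.pi * inner ℝ ξ x : ℝ) * Complex.I +
        (2 * Real.pi * inner ℝ ξ y : ℝ) * Complex.I by push_cast; ring, Complex.exp_add]
      ring
    simp_rw [e1]
    rw [integral_integral_swap]
    · refine integral_congr_ae (Eventually.of_forall fun ξ => ?_)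
      simp only
      rw [integral_const_mul, integral_mul_const, integral_one_sub_exp_eq_levySymbol hμ]
    · have hb : Integrable (fun q : EuclideanSpace ℝ (Fin d) × EuclideanSpace ℝ (Fin d) =>
          (2 : ℝ) * ‖Φ q.2‖) (μ.prod volume) :=
        (integrable_const (2 : ℝ)).mul_prod hΦi.norm
      refine hb.mono' (Continuous.aestronglyMeasurable (by fun_prop))
        (Eventually.of_forall fun q => ?_)
      simp only [Function.uncurry]
      rw [norm_mul, Complex.norm_exp_ofReal_mul_I, one_mul, norm_mul]
      gcongr
      refine (norm_sub_le _ _).trans ?_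
      rw [Complex.norm_exp_ofReal_mul_I, norm_one]
      norm_num
  rw [← key, Complex.ofReal_re]

lemma fracLaplacian_eq_re (x : EuclideanSpace ℝ (Fin d)) :
    fracLaplacian α φ x = (∫ ξ, Complex.exp ((2 * Real.pi * inner ℝ ξ x : ℝ) * Complex.I) *
      ((((2 * Real.pi * ‖ξ‖) ^ α : ℝ) : ℂ) *
        𝓕 (fun y : EuclideanSpace ℝ (Fin d) => (φ y : ℂ)) ξ)).re := by
  rw [fracLaplacian, Real.fourierInv_eq']
  rfl

lemma continuous_levySymbol (μ : Measure (EuclideanSpace ℝ (Fin d))) [IsFiniteMeasure μ] :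
    Continuous (levySymbol μ) := by
  refine continuous_of_dominated (bound := fun _ => 2)
    (fun ξ => (continuous_one_sub_cos_inner ξ).aestronglyMeasurable) (fun ξ => ?_)
    (integrable_const _) (Eventually.of_forall fun y => by fun_prop)
  exact Eventually.of_forall fun y => abs_one_sub_cos_le _

/-- The jump operators converge to the fractional Laplacian uniformly on test functions. -/
lemma IsLevyApprox.exists_abs_levyOp_sub_le (h : IsLevyApprox α μ) (hα : 0 < α) (hα2 : α ≤ 2)
    (hφ : IsTestFun φ) : ∃ e : ℕ → ℝ, Tendsto e atTop (𝓝 0) ∧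
      ∀ m x, |levyOp (μ m) φ x - fracLaplacian α φ x| ≤ e m := by
  set Φ := 𝓕 (fun y : EuclideanSpace ℝ (Fin d) => (φ y : ℂ)) with hΦ
  have hΦc : Continuous Φ := hφ.continuous_fourier
  have hsi := hφ.integrable_symbol_mul_fourier hα hα2
  have hsc : Continuous fun ξ : EuclideanSpace ℝ (Fin d) => (2 * Real.pi * ‖ξ‖) ^ α :=
    Continuous.rpow_const (by fun_prop) fun _ => Or.inr hα.le
  have hmc : ∀ m, Continuous (levySymbol (μ m)) := fun m => by
    have := h.finite m
    exact continuous_levySymbol _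
  have habs : ∀ m ξ, |levySymbol (μ m) ξ - (2 * Real.pi * ‖ξ‖) ^ α| ≤ (2 * Real.pi * ‖ξ‖) ^ α := by
    intro m ξ
    have h1 := h.symbol_le m ξ
    have h2 := levySymbol_nonneg (μ m) ξ
    rw [abs_le]
    constructor <;> linarith
  refine ⟨fun m => ∫ ξ, |levySymbol (μ m) ξ - (2 * Real.pi * ‖ξ‖) ^ α| * ‖Φ ξ‖, ?_, fun m x => ?_⟩
  · have := tendsto_integral_of_dominated_convergence
      (F := fun m ξ => |levySymbol (μ m) ξ - (2 * Real.pi * ‖ξ‖) ^ α| * ‖Φ ξ‖) (f := fun _ => 0)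
      (fun ξ => (2 * Real.pi * ‖ξ‖) ^ α * ‖Φ ξ‖)
      (fun m => (((hmc m).sub hsc).abs.mul hΦc.norm).aestronglyMeasurable) hsi
      (fun m => Eventually.of_forall fun ξ => ?_) (Eventually.of_forall fun ξ => ?_)
    · simpa using this
    · rw [Real.norm_of_nonneg (by positivity)]
      gcongr
      exact habs m ξ
    · have h1 := ((h.symbol_tendsto ξ).sub_const ((2 * Real.pi * ‖ξ‖) ^ α)).abs.mul_const ‖Φ ξ‖
      simpa using h1
  · have := h.finite m
    rw [levyOp_eq_re hφ (h.neg m), fracLaplacian_eq_re, ← Complex.sub_re]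
    have hI : ∀ s : EuclideanSpace ℝ (Fin d) → ℝ, Continuous s →
        (∀ ξ, |s ξ| ≤ (2 * Real.pi * ‖ξ‖) ^ α) → Integrable fun ξ =>
          Complex.exp ((2 * Real.pi * inner ℝ ξ x : ℝ) * Complex.I) * ((s ξ : ℂ) * Φ ξ) := by
      intro s hs hs1
      refine hsi.mono' (Continuous.aestronglyMeasurable (by fun_prop))
        (Eventually.of_forall fun ξ => ?_)
      rw [norm_mul, Complex.norm_exp_ofReal_mul_I, one_mul, norm_mul, Complex.norm_real,
        Real.norm_eq_abs]
      gcongr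
      exact hs1 ξ
    rw [← integral_sub (hI _ (hmc m) fun ξ => by
      rw [abs_of_nonneg (levySymbol_nonneg _ _)]; exact h.symbol_le m ξ)
      (hI _ hsc fun ξ => by rw [abs_of_nonneg (by positivity)])]
    refine (Complex.abs_re_le_norm _).trans ((norm_integral_le_integral_norm _).trans (le_of_eq ?_))
    refine integral_congr_ae (Eventually.of_forall fun ξ => ?_)
    simp only
    rw [← mul_sub, norm_mul, Complex.norm_exp_ofReal_mul_I, one_mul, ← sub_mul, norm_mul,
      ← Complex.ofReal_sub, Complex.norm_real, Real.norm_eq_abs]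

lemma IsTestFun.exists_abs_le (hφ : IsTestFun φ) : ∃ C, 0 ≤ C ∧ ∀ x, |φ x| ≤ C := by
  obtain ⟨C, hC⟩ := hφ.2.exists_bound_of_continuous hφ.1.continuous
  exact ⟨C, (norm_nonneg _).trans (hC 0), hC⟩

lemma IsTestFun.continuous_levyOp (hφ : IsTestFun φ) (μ : Measure (EuclideanSpace ℝ (Fin d)))
    [IsFiniteMeasure μ] : Continuous (levyOp μ φ) := by
  obtain ⟨C, hC0, hC⟩ := hφ.exists_abs_le
  have hc := hφ.1.continuous
  refine continuous_of_dominated (bound := fun _ => C + C)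
    (fun x => Continuous.aestronglyMeasurable (by fun_prop)) (fun x => ?_)
    (integrable_const _) (Eventually.of_forall fun y => by fun_prop)
  exact Eventually.of_forall fun y => (abs_sub _ _).trans (add_le_add (hC _) (hC _))

lemma IsLevyApprox.tendsto_levyOp (h : IsLevyApprox α μ) (hα : 0 < α) (hα2 : α ≤ 2)
    (hφ : IsTestFun φ) (x : EuclideanSpace ℝ (Fin d)) :
    Tendsto (fun m => levyOp (μ m) φ x) atTop (𝓝 (fracLaplacian α φ x)) := by
  obtain ⟨e, he, hb⟩ := h.exists_abs_levyOp_sub_le hα hα2 hφ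
  refine tendsto_iff_norm_sub_tendsto_zero.2 ?_
  exact squeeze_zero (fun _ => norm_nonneg _) (fun m => hb m x) he

lemma continuous_fracLaplacian (hα : 0 < α) (hα2 : α ≤ 2) (hφ : IsTestFun φ) :
    Continuous (fracLaplacian α φ) := by
  obtain ⟨μ, h⟩ := exists_isLevyApprox d hα hα2
  obtain ⟨e, he, hb⟩ := h.exists_abs_levyOp_sub_le hα hα2 hφ
  have hu : TendstoUniformly (fun m => levyOp (μ m) φ) (fracLaplacian α φ) atTop := by
    rw [Metric.tendstoUniformly_iff]
    intro ε hε
    filter_upwards [he.eventually (gt_mem_nhds hε)] with m hm x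
    rw [dist_comm, Real.dist_eq]
    exact (hb m x).trans_lt hm
  refine hu.continuous (Eventually.of_forall fun m => ?_).frequently
  have := h.finite m
  exact hφ.continuous_levyOp _

lemma exists_abs_fracLaplacian_le (α : ℝ) (φ : EuclideanSpace ℝ (Fin d) → ℝ) :
    ∃ C, 0 ≤ C ∧ ∀ x, |fracLaplacian α φ x| ≤ C := by
  refine ⟨∫ ξ, (2 * Real.pi * ‖ξ‖) ^ α *
    ‖𝓕 (fun y : EuclideanSpace ℝ (Fin d) => (φ y : ℂ)) ξ‖, by positivity, fun x => ?_⟩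
  rw [fracLaplacian_eq_re]
  refine (Complex.abs_re_le_norm _).trans ((norm_integral_le_integral_norm _).trans (le_of_eq ?_))
  refine integral_congr_ae (Eventually.of_forall fun ξ => ?_)
  simp only
  rw [norm_mul, Complex.norm_exp_ofReal_mul_I, one_mul, norm_mul, Complex.norm_real,
    Real.norm_of_nonneg (by positivity)]

/-- The fractional Laplacian commutes with translations and with the reflection at the origin. -/
lemma fracLaplacian_comp_sub_left (hα : 0 < α) (hα2 : α ≤ 2) (hφ : IsTestFun φ)
    (x y : EuclideanSpace ℝ (Fin d)) :
    fracLaplacian α (fun z => φ (x - z)) y = fracLaplacian α φ (x - y) := by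
  obtain ⟨μ, h⟩ := exists_isLevyApprox d hα hα2
  refine tendsto_nhds_unique (h.tendsto_levyOp hα hα2 (hφ.comp_sub_left x) y) ?_
  refine (h.tendsto_levyOp hα hα2 hφ (x - y)).congr fun m => ?_
  rw [levyOp, levyOp, ← integral_comp_neg_of_map_neg (h.neg m)]
  refine integral_congr_ae (Eventually.of_forall fun z => ?_)
  simp only
  congr 2
  abel

end JumpOperators

/-! ### Plancherel's theorem and the Sobolev constant -/

section Plancherel

lemma integrable_schwartz_mul {f : EuclideanSpace ℝ (Fin d) → ℂ} (hf : Integrable f)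
    (φ : 𝓢(EuclideanSpace ℝ (Fin d), ℂ)) : Integrable fun x => φ x * f x := by
  obtain ⟨C, hC⟩ := φ.decay 0 0
  refine hf.bdd_mul (c := C) φ.continuous.aestronglyMeasurable
    (Eventually.of_forall fun x => ?_)
  simpa using hC.2 x

lemma continuous_fourier_of_integrable {f : EuclideanSpace ℝ (Fin d) → ℂ} (hf : Integrable f) :
    Continuous (𝓕 f) :=
  VectorFourier.fourierIntegral_continuous Real.continuous_fourierChar
    (by exact continuous_inner) hf

lemma norm_fourier_le {f : EuclideanSpace ℝ (Fin d) → ℂ} (x : EuclideanSpace ℝ (Fin d)) :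
    ‖𝓕 f x‖ ≤ ∫ y, ‖f y‖ :=
  VectorFourier.norm_fourierIntegral_le_integral_norm _ _ _ _ _

lemma integrable_schwartz_mul_fourier {f : EuclideanSpace ℝ (Fin d) → ℂ} (hf : Integrable f)
    (φ : 𝓢(EuclideanSpace ℝ (Fin d), ℂ)) : Integrable fun x => φ x * 𝓕 f x :=
  φ.integrable.mul_bdd (c := ∫ y, ‖f y‖) (continuous_fourier_of_integrable hf).aestronglyMeasurable
    (Eventually.of_forall norm_fourier_le)

lemma integral_fourier_schwartz_mul {f : EuclideanSpace ℝ (Fin d) → ℂ} (hf : Integrable f)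
    (φ : 𝓢(EuclideanSpace ℝ (Fin d), ℂ)) : ∫ x, 𝓕 φ x * f x = ∫ x, φ x * 𝓕 f x := by
  have := VectorFourier.integral_fourierIntegral_smul_eq_flip (L := innerₗ (EuclideanSpace ℝ (Fin d)))
    (μ := volume) (ν := volume)
    Real.continuous_fourierChar (by exact continuous_inner) φ.integrable hf
  simpa using! this

/-- An integrable function and its Fourier transform are a tempered distribution and its Fourier
transform. -/
lemma exists_isFunctionRep {f : EuclideanSpace ℝ (Fin d) → ℂ} (hf : Integrable f) :
    ∃ u : 𝓢'(EuclideanSpace ℝ (Fin d), ℂ), IsFunctionRep u f ∧ IsFunctionRep (𝓕 u) (𝓕 f) := by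
  have hfl : MemLp f 1 volume := memLp_one_iff_integrable.2 hf
  have hu : ∀ φ : 𝓢(EuclideanSpace ℝ (Fin d), ℂ),
      Lp.toTemperedDistribution (hfl.toLp f) φ = ∫ x, φ x * f x := by
    intro φ
    rw [Lp.toTemperedDistribution_apply]
    refine integral_congr_ae ?_
    filter_upwards [hfl.coeFn_toLp] with x hx
    rw [hx, smul_eq_mul]
  refine ⟨Lp.toTemperedDistribution (hfl.toLp f), ⟨hf.locallyIntegrable, fun φ =>
    ⟨integrable_schwartz_mul hf φ, hu φ⟩⟩, ⟨?_, fun φ =>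
    ⟨integrable_schwartz_mul_fourier hf φ, ?_⟩⟩⟩
  · exact (continuous_fourier_of_integrable hf).locallyIntegrable
  · rw [TemperedDistribution.fourier_apply, hu, integral_fourier_schwartz_mul hf]

/-- Plancherel's theorem on `L¹ ∩ L²`. -/
lemma eLpNorm_fourier {f : EuclideanSpace ℝ (Fin d) → ℂ} (hf : Integrable f)
    (hf2 : MemLp f 2 volume) : eLpNorm (𝓕 f) 2 volume = eLpNorm f 2 volume := by
  set g : Lp ℂ 2 (volume : Measure (EuclideanSpace ℝ (Fin d))) := hf2.toLp f with hg
  have hae : ∀ᵐ x, (𝓕 g : Lp ℂ 2 (volume : Measure (EuclideanSpace ℝ (Fin d)))) x = 𝓕 f x := by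
    refine ae_eq_of_integral_contDiff_smul_eq ((Lp.memLp _).locallyIntegrable (by norm_num))
      (continuous_fourier_of_integrable hf).locallyIntegrable fun φ h1 h2 => ?_
    obtain ⟨ψ, hψ⟩ := IsTestFun.exists_schwartz (φ := φ) ⟨h1, h2⟩
    have h3 := congrArg (fun u : 𝓢'(EuclideanSpace ℝ (Fin d), ℂ) => u ψ)
      (Lp.fourier_toTemperedDistribution_eq g)
    simp only [TemperedDistribution.fourier_apply, Lp.toTemperedDistribution_apply] at h3
    have h4 : ∫ x, 𝓕 ψ x • g x = ∫ x, 𝓕 ψ x * f x := by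
      refine integral_congr_ae ?_
      filter_upwards [hf2.coeFn_toLp] with x hx
      rw [hg, hx, smul_eq_mul]
    have e : ∀ x, φ x • (𝓕 g : Lp ℂ 2 (volume : Measure (EuclideanSpace ℝ (Fin d)))) x =
        ψ x • (𝓕 g : Lp ℂ 2 (volume : Measure (EuclideanSpace ℝ (Fin d)))) x := by
      intro x
      rw [hψ]
      simp
    have e' : ∀ x, φ x • 𝓕 f x = ψ x * 𝓕 f x := by
      intro x
      rw [hψ]
      simp
    simp_rw [e, e']
    rw [← h3, h4]
    exact integral_fourier_schwartz_mul hf ψ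
  rw [← eLpNorm_congr_ae hae, ← eLpNorm_congr_ae hf2.coeFn_toLp, ← hg]
  have h5 := Lp.norm_fourier_eq g
  rw [Lp.norm_def, Lp.norm_def] at h5
  exact (ENNReal.toReal_eq_toReal_iff' (Lp.eLpNorm_ne_top _) (Lp.eLpNorm_ne_top _)).1 h5

lemma eLpNorm_two_sq {X : Type*} [MeasurableSpace X] {ν : Measure X} {F : Type*}
    [NormedAddCommGroup F] (f : X → F) :
    eLpNorm f 2 ν ^ 2 = ∫⁻ x, ‖f x‖ₑ ^ 2 ∂ν := by
  have := eLpNorm_nnreal_pow_eq_lintegral (f := f) (μ := ν) (p := 2) (by norm_num)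
  simpa using this

variable {g : EuclideanSpace ℝ (Fin d) → ℝ}

lemma fourier_sub_translate (hg : Integrable g) (y ξ : EuclideanSpace ℝ (Fin d)) :
    𝓕 (fun x => ((g x - g (x + y) : ℝ) : ℂ)) ξ =
      (1 - Complex.exp ((2 * Real.pi * inner ℝ ξ y : ℝ) * Complex.I)) *
        𝓕 (fun x => (g x : ℂ)) ξ := by
  have h := congrFun (VectorFourier.fourierIntegral_comp_add_right Real.fourierChar
    (volume : Measure (EuclideanSpace ℝ (Fin d))) (innerₗ (EuclideanSpace ℝ (Fin d)))
    (fun x => (g x : ℂ)) y) ξ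
  have h1 : 𝓕 (fun x => (g (x + y) : ℂ)) ξ =
      Complex.exp ((2 * Real.pi * inner ℝ ξ y : ℝ) * Complex.I) * 𝓕 (fun x => (g x : ℂ)) ξ := by
    refine h.trans ?_
    rw [Circle.smul_def, Real.fourierChar_apply, real_inner_comm]
    rfl
  have h2 : 𝓕 (fun x => ((g x - g (x + y) : ℝ) : ℂ)) ξ =
      𝓕 (fun x => (g x : ℂ)) ξ - 𝓕 (fun x => (g (x + y) : ℂ)) ξ := by
    rw [Real.fourier_eq, Real.fourier_eq, Real.fourier_eq, ← integral_sub]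
    · refine integral_congr_ae (Eventually.of_forall fun x => ?_)
      simp only [Complex.ofReal_sub, smul_sub]
    · exact (Real.fourierIntegral_convergent_iff ξ).2 hg.ofReal
    · exact (Real.fourierIntegral_convergent_iff ξ).2 (hg.comp_add_right y).ofReal
  rw [h2, h1]
  ring

lemma enorm_one_sub_exp_sq (θ : ℝ) :
    ‖1 - Complex.exp ((θ : ℝ) * Complex.I)‖ₑ ^ 2 = ENNReal.ofReal (2 * (1 - Real.cos θ)) := by
  rw [← ofReal_norm, ← ENNReal.ofReal_pow (norm_nonneg _)]
  congr 1
  rw [← Complex.normSq_eq_norm_sq, Complex.normSq_apply]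
  simp only [Complex.sub_re, Complex.sub_im, Complex.one_re, Complex.one_im,
    Complex.exp_ofReal_mul_I_re, Complex.exp_ofReal_mul_I_im]
  nlinarith [Real.sin_sq_add_cos_sq θ]

lemma lintegral_sq_sub_translate (hg : Continuous g) (hgs : HasCompactSupport g)
    (y : EuclideanSpace ℝ (Fin d)) :
    ∫⁻ x, ENNReal.ofReal ((g x - g (x + y)) ^ 2) =
      ∫⁻ ξ, ENNReal.ofReal (2 * (1 - Real.cos (2 * Real.pi * inner ℝ ξ y))) *
        ‖𝓕 (fun x => (g x : ℂ)) ξ‖ₑ ^ 2 := by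
  have hi : Integrable g := hg.integrable_of_hasCompactSupport hgs
  have hyc : Continuous fun x => g (x + y) := by fun_prop
  have hys : HasCompactSupport fun x => g (x + y) :=
    hgs.comp_homeomorph (Homeomorph.addRight y)
  have hdc : Continuous fun x => ((g x - g (x + y) : ℝ) : ℂ) := by fun_prop
  have hds : HasCompactSupport fun x => ((g x - g (x + y) : ℝ) : ℂ) :=
    (hgs.sub hys).comp_left (g := fun x : ℝ => (x : ℂ)) (by simp)
  have h := eLpNorm_fourier (hdc.integrable_of_hasCompactSupport hds)
    (hdc.memLp_of_hasCompactSupport hds)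
  have h2 := congrArg (· ^ 2) h
  simp only [eLpNorm_two_sq] at h2
  have e : ∀ x, ENNReal.ofReal ((g x - g (x + y)) ^ 2) = ‖((g x - g (x + y) : ℝ) : ℂ)‖ₑ ^ 2 := by
    intro x
    rw [← ofReal_norm, ← ENNReal.ofReal_pow (norm_nonneg _), Complex.norm_real, Real.norm_eq_abs,
      sq_abs]
  simp_rw [e]
  rw [← h2]
  refine lintegral_congr fun ξ => ?_
  rw [fourier_sub_translate hi, enorm_mul, mul_pow, enorm_one_sub_exp_sq]

/-- The energy of the jump process in Fourier variables. -/
lemma lintegral_lintegral_sq_sub_translate (hg : Continuous g) (hgs : HasCompactSupport g)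
    (μ : Measure (EuclideanSpace ℝ (Fin d))) [IsFiniteMeasure μ] :
    ∫⁻ y, ∫⁻ x, ENNReal.ofReal ((g x - g (x + y)) ^ 2) ∂volume ∂μ =
      2 * ∫⁻ ξ, ENNReal.ofReal (levySymbol μ ξ) * ‖𝓕 (fun x => (g x : ℂ)) ξ‖ₑ ^ 2 := by
  have hi : Integrable g := hg.integrable_of_hasCompactSupport hgs
  have hc := continuous_fourier_of_integrable hi.ofReal
  simp_rw [lintegral_sq_sub_translate hg hgs]
  rw [lintegral_lintegral_swap, ← lintegral_const_mul' _ _ (by simp)]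
  · refine lintegral_congr fun ξ => ?_
    rw [lintegral_mul_const', ← mul_assoc]
    · congr 1
      rw [levySymbol, ofReal_integral_eq_lintegral_ofReal (integrable_of_norm_le_const
        (continuous_one_sub_cos_inner ξ).aestronglyMeasurable fun z => abs_one_sub_cos_le _)
        (Eventually.of_forall fun z => one_sub_cos_nonneg _), ← lintegral_const_mul' _ _ (by simp)]
      refine lintegral_congr fun y => ?_
      rw [ENNReal.ofReal_mul (by norm_num)]
      simp
    · simp
  · refine Measurable.aemeasurable ?_
    have h1 : Measurable fun q : EuclideanSpace ℝ (Fin d) × EuclideanSpace ℝ (Fin d) =>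
        ENNReal.ofReal (2 * (1 - Real.cos (2 * Real.pi * inner ℝ q.2 q.1))) :=
      (Continuous.measurable (by fun_prop)).ennreal_ofReal
    have h2 : Measurable fun q : EuclideanSpace ℝ (Fin d) × EuclideanSpace ℝ (Fin d) =>
        ‖𝓕 (fun x => (g x : ℂ)) q.2‖ₑ ^ 2 := (hc.comp continuous_snd).measurable.enorm.pow_const 2
    exact h1.mul h2

/-- The Sobolev energy is bounded by the lower limit of the energies of the approximating jump
processes. The factor `2` comes from counting each jump in both directions. -/
lemma IsLevyApprox.two_mul_sobolevEnergy_le {α : ℝ}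
    {μ : ℕ → Measure (EuclideanSpace ℝ (Fin d))} (h : IsLevyApprox α μ)
    (hg : Continuous g) (hgs : HasCompactSupport g) :
    2 * sobolevEnergy (α / 2) (𝓕 fun x => (g x : ℂ)) ≤
      liminf (fun m => ∫⁻ y, ∫⁻ x, ENNReal.ofReal ((g x - g (x + y)) ^ 2) ∂volume ∂(μ m)) atTop := by
  have hi : Integrable g := hg.integrable_of_hasCompactSupport hgs
  have hc := continuous_fourier_of_integrable hi.ofReal
  have e : ∀ m, ∫⁻ y, ∫⁻ x, ENNReal.ofReal ((g x - g (x + y)) ^ 2) ∂volume ∂(μ m) =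
      ∫⁻ ξ, 2 * (ENNReal.ofReal (levySymbol (μ m) ξ) * ‖𝓕 (fun x => (g x : ℂ)) ξ‖ₑ ^ 2) := by
    intro m
    have := h.finite m
    rw [lintegral_lintegral_sq_sub_translate hg hgs, lintegral_const_mul' _ _ (by simp)]
  simp_rw [e]
  refine le_trans (le_of_eq ?_) (lintegral_liminf_le' fun m => ?_)
  · rw [sobolevEnergy, ← lintegral_const_mul' _ _ (by simp)]
    refine lintegral_congr fun ξ => ?_
    have h1 : Tendsto (fun m => 2 * (ENNReal.ofReal (levySymbol (μ m) ξ) *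
        ‖𝓕 (fun x => (g x : ℂ)) ξ‖ₑ ^ 2)) atTop (𝓝 (2 * (ENNReal.ofReal ((2 * Real.pi * ‖ξ‖) ^ α) *
        ‖𝓕 (fun x => (g x : ℂ)) ξ‖ₑ ^ 2))) := by
      refine ENNReal.Tendsto.const_mul (ENNReal.Tendsto.mul_const
        (ENNReal.tendsto_ofReal (h.symbol_tendsto ξ)) (Or.inr (by simp))) (Or.inr (by simp))
    rw [h1.liminf_eq, ENNReal.ofReal_mul (by positivity), ENNReal.ofReal_pow (norm_nonneg _),
      ofReal_norm]
    congr 4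
    ring
  · have := h.finite m
    have h1 : Measurable fun ξ => ENNReal.ofReal (levySymbol (μ m) ξ) :=
      (continuous_levySymbol _).measurable.ennreal_ofReal
    have h2 : Measurable fun ξ => ‖𝓕 (fun x => (g x : ℂ)) ξ‖ₑ ^ 2 :=
      hc.measurable.enorm.pow_const 2
    exact ((h1.mul h2).const_mul _).aemeasurable

lemma fourier_const_mul (c : ℝ) (ξ : EuclideanSpace ℝ (Fin d)) :
    𝓕 (fun x => ((c * g x : ℝ) : ℂ)) ξ = c * 𝓕 (fun x => (g x : ℂ)) ξ := by
  rw [Real.fourier_eq, Real.fourier_eq, ← integral_const_mul]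
  refine integral_congr_ae (Eventually.of_forall fun x => ?_)
  simp only [Complex.ofReal_mul, Circle.smul_def, smul_eq_mul]
  ring

lemma sobolevEnergy_const_mul (h c : ℝ) :
    sobolevEnergy h (𝓕 fun x => ((c * g x : ℝ) : ℂ)) =
      ENNReal.ofReal (c ^ 2) * sobolevEnergy h (𝓕 fun x => (g x : ℂ)) := by
  rw [sobolevEnergy, sobolevEnergy, ← lintegral_const_mul' _ _ (by simp)]
  refine lintegral_congr fun ξ => ?_
  rw [fourier_const_mul, ← ENNReal.ofReal_mul (by positivity), norm_mul, Complex.norm_real,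
    mul_pow, Real.norm_eq_abs, sq_abs]
  congr 1
  ring

/-- Functions of zero energy vanish, since the symbol has no zero besides the origin. This excludes
the one case in which a function cannot be normalized in the supremum that defines the Sobolev
constant. -/
lemma eq_zero_of_sobolevEnergy_eq_zero [Nonempty (Fin d)] {h : ℝ} (hg : Continuous g)
    (hgs : HasCompactSupport g)
    (hE : sobolevEnergy h (𝓕 fun x => (g x : ℂ)) = 0) : g = 0 := by
  have hi : Integrable fun x => (g x : ℂ) := (hg.integrable_of_hasCompactSupport hgs).ofReal
  have hc := continuous_fourier_of_integrable hi
  have hm : Measurable fun ξ : EuclideanSpace ℝ (Fin d) =>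
      ENNReal.ofReal ((2 * Real.pi * ‖ξ‖) ^ (2 * h) * ‖𝓕 (fun x => (g x : ℂ)) ξ‖ ^ 2) := by
    have := hc.measurable
    fun_prop
  rw [sobolevEnergy, lintegral_eq_zero_iff hm] at hE
  have hne : ∀ᵐ ξ : EuclideanSpace ℝ (Fin d), ξ ≠ 0 := by
    simp [ae_iff]
  have h0 : 𝓕 (fun x => (g x : ℂ)) =ᵐ[volume] fun _ => 0 := by
    filter_upwards [hE, hne] with ξ h1 h2
    have h3 : 0 < (2 * Real.pi * ‖ξ‖) ^ (2 * h) := by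
      have := norm_pos_iff.2 h2
      positivity
    simp only [Pi.zero_apply, ENNReal.ofReal_eq_zero] at h1
    have h4 : ‖𝓕 (fun x => (g x : ℂ)) ξ‖ ^ 2 ≤ 0 := by
      by_contra hcon
      push Not at hcon
      exact absurd h1 (not_le.2 (mul_pos h3 hcon))
    have h5 : ‖𝓕 (fun x => (g x : ℂ)) ξ‖ = 0 := by
      have := sq_nonneg ‖𝓕 (fun x => (g x : ℂ)) ξ‖
      exact pow_eq_zero_iff (two_ne_zero) |>.1 (le_antisymm h4 this)
    exact norm_eq_zero.1 h5
  have h6 : 𝓕 (fun x => (g x : ℂ)) = fun _ => 0 :=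
    Continuous.ae_eq_iff_eq volume hc continuous_const |>.1 h0
  have hgc : Continuous fun x => (g x : ℂ) := by fun_prop
  have h7 := hgc.fourierInv_fourier_eq hi (by rw [h6]; exact integrable_zero _ _ _)
  funext x
  have h8 := congrFun h7 x
  rw [h6, Real.fourierInv_eq'] at h8
  simp at h8
  simpa using h8.symm

/-- The Sobolev inequality which defines the Sobolev constant, without normalization. -/
lemma sobolevConst_mul_le [Nonempty (Fin d)] {h : ℝ}
    (hg : Continuous g) (hgs : HasCompactSupport g) :
    sobolevConst d h * eLpNorm g (ENNReal.ofReal (2 * d / (d - 2 * h))) volume ^ 2 ≤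
      sobolevEnergy h (𝓕 fun x => (g x : ℂ)) := by
  set E := sobolevEnergy h (𝓕 fun x => (g x : ℂ)) with hE
  rcases eq_or_ne E ∞ with hT | hT
  · rw [hT]; exact le_top
  rcases eq_or_ne E 0 with h0 | h0
  · rw [eq_zero_of_sobolevEnergy_eq_zero hg hgs h0]
    simp
  set c : ℝ := √(E.toReal⁻¹) with hc
  have hEpos : 0 < E.toReal := ENNReal.toReal_pos h0 hT
  have hcc : c ^ 2 = E.toReal⁻¹ := Real.sq_sqrt (by positivity)
  have hEc : sobolevEnergy h (𝓕 fun x => ((c * g x : ℝ) : ℂ)) = 1 := by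
    rw [sobolevEnergy_const_mul, ← hE, hcc, ENNReal.ofReal_inv_of_pos hEpos,
      ENNReal.ofReal_toReal hT, ENNReal.inv_mul_cancel h0 hT]
  have hcg : Continuous fun x => c * g x := by fun_prop
  have hcs : HasCompactSupport fun x => c * g x := hgs.mul_left
  obtain ⟨u, hu1, hu2⟩ := exists_isFunctionRep (hcg.integrable_of_hasCompactSupport hcs).ofReal
  have hS : IsHomSobolev h (fun x => c * g x) (𝓕 fun x => ((c * g x : ℝ) : ℂ)) :=
    ⟨⟨u, hu1, hu2⟩, by rw [hEc]; simp⟩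
  set q := ENNReal.ofReal (2 * d / (d - 2 * h)) with hq
  have hsup : eLpNorm (fun x => c * g x) q volume ^ 2 ≤ (sobolevConst d h)⁻¹ := by
    rw [sobolevConst, inv_inv]
    exact le_iSup_of_le (fun x => c * g x) (le_iSup_of_le _ (le_iSup_of_le hS
      (le_iSup_of_le hEc le_rfl)))
  have hsc : eLpNorm (fun x => c * g x) q volume ^ 2 = E⁻¹ * eLpNorm g q volume ^ 2 := by
    have : (fun x => c * g x) = c • g := rfl
    rw [this, eLpNorm_const_smul, mul_pow, ← ofReal_norm, ← ENNReal.ofReal_pow (norm_nonneg _),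
      Real.norm_eq_abs, sq_abs, hcc, ENNReal.ofReal_inv_of_pos hEpos, ENNReal.ofReal_toReal hT]
  rw [hsc] at hsup
  calc sobolevConst d h * eLpNorm g q volume ^ 2
      = E * (sobolevConst d h * (E⁻¹ * eLpNorm g q volume ^ 2)) := by
        rw [mul_left_comm, ← mul_assoc E, ENNReal.mul_inv_cancel h0 hT, one_mul]
    _ ≤ E * (sobolevConst d h * (sobolevConst d h)⁻¹) := by gcongr
    _ ≤ E * 1 := by gcongr; exact ENNReal.mul_inv_le_one _
    _ = E := mul_one _

end Plancherel

/-! ### Cutoffs and convolutions under the fractional Laplacian -/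

section Cutoffs

variable {φ : EuclideanSpace ℝ (Fin d) → ℝ} {α : ℝ}
  {μ : ℕ → Measure (EuclideanSpace ℝ (Fin d))}

lemma IsTestFun.comp_smul (hφ : IsTestFun φ) {c : ℝ} (hc : c ≠ 0) :
    IsTestFun fun x => φ (c • x) :=
  ⟨hφ.1.comp (contDiff_const_smul c),
    hφ.2.comp_homeomorph (Homeomorph.smulOfNeZero c hc)⟩

lemma IsTestFun.sq (hφ : IsTestFun φ) : IsTestFun fun x => φ x ^ 2 :=
  ⟨hφ.1.pow 2, hφ.2.comp_left (g := fun t : ℝ => t ^ 2) (by simp)⟩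

lemma IsTestFun.exists_abs_sub_le (hφ : IsTestFun φ) :
    ∃ K, 0 ≤ K ∧ ∀ x y, |φ x - φ (x + y)| ≤ K * ‖y‖ := by
  obtain ⟨C, hC⟩ := hφ.1.lipschitzWith_of_hasCompactSupport hφ.2 (by simp)
  refine ⟨C, C.2, fun x y => ?_⟩
  have := hC.dist_le_mul x (x + y)
  rw [Real.dist_eq] at this
  simpa using this

lemma IsTestFun.exists_abs_second_difference_le (hφ : IsTestFun φ) :
    ∃ K, 0 ≤ K ∧ ∀ x y, |2 * φ x - φ (x + y) - φ (x - y)| ≤ K * ‖y‖ ^ 2 := by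
  obtain ⟨C, hC⟩ := (hφ.1.fderiv_right (m := (⊤ : ℕ∞)) (by simp)).lipschitzWith_of_hasCompactSupport
    (hφ.2.fderiv ℝ) (by simp)
  have hd : Differentiable ℝ φ := hφ.1.differentiable (by simp)
  refine ⟨C, C.2, fun x y => ?_⟩
  have hg : ∀ z, HasFDerivAt (fun z => φ (z + y) - φ z) (fderiv ℝ φ (z + y) - fderiv ℝ φ z) z :=
    fun z => ((hasFDerivAt_comp_add_right y).2 (hd (z + y)).hasFDerivAt).sub (hd z).hasFDerivAt
  have hb : ∀ z ∈ (univ : Set (EuclideanSpace ℝ (Fin d))),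
      ‖fderiv ℝ φ (z + y) - fderiv ℝ φ z‖ ≤ C * ‖y‖ := by
    intro z _
    have := hC.dist_le_mul (z + y) z
    rw [dist_eq_norm, dist_eq_norm] at this
    simpa using this
  have h := convex_univ.norm_image_sub_le_of_norm_hasFDerivWithin_le
    (fun z _ => (hg z).hasFDerivWithinAt) hb (mem_univ (x - y)) (mem_univ x)
  rw [Real.norm_eq_abs, sub_add_cancel, sub_sub_cancel] at h
  rw [abs_sub_comm] at h
  calc |2 * φ x - φ (x + y) - φ (x - y)| = |φ x - φ (x - y) - (φ (x + y) - φ x)| := by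
        congr 1; ring
    _ ≤ C * ‖y‖ * ‖y‖ := h
    _ = C * ‖y‖ ^ 2 := by ring

lemma le_mul_min_one {a K C t : ℝ} (h1 : a ≤ C) (h2 : a ≤ K * t) (hK : 0 ≤ K) (hC : 0 ≤ C)
    (ht : 0 ≤ t) : a ≤ (K + C) * min 1 t := by
  rcases le_total 1 t with h | h
  · rw [min_eq_left h]; linarith
  · rw [min_eq_right h]; nlinarith

lemma IsTestFun.exists_sq_sub_le_min (hφ : IsTestFun φ) :
    ∃ K, 0 ≤ K ∧ ∀ x y, (φ x - φ (x + y)) ^ 2 ≤ K * min 1 (‖y‖ ^ 2) := by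
  obtain ⟨K, hK, h1⟩ := hφ.exists_abs_sub_le
  obtain ⟨C, hC, h2⟩ := hφ.exists_abs_le
  refine ⟨K ^ 2 + (2 * C) ^ 2, by positivity, fun x y => ?_⟩
  refine le_mul_min_one ?_ ?_ (by positivity) (by positivity) (by positivity)
  · rw [← sq_abs]
    have := (abs_sub (φ x) (φ (x + y))).trans (add_le_add (h2 _) (h2 _))
    exact pow_le_pow_left₀ (abs_nonneg _) (by linarith) 2
  · rw [← sq_abs, ← mul_pow]
    exact pow_le_pow_left₀ (abs_nonneg _) (h1 x y) 2

lemma IsTestFun.exists_second_difference_le_min (hφ : IsTestFun φ) :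
    ∃ K, 0 ≤ K ∧ ∀ x y, |2 * φ x - φ (x + y) - φ (x - y)| ≤ K * min 1 (‖y‖ ^ 2) := by
  obtain ⟨K, hK, h1⟩ := hφ.exists_abs_second_difference_le
  obtain ⟨C, hC, h2⟩ := hφ.exists_abs_le
  refine ⟨K + 4 * C, by positivity, fun x y => ?_⟩
  refine le_mul_min_one ?_ (h1 x y) (by positivity) (by positivity) (by positivity)
  have a := abs_le.1 (h2 x)
  have b := abs_le.1 (h2 (x + y))
  have c := abs_le.1 (h2 (x - y))
  rw [abs_le]
  constructor <;> linarith [a.1, a.2, b.1, b.2, c.1, c.2]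

lemma integral_min_one_le {α : ℝ} {ν : Measure (EuclideanSpace ℝ (Fin d))} {C : ℝ≥0} {l : ℝ}
    (hl : 0 < l) (h : ∫⁻ y, ENNReal.ofReal (min 1 ((l * ‖y‖) ^ 2)) ∂ν ≤ C * ENNReal.ofReal (l ^ α)) :
    ∫ y, min 1 ((l * ‖y‖) ^ 2) ∂ν ≤ C * l ^ α := by
  rw [integral_eq_lintegral_of_nonneg_ae (Eventually.of_forall fun y => by positivity)
    (Continuous.aestronglyMeasurable (by fun_prop))]
  refine ENNReal.toReal_le_of_le_ofReal (by positivity) (h.trans (le_of_eq ?_))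
  rw [ENNReal.ofReal_mul (NNReal.coe_nonneg C), ENNReal.ofReal_coe_nnreal]

/-- The fractional Laplacian of a cutoff at scale `l⁻¹` is of size `l ^ α`. -/
lemma exists_abs_fracLaplacian_comp_smul_le (hα : 0 < α) (hα2 : α ≤ 2) (hφ : IsTestFun φ) :
    ∃ K, 0 ≤ K ∧ ∀ l : ℝ, 0 < l → ∀ x, |fracLaplacian α (fun x => φ (l • x)) x| ≤ K * l ^ α := by
  obtain ⟨μ, h⟩ := exists_isLevyApprox d hα hα2
  obtain ⟨C, hC⟩ := h.exists_moment_le hα hα2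
  obtain ⟨K, hK, hb⟩ := hφ.exists_second_difference_le_min
  refine ⟨K * C, by positivity, fun l hl x => ?_⟩
  have hφl := hφ.comp_smul hl.ne'
  refine le_of_tendsto (h.tendsto_levyOp hα hα2 hφl x).abs (Eventually.of_forall fun m => ?_)
  have := h.finite m
  obtain ⟨B, hB0, hB⟩ := hφl.exists_abs_le
  have hc := hφl.1.continuous
  have hi : ∀ s : ℝ, Integrable (fun y => φ (l • x) - φ (l • (x + s • y))) (μ m) := by
    intro s
    refine integrable_of_norm_le_const (C := B + B) (Continuous.aestronglyMeasurable ?_)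
      fun y => (abs_sub _ _).trans (add_le_add (hB _) (hB _))
    exact continuous_const.sub (hc.comp (by fun_prop))
  -- symmetrizing in `y` produces second differences, which are quadratic in the jump
  have e1 : levyOp (μ m) (fun x => φ (l • x)) x = ∫ y, (φ (l • x) - φ (l • (x - y))) ∂(μ m) := by
    rw [levyOp, ← integral_comp_neg_of_map_neg (h.neg m)]
    simp [sub_eq_add_neg]
  have e2 : 2 * levyOp (μ m) (fun x => φ (l • x)) x =
      ∫ y, (2 * φ (l • x) - φ (l • x + l • y) - φ (l • x - l • y)) ∂(μ m) := by
    rw [two_mul]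
    nth_rewrite 2 [e1]
    rw [levyOp, ← integral_add (by simpa using hi 1)
      (by simpa [sub_eq_add_neg] using hi (-1))]
    refine integral_congr_ae (Eventually.of_forall fun y => ?_)
    simp only [smul_add, smul_sub]
    ring
  have e3 : |2 * levyOp (μ m) (fun x => φ (l • x)) x| ≤ K * (C * l ^ α) := by
    rw [e2, ← Real.norm_eq_abs]
    refine (norm_integral_le_of_norm_le (g := fun y : EuclideanSpace ℝ (Fin d) =>
      K * min 1 ((l * ‖y‖) ^ 2)) ?_ ?_).trans ?_
    · refine (integrable_of_norm_le_const (C := 1)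
        (Continuous.aestronglyMeasurable (by fun_prop)) fun y => ?_).const_mul K
      rw [abs_of_nonneg (by positivity)]
      exact min_le_left _ _
    · refine Eventually.of_forall fun y => ?_
      have := hb (l • x) (l • y)
      rwa [norm_smul, Real.norm_of_nonneg hl.le] at this
    · rw [integral_const_mul]
      exact mul_le_mul_of_nonneg_left (integral_min_one_le hl (hC m l hl)) hK
  rw [abs_mul, abs_two] at e3
  have : 0 ≤ |levyOp (μ m) (fun x => φ (l • x)) x| := abs_nonneg _
  nlinarith

/-- The energy density of a cutoff at scale `l⁻¹` is of size `l ^ α`, uniformly along the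
approximation. -/
lemma IsLevyApprox.exists_integral_sq_sub_comp_smul_le (h : IsLevyApprox α μ) (hα : 0 < α)
    (hα2 : α ≤ 2) (hφ : IsTestFun φ) :
    ∃ K, 0 ≤ K ∧ ∀ l : ℝ, 0 < l → ∀ m x,
      ∫ y, (φ (l • x) - φ (l • (x + y))) ^ 2 ∂(μ m) ≤ K * l ^ α := by
  obtain ⟨C, hC⟩ := h.exists_moment_le hα hα2
  obtain ⟨K, hK, hb⟩ := hφ.exists_sq_sub_le_min
  refine ⟨K * C, by positivity, fun l hl m x => ?_⟩
  have := h.finite m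
  calc ∫ y, (φ (l • x) - φ (l • (x + y))) ^ 2 ∂(μ m)
      ≤ ∫ y, K * min 1 ((l * ‖y‖) ^ 2) ∂(μ m) := by
        refine integral_mono_of_nonneg (Eventually.of_forall fun y => sq_nonneg _) ?_
          (Eventually.of_forall fun y => ?_)
        · refine (integrable_of_norm_le_const (C := 1)
            (Continuous.aestronglyMeasurable (by fun_prop)) fun y => ?_).const_mul K
          rw [abs_of_nonneg (by positivity)]
          exact min_le_left _ _
        · have := hb (l • x) (l • y)
          rw [norm_smul, Real.norm_of_nonneg hl.le] at this
          simpa only [smul_add] using this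
    _ ≤ K * (C * l ^ α) := by
        rw [integral_const_mul]
        exact mul_le_mul_of_nonneg_left (integral_min_one_le hl (hC m l hl)) hK
    _ = K * C * l ^ α := by ring

end Cutoffs

section Convolution

variable {f g : EuclideanSpace ℝ (Fin d) → ℝ} {w : EuclideanSpace ℝ (Fin d) → ℝ} {C : ℝ}

lemma integrable_bounded_mul_translate (hf : Continuous f) (hC : ∀ x, |f x| ≤ C)
    (hw : Integrable w) (x : EuclideanSpace ℝ (Fin d)) :
    Integrable fun y => f (x - y) * w y :=
  hw.bdd_mul (c := C) (Continuous.aestronglyMeasurable (by fun_prop))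
    (Eventually.of_forall fun _ => hC _)

lemma mollify_eq_integral_mul (f w : EuclideanSpace ℝ (Fin d) → ℝ)
    (x : EuclideanSpace ℝ (Fin d)) : mollify f w x = ∫ y, f (x - y) * w y :=
  mollify_eq_integral_sub f w x

lemma continuous_mollify_of_bounded (hf : Continuous f) (hC : ∀ x, |f x| ≤ C)
    (hw : Integrable w) : Continuous (mollify f w) := by
  have e : mollify f w = fun x => ∫ y, f (x - y) * w y := by
    funext x
    rw [mollify_eq_integral_mul]
  rw [e]
  refine continuous_of_dominated (bound := fun y => C * |w y|) (fun x => ?_) (fun x => ?_)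
    (hw.abs.const_mul C) (Eventually.of_forall fun y => by fun_prop)
  · exact (integrable_bounded_mul_translate hf hC hw x).1
  · refine Eventually.of_forall fun y => ?_
    rw [norm_mul]
    exact mul_le_mul_of_nonneg_right (hC _) (abs_nonneg _)

lemma abs_mollify_le (hC : ∀ x, |f x| ≤ C) (hw : Integrable w) (x : EuclideanSpace ℝ (Fin d)) :
    |mollify f w x| ≤ C * ∫ y, |w y| := by
  rw [mollify_eq_integral_mul, ← integral_const_mul, ← Real.norm_eq_abs]
  refine norm_integral_le_of_norm_le (hw.abs.const_mul C) (Eventually.of_forall fun y => ?_)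
  rw [norm_mul]
  exact mul_le_mul_of_nonneg_right (hC _) (abs_nonneg _)

lemma mollify_sub_left (hf : Continuous f) (hC : ∀ x, |f x| ≤ C) {C' : ℝ} (hg : Continuous g)
    (hC' : ∀ x, |g x| ≤ C') (hw : Integrable w) (x : EuclideanSpace ℝ (Fin d)) :
    mollify f w x - mollify g w x = mollify (fun z => f z - g z) w x := by
  rw [mollify_eq_integral_mul, mollify_eq_integral_mul, mollify_eq_integral_mul,
    ← integral_sub (integrable_bounded_mul_translate hf hC hw x)
      (integrable_bounded_mul_translate hg hC' hw x)]
  simp [sub_mul]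

lemma abs_levyOp_le (μ : Measure (EuclideanSpace ℝ (Fin d))) [IsFiniteMeasure μ]
    (hC : ∀ x, |f x| ≤ C) (x : EuclideanSpace ℝ (Fin d)) :
    |levyOp μ f x| ≤ (C + C) * μ.real univ := by
  have := norm_integral_le_of_norm_le_const (μ := μ) (f := fun y => f x - f (x + y)) (C := C + C)
    (Eventually.of_forall fun y => (abs_sub _ _).trans (add_le_add (hC _) (hC _)))
  exact this

/-- Jump operators commute with convolutions. -/
lemma levyOp_mollify (μ : Measure (EuclideanSpace ℝ (Fin d))) [IsFiniteMeasure μ]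
    (hf : Continuous f) (hC : ∀ x, |f x| ≤ C) (hw : Integrable w)
    (x : EuclideanSpace ℝ (Fin d)) :
    levyOp μ (mollify f w) x = mollify (levyOp μ f) w x := by
  rw [levyOp, mollify_eq_integral_mul (levyOp μ f)]
  have e : ∀ y, mollify f w x - mollify f w (x + y) =
      ∫ z, (f (x - z) - f (x - z + y)) * w z := by
    intro y
    rw [mollify_eq_integral_mul, mollify_eq_integral_mul,
      ← integral_sub (integrable_bounded_mul_translate hf hC hw x)
      (integrable_bounded_mul_translate hf hC hw (x + y))]
    refine integral_congr_ae (Eventually.of_forall fun z => ?_)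
    simp only
    rw [show x + y - z = x - z + y by abel]
    ring
  simp_rw [e]
  rw [integral_integral_swap]
  · refine integral_congr_ae (Eventually.of_forall fun z => ?_)
    exact integral_mul_const (w z) _
  · have h1 : Integrable (fun q : EuclideanSpace ℝ (Fin d) × EuclideanSpace ℝ (Fin d) =>
        (C + C) * |w q.2|) (μ.prod volume) := (integrable_const (C + C)).mul_prod hw.abs
    refine h1.mono' ?_ (Eventually.of_forall fun q => ?_)
    · exact AEStronglyMeasurable.mul (Continuous.aestronglyMeasurable (by fun_prop))
        hw.1.comp_snd
    · simp only [Function.uncurry]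
      rw [norm_mul]
      exact mul_le_mul_of_nonneg_right ((abs_sub _ _).trans (add_le_add (hC _) (hC _)))
        (abs_nonneg _)

end Convolution

/-! ### Entropies and the localized energy estimate -/

/-- A convex entropy `β` of linear growth with derivative `b`, together with a function `F` which
plays the role of `β''^{1/2}` integrated: it satisfies the Stroock-Varopoulos type inequality
`2 (F u - F v)² ≤ (b u - b v) (u - v)`, and `F²` controls the defect `u b(u) - β(u)` which
multiplies the divergence of the transport field. -/
structure IsEntropy (β b F : ℝ → ℝ) (L c : ℝ) : Prop where
  hasDerivAt : ∀ u, HasDerivAt β (b u) u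
  continuous_deriv : Continuous b
  abs_deriv_le : ∀ u, |b u| ≤ L
  convex : ∀ u v, β v + b v * (u - v) ≤ β u
  nonneg : ∀ u, 0 ≤ β u
  map_zero : β 0 = 0
  continuous_root : Continuous F
  sq_root_le : ∀ u, F u ^ 2 ≤ L * |u|
  two_mul_sq_sub_le : ∀ u v, 2 * (F u - F v) ^ 2 ≤ (b u - b v) * (u - v)
  defect_le : ∀ u, u * b u - β u ≤ c * F u ^ 2

namespace IsEntropy

variable {β b F : ℝ → ℝ} {L c : ℝ}

lemma bound_nonneg (h : IsEntropy β b F L c) : 0 ≤ L := (abs_nonneg _).trans (h.abs_deriv_le 0)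

lemma continuous (h : IsEntropy β b F L c) : Continuous β :=
  continuous_iff_continuousAt.2 fun u => (h.hasDerivAt u).continuousAt

lemma abs_sub_le (h : IsEntropy β b F L c) (u v : ℝ) : |β u - β v| ≤ L * |u - v| := by
  have key : ∀ u v, β u - β v ≤ L * |u - v| := by
    intro u v
    have h1 := h.convex v u
    have h2 : b u * (u - v) ≤ L * |u - v| := (le_abs_self _).trans (by
      rw [abs_mul]
      exact mul_le_mul_of_nonneg_right (h.abs_deriv_le u) (abs_nonneg _))
    linarith
  rw [abs_le]
  have h1 := key u v
  have h2 := key v u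
  rw [abs_sub_comm] at h2
  constructor <;> linarith

lemma le_mul_abs (h : IsEntropy β b F L c) (u : ℝ) : β u ≤ L * |u| := by
  have := (le_abs_self _).trans (h.abs_sub_le u 0)
  simpa [h.map_zero] using this

lemma defect_nonneg (h : IsEntropy β b F L c) (u : ℝ) : 0 ≤ u * b u - β u := by
  have := h.convex 0 u
  rw [h.map_zero] at this
  linarith

/-- The pointwise inequality behind the localized energy estimate, with `s, t` the values of a
cutoff at two points and `u, v` the values of the solution there. Convexity of the entropy moves
both squared cutoff values in the dissipation to the smaller one, and Young's inequality with
parameter `k` separates the increment of `F` from the increment of the cutoff. -/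
lemma localized_sq_sub_le (h : IsEntropy β b F L c) {k : ℝ} (hk : 0 < k) {s t : ℝ}
    (u v : ℝ) :
    2 * (s * F u - t * F v) ^ 2 ≤
      (1 + k) * ((s ^ 2 * b u * (u - v) - β u * (s ^ 2 - t ^ 2)) +
        (t ^ 2 * b v * (v - u) - β v * (t ^ 2 - s ^ 2))) +
      2 * (1 + 1 / k) * ((s - t) ^ 2 * F u ^ 2 + (t - s) ^ 2 * F v ^ 2) := by
  have young : ∀ x y : ℝ, (x + y) ^ 2 ≤ (1 + k) * x ^ 2 + (1 + 1 / k) * y ^ 2 := by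
    intro x y
    have : (1 + k) * x ^ 2 + (1 + 1 / k) * y ^ 2 - (x + y) ^ 2 = (k * x - y) ^ 2 / k := by
      field_simp
      ring
    have h2 : 0 ≤ (k * x - y) ^ 2 / k := by positivity
    linarith
  have c1 := h.convex v u
  have c2 := h.convex u v
  have sv := h.two_mul_sq_sub_le u v
  have hk1 : 0 < 1 + k := by linarith
  have hk2 : 0 < 1 + 1 / k := by positivity
  have main : 2 * min (s ^ 2) (t ^ 2) * (F u - F v) ^ 2 ≤
      (s ^ 2 * b u * (u - v) - β u * (s ^ 2 - t ^ 2)) +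
        (t ^ 2 * b v * (v - u) - β v * (t ^ 2 - s ^ 2)) := by
    rcases le_total (s ^ 2) (t ^ 2) with hst | hst
    · rw [min_eq_left hst]
      nlinarith [mul_nonneg (sq_nonneg s) (sub_nonneg.2 sv),
        mul_nonneg (sub_nonneg.2 hst) (sub_nonneg.2 c2)]
    · rw [min_eq_right hst]
      nlinarith [mul_nonneg (sq_nonneg t) (sub_nonneg.2 sv),
        mul_nonneg (sub_nonneg.2 hst) (sub_nonneg.2 c1)]
  have hF : 2 * (s * F u - t * F v) ^ 2 ≤ (1 + k) * (2 * min (s ^ 2) (t ^ 2) * (F u - F v) ^ 2) +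
      2 * (1 + 1 / k) * ((s - t) ^ 2 * F u ^ 2 + (t - s) ^ 2 * F v ^ 2) := by
    rcases le_total (s ^ 2) (t ^ 2) with hst | hst
    · rw [min_eq_left hst]
      have y1 := young (s * (F u - F v)) ((s - t) * F v)
      have p1 : 0 ≤ (1 + 1 / k) * ((s - t) ^ 2 * F u ^ 2) := by positivity
      have e : s * (F u - F v) + (s - t) * F v = s * F u - t * F v := by ring
      rw [e, mul_pow, mul_pow] at y1
      nlinarith
    · rw [min_eq_right hst]
      have y1 := young (t * (F u - F v)) ((s - t) * F u)
      have p1 : 0 ≤ (1 + 1 / k) * ((t - s) ^ 2 * F v ^ 2) := by positivity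
      have e : t * (F u - F v) + (s - t) * F u = s * F u - t * F v := by ring
      rw [e, mul_pow, mul_pow] at y1
      nlinarith
  nlinarith [mul_le_mul_of_nonneg_left main hk1.le]

end IsEntropy

section EnergyEstimate

lemma two_mul_ofReal (a : ℝ) : 2 * ENNReal.ofReal a = ENNReal.ofReal (2 * a) := by
  rw [ENNReal.ofReal_mul (by norm_num), ENNReal.ofReal_ofNat]

variable {β b F : ℝ → ℝ} {L c : ℝ} {η u w : EuclideanSpace ℝ (Fin d) → ℝ}

/-- The involution which exchanges the end points of a jump preserves the product of Lebesgue
measure and a symmetric jump measure. -/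
lemma measurePreserving_jump_swap {μ : Measure (EuclideanSpace ℝ (Fin d))} [IsFiniteMeasure μ]
    (hμ : μ.map (fun y => -y) = μ) :
    MeasurePreserving (fun q : EuclideanSpace ℝ (Fin d) × EuclideanSpace ℝ (Fin d) =>
      (-q.1, q.2 + q.1)) (μ.prod volume) (μ.prod volume) := by
  have h1 : MeasurePreserving (fun y : EuclideanSpace ℝ (Fin d) => -y) μ μ := ⟨measurable_neg, hμ⟩
  refine h1.skew_product (g := fun y x => x + y) (Continuous.measurable (by fun_prop))
    (Eventually.of_forall fun y => ?_)
  exact (measurePreserving_add_right volume y).map_eq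

lemma IsEntropy.integrable_comp (h : IsEntropy β b F L c) (hu : Integrable u) :
    Integrable fun x => β (u x) := by
  refine (hu.abs.const_mul L).mono' (h.continuous.comp_aestronglyMeasurable hu.1)
    (Eventually.of_forall fun x => ?_)
  rw [Real.norm_of_nonneg (h.nonneg _)]
  exact h.le_mul_abs _

lemma IsEntropy.integrable_sq_root (h : IsEntropy β b F L c) (hu : Integrable u) :
    Integrable fun x => F (u x) ^ 2 := by
  refine (hu.abs.const_mul L).mono'
    ((h.continuous_root.pow 2).comp_aestronglyMeasurable hu.1) (Eventually.of_forall fun x => ?_)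
  rw [Real.norm_of_nonneg (sq_nonneg _)]
  exact h.sq_root_le _

/-- Localized energy estimate for one jump process. The pointwise inequality is integrated over all
jumps `(y, x)`, and the two halves of its right-hand side agree since reversing the jump preserves
the measure. -/
lemma IsEntropy.lintegral_sq_sub_le (h : IsEntropy β b F L c)
    {μ : Measure (EuclideanSpace ℝ (Fin d))} [IsFiniteMeasure μ]
    (hμ : μ.map (fun y => -y) = μ) (hη : IsTestFun η) (huc : Continuous u) {C : ℝ}
    (hub : ∀ x, |u x| ≤ C) (hui : Integrable u) {k : ℝ} (hk : 0 < k) {N : ℝ}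
    (hN : ∀ x, ∫ y, (η x - η (x + y)) ^ 2 ∂μ ≤ N) :
    0 ≤ (1 + k) * ((∫ x, η x ^ 2 * b (u x) * levyOp μ u x) -
          ∫ x, β (u x) * levyOp μ (fun x => η x ^ 2) x) +
        2 * (1 + 1 / k) * (N * ∫ x, F (u x) ^ 2) ∧
    2 * ∫⁻ y, ∫⁻ x, ENNReal.ofReal ((η x * F (u x) - η (x + y) * F (u (x + y))) ^ 2) ∂volume ∂μ ≤
      ENNReal.ofReal (2 * ((1 + k) * ((∫ x, η x ^ 2 * b (u x) * levyOp μ u x) -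
          ∫ x, β (u x) * levyOp μ (fun x => η x ^ 2) x) +
        2 * (1 + 1 / k) * (N * ∫ x, F (u x) ^ 2))) := by
  obtain ⟨Cη, hCη0, hCη⟩ := hη.exists_abs_le
  obtain ⟨Cs, hCs0, hCs⟩ := hη.sq.exists_abs_le
  have hηc := hη.1.continuous
  have hbc := h.continuous_deriv
  have hβc := h.continuous
  have hFc := h.continuous_root
  have hC0 : 0 ≤ C := (abs_nonneg _).trans (hub 0)
  have hηi : Integrable fun x => η x ^ 2 :=
    hη.sq.1.continuous.integrable_of_hasCompactSupport hη.sq.2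
  set π := μ.prod (volume : Measure (EuclideanSpace ℝ (Fin d))) with hπ
  -- the three integrands, as functions of the jump and of its starting point
  set P1 : EuclideanSpace ℝ (Fin d) × EuclideanSpace ℝ (Fin d) → ℝ := fun q =>
    η q.2 ^ 2 * b (u q.2) * (u q.2 - u (q.2 + q.1)) with hP1
  set P2 : EuclideanSpace ℝ (Fin d) × EuclideanSpace ℝ (Fin d) → ℝ := fun q =>
    β (u q.2) * (η q.2 ^ 2 - η (q.2 + q.1) ^ 2) with hP2
  set P3 : EuclideanSpace ℝ (Fin d) × EuclideanSpace ℝ (Fin d) → ℝ := fun q =>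
    (η q.2 - η (q.2 + q.1)) ^ 2 * F (u q.2) ^ 2 with hP3
  have i1 : Integrable P1 π := by
    have hb1 : Integrable (fun q : EuclideanSpace ℝ (Fin d) × EuclideanSpace ℝ (Fin d) =>
        (L * (C + C)) * η q.2 ^ 2) π := (integrable_const _).mul_prod hηi
    refine hb1.mono' (Continuous.aestronglyMeasurable (by fun_prop))
      (Eventually.of_forall fun q => ?_)
    rw [hP1, norm_mul, norm_mul, Real.norm_of_nonneg (sq_nonneg _)]
    have a1 : ‖b (u q.2)‖ ≤ L := h.abs_deriv_le _
    have a2 : ‖u q.2 - u (q.2 + q.1)‖ ≤ C + C := (abs_sub _ _).trans (add_le_add (hub _) (hub _))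
    calc η q.2 ^ 2 * ‖b (u q.2)‖ * ‖u q.2 - u (q.2 + q.1)‖ ≤ η q.2 ^ 2 * L * (C + C) := by
          gcongr
          exact mul_nonneg (sq_nonneg _) h.bound_nonneg
      _ = _ := by ring
  have i2 : Integrable P2 π := by
    have hb1 : Integrable (fun q : EuclideanSpace ℝ (Fin d) × EuclideanSpace ℝ (Fin d) =>
        (Cs + Cs) * β (u q.2)) π := (integrable_const _).mul_prod (h.integrable_comp hui)
    refine hb1.mono' (Continuous.aestronglyMeasurable (by fun_prop))
      (Eventually.of_forall fun q => ?_)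
    rw [hP2, norm_mul, Real.norm_of_nonneg (h.nonneg _), mul_comm]
    exact mul_le_mul_of_nonneg_right ((abs_sub _ _).trans (add_le_add (hCs _) (hCs _)))
      (h.nonneg _)
  have i3 : Integrable P3 π := by
    have hb1 : Integrable (fun q : EuclideanSpace ℝ (Fin d) × EuclideanSpace ℝ (Fin d) =>
        (Cη + Cη) ^ 2 * F (u q.2) ^ 2) π := (integrable_const _).mul_prod (h.integrable_sq_root hui)
    refine hb1.mono' (Continuous.aestronglyMeasurable (by fun_prop))
      (Eventually.of_forall fun q => ?_)
    rw [hP3, norm_mul, Real.norm_of_nonneg (sq_nonneg _), Real.norm_of_nonneg (sq_nonneg _)]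
    refine mul_le_mul_of_nonneg_right ?_ (sq_nonneg _)
    rw [← sq_abs]
    exact pow_le_pow_left₀ (abs_nonneg _) ((abs_sub _ _).trans (add_le_add (hCη _) (hCη _))) 2
  have v1 : ∫ q, P1 q ∂π = ∫ x, η x ^ 2 * b (u x) * levyOp μ u x := by
    rw [hπ, integral_prod_symm _ i1]
    refine integral_congr_ae (Eventually.of_forall fun x => ?_)
    exact integral_const_mul (η x ^ 2 * b (u x)) fun y => u x - u (x + y)
  have v2 : ∫ q, P2 q ∂π = ∫ x, β (u x) * levyOp μ (fun x => η x ^ 2) x := by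
    rw [hπ, integral_prod_symm _ i2]
    refine integral_congr_ae (Eventually.of_forall fun x => ?_)
    exact integral_const_mul (β (u x)) fun y => η x ^ 2 - η (x + y) ^ 2
  have v3 : ∫ q, P3 q ∂π ≤ N * ∫ x, F (u x) ^ 2 := by
    rw [hπ, integral_prod_symm _ i3, ← integral_const_mul]
    refine integral_mono i3.integral_prod_right ((h.integrable_sq_root hui).const_mul N) fun x => ?_
    simp only [hP3]
    rw [integral_mul_const]
    exact mul_le_mul_of_nonneg_right (hN x) (sq_nonneg _)
  have hT := measurePreserving_jump_swap hμ
  set τ : EuclideanSpace ℝ (Fin d) × EuclideanSpace ℝ (Fin d) →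
    EuclideanSpace ℝ (Fin d) × EuclideanSpace ℝ (Fin d) := fun q => (-q.1, q.2 + q.1) with hτ
  have iT : ∀ {G : EuclideanSpace ℝ (Fin d) × EuclideanSpace ℝ (Fin d) → ℝ}, Integrable G π →
      Integrable (fun q => G (τ q)) π ∧ ∫ q, G (τ q) ∂π = ∫ q, G q ∂π := by
    intro G hG
    refine ⟨hT.integrable_comp_of_integrable hG, ?_⟩
    have e := integral_map (μ := π) (φ := τ) hT.measurable.aemeasurable (f := G)
      (by rw [hT.map_eq]; exact hG.1)
    rw [hT.map_eq] at e
    exact e.symm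
  set Q : EuclideanSpace ℝ (Fin d) × EuclideanSpace ℝ (Fin d) → ℝ := fun q =>
    (1 + k) * ((P1 q - P2 q) + (P1 (τ q) - P2 (τ q))) +
      2 * (1 + 1 / k) * (P3 q + P3 (τ q)) with hQ
  have hQi : Integrable Q π :=
    (((i1.sub i2).add ((iT i1).1.sub (iT i2).1)).const_mul (1 + k)).add
      ((i3.add (iT i3).1).const_mul (2 * (1 + 1 / k)))
  have hQv : ∫ q, Q q ∂π = 2 * ((1 + k) * ((∫ q, P1 q ∂π) - ∫ q, P2 q ∂π) +
      2 * (1 + 1 / k) * ∫ q, P3 q ∂π) := by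
    have e1 : ∫ q, Q q ∂π = (∫ q, (1 + k) * ((P1 q - P2 q) + (P1 (τ q) - P2 (τ q))) ∂π) +
        ∫ q, 2 * (1 + 1 / k) * (P3 q + P3 (τ q)) ∂π :=
      integral_add (((i1.sub i2).add ((iT i1).1.sub (iT i2).1)).const_mul (1 + k))
        ((i3.add (iT i3).1).const_mul (2 * (1 + 1 / k)))
    have e2 : ∫ q, ((P1 q - P2 q) + (P1 (τ q) - P2 (τ q))) ∂π =
        (∫ q, (P1 q - P2 q) ∂π) + ∫ q, (P1 (τ q) - P2 (τ q)) ∂π :=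
      integral_add (i1.sub i2) ((iT i1).1.sub (iT i2).1)
    rw [e1, integral_const_mul, integral_const_mul, e2, integral_add i3 (iT i3).1,
      integral_sub i1 i2, integral_sub (iT i1).1 (iT i2).1, (iT i1).2, (iT i2).2, (iT i3).2]
    ring
  have hpt : ∀ q, 2 * (η q.2 * F (u q.2) - η (q.2 + q.1) * F (u (q.2 + q.1))) ^ 2 ≤ Q q := by
    intro q
    have := h.localized_sq_sub_le hk (s := η q.2) (t := η (q.2 + q.1)) (u q.2) (u (q.2 + q.1))
    simp only [hQ, hP1, hP2, hP3, hτ, add_neg_cancel_right]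
    linarith
  have hQ0 : ∀ q, 0 ≤ Q q := fun q => le_trans (by positivity) (hpt q)
  have hk2 : 0 ≤ 2 * (1 + 1 / k) := by positivity
  have hle : ∫ q, Q q ∂π ≤ 2 * ((1 + k) * ((∫ x, η x ^ 2 * b (u x) * levyOp μ u x) -
          ∫ x, β (u x) * levyOp μ (fun x => η x ^ 2) x) +
        2 * (1 + 1 / k) * (N * ∫ x, F (u x) ^ 2)) := by
    rw [hQv, v1, v2]
    have := mul_le_mul_of_nonneg_left v3 hk2
    linarith
  constructor
  · have := (integral_nonneg (μ := π) hQ0).trans hle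
    linarith
  · refine le_trans ?_ (ENNReal.ofReal_le_ofReal hle)
    rw [ofReal_integral_eq_lintegral_ofReal hQi (Eventually.of_forall hQ0),
      ← lintegral_const_mul' _ _ (by simp), lintegral_prod _ hQi.1.aemeasurable.ennreal_ofReal]
    refine lintegral_mono fun y => ?_
    simp only
    rw [← lintegral_const_mul' _ _ (by simp)]
    refine lintegral_mono fun x => ?_
    simp only
    rw [two_mul_ofReal]
    exact ENNReal.ofReal_le_ofReal (hpt (y, x))

/-- Localized energy estimate: the dissipation of the entropy controls the norm given by the Sobolev
embedding, up to an error produced by the cutoff. It is the limit of the estimates for the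
approximating jump processes: the right-hand sides converge since the jump operators converge
uniformly on test functions, and Fatou's lemma in Fourier variables bounds the Sobolev energy of
`η F(u)` by the energies of the jumps. -/
lemma IsEntropy.two_mul_sobolevConst_mul_le [Nonempty (Fin d)] (h : IsEntropy β b F L c) {α : ℝ}
    (hα : 0 < α) (hα2 : α ≤ 2)
    {μ : ℕ → Measure (EuclideanSpace ℝ (Fin d))} (hμ : IsLevyApprox α μ)
    {ρ : EuclideanSpace ℝ (Fin d) → ℝ} {ε : ℝ} {M : ℝ≥0} (hρ : IsMollifier ρ ε M)
    (hη : IsTestFun η) (hw : Integrable w) {k : ℝ} (hk : 0 < k) {N : ℝ}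
    (hN : ∀ m x, ∫ y, (η x - η (x + y)) ^ 2 ∂(μ m) ≤ N) :
    0 ≤ (1 + k) * ((∫ x, η x ^ 2 * b (mollify ρ w x) * mollify (fracLaplacian α ρ) w x) -
          ∫ x, β (mollify ρ w x) * fracLaplacian α (fun x => η x ^ 2) x) +
        2 * (1 + 1 / k) * (N * ∫ x, F (mollify ρ w x) ^ 2) ∧
    2 * (sobolevConst d (α / 2) * eLpNorm (fun x => η x * F (mollify ρ w x))
      (ENNReal.ofReal (2 * d / (d - 2 * (α / 2)))) volume ^ 2) ≤
      ENNReal.ofReal ((1 + k) *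
        ((∫ x, η x ^ 2 * b (mollify ρ w x) * mollify (fracLaplacian α ρ) w x) -
          ∫ x, β (mollify ρ w x) * fracLaplacian α (fun x => η x ^ 2) x) +
        2 * (1 + 1 / k) * (N * ∫ x, F (mollify ρ w x) ^ 2)) := by
  set u := mollify ρ w with hu
  obtain ⟨Cρ, hCρ0, hCρ⟩ := hρ.testFun.exists_abs_le
  have hρc := hρ.testFun.1.continuous
  have huc : Continuous u := continuous_mollify_of_bounded hρc hCρ hw
  have hub := abs_mollify_le hCρ hw
  have hui : Integrable u := hρ.integrable_mollify hw
  have hηc := hη.1.continuous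
  have hηi : Integrable fun x => η x ^ 2 :=
    hη.sq.1.continuous.integrable_of_hasCompactSupport hη.sq.2
  set X : ℕ → ℝ := fun m => (1 + k) * ((∫ x, η x ^ 2 * b (u x) * levyOp (μ m) u x) -
          ∫ x, β (u x) * levyOp (μ m) (fun x => η x ^ 2) x) +
        2 * (1 + 1 / k) * (N * ∫ x, F (u x) ^ 2) with hX
  have hfin := hμ.finite
  have hm := fun m => h.lintegral_sq_sub_le (hμ.neg m) hη huc hub hui hk (hN m)
  have hI : 0 ≤ ∫ y, |w y| := integral_nonneg fun y => abs_nonneg _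
  have hXlim : Tendsto X atTop (𝓝 ((1 + k) *
        ((∫ x, η x ^ 2 * b (u x) * mollify (fracLaplacian α ρ) w x) -
          ∫ x, β (u x) * fracLaplacian α (fun x => η x ^ 2) x) +
        2 * (1 + 1 / k) * (N * ∫ x, F (u x) ^ 2))) := by
    refine ((Tendsto.sub ?_ ?_).const_mul _).add tendsto_const_nhds
    · obtain ⟨e, he, hb⟩ := hμ.exists_abs_levyOp_sub_le hα hα2 hρ.testFun
      obtain ⟨CΛ, hCΛ0, hCΛ⟩ := exists_abs_fracLaplacian_le α ρ
      have hΛc := continuous_fracLaplacian hα hα2 hρ.testFun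
      have hdiff : ∀ m x, |levyOp (μ m) u x - mollify (fracLaplacian α ρ) w x| ≤
          e m * ∫ y, |w y| := by
        intro m x
        rw [hu, levyOp_mollify (μ m) hρc hCρ hw,
          mollify_sub_left (hρ.testFun.continuous_levyOp (μ m)) (abs_levyOp_le (μ m) hCρ) hΛc hCΛ hw]
        exact abs_mollify_le (hb m) hw x
      obtain ⟨B, hB⟩ := he.bddAbove_range
      have hB' : ∀ m, e m ≤ B := fun m => hB (mem_range_self m)
      have hΛw := abs_mollify_le hCΛ hw
      refine tendsto_integral_of_dominated_convergence
        (fun x => η x ^ 2 * (L * ((B + CΛ) * ∫ y, |w y|))) (fun m => ?_) (hηi.mul_const _)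
        (fun m => Eventually.of_forall fun x => ?_) (Eventually.of_forall fun x => ?_)
      · have : Continuous (levyOp (μ m) u) := by
          have e1 : levyOp (μ m) u = mollify (levyOp (μ m) ρ) w :=
            funext fun x => levyOp_mollify (μ m) hρc hCρ hw x
          rw [e1]
          exact continuous_mollify_of_bounded (hρ.testFun.continuous_levyOp (μ m))
            (abs_levyOp_le (μ m) hCρ) hw
        have hbc := h.continuous_deriv
        exact Continuous.aestronglyMeasurable (by fun_prop)
      · rw [norm_mul, norm_mul, Real.norm_of_nonneg (sq_nonneg _), mul_assoc]
        have a1 : ‖b (u x)‖ ≤ L := h.abs_deriv_le _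
        have a2 : ‖levyOp (μ m) u x‖ ≤ (B + CΛ) * ∫ y, |w y| := by
          have h1 := hdiff m x
          have h2 := hΛw x
          have h3 := mul_le_mul_of_nonneg_right (hB' m) hI
          rw [Real.norm_eq_abs]
          have h4 := abs_sub_abs_le_abs_sub (levyOp (μ m) u x) (mollify (fracLaplacian α ρ) w x)
          linarith
        have hL := h.bound_nonneg
        gcongr
      · refine Tendsto.const_mul _ ?_
        refine tendsto_iff_norm_sub_tendsto_zero.2 ?_
        refine squeeze_zero (fun _ => norm_nonneg _) (fun m => hdiff m x) ?_
        simpa using he.mul_const (∫ y, |w y|)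
    · obtain ⟨e, he, hb⟩ := hμ.exists_abs_levyOp_sub_le hα hα2 hη.sq
      obtain ⟨CΛ, hCΛ0, hCΛ⟩ := exists_abs_fracLaplacian_le α fun x => η x ^ 2
      obtain ⟨B, hB⟩ := he.bddAbove_range
      have hB' : ∀ m, e m ≤ B := fun m => hB (mem_range_self m)
      have hβi := h.integrable_comp hui
      refine tendsto_integral_of_dominated_convergence
        (fun x => β (u x) * (B + CΛ)) (fun m => ?_) (hβi.mul_const _)
        (fun m => Eventually.of_forall fun x => ?_) (Eventually.of_forall fun x => ?_)
      · exact hβi.1.mul (hη.sq.continuous_levyOp (μ m)).aestronglyMeasurable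
      · rw [norm_mul, Real.norm_of_nonneg (h.nonneg _)]
        refine mul_le_mul_of_nonneg_left ?_ (h.nonneg _)
        rw [Real.norm_eq_abs]
        have h1 := hb m x
        have h2 := hCΛ x
        have h4 := abs_sub_abs_le_abs_sub (levyOp (μ m) (fun x => η x ^ 2) x)
          (fracLaplacian α (fun x => η x ^ 2) x)
        linarith [hB' m]
      · exact (hμ.tendsto_levyOp hα hα2 hη.sq x).const_mul _
  refine ⟨ge_of_tendsto' hXlim fun m => (hm m).1, ?_⟩
  have hgc : Continuous fun x => η x * F (u x) := hηc.mul (h.continuous_root.comp huc)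
  have hgs : HasCompactSupport fun x => η x * F (u x) := hη.2.mul_right
  have hS := sobolevConst_mul_le (h := α / 2) hgc hgs
  have hE := hμ.two_mul_sobolevEnergy_le hgc hgs
  have hlim : Tendsto (fun m => ENNReal.ofReal (X m)) atTop (𝓝 (ENNReal.ofReal ((1 + k) *
        ((∫ x, η x ^ 2 * b (u x) * mollify (fracLaplacian α ρ) w x) -
          ∫ x, β (u x) * fracLaplacian α (fun x => η x ^ 2) x) +
        2 * (1 + 1 / k) * (N * ∫ x, F (u x) ^ 2)))) := ENNReal.tendsto_ofReal hXlim
  have hle : ∀ m, ∫⁻ y, ∫⁻ x, ENNReal.ofReal ((η x * F (u x) - η (x + y) * F (u (x + y))) ^ 2)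
      ∂volume ∂(μ m) ≤ ENNReal.ofReal (X m) := by
    intro m
    have := (hm m).2
    rw [ENNReal.ofReal_mul (by norm_num), ENNReal.ofReal_ofNat] at this
    exact (ENNReal.mul_le_mul_iff_right (by simp) (by simp)).1 this
  calc _ ≤ 2 * sobolevEnergy (α / 2) (𝓕 fun x => ((η x * F (u x) : ℝ) : ℂ)) := by gcongr
    _ ≤ _ := hE
    _ ≤ liminf (fun m => ENNReal.ofReal (X m)) atTop :=
        liminf_le_liminf (Eventually.of_forall hle)
    _ = _ := hlim.liminf_eq

end EnergyEstimate

/-! ### Passing to the limit in the renormalized equation -/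

section RenormalizedLimit

variable {β b F : ℝ → ℝ} {L c : ℝ} {w δ χ : EuclideanSpace ℝ (Fin d) → ℝ}
  {v : EuclideanSpace ℝ (Fin d) → EuclideanSpace ℝ (Fin d)} {r r' : ℝ≥0∞}

lemma memLp_fderiv_apply (hχ : IsTestFun χ) (hvm : AEStronglyMeasurable v volume) {p : ℝ≥0∞}
    (hvL : ∀ R, MemLp v p (volume.restrict (Metric.ball 0 R))) :
    MemLp (fun x => fderiv ℝ χ x (v x)) p volume := by
  have hfd : Continuous (fderiv ℝ χ) := hχ.1.continuous_fderiv (by simp)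
  refine (memLp_smul_of_hasCompactSupport hfd.norm (hχ.2.fderiv ℝ).norm hvL).mono
    (aestronglyMeasurable_clm_apply hfd.aestronglyMeasurable hvm)
    (Eventually.of_forall fun x => ?_)
  rw [norm_smul, norm_norm]
  exact (fderiv ℝ χ x).le_opNorm _

lemma enorm_deriv_le (h : IsEntropy β b F L c) (u : ℝ) : ‖b u‖ₑ ≤ ENNReal.ofReal L := by
  rw [← ofReal_norm]
  exact ENNReal.ofReal_le_ofReal (h.abs_deriv_le u)

lemma enorm_entropy_le (h : IsEntropy β b F L c) (u : ℝ) : ‖β u‖ₑ ≤ ENNReal.ofReal L * ‖u‖ₑ := by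
  rw [← ofReal_norm, ← ofReal_norm, ← ENNReal.ofReal_mul h.bound_nonneg]
  refine ENNReal.ofReal_le_ofReal ?_
  rw [Real.norm_of_nonneg (h.nonneg u)]
  exact h.le_mul_abs u

lemma enorm_entropy_sub_le (h : IsEntropy β b F L c) (u v : ℝ) :
    ‖β u - β v‖ₑ ≤ ENNReal.ofReal L * ‖u - v‖ₑ := by
  rw [← ofReal_norm, ← ofReal_norm, ← ENNReal.ofReal_mul h.bound_nonneg]
  exact ENNReal.ofReal_le_ofReal (h.abs_sub_le u v)

/-- Bound of the renormalized transport term, uniform in the mollification parameter. -/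
lemma enorm_integral_mul_mollifiedTransport_le (hr : r⁻¹ + r'⁻¹ = 1) (h : IsEntropy β b F L c)
    {M : ℝ≥0} {n : ℕ} (hM : IsMollifier (mollifier d n) (((n : ℝ) + 1)⁻¹) M)
    (hw : MemLp w r volume) (hv : HasWeakDiv v δ)
    (hvL : ∀ R, MemLp v r' (volume.restrict (Metric.ball 0 R)))
    (hδL : ∀ R, MemLp δ r' (volume.restrict (Metric.ball 0 R)))
    (hχ : IsTestFun χ) {K R : ℝ} (hK : ∀ x, ‖fderiv ℝ χ x‖ ≤ K) (hχ1 : ∀ x, |χ x| ≤ 1)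
    (hR : ∀ x, R ≤ ‖x‖ → χ x = 0) (hR' : ∀ x, R ≤ ‖x‖ → fderiv ℝ χ x = 0) :
    ‖∫ x, χ x * b (mollify (mollifier d n) w x) * mollifiedTransport (mollifier d n) w v x‖ₑ ≤
      ENNReal.ofReal L * (eLpNorm w r volume *
          (ENNReal.ofReal K * eLpNorm v r' (volume.restrict (Metric.ball 0 R))) +
        eLpNorm w r volume * eLpNorm δ r' (volume.restrict (Metric.ball 0 R)) +
        ∫⁻ x in Metric.ball 0 R, ‖transportCommutator (mollifier d n) w v x‖ₑ) := by
  have hwl : LocallyIntegrable w volume := hw.locallyIntegrable (one_le_of_inv_add_inv hr)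
  have hwv := locallyIntegrable_smul_of_conjugate hr hw hvL
  have hvm := hv.1.aestronglyMeasurable
  have hδm := hv.2.1.aestronglyMeasurable
  have huc : Continuous (mollify (mollifier d n) w) := (hM.contDiff_mollify hwl).continuous
  set u := mollify (mollifier d n) w with hu
  set B := Metric.ball (0 : EuclideanSpace ℝ (Fin d)) R with hB
  have hBm : MeasurableSet B := Metric.isOpen_ball.measurableSet
  have hnB : ∀ x, x ∉ B → R ≤ ‖x‖ := fun x hx => by
    rwa [hB, mem_ball_zero_iff, not_lt] at hx
  rw [integral_mul_mollifiedTransport hM.testFun hwl hwv hv hχ h.hasDerivAt h.continuous_deriv]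
  refine (enorm_add_le _ _).trans ?_
  rw [mul_add]
  refine add_le_add ?_ ?_
  · refine (enorm_integral_le_lintegral_enorm _).trans ?_
    have hvi := memLp_indicator_ball (hvL R)
    have hδi := memLp_indicator_ball (hδL R)
    have b1 := hM.lintegral_mollify_mul_enorm_le hr hw.1 hvi.1
    have b2 := hM.lintegral_mollify_mul_enorm_le hr hw.1 hδi.1
    rw [eLpNorm_indicator_ball] at b1 b2
    have hm1 : AEMeasurable (fun x => ENNReal.ofReal K * (‖u x‖ₑ * ‖B.indicator v x‖ₑ)) volume :=
      (huc.aestronglyMeasurable.enorm.mul hvi.1.enorm).const_mul _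
    calc ∫⁻ x, ‖β (u x) * (fderiv ℝ χ x (v x) + χ x * δ x)‖ₑ
        ≤ ∫⁻ x, ENNReal.ofReal L * (ENNReal.ofReal K * (‖u x‖ₑ * ‖B.indicator v x‖ₑ) +
            ‖u x‖ₑ * ‖B.indicator δ x‖ₑ) := by
          refine lintegral_mono fun x => ?_
          by_cases hx : x ∈ B
          · simp only [indicator_of_mem hx]
            rw [enorm_mul]
            have e1 : ‖fderiv ℝ χ x (v x)‖ₑ ≤ ENNReal.ofReal K * ‖v x‖ₑ := by
              rw [← ofReal_norm, ← ofReal_norm, ← ENNReal.ofReal_mul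
                ((norm_nonneg _).trans (hK x))]
              exact ENNReal.ofReal_le_ofReal (((fderiv ℝ χ x).le_opNorm _).trans
                (mul_le_mul_of_nonneg_right (hK x) (norm_nonneg _)))
            have e2 : ‖χ x * δ x‖ₑ ≤ ‖δ x‖ₑ := by
              rw [enorm_mul]
              refine mul_le_of_le_one_left zero_le ?_
              rw [← ofReal_norm, Real.norm_eq_abs]
              exact ENNReal.ofReal_le_one.2 (hχ1 x)
            calc ‖β (u x)‖ₑ * ‖fderiv ℝ χ x (v x) + χ x * δ x‖ₑ
                ≤ (ENNReal.ofReal L * ‖u x‖ₑ) * (ENNReal.ofReal K * ‖v x‖ₑ + ‖δ x‖ₑ) := by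
                  gcongr
                  · exact enorm_entropy_le h _
                  · exact (enorm_add_le _ _).trans (add_le_add e1 e2)
              _ = _ := by ring
          · rw [hR x (hnB x hx), hR' x (hnB x hx)]
            simp
      _ = ENNReal.ofReal L * (ENNReal.ofReal K * (∫⁻ x, ‖u x‖ₑ * ‖B.indicator v x‖ₑ) +
            ∫⁻ x, ‖u x‖ₑ * ‖B.indicator δ x‖ₑ) := by
          rw [lintegral_const_mul' _ _ (by simp), lintegral_add_left' hm1,
            lintegral_const_mul' _ _ (by simp)]
      _ ≤ _ := by
          refine mul_le_mul_right (add_le_add ?_ b2) _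
          rw [mul_left_comm]
          exact mul_le_mul_right b1 _
  · refine (enorm_integral_le_lintegral_enorm _).trans ?_
    rw [← lintegral_const_mul' _ _ (by simp), ← lintegral_indicator hBm]
    refine lintegral_mono fun x => ?_
    by_cases hx : x ∈ B
    · rw [indicator_of_mem hx, enorm_mul, enorm_mul]
      gcongr
      calc ‖χ x‖ₑ * ‖b (u x)‖ₑ ≤ 1 * ENNReal.ofReal L := by
            gcongr
            · rw [← ofReal_norm, Real.norm_eq_abs]
              exact ENNReal.ofReal_le_one.2 (hχ1 x)
            · exact enorm_deriv_le h _
        _ = _ := one_mul _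
    · rw [indicator_of_notMem hx, hR x (hnB x hx)]
      simp

lemma tendsto_integral_of_lintegral_enorm_sub {X : Type*} [MeasurableSpace X] {μ : Measure X}
    {f : ℕ → X → ℝ} {g : X → ℝ} (hg : Integrable g μ) (hf : ∀ n, AEStronglyMeasurable (f n) μ)
    {B : ℕ → ℝ≥0∞} (hB : Tendsto B atTop (𝓝 0))
    (h : ∀ n, ∫⁻ x, ‖f n x - g x‖ₑ ∂μ ≤ B n) :
    Tendsto (fun n => ∫ x, f n x ∂μ) atTop (𝓝 (∫ x, g x ∂μ)) := by
  have hlim : Tendsto (fun n => ∫⁻ x, ‖f n x - g x‖ₑ ∂μ) atTop (𝓝 0) :=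
    tendsto_of_tendsto_of_tendsto_of_le_of_le tendsto_const_nhds hB (fun _ => zero_le) h
  refine tendsto_integral_of_L1 _ hg.1 ?_ hlim
  filter_upwards [hlim.eventually (gt_mem_nhds ENNReal.zero_lt_top)] with n hn
  have h1 : Integrable (fun x => f n x - g x) μ := ⟨(hf n).sub hg.1, hn⟩
  exact (h1.add hg).congr (Eventually.of_forall fun x => by simp)

lemma integrable_defect (hr : r⁻¹ + r'⁻¹ = 1) (h : IsEntropy β b F L c) (hw : MemLp w r volume)
    (hδL : ∀ R, MemLp δ r' (volume.restrict (Metric.ball 0 R))) (hχ : IsTestFun χ) :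
    Integrable fun x => χ x * ((w x * b (w x) - β (w x)) * δ x) := by
  have h1 := memLp_one_iff_integrable.1 (memLp_one_smul_of_conjugate hr hw
    (memLp_smul_of_hasCompactSupport hχ.1.continuous hχ.2 hδL))
  have hc : Continuous fun u => u * b u - β u :=
    (continuous_id.mul h.continuous_deriv).sub h.continuous
  have hδm : AEStronglyMeasurable δ volume :=
    (locallyIntegrable_of_memLp_ball (one_le_of_inv_add_inv (by rwa [add_comm]))
      hδL).aestronglyMeasurable
  refine (h1.norm.const_mul L).mono' (hχ.1.continuous.aestronglyMeasurable.mul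
    ((hc.comp_aestronglyMeasurable hw.1).mul hδm)) (Eventually.of_forall fun x => ?_)
  have e : |w x * b (w x) - β (w x)| ≤ L * |w x| := by
    rw [abs_of_nonneg (h.defect_nonneg _)]
    have h2 : w x * b (w x) ≤ L * |w x| := (le_abs_self _).trans (by
      rw [abs_mul, mul_comm]
      exact mul_le_mul_of_nonneg_right (h.abs_deriv_le _) (abs_nonneg _))
    linarith [h.nonneg (w x)]
  simp only [norm_mul, Real.norm_eq_abs, smul_eq_mul]
  calc |χ x| * (|w x * b (w x) - β (w x)| * |δ x|) ≤ |χ x| * ((L * |w x|) * |δ x|) := by gcongr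
    _ = _ := by ring

lemma integrable_entropy_mul_fderiv (hr : r⁻¹ + r'⁻¹ = 1) (h : IsEntropy β b F L c)
    (hw : MemLp w r volume) (hvm : AEStronglyMeasurable v volume)
    (hvL : ∀ R, MemLp v r' (volume.restrict (Metric.ball 0 R))) (hχ : IsTestFun χ) :
    Integrable fun x => β (w x) * fderiv ℝ χ x (v x) := by
  have hg := memLp_fderiv_apply hχ hvm hvL
  have h1 := memLp_one_iff_integrable.1 (memLp_one_smul_of_conjugate hr hw hg)
  refine (h1.norm.const_mul L).mono' ((h.continuous.comp_aestronglyMeasurable hw.1).mul hg.1)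
    (Eventually.of_forall fun x => ?_)
  rw [norm_mul, norm_smul, ← mul_assoc, Real.norm_of_nonneg (h.nonneg _)]
  exact mul_le_mul_of_nonneg_right (h.le_mul_abs _) (norm_nonneg _)

/-- As the mollification is removed, the commutator turns the divergence term into the one with
the defect `u b(u) - β(u)` of the entropy. -/
lemma tendsto_integral_mul_mollifiedTransport (hr : r⁻¹ + r'⁻¹ = 1) (h : IsEntropy β b F L c)
    (hw : MemLp w r volume) (hv : HasWeakDiv v δ)
    (hvL : ∀ R, MemLp v r' (volume.restrict (Metric.ball 0 R)))
    (hδL : ∀ R, MemLp δ r' (volume.restrict (Metric.ball 0 R)))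
    (hχ : IsTestFun χ) (hχ1 : ∀ x, |χ x| ≤ 1)
    (hC : ∀ R : ℝ, Tendsto (fun n => ∫⁻ x in Metric.ball 0 R,
      ‖transportCommutator (mollifier d n) w v x + w x * δ x‖ₑ) atTop (𝓝 0)) :
    Tendsto (fun n => ∫ x, χ x * b (mollify (mollifier d n) w x) *
      mollifiedTransport (mollifier d n) w v x) atTop
      (𝓝 ((∫ x, β (w x) * fderiv ℝ χ x (v x)) -
        ∫ x, χ x * ((w x * b (w x) - β (w x)) * δ x))) := by
  obtain ⟨M, hM⟩ := exists_isMollifier d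
  have hwl : LocallyIntegrable w volume := hw.locallyIntegrable (one_le_of_inv_add_inv hr)
  have hwv := locallyIntegrable_smul_of_conjugate hr hw hvL
  have hvm := hv.1.aestronglyMeasurable
  have hδm := hv.2.1.aestronglyMeasurable
  have huc : ∀ n, Continuous (mollify (mollifier d n) w) := fun n =>
    ((hM n).contDiff_mollify hwl).continuous
  obtain ⟨R, hR0, hR⟩ := exists_forall_lt_norm_eq_zero hχ.2
  have hg : MemLp (fun x => fderiv ℝ χ x (v x) + χ x * δ x) r' volume :=
    (memLp_fderiv_apply hχ hvm hvL).add
      (memLp_smul_of_hasCompactSupport hχ.1.continuous hχ.2 hδL)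
  have hχδ : Integrable fun x => χ x * (w x * δ x) := by
    have := memLp_one_iff_integrable.1 (memLp_one_smul_of_conjugate hr hw
      (memLp_smul_of_hasCompactSupport hχ.1.continuous hχ.2 hδL))
    refine this.congr (Eventually.of_forall fun x => ?_)
    simp only [smul_eq_mul]
    ring
  have i1 : Integrable fun x => β (w x) * (fderiv ℝ χ x (v x) + χ x * δ x) := by
    have h1 := memLp_one_iff_integrable.1 (memLp_one_smul_of_conjugate hr hw hg)
    refine (h1.norm.const_mul L).mono' ((h.continuous.comp_aestronglyMeasurable hw.1).mul hg.1)
      (Eventually.of_forall fun x => ?_)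
    rw [norm_mul, norm_smul, ← mul_assoc, Real.norm_of_nonneg (h.nonneg _)]
    exact mul_le_mul_of_nonneg_right (h.le_mul_abs _) (norm_nonneg _)
  have i2 : Integrable fun x => χ x * b (w x) * (w x * δ x) := by
    refine (hχδ.norm.const_mul L).mono' ((hχ.1.continuous.aestronglyMeasurable.mul
      (h.continuous_deriv.comp_aestronglyMeasurable hw.1)).mul (hw.1.mul hδm))
      (Eventually.of_forall fun x => ?_)
    rw [norm_mul, norm_mul, norm_mul (χ x), mul_right_comm, mul_comm]
    exact mul_le_mul_of_nonneg_right (h.abs_deriv_le _) (by positivity)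
  -- the limit of the terms with the entropy
  have l1 : Tendsto (fun n => ∫ x, β (mollify (mollifier d n) w x) *
      (fderiv ℝ χ x (v x) + χ x * δ x)) atTop
      (𝓝 (∫ x, β (w x) * (fderiv ℝ χ x (v x) + χ x * δ x))) := by
    have hlim := ENNReal.Tendsto.const_mul (tendsto_lintegral_mollify_sub_mul hr hw hg)
      (Or.inr (ENNReal.ofReal_ne_top (r := L)))
    rw [mul_zero] at hlim
    refine tendsto_integral_of_lintegral_enorm_sub i1 (fun n =>
      (h.continuous.comp (huc n)).aestronglyMeasurable.mul hg.1) hlim fun n => ?_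
    rw [← lintegral_const_mul' _ _ (by simp)]
    refine lintegral_mono fun x => ?_
    rw [← sub_mul, enorm_mul, ← mul_assoc]
    gcongr
    exact enorm_entropy_sub_le h _ _
  -- the limit of the terms with the commutator
  have hdc : Tendsto (fun n => ∫⁻ x, ‖(b (mollify (mollifier d n) w x) - b (w x)) *
      (χ x * (w x * δ x))‖ₑ) atTop (𝓝 0) := by
    have := tendsto_lintegral_of_dominated_convergence' (μ := (volume :
      Measure (EuclideanSpace ℝ (Fin d))))
      (F := fun n x => ‖(b (mollify (mollifier d n) w x) - b (w x)) * (χ x * (w x * δ x))‖ₑ)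
      (f := fun _ => 0) (fun x => (ENNReal.ofReal L + ENNReal.ofReal L) * ‖χ x * (w x * δ x)‖ₑ)
      (fun n => ?_) (fun n => Eventually.of_forall fun x => ?_) ?_ ?_
    · simpa using this
    · exact ((((h.continuous_deriv.comp (huc n)).aestronglyMeasurable).sub
        (h.continuous_deriv.comp_aestronglyMeasurable hw.1)).mul hχδ.1).enorm
    · simp only
      rw [enorm_mul]
      gcongr
      exact enorm_sub_le.trans (add_le_add (enorm_deriv_le h _) (enorm_deriv_le h _))
    · rw [lintegral_const_mul' _ _ (by simp)]
      exact ENNReal.mul_ne_top (by simp) hχδ.2.ne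
    · filter_upwards [ae_tendsto_mollify hwl] with x hx
      have h1 := ((h.continuous_deriv.tendsto _).comp hx).sub_const (b (w x))
      have h2 := (h1.mul_const (χ x * (w x * δ x))).enorm
      simpa using h2
  have l2 : Tendsto (fun n => ∫ x, χ x * b (mollify (mollifier d n) w x) *
      transportCommutator (mollifier d n) w v x) atTop
      (𝓝 (∫ x, -(χ x * b (w x) * (w x * δ x)))) := by
    have hlim := (ENNReal.Tendsto.const_mul (hC (R + 1))
      (Or.inr (ENNReal.ofReal_ne_top (r := L)))).add hdc
    rw [mul_zero, add_zero] at hlim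
    have hcm : ∀ n, AEStronglyMeasurable (transportCommutator (mollifier d n) w v) volume := by
      intro n
      have e : transportCommutator (mollifier d n) w v = fun x =>
          mollifiedTransport (mollifier d n) w v x +
            fderiv ℝ (mollify (mollifier d n) w) x (v x) :=
        funext fun x => transportCommutator_eq (hM n).testFun hwl hwv x
      rw [e]
      exact (continuous_mollifiedTransport (hM n).testFun hwv).aestronglyMeasurable.add
        (aestronglyMeasurable_clm_apply
          (((hM n).contDiff_mollify hwl).continuous_fderiv (by simp)).aestronglyMeasurable hvm)
    refine tendsto_integral_of_lintegral_enorm_sub i2.neg (fun n => ?_) hlim fun n => ?_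
    · exact (hχ.1.continuous.mul (h.continuous_deriv.comp (huc n))).aestronglyMeasurable.mul (hcm n)
    · have hBm : MeasurableSet (Metric.ball (0 : EuclideanSpace ℝ (Fin d)) (R + 1)) :=
        Metric.isOpen_ball.measurableSet
      have hm : AEMeasurable (fun x => (Metric.ball (0 : EuclideanSpace ℝ (Fin d)) (R + 1)).indicator
          (fun a => ENNReal.ofReal L * ‖transportCommutator (mollifier d n) w v a + w a * δ a‖ₑ) x)
          volume :=
        AEMeasurable.indicator ((((hcm n).add (hw.1.mul hδm)).enorm).const_mul _) hBm
      rw [← lintegral_const_mul' _ _ (by simp), ← lintegral_indicator hBm,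
        ← lintegral_add_left' hm]
      refine lintegral_mono fun x => ?_
      have e : χ x * b (mollify (mollifier d n) w x) * transportCommutator (mollifier d n) w v x -
          -(χ x * b (w x) * (w x * δ x)) =
          χ x * b (mollify (mollifier d n) w x) *
            (transportCommutator (mollifier d n) w v x + w x * δ x) -
          (b (mollify (mollifier d n) w x) - b (w x)) * (χ x * (w x * δ x)) := by ring
      simp only
      rw [e]
      refine enorm_sub_le.trans (add_le_add ?_ le_rfl)
      by_cases hx : x ∈ Metric.ball (0 : EuclideanSpace ℝ (Fin d)) (R + 1)
      · rw [indicator_of_mem hx, enorm_mul, enorm_mul]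
        gcongr
        calc ‖χ x‖ₑ * ‖b (mollify (mollifier d n) w x)‖ₑ ≤ 1 * ENNReal.ofReal L := by
              gcongr
              · rw [← ofReal_norm, Real.norm_eq_abs]
                exact ENNReal.ofReal_le_one.2 (hχ1 x)
              · exact enorm_deriv_le h _
          _ = _ := one_mul _
      · rw [mem_ball_zero_iff, not_lt] at hx
        rw [hR x (by linarith)]
        simp
  have hsum := l1.add l2
  have e : (∫ x, β (w x) * (fderiv ℝ χ x (v x) + χ x * δ x)) +
      ∫ x, -(χ x * b (w x) * (w x * δ x)) =
      (∫ x, β (w x) * fderiv ℝ χ x (v x)) -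
        ∫ x, χ x * ((w x * b (w x) - β (w x)) * δ x) := by
    have i2' : Integrable fun x => -(χ x * b (w x) * (w x * δ x)) := i2.neg
    rw [← integral_add i1 i2', ← integral_sub (integrable_entropy_mul_fderiv hr h hw hvm hvL hχ)
      (integrable_defect hr h hw hδL hχ)]
    refine integral_congr_ae (Eventually.of_forall fun x => ?_)
    simp only
    ring
  rw [e] at hsum
  refine hsum.congr fun n => ?_
  rw [integral_mul_mollifiedTransport (hM n).testFun hwl hwv hv hχ h.hasDerivAt h.continuous_deriv]

end RenormalizedLimit

/-! ### The chain rule in time and joint measurability -/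

section ChainRule

lemma AbsolutelyContinuousOnInterval.comp_lipschitz {f β : ℝ → ℝ} {a b L : ℝ}
    (hf : AbsolutelyContinuousOnInterval f a b) (hβ : ∀ u v, |β u - β v| ≤ L * |u - v|) :
    AbsolutelyContinuousOnInterval (fun t => β (f t)) a b := by
  have h := Tendsto.const_mul L hf
  rw [mul_zero] at h
  refine squeeze_zero (fun E => Finset.sum_nonneg fun i _ => dist_nonneg) (fun E => ?_) h
  rw [Finset.mul_sum]
  refine Finset.sum_le_sum fun i _ => ?_
  rw [Real.dist_eq, Real.dist_eq]
  exact hβ _ _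

/-- The chain rule for the primitive of an integrable function and a `C¹` Lipschitz function. -/
lemma comp_sub_eq_integral_of_forall_eq {f g β b : ℝ → ℝ} {t₀ t₁ L : ℝ} (ht : t₀ ≤ t₁)
    (hg : IntervalIntegrable g volume t₀ t₁)
    (hf : ∀ s ∈ Icc t₀ t₁, f s = f t₀ + ∫ τ in t₀..s, g τ)
    (hβ : ∀ u v, |β u - β v| ≤ L * |u - v|) (hb : ∀ u, HasDerivAt β (b u) u) :
    β (f t₁) - β (f t₀) = ∫ τ in t₀..t₁, b (f τ) * g τ := by
  set G : ℝ → ℝ := fun s => f t₀ + ∫ τ in t₀..s, g τ with hG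
  have hac0 := hg.absolutelyContinuousOnInterval_intervalIntegral (c := t₀) left_mem_uIcc
  have hac := hac0.comp_lipschitz (β := fun u => β (f t₀ + u)) (L := L) fun u v => by
    simpa using hβ (f t₀ + u) (f t₀ + v)
  have h1 : β (G t₁) - β (G t₀) = ∫ τ in t₀..t₁, deriv (fun t => β (G t)) τ :=
    hac.integral_deriv_eq_sub.symm
  have e0 : G t₀ = f t₀ := by simp [hG]
  have e1 : G t₁ = f t₁ := (hf t₁ ⟨ht, le_rfl⟩).symm
  rw [e0, e1] at h1
  rw [h1]
  refine intervalIntegral.integral_congr_ae ?_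
  filter_upwards [hg.ae_hasDerivAt_integral] with τ hτ hτ'
  have hm := uIoc_subset_uIcc hτ'
  have hd : HasDerivAt G (g τ) τ := (hτ hm t₀ left_mem_uIcc).const_add (f t₀)
  rw [uIcc_of_le ht] at hm
  have hc : deriv (fun t => β (G t)) τ = b (G τ) * g τ := ((hb (G τ)).comp τ hd).deriv
  rw [hc, hf τ hm]

end ChainRule

section JointMeasurability

variable {X : Type*} [MeasurableSpace X] {μ : Measure X}
  {H : Type*} [NormedAddCommGroup H]

lemma aemeasurable_eLpNorm_of_prod {Y : Type*} [MeasurableSpace Y] {ν : Measure Y} [SFinite ν]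
    {f : X → Y → H} (hf : AEStronglyMeasurable (Function.uncurry f) (μ.prod ν)) (m : ℝ≥0∞) :
    AEMeasurable (fun x => eLpNorm (f x) m ν) μ := by
  have hg := hf.stronglyMeasurable_mk
  set g := hf.mk with hgdef
  have key : Measurable fun x => eLpNorm (fun y => g (x, y)) m ν := by
    rcases eq_or_ne m 0 with rfl | h0
    · simp
    rcases eq_or_ne m ∞ with rfl | ht
    · simp_rw [eLpNorm_exponent_top, eLpNormEssSup]
      refine measurable_of_Ioi fun a => ?_
      have e : (fun x => essSup (fun y => ‖g (x, y)‖ₑ) ν) ⁻¹' Ioi a =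
          {x | ν (Prod.mk x ⁻¹' {z | a < ‖g z‖ₑ}) = 0}ᶜ := by
        ext x
        simp only [mem_preimage, mem_Ioi, mem_compl_iff, mem_ofPred_eq]
        rw [← not_iff_not, not_lt, not_not]
        constructor
        · intro h
          have h1 : ∀ᵐ y ∂ν, ‖g (x, y)‖ₑ ≤ essSup (fun y => ‖g (x, y)‖ₑ) ν :=
            ENNReal.ae_le_essSup _
          have h2 : ∀ᵐ y ∂ν, ‖g (x, y)‖ₑ ≤ a := h1.mono fun y hy => hy.trans h
          simpa [ae_iff] using h2
        · intro h
          refine essSup_le_of_ae_le _ ?_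
          simpa [EventuallyLE, ae_iff] using h
      rw [e]
      exact ((measurable_measure_prodMk_left
        (measurableSet_lt measurable_const hg.enorm)) (measurableSet_singleton 0)).compl
    · simp_rw [eLpNorm_eq_lintegral_rpow_enorm_toReal h0 ht]
      exact ((hg.enorm.pow_const _).lintegral_prod_right').pow_const _
  refine ⟨_, key, ?_⟩
  filter_upwards [Measure.ae_ae_of_ae_prod hf.ae_eq_mk] with x hx
  exact eLpNorm_congr_ae hx

variable [SFinite μ]

lemma aestronglyMeasurable_translate_prod {f : X → EuclideanSpace ℝ (Fin d) → H}
    (hf : AEStronglyMeasurable (Function.uncurry f) (μ.prod volume)) :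
    AEStronglyMeasurable (fun q : (X × EuclideanSpace ℝ (Fin d)) × EuclideanSpace ℝ (Fin d) =>
      f q.1.1 (q.1.2 - q.2)) ((μ.prod volume).prod volume) := by
  refine hf.comp_quasiMeasurePreserving 
    (f := fun q : (X × EuclideanSpace ℝ (Fin d)) × EuclideanSpace ℝ (Fin d) =>
      (q.1.1, q.1.2 - q.2))
    (QuasiMeasurePreserving.prod_of_left (by fun_prop) ?_)
  exact Eventually.of_forall fun z =>
    ((MeasurePreserving.id μ).prod (measurePreserving_sub_const z)).quasiMeasurePreserving

lemma aestronglyMeasurable_mollify_prod {f : X → EuclideanSpace ℝ (Fin d) → ℝ}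
    (hf : AEStronglyMeasurable (Function.uncurry f) (μ.prod volume))
    {ρ : EuclideanSpace ℝ (Fin d) → ℝ} (hρ : Continuous ρ) :
    AEStronglyMeasurable (fun p : X × EuclideanSpace ℝ (Fin d) => mollify ρ (f p.1) p.2)
      (μ.prod volume) :=
  AEStronglyMeasurable.integral_prod_right' 
    (f := fun q : (X × EuclideanSpace ℝ (Fin d)) × EuclideanSpace ℝ (Fin d) =>
      ρ q.2 • f q.1.1 (q.1.2 - q.2))
    (hρ.aestronglyMeasurable.comp_snd.smul (aestronglyMeasurable_translate_prod hf))

lemma aestronglyMeasurable_mollifiedTransport_prod {f : X → EuclideanSpace ℝ (Fin d) → ℝ}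
    {v : X → EuclideanSpace ℝ (Fin d) → EuclideanSpace ℝ (Fin d)}
    (hf : AEStronglyMeasurable (Function.uncurry f) (μ.prod volume))
    (hv : AEStronglyMeasurable (Function.uncurry v) (μ.prod volume))
    {ρ : EuclideanSpace ℝ (Fin d) → ℝ} (hρ : IsTestFun ρ) :
    AEStronglyMeasurable
      (fun p : X × EuclideanSpace ℝ (Fin d) => mollifiedTransport ρ (f p.1) (v p.1) p.2)
      (μ.prod volume) := by
  refine AEStronglyMeasurable.neg (AEStronglyMeasurable.integral_prod_right'
    (f := fun q : (X × EuclideanSpace ℝ (Fin d)) × EuclideanSpace ℝ (Fin d) =>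
      f q.1.1 (q.1.2 - q.2) * fderiv ℝ ρ q.2 (v q.1.1 (q.1.2 - q.2))) ?_)
  exact (aestronglyMeasurable_translate_prod hf).mul (aestronglyMeasurable_clm_apply
    ((hρ.1.continuous_fderiv (by simp)).aestronglyMeasurable.comp_snd)
    (aestronglyMeasurable_translate_prod hv))

end JointMeasurability

/-! ### The mollified equation -/

/-- The mollified right-hand side `ρ * (- div (w v) - (-Δ)^{α/2} w)` of the equation. -/
def mollifiedFlux (α : ℝ) (ρ w : EuclideanSpace ℝ (Fin d) → ℝ)
    (v : EuclideanSpace ℝ (Fin d) → EuclideanSpace ℝ (Fin d)) (x : EuclideanSpace ℝ (Fin d)) : ℝ :=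
  mollifiedTransport ρ w v x - mollify (fracLaplacian α ρ) w x

/-- What the energy estimate on `[t₀, t₁]` uses of a solution: the bounds and the weak formulation,
the integrability of the field and of its divergence, the vanishing of the commutators with the
mollifiers together with a bound of them that is integrable in time, and the growth condition in the
form which the removal of the spatial cutoff needs. -/
structure IsRenormalizable (α : ℝ) (r r' : ℝ≥0∞)
    (v : ℝ → EuclideanSpace ℝ (Fin d) → EuclideanSpace ℝ (Fin d))
    (δ : ℝ → EuclideanSpace ℝ (Fin d) → ℝ) (ψ : ℝ → EuclideanSpace ℝ (Fin d) → ℝ)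
    (t₀ t₁ : ℝ) : Prop where
  le : t₀ ≤ t₁
  measurable : AEStronglyMeasurable (Function.uncurry ψ)
    (((volume : Measure ℝ).restrict (Ioc t₀ t₁)).prod volume)
  measurable_field : AEStronglyMeasurable (Function.uncurry v)
    (((volume : Measure ℝ).restrict (Ioc t₀ t₁)).prod volume)
  measurable_div : AEStronglyMeasurable (Function.uncurry δ)
    (((volume : Measure ℝ).restrict (Ioc t₀ t₁)).prod volume)
  bounded : ∃ C : ℝ≥0, ∀ s ∈ Icc t₀ t₁, AEStronglyMeasurable (ψ s) volume ∧
    eLpNorm (ψ s) 1 volume ≤ C ∧ eLpNorm (ψ s) r volume ≤ C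
  equation : ∀ φ : EuclideanSpace ℝ (Fin d) → ℝ, IsTestFun φ → ∀ s ∈ Icc t₀ t₁,
    ∫ x, ψ s x * φ x = (∫ x, ψ t₀ x * φ x) +
      ∫ τ in t₀..s, ∫ x, ψ τ x * (fderiv ℝ φ x (v τ x) - fracLaplacian α φ x)
  field_lt_top : ∀ R : ℝ,
    ∫⁻ s in Ioc t₀ t₁, eLpNorm (v s) r' (volume.restrict (Metric.ball 0 R)) < ∞
  div_lt_top : ∀ R : ℝ,
    ∫⁻ s in Ioc t₀ t₁, eLpNorm (δ s) r' (volume.restrict (Metric.ball 0 R)) < ∞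
  weakDiv : ∀ᵐ s ∂((volume : Measure ℝ).restrict (Ioc t₀ t₁)), HasWeakDiv (v s) (δ s)
  commutator_tendsto : ∀ᵐ s ∂((volume : Measure ℝ).restrict (Ioc t₀ t₁)), ∀ R : ℝ,
    Tendsto (fun n => ∫⁻ x in Metric.ball 0 R,
      ‖transportCommutator (mollifier d n) (ψ s) (v s) x + ψ s x * δ s x‖ₑ) atTop (𝓝 0)
  commutator_le : ∀ R : ℝ, ∃ D : ℝ → ℝ≥0∞,
    AEMeasurable D ((volume : Measure ℝ).restrict (Ioc t₀ t₁)) ∧ ∫⁻ s in Ioc t₀ t₁, D s < ∞ ∧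
    ∀ᵐ s ∂((volume : Measure ℝ).restrict (Ioc t₀ t₁)), ∀ n,
      ∫⁻ x in Metric.ball 0 R, ‖transportCommutator (mollifier d n) (ψ s) (v s) x‖ₑ ≤ D s
  growth : ∃ g : ℝ → EuclideanSpace ℝ (Fin d) → ℝ≥0∞,
    AEMeasurable (Function.uncurry g) (((volume : Measure ℝ).restrict (Ioc t₀ t₁)).prod volume) ∧
    ∫⁻ z, ‖ψ z.1 z.2‖ₑ * g z.1 z.2 ∂(((volume : Measure ℝ).restrict (Ioc t₀ t₁)).prod volume) < ∞ ∧
    ∀ᵐ z ∂(((volume : Measure ℝ).restrict (Ioc t₀ t₁)).prod volume),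
      ‖v z.1 z.2‖ₑ ≤ ENNReal.ofReal (1 + ‖z.2‖) * g z.1 z.2

section LocalIntegrability

variable {H : Type*} [NormedAddCommGroup H] {μ : Measure ℝ}
  {f : ℝ → EuclideanSpace ℝ (Fin d) → H}

lemma aemeasurable_eLpNorm_ball
    (hf : AEStronglyMeasurable (Function.uncurry f) (μ.prod volume)) (m : ℝ≥0∞) (R : ℝ) :
    AEMeasurable (fun s => eLpNorm (f s) m (volume.restrict (Metric.ball 0 R))) μ :=
  aemeasurable_eLpNorm_of_prod (hf.mono_ac
    (Measure.AbsolutelyContinuous.rfl.prod Measure.restrict_le_self.absolutelyContinuous)) m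

lemma ae_forall_memLp_ball [SFinite μ]
    (hf : AEStronglyMeasurable (Function.uncurry f) (μ.prod volume)) {m : ℝ≥0∞}
    (h : ∀ R : ℝ, ∫⁻ s, eLpNorm (f s) m (volume.restrict (Metric.ball 0 R)) ∂μ < ∞) :
    ∀ᵐ s ∂μ, ∀ R : ℝ, MemLp (f s) m (volume.restrict (Metric.ball 0 R)) := by
  have h1 : ∀ᵐ s ∂μ, ∀ n : ℕ, eLpNorm (f s) m (volume.restrict (Metric.ball 0 n)) < ∞ :=
    ae_all_iff.2 fun n => ae_lt_top' (aemeasurable_eLpNorm_ball hf m n) (h n).ne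
  filter_upwards [h1, hf.prodMk_left] with s hs hm R
  obtain ⟨n, hn⟩ := exists_nat_ge R
  refine ⟨hm.restrict, (eLpNorm_mono_measure _ (Measure.restrict_mono ?_ le_rfl)).trans_lt (hs n)⟩
  exact Metric.ball_subset_ball hn

end LocalIntegrability

section MollifiedEquation

variable {α : ℝ} {r r' : ℝ≥0∞} {v : ℝ → EuclideanSpace ℝ (Fin d) → EuclideanSpace ℝ (Fin d)}
  {δ ψ : ℝ → EuclideanSpace ℝ (Fin d) → ℝ} {t₀ t₁ : ℝ}
  {ρ : EuclideanSpace ℝ (Fin d) → ℝ} {ε : ℝ} {M : ℝ≥0}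

/-- Testing the right-hand side of the equation with `y ↦ ρ (x - y)` gives the mollified flux at
`x`. -/
lemma integral_mul_test_eq_mollifiedFlux (hα : 0 < α) (hα2 : α ≤ 2) (hρ : IsMollifier ρ ε M)
    {w : EuclideanSpace ℝ (Fin d) → ℝ} {V : EuclideanSpace ℝ (Fin d) → EuclideanSpace ℝ (Fin d)}
    (hw : Integrable w) (hwV : LocallyIntegrable (fun x => w x • V x) volume)
    (x : EuclideanSpace ℝ (Fin d)) :
    ∫ y, w y * (fderiv ℝ (fun z => ρ (x - z)) y (V y) - fracLaplacian α (fun z => ρ (x - z)) y) =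
      mollifiedFlux α ρ w V x := by
  have h1 := integrable_mollifiedTransport hρ.testFun hwV x
  have h1' : Integrable (fun y => w y * fderiv ℝ ρ (x - y) (V y)) := by
    have := h1.comp_sub_left x
    simpa using this
  obtain ⟨C, hC0, hC⟩ := exists_abs_fracLaplacian_le α ρ
  have h2 : Integrable (fun y => w y * fracLaplacian α ρ (x - y)) := by
    have hc : Continuous fun y => fracLaplacian α ρ (x - y) :=
      (continuous_fracLaplacian hα hα2 hρ.testFun).comp (continuous_const.sub continuous_id)
    exact hw.mul_bdd hc.aestronglyMeasurable (Eventually.of_forall fun y => hC _)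
  have e : ∀ y, w y * (fderiv ℝ (fun z => ρ (x - z)) y (V y) -
      fracLaplacian α (fun z => ρ (x - z)) y) =
      -(w y * fderiv ℝ ρ (x - y) (V y)) - w y * fracLaplacian α ρ (x - y) := fun y => by
    rw [fderiv_comp_sub_left hρ.testFun, fracLaplacian_comp_sub_left hα hα2 hρ.testFun]
    ring
  simp_rw [e]
  have h1n : Integrable (fun y => -(w y * fderiv ℝ ρ (x - y) (V y))) := h1'.neg
  rw [integral_sub h1n h2, integral_neg, mollifiedFlux, mollify_eq_integral_sub, mollifiedTransport,
    ← integral_sub_left_eq_self (fun z => w (x - z) * fderiv ℝ ρ z (V (x - z))) volume x]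
  simp [mul_comm]

lemma enorm_mollifiedTransport_le (hr : r⁻¹ + r'⁻¹ = 1) (hρ : IsMollifier ρ ε M) (hε : ε ≤ 1)
    {K : ℝ} (hK : ∀ x, ‖fderiv ℝ ρ x‖ ≤ K)
    {w : EuclideanSpace ℝ (Fin d) → ℝ} {V : EuclideanSpace ℝ (Fin d) → EuclideanSpace ℝ (Fin d)}
    (hw : AEStronglyMeasurable w volume) {R : ℝ}
    (hV : AEStronglyMeasurable V (volume.restrict (Metric.ball 0 (R + 1))))
    {x : EuclideanSpace ℝ (Fin d)} (hx : ‖x‖ < R) :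
    ‖mollifiedTransport ρ w V x‖ₑ ≤ ENNReal.ofReal K *
      (eLpNorm w r volume * eLpNorm V r' (volume.restrict (Metric.ball 0 (R + 1)))) := by
  set B := Metric.ball (0 : EuclideanSpace ℝ (Fin d)) (R + 1) with hB
  have hBm : MeasurableSet B := Metric.isOpen_ball.measurableSet
  rw [mollifiedTransport, enorm_neg,
    ← integral_sub_left_eq_self (fun z => w (x - z) * fderiv ℝ ρ z (V (x - z))) volume x]
  simp only [sub_sub_cancel]
  refine (enorm_integral_le_lintegral_enorm _).trans ?_
  have h1 := lintegral_enorm_mul_enorm_le hr hw ((aestronglyMeasurable_indicator_iff hBm).2 hV)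
  rw [eLpNorm_indicator_eq_eLpNorm_restrict hBm] at h1
  refine le_trans ?_ (mul_le_mul_right h1 _)
  rw [← lintegral_const_mul' _ _ (by simp)]
  refine lintegral_mono fun y => ?_
  by_cases hy : y ∈ B
  · rw [indicator_of_mem hy, enorm_mul, mul_left_comm]
    refine mul_le_mul_right ?_ _
    rw [← ofReal_norm, ← ofReal_norm (V y), ← ENNReal.ofReal_mul ((norm_nonneg _).trans (hK 0))]
    exact ENNReal.ofReal_le_ofReal (((fderiv ℝ ρ (x - y)).le_opNorm _).trans
      (mul_le_mul_of_nonneg_right (hK _) (norm_nonneg _)))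
  · have h0 : fderiv ℝ ρ (x - y) = 0 := by
      refine hρ.fderiv_eq_zero ?_
      rw [hB, mem_ball_zero_iff, not_lt] at hy
      have := norm_sub_norm_le y x
      rw [norm_sub_rev] at this
      linarith
    simp [h0]

namespace IsRenormalizable

lemma ae_memLp_field (h : IsRenormalizable α r r' v δ ψ t₀ t₁) :
    ∀ᵐ s ∂((volume : Measure ℝ).restrict (Ioc t₀ t₁)), ∀ R : ℝ,
      MemLp (v s) r' (volume.restrict (Metric.ball 0 R)) :=
  ae_forall_memLp_ball h.measurable_field h.field_lt_top

lemma ae_memLp_div (h : IsRenormalizable α r r' v δ ψ t₀ t₁) :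
    ∀ᵐ s ∂((volume : Measure ℝ).restrict (Ioc t₀ t₁)), ∀ R : ℝ,
      MemLp (δ s) r' (volume.restrict (Metric.ball 0 R)) :=
  ae_forall_memLp_ball h.measurable_div h.div_lt_top

lemma memLp (h : IsRenormalizable α r r' v δ ψ t₀ t₁) {s : ℝ} (hs : s ∈ Icc t₀ t₁) :
    MemLp (ψ s) r volume := by
  obtain ⟨C, hC⟩ := h.bounded
  exact ⟨(hC s hs).1, (hC s hs).2.2.trans_lt ENNReal.coe_lt_top⟩

lemma integrable (h : IsRenormalizable α r r' v δ ψ t₀ t₁) {s : ℝ} (hs : s ∈ Icc t₀ t₁) :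
    Integrable (ψ s) := by
  obtain ⟨C, hC⟩ := h.bounded
  exact memLp_one_iff_integrable.1 ⟨(hC s hs).1, (hC s hs).2.1.trans_lt ENNReal.coe_lt_top⟩

lemma ae_mem_Icc : ∀ᵐ s ∂((volume : Measure ℝ).restrict (Ioc t₀ t₁)), s ∈ Icc t₀ t₁ :=
  (ae_restrict_mem measurableSet_Ioc).mono fun _ hs => Ioc_subset_Icc_self hs

lemma ae_locallyIntegrable (h : IsRenormalizable α r r' v δ ψ t₀ t₁) (hr : r⁻¹ + r'⁻¹ = 1) :
    ∀ᵐ s ∂((volume : Measure ℝ).restrict (Ioc t₀ t₁)),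
      LocallyIntegrable (fun x => ψ s x • v s x) volume := by
  filter_upwards [h.ae_memLp_field, ae_mem_Icc] with s hv hs
  exact locallyIntegrable_smul_of_conjugate hr (h.memLp hs) hv

/-- The equation tested with the translates of a mollifier. -/
lemma mollify_eq (h : IsRenormalizable α r r' v δ ψ t₀ t₁) (hr : r⁻¹ + r'⁻¹ = 1) (hα : 0 < α)
    (hα2 : α ≤ 2) (hρ : IsMollifier ρ ε M) (x : EuclideanSpace ℝ (Fin d)) {s : ℝ}
    (hs : s ∈ Icc t₀ t₁) :
    mollify ρ (ψ s) x = mollify ρ (ψ t₀) x +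
      ∫ τ in t₀..s, mollifiedFlux α ρ (ψ τ) (v τ) x := by
  have := h.equation _ (hρ.testFun.comp_sub_left x) s hs
  rw [mollify_eq_integral_sub, mollify_eq_integral_sub]
  simp only [smul_eq_mul, mul_comm (ρ _)]
  rw [this]
  congr 1
  refine intervalIntegral.integral_congr_ae_restrict ?_
  rw [uIoc_of_le hs.1]
  have hsub : Ioc t₀ s ⊆ Ioc t₀ t₁ := Ioc_subset_Ioc_right hs.2
  filter_upwards [ae_restrict_of_ae_restrict_of_subset hsub (h.ae_locallyIntegrable hr),
    ae_restrict_of_ae_restrict_of_subset hsub ae_mem_Icc] with τ hτ hm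
  exact integral_mul_test_eq_mollifiedFlux hα hα2 hρ (h.integrable hm) hτ x

lemma measurable_mollifiedFlux (h : IsRenormalizable α r r' v δ ψ t₀ t₁) (hα : 0 < α)
    (hα2 : α ≤ 2) (hρ : IsMollifier ρ ε M) :
    AEStronglyMeasurable (fun z : ℝ × EuclideanSpace ℝ (Fin d) =>
      mollifiedFlux α ρ (ψ z.1) (v z.1) z.2)
      (((volume : Measure ℝ).restrict (Ioc t₀ t₁)).prod volume) :=
  (aestronglyMeasurable_mollifiedTransport_prod h.measurable h.measurable_field hρ.testFun).sub
    (aestronglyMeasurable_mollify_prod h.measurable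
      (continuous_fracLaplacian hα hα2 hρ.testFun))

lemma exists_enorm_mollifiedFlux_le (h : IsRenormalizable α r r' v δ ψ t₀ t₁)
    (hr : r⁻¹ + r'⁻¹ = 1) (hρ : IsMollifier ρ ε M) (hε : ε ≤ 1) (R : ℝ) :
    ∃ γ : ℝ → ℝ≥0∞, AEMeasurable γ ((volume : Measure ℝ).restrict (Ioc t₀ t₁)) ∧
      ∫⁻ s in Ioc t₀ t₁, γ s < ∞ ∧
      ∀ᵐ s ∂((volume : Measure ℝ).restrict (Ioc t₀ t₁)), ∀ x : EuclideanSpace ℝ (Fin d), ‖x‖ < R →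
        ‖mollifiedFlux α ρ (ψ s) (v s) x‖ₑ ≤ γ s := by
  obtain ⟨C, hC⟩ := h.bounded
  obtain ⟨K, hK⟩ := (hρ.testFun.2.fderiv ℝ).exists_bound_of_continuous
    (hρ.testFun.1.continuous_fderiv (by simp))
  obtain ⟨A, hA0, hA⟩ := exists_abs_fracLaplacian_le α ρ
  have hvm := aemeasurable_eLpNorm_ball h.measurable_field r' (R + 1)
  refine ⟨fun s => ENNReal.ofReal K * (C * eLpNorm (v s) r'
    (volume.restrict (Metric.ball 0 (R + 1)))) + ENNReal.ofReal A * C,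
    ((hvm.const_mul _).const_mul _).add_const _, ?_, ?_⟩
  · rw [lintegral_add_right' _ aemeasurable_const, lintegral_const_mul' _ _ (by simp),
      lintegral_const_mul' _ _ (by simp), lintegral_const]
    refine ENNReal.add_lt_top.2 ⟨ENNReal.mul_lt_top (by simp)
      (ENNReal.mul_lt_top (by simp) (h.field_lt_top _)), ENNReal.mul_lt_top
        (ENNReal.mul_lt_top (by simp) (by simp)) (by simp)⟩
  · filter_upwards [h.ae_memLp_field, ae_mem_Icc] with s hv hs x hx
    refine enorm_sub_le.trans (add_le_add ?_ ?_)
    · refine (enorm_mollifiedTransport_le hr hρ hε hK (hC s hs).1 (hv _).1 hx).trans ?_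
      gcongr
      exact (hC s hs).2.2
    · have h1 := abs_mollify_le hA (h.integrable hs) x
      have h2 : eLpNorm (ψ s) 1 volume = ENNReal.ofReal (∫ y, |ψ s y|) := by
        rw [eLpNorm_one_eq_lintegral_enorm, ← ofReal_integral_norm_eq_lintegral_enorm
          (h.integrable hs)]
        rfl
      rw [← ofReal_norm, Real.norm_eq_abs]
      refine (ENNReal.ofReal_le_ofReal h1).trans ?_
      rw [ENNReal.ofReal_mul hA0, ← h2]
      gcongr
      exact (hC s hs).2.1

end IsRenormalizable

end MollifiedEquation

/-! ### The entropy identity of the mollified solution -/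

section EntropyIdentity

variable {α : ℝ} {r r' : ℝ≥0∞} {v : ℝ → EuclideanSpace ℝ (Fin d) → EuclideanSpace ℝ (Fin d)}
  {δ ψ : ℝ → EuclideanSpace ℝ (Fin d) → ℝ} {t₀ t₁ : ℝ}
  {ρ χ : EuclideanSpace ℝ (Fin d) → ℝ} {ε : ℝ} {M : ℝ≥0} {β b F : ℝ → ℝ} {L c : ℝ}

namespace IsRenormalizable

lemma integrable_prod_mul_mollifiedFlux (h : IsRenormalizable α r r' v δ ψ t₀ t₁)
    (hr : r⁻¹ + r'⁻¹ = 1) (hα : 0 < α) (hα2 : α ≤ 2) (hρ : IsMollifier ρ ε M) (hε : ε ≤ 1)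
    (hβ : IsEntropy β b F L c) (hχ : IsTestFun χ) :
    Integrable (fun z : ℝ × EuclideanSpace ℝ (Fin d) =>
      χ z.2 * (b (mollify ρ (ψ z.1) z.2) * mollifiedFlux α ρ (ψ z.1) (v z.1) z.2))
      (((volume : Measure ℝ).restrict (Ioc t₀ t₁)).prod volume) := by
  obtain ⟨R, hR0, hR⟩ := exists_forall_lt_norm_eq_zero hχ.2
  obtain ⟨γ, hγm, hγ, hle⟩ := h.exists_enorm_mollifiedFlux_le (α := α) hr hρ hε (R + 1)
  have hm : AEStronglyMeasurable (fun z : ℝ × EuclideanSpace ℝ (Fin d) =>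
      χ z.2 * (b (mollify ρ (ψ z.1) z.2) * mollifiedFlux α ρ (ψ z.1) (v z.1) z.2))
      (((volume : Measure ℝ).restrict (Ioc t₀ t₁)).prod volume) :=
    (hχ.1.continuous.aestronglyMeasurable.comp_snd).mul
      ((hβ.continuous_deriv.comp_aestronglyMeasurable
        (aestronglyMeasurable_mollify_prod h.measurable hρ.continuous)).mul
        (h.measurable_mollifiedFlux hα hα2 hρ))
  refine ⟨hm, ?_⟩
  rw [HasFiniteIntegral, lintegral_prod _ hm.enorm]
  have hχi : Integrable χ := hχ.1.continuous.integrable_of_hasCompactSupport hχ.2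
  calc ∫⁻ s in Ioc t₀ t₁, ∫⁻ x, ‖χ x * (b (mollify ρ (ψ s) x) *
        mollifiedFlux α ρ (ψ s) (v s) x)‖ₑ
      ≤ ∫⁻ s in Ioc t₀ t₁, (∫⁻ x, ‖χ x‖ₑ) * ENNReal.ofReal L * γ s := by
        refine lintegral_mono_ae ?_
        filter_upwards [hle, h.ae_memLp_field] with s hs _
        rw [mul_assoc, mul_comm, ← lintegral_const_mul'' _ hχi.1.enorm]
        refine lintegral_mono fun x => ?_
        rw [enorm_mul, mul_comm]
        by_cases hx : ‖x‖ < R + 1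
        · refine mul_le_mul_left ?_ _
          rw [enorm_mul]
          exact mul_le_mul' (enorm_deriv_le hβ _) (hs x hx)
        · rw [hR x (by linarith)]
          simp
    _ < ∞ := by
        rw [lintegral_const_mul'' _ hγm]
        exact ENNReal.mul_lt_top (ENNReal.mul_lt_top hχi.2 (by simp)) hγ

/-- The evolution of the localized entropy of the mollified solution. -/
lemma integral_entropy_sub (h : IsRenormalizable α r r' v δ ψ t₀ t₁)
    (hr : r⁻¹ + r'⁻¹ = 1) (hα : 0 < α) (hα2 : α ≤ 2) (hρ : IsMollifier ρ ε M) (hε : ε ≤ 1)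
    (hβ : IsEntropy β b F L c) (hχ : IsTestFun χ) :
    (∫ x, χ x * β (mollify ρ (ψ t₁) x)) - ∫ x, χ x * β (mollify ρ (ψ t₀) x) =
      ∫ s in Ioc t₀ t₁, ∫ x, χ x * (b (mollify ρ (ψ s) x) *
        mollifiedFlux α ρ (ψ s) (v s) x) := by
  have hint := h.integrable_prod_mul_mollifiedFlux hr hα hα2 hρ hε hβ hχ
  obtain ⟨R, hR0, hR⟩ := exists_forall_lt_norm_eq_zero hχ.2
  obtain ⟨γ, hγm, hγ, hle⟩ := h.exists_enorm_mollifiedFlux_le (α := α) hr hρ hε (R + 1)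
  have hi : ∀ s ∈ Icc t₀ t₁, Integrable fun x => χ x * β (mollify ρ (ψ s) x) := fun s hs =>
    (hχ.1.continuous.mul (hβ.continuous.comp
      (hρ.contDiff_mollify (h.integrable hs).locallyIntegrable).continuous)
      ).integrable_of_hasCompactSupport hχ.2.mul_right
  rw [← integral_sub (hi t₁ ⟨h.le, le_rfl⟩) (hi t₀ ⟨le_rfl, h.le⟩),
    integral_integral_swap (f := fun s x => χ x * (b (mollify ρ (ψ s) x) *
        mollifiedFlux α ρ (ψ s) (v s) x)) hint]
  refine integral_congr_ae ?_
  have hslice := (h.measurable_mollifiedFlux hα hα2 hρ).prod_swap.prodMk_left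
  filter_upwards [hslice] with x hx
  by_cases hxR : ‖x‖ < R + 1
  · have hg : IntervalIntegrable (fun s => mollifiedFlux α ρ (ψ s) (v s) x) volume t₀ t₁ := by
      rw [intervalIntegrable_iff_integrableOn_Ioc_of_le h.le]
      refine ⟨hx, lt_of_le_of_lt (lintegral_mono_ae ?_) hγ⟩
      filter_upwards [hle] with s hs using hs x hxR
    rw [integral_const_mul, ← mul_sub, comp_sub_eq_integral_of_forall_eq
      (f := fun s => mollify ρ (ψ s) x) h.le hg (fun s hs => h.mollify_eq hr hα hα2 hρ x hs)
      hβ.abs_sub_le hβ.hasDerivAt, intervalIntegral.integral_of_le h.le]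
  · rw [hR x (by linarith)]
    simp

/-- Splitting of the rate of change of the entropy into transport and diffusion. -/
lemma ae_integral_mul_mollifiedFlux (h : IsRenormalizable α r r' v δ ψ t₀ t₁)
    (hr : r⁻¹ + r'⁻¹ = 1) (hα : 0 < α) (hα2 : α ≤ 2) (hρ : IsMollifier ρ ε M)
    (hβ : IsEntropy β b F L c) (hχ : IsTestFun χ) :
    ∀ᵐ s ∂((volume : Measure ℝ).restrict (Ioc t₀ t₁)),
      ∫ x, χ x * (b (mollify ρ (ψ s) x) * mollifiedFlux α ρ (ψ s) (v s) x) =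
      (∫ x, χ x * b (mollify ρ (ψ s) x) * mollifiedTransport ρ (ψ s) (v s) x) -
        ∫ x, χ x * b (mollify ρ (ψ s) x) * mollify (fracLaplacian α ρ) (ψ s) x := by
  obtain ⟨A, hA0, hA⟩ := exists_abs_fracLaplacian_le α ρ
  filter_upwards [h.ae_locallyIntegrable hr, ae_mem_Icc] with s hs hm
  have hc : Continuous fun x => χ x * b (mollify ρ (ψ s) x) := hχ.1.continuous.mul
    (hβ.continuous_deriv.comp
      (hρ.contDiff_mollify (h.integrable hm).locallyIntegrable).continuous)
  have hcs : HasCompactSupport fun x => χ x * b (mollify ρ (ψ s) x) := hχ.2.mul_right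
  rw [← integral_sub]
  · refine integral_congr_ae (Eventually.of_forall fun x => ?_)
    simp only [mollifiedFlux]
    ring
  · exact (hc.mul (continuous_mollifiedTransport hρ.testFun hs)).integrable_of_hasCompactSupport
      hcs.mul_right
  · exact (hc.mul (continuous_mollify_of_bounded (continuous_fracLaplacian hα hα2 hρ.testFun)
      hA (h.integrable hm))).integrable_of_hasCompactSupport hcs.mul_right

end IsRenormalizable

end EntropyIdentity

/-! ### The cutoff energy inequality -/

section CutoffEnergy

variable {α : ℝ} {r r' : ℝ≥0∞} {v : ℝ → EuclideanSpace ℝ (Fin d) → EuclideanSpace ℝ (Fin d)}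
  {δ ψ : ℝ → EuclideanSpace ℝ (Fin d) → ℝ} {t₀ t₁ : ℝ}
  {ρ η χ : EuclideanSpace ℝ (Fin d) → ℝ} {ε : ℝ} {M : ℝ≥0} {β b F : ℝ → ℝ} {L c : ℝ}

lemma integral_abs_mollify_le (hρ : IsMollifier ρ ε M) {w : EuclideanSpace ℝ (Fin d) → ℝ}
    (hw : Integrable w) : ∫ x, |mollify ρ w x| ≤ ∫ x, |w x| := by
  have h1 := hρ.lintegral_mollify_le hw.1
  have h2 := (hρ.integrable_mollify hw)
  rw [← ofReal_integral_norm_eq_lintegral_enorm h2, ← ofReal_integral_norm_eq_lintegral_enorm hw,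
    ENNReal.ofReal_le_ofReal_iff (integral_nonneg fun x => norm_nonneg _)] at h1
  exact h1

/-- At a fixed time, the dissipation of the entropy controls the norm in the Sobolev inequality, up
to the errors of the cutoff. -/
lemma sobolevConst_mul_le_dissipation [Nonempty (Fin d)] (hβ : IsEntropy β b F L c) (hα : 0 < α)
    (hα2 : α ≤ 2)
    {μ : ℕ → Measure (EuclideanSpace ℝ (Fin d))} (hμ : IsLevyApprox α μ)
    (hρ : IsMollifier ρ ε M) (hη : IsTestFun η) {w : EuclideanSpace ℝ (Fin d) → ℝ}
    (hw : Integrable w) {C : ℝ} (hC : ∫ x, |w x| ≤ C) {k N κ : ℝ} (hk : 0 < k)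
    (hN0 : 0 ≤ N) (hN : ∀ m x, ∫ y, (η x - η (x + y)) ^ 2 ∂(μ m) ≤ N)
    (hκ : ∀ x, |fracLaplacian α (fun x => η x ^ 2) x| ≤ κ) :
    0 ≤ (∫ x, η x ^ 2 * b (mollify ρ w x) * mollify (fracLaplacian α ρ) w x) +
        L * C * (κ + 2 / k * N) ∧
    2 * (sobolevConst d (α / 2) * eLpNorm (fun x => η x * F (mollify ρ w x))
      (ENNReal.ofReal (2 * d / (d - 2 * (α / 2)))) volume ^ 2) ≤
      ENNReal.ofReal ((1 + k) *
        ((∫ x, η x ^ 2 * b (mollify ρ w x) * mollify (fracLaplacian α ρ) w x) +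
          L * C * (κ + 2 / k * N))) := by
  obtain ⟨h0, hle⟩ := hβ.two_mul_sobolevConst_mul_le hα hα2 hμ hρ hη hw hk hN
  have hL := hβ.bound_nonneg
  have hu := hρ.integrable_mollify hw
  have hI : ∫ x, |mollify ρ w x| ≤ C := (integral_abs_mollify_le hρ hw).trans hC
  have hκ0 : 0 ≤ κ := (abs_nonneg _).trans (hκ 0)
  have h1 : ∫ x, F (mollify ρ w x) ^ 2 ≤ L * C := by
    refine (integral_mono (hβ.integrable_sq_root hu) (hu.abs.const_mul L) fun x =>
      hβ.sq_root_le _).trans ?_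
    rw [integral_const_mul]
    exact mul_le_mul_of_nonneg_left hI hL
  have h2 : -(∫ x, β (mollify ρ w x) * fracLaplacian α (fun x => η x ^ 2) x) ≤ L * C * κ := by
    refine (neg_le_abs _).trans ?_
    rw [← Real.norm_eq_abs]
    refine (norm_integral_le_of_norm_le ((hu.abs.const_mul L).mul_const κ)
      (Eventually.of_forall fun x => ?_)).trans ?_
    · rw [norm_mul, Real.norm_of_nonneg (hβ.nonneg _)]
      exact mul_le_mul (hβ.le_mul_abs _) (hκ x) (norm_nonneg _) (by positivity)
    · rw [integral_mul_const, integral_const_mul]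
      exact mul_le_mul_of_nonneg_right (mul_le_mul_of_nonneg_left hI hL) hκ0
  set B := ∫ x, η x ^ 2 * b (mollify ρ w x) * mollify (fracLaplacian α ρ) w x
  set E := ∫ x, β (mollify ρ w x) * fracLaplacian α (fun x => η x ^ 2) x
  have hX : (1 + k) * (B - E) + 2 * (1 + 1 / k) * (N * ∫ x, F (mollify ρ w x) ^ 2) ≤
      (1 + k) * (B + L * C * (κ + 2 / k * N)) := by
    have e1 : (1 + k) * (B + L * C * (κ + 2 / k * N)) =
        (1 + k) * (B + L * C * κ) + 2 * (1 + 1 / k) * (N * (L * C)) := by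
      field_simp
      ring
    rw [e1]
    refine add_le_add (mul_le_mul_of_nonneg_left (by linarith) (by positivity))
      (mul_le_mul_of_nonneg_left (mul_le_mul_of_nonneg_left h1 hN0) (by positivity))
  refine ⟨?_, hle.trans (ENNReal.ofReal_le_ofReal hX)⟩
  exact nonneg_of_mul_nonneg_right (h0.trans hX) (by positivity)

namespace IsRenormalizable

lemma integrable_integral_mul_mollifiedFlux (h : IsRenormalizable α r r' v δ ψ t₀ t₁)
    (hr : r⁻¹ + r'⁻¹ = 1) (hα : 0 < α) (hα2 : α ≤ 2) (hρ : IsMollifier ρ ε M) (hε : ε ≤ 1)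
    (hβ : IsEntropy β b F L c) (hχ : IsTestFun χ) :
    IntegrableOn (fun s => ∫ x, χ x * (b (mollify ρ (ψ s) x) *
        mollifiedFlux α ρ (ψ s) (v s) x)) (Ioc t₀ t₁) volume :=
  (h.integrable_prod_mul_mollifiedFlux hr hα hα2 hρ hε hβ hχ).integral_prod_left

lemma aestronglyMeasurable_integral_mul_mollifiedTransport
    (h : IsRenormalizable α r r' v δ ψ t₀ t₁) (hρ : IsMollifier ρ ε M)
    (hβ : IsEntropy β b F L c) (hχ : IsTestFun χ) :
    AEStronglyMeasurable (fun s => ∫ x, χ x * b (mollify ρ (ψ s) x) *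
      mollifiedTransport ρ (ψ s) (v s) x) (volume.restrict (Ioc t₀ t₁)) := by
  refine AEStronglyMeasurable.integral_prod_right'
    (f := fun z : ℝ × EuclideanSpace ℝ (Fin d) => χ z.2 * b (mollify ρ (ψ z.1) z.2) *
      mollifiedTransport ρ (ψ z.1) (v z.1) z.2) ?_
  exact ((hχ.1.continuous.aestronglyMeasurable.comp_snd).mul
    (hβ.continuous_deriv.comp_aestronglyMeasurable
      (aestronglyMeasurable_mollify_prod h.measurable hρ.continuous))).mul
    (aestronglyMeasurable_mollifiedTransport_prod h.measurable h.measurable_field hρ.testFun)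

/-- The renormalized transport term is dominated, uniformly in the mollification parameter, by an
integrable function of time. -/
lemma exists_enorm_integral_mul_mollifiedTransport_le (h : IsRenormalizable α r r' v δ ψ t₀ t₁)
    (hr : r⁻¹ + r'⁻¹ = 1) (hβ : IsEntropy β b F L c) (hχ : IsTestFun χ) (hχ1 : ∀ x, |χ x| ≤ 1) :
    ∃ γ : ℝ → ℝ≥0∞, AEMeasurable γ ((volume : Measure ℝ).restrict (Ioc t₀ t₁)) ∧
      ∫⁻ s in Ioc t₀ t₁, γ s < ∞ ∧
      ∀ᵐ s ∂((volume : Measure ℝ).restrict (Ioc t₀ t₁)), ∀ n : ℕ,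
        ‖∫ x, χ x * b (mollify (mollifier d n) (ψ s) x) *
          mollifiedTransport (mollifier d n) (ψ s) (v s) x‖ₑ ≤ γ s := by
  obtain ⟨C, hC⟩ := h.bounded
  obtain ⟨M, hM⟩ := exists_isMollifier d
  obtain ⟨K, hK⟩ := (hχ.2.fderiv ℝ).exists_bound_of_continuous
    (hχ.1.continuous_fderiv (by simp))
  obtain ⟨R₁, -, hR₁⟩ := exists_forall_lt_norm_eq_zero hχ.2
  obtain ⟨R₂, -, hR₂⟩ := exists_forall_lt_norm_eq_zero (hχ.2.fderiv ℝ)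
  set R := max R₁ R₂ + 1 with hR
  obtain ⟨D, hDm, hD, hDle⟩ := h.commutator_le R
  have hvm := aemeasurable_eLpNorm_ball h.measurable_field r' R
  have hδm := aemeasurable_eLpNorm_ball h.measurable_div r' R
  refine ⟨fun s => ENNReal.ofReal L * (C * (ENNReal.ofReal K *
      eLpNorm (v s) r' (volume.restrict (Metric.ball 0 R))) +
      C * eLpNorm (δ s) r' (volume.restrict (Metric.ball 0 R)) + D s),
    (((((hvm.const_mul _).const_mul _).add (hδm.const_mul _)).add hDm).const_mul _), ?_, ?_⟩
  · rw [lintegral_const_mul' _ _ (by simp), lintegral_add_right' _ hDm,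
      lintegral_add_right' _ (hδm.const_mul _), lintegral_const_mul' _ _ (by simp),
      lintegral_const_mul' _ _ (by simp), lintegral_const_mul' _ _ (by simp)]
    exact ENNReal.mul_lt_top (by simp) (ENNReal.add_lt_top.2 ⟨ENNReal.add_lt_top.2
      ⟨ENNReal.mul_lt_top (by simp) (ENNReal.mul_lt_top (by simp) (h.field_lt_top _)),
      ENNReal.mul_lt_top (by simp) (h.div_lt_top _)⟩, hD⟩)
  · filter_upwards [hDle, h.ae_memLp_field, h.ae_memLp_div, h.weakDiv, ae_mem_Icc]
      with s hs hv hδ hdiv hm n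
    refine (enorm_integral_mul_mollifiedTransport_le hr hβ (hM n) (h.memLp hm) hdiv hv hδ hχ hK
      hχ1 (R := R) (fun x hx => hR₁ x ?_) (fun x hx => hR₂ x ?_)).trans ?_
    · linarith [le_max_left R₁ R₂]
    · linarith [le_max_right R₁ R₂]
    · have hCs := (hC s hm).2.2
      refine mul_le_mul_right (add_le_add (add_le_add ?_ ?_) (hs n)) _
      · exact mul_le_mul_left hCs _
      · exact mul_le_mul_left hCs _

/-- The localized energy estimate for the mollified solution: the evolution of the entropy,
integrated over the time interval, combined with the estimate of the dissipation at fixed times. -/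
lemma lintegral_sobolevConst_mul_mollify_le [Nonempty (Fin d)]
    (h : IsRenormalizable α r r' v δ ψ t₀ t₁)
    (hr : r⁻¹ + r'⁻¹ = 1) (hα : 0 < α) (hα2 : α ≤ 2) (hβ : IsEntropy β b F L c)
    {μ : ℕ → Measure (EuclideanSpace ℝ (Fin d))} (hμ : IsLevyApprox α μ)
    (hη : IsTestFun η) (hη1 : ∀ x, |η x ^ 2| ≤ 1) {C : ℝ} (hC : ∀ s ∈ Icc t₀ t₁, ∫ x, |ψ s x| ≤ C)
    {k N κ : ℝ} (hk : 0 < k)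
    (hN0 : 0 ≤ N) (hN : ∀ m x, ∫ y, (η x - η (x + y)) ^ 2 ∂(μ m) ≤ N)
    (hκ : ∀ x, |fracLaplacian α (fun x => η x ^ 2) x| ≤ κ) (n : ℕ) :
    0 ≤ (∫ s in Ioc t₀ t₁, ∫ x, η x ^ 2 * b (mollify (mollifier d n) (ψ s) x) *
          mollifiedTransport (mollifier d n) (ψ s) (v s) x) -
        ((∫ x, η x ^ 2 * β (mollify (mollifier d n) (ψ t₁) x)) -
          ∫ x, η x ^ 2 * β (mollify (mollifier d n) (ψ t₀) x)) +
        (t₁ - t₀) * (L * C * (κ + 2 / k * N)) ∧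
    ∫⁻ s in Ioc t₀ t₁, 2 * (sobolevConst d (α / 2) *
      eLpNorm (fun x => η x * F (mollify (mollifier d n) (ψ s) x))
      (ENNReal.ofReal (2 * d / (d - 2 * (α / 2)))) volume ^ 2) ≤
      ENNReal.ofReal ((1 + k) * ((∫ s in Ioc t₀ t₁, ∫ x,
          η x ^ 2 * b (mollify (mollifier d n) (ψ s) x) *
          mollifiedTransport (mollifier d n) (ψ s) (v s) x) -
        ((∫ x, η x ^ 2 * β (mollify (mollifier d n) (ψ t₁) x)) -
          ∫ x, η x ^ 2 * β (mollify (mollifier d n) (ψ t₀) x)) +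
        (t₁ - t₀) * (L * C * (κ + 2 / k * N)))) := by
  obtain ⟨M, hM⟩ := exists_isMollifier d
  have hε : ((n : ℝ) + 1)⁻¹ ≤ 1 := inv_le_one_of_one_le₀ (by linarith [n.cast_nonneg (α := ℝ)])
  set ρ := mollifier d n
  set e := L * C * (κ + 2 / k * N) with he
  set A : ℝ → ℝ := fun s => ∫ x, η x ^ 2 * b (mollify ρ (ψ s) x) *
    mollifiedTransport ρ (ψ s) (v s) x with hA
  set D : ℝ → ℝ := fun s => ∫ x, η x ^ 2 * (b (mollify ρ (ψ s) x) *
        mollifiedFlux α ρ (ψ s) (v s) x) with hD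
  have hDi : Integrable D (volume.restrict (Ioc t₀ t₁)) :=
    h.integrable_integral_mul_mollifiedFlux hr hα hα2 (hM n) hε hβ hη.sq
  have hAi : Integrable A (volume.restrict (Ioc t₀ t₁)) := by
    obtain ⟨γ, hγm, hγ, hle⟩ := h.exists_enorm_integral_mul_mollifiedTransport_le hr hβ hη.sq hη1
    refine ⟨h.aestronglyMeasurable_integral_mul_mollifiedTransport (hM n) hβ hη.sq,
      lt_of_le_of_lt (lintegral_mono_ae ?_) hγ⟩
    filter_upwards [hle] with s hs using hs n
  have key : ∀ᵐ s ∂((volume : Measure ℝ).restrict (Ioc t₀ t₁)), 0 ≤ A s - D s + e ∧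
      2 * (sobolevConst d (α / 2) * eLpNorm (fun x => η x * F (mollify ρ (ψ s) x))
      (ENNReal.ofReal (2 * d / (d - 2 * (α / 2)))) volume ^ 2) ≤
      ENNReal.ofReal ((1 + k) * (A s - D s + e)) := by
    filter_upwards [h.ae_integral_mul_mollifiedFlux hr hα hα2 (hM n) hβ hη.sq, ae_mem_Icc]
      with s hs hm
    have hB := sobolevConst_mul_le_dissipation hβ hα hα2 hμ (hM n) hη (h.integrable hm) (hC s hm)
      hk hN0 hN hκ
    have e1 : A s - D s =
        ∫ x, η x ^ 2 * b (mollify ρ (ψ s) x) * mollify (fracLaplacian α ρ) (ψ s) x := by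
      simp only [hA, hD]
      rw [hs]
      ring
    rw [e1]
    exact hB
  have hi : Integrable (fun s => A s - D s + e) (volume.restrict (Ioc t₀ t₁)) :=
    (hAi.sub hDi).add (integrable_const _)
  have hI : ∫ s in Ioc t₀ t₁, (A s - D s + e) = (∫ s in Ioc t₀ t₁, A s) -
      ((∫ x, η x ^ 2 * β (mollify ρ (ψ t₁) x)) - ∫ x, η x ^ 2 * β (mollify ρ (ψ t₀) x)) +
      (t₁ - t₀) * e := by
    have hAD : Integrable (fun s => A s - D s) (volume.restrict (Ioc t₀ t₁)) := hAi.sub hDi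
    rw [integral_add hAD (integrable_const _), integral_sub hAi hDi, setIntegral_const,
      h.integral_entropy_sub hr hα hα2 (hM n) hε hβ hη.sq, Measure.real, Real.volume_Ioc,
      ENNReal.toReal_ofReal (sub_nonneg.2 h.le), smul_eq_mul]
  rw [← hI]
  refine ⟨integral_nonneg_of_ae (key.mono fun s hs => hs.1), ?_⟩
  rw [← integral_const_mul, ofReal_integral_eq_lintegral_ofReal (hi.const_mul _)]
  · exact lintegral_mono_ae (key.mono fun s hs => hs.2)
  · exact key.mono fun s hs => mul_nonneg (by positivity) hs.1

lemma tendsto_integral_mul_entropy_mollify (hβ : IsEntropy β b F L c) (hχ : IsTestFun χ)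
    (hχ1 : ∀ x, |χ x| ≤ 1) {w : EuclideanSpace ℝ (Fin d) → ℝ} (hw : Integrable w) :
    Tendsto (fun n => ∫ x, χ x * β (mollify (mollifier d n) w x)) atTop
      (𝓝 (∫ x, χ x * β (w x))) := by
  obtain ⟨M, hM⟩ := exists_isMollifier d
  have hlim := ENNReal.Tendsto.const_mul (tendsto_lintegral_mollify_sub
    (memLp_one_iff_integrable.2 hw)) (Or.inr (ENNReal.ofReal_ne_top (r := L)))
  rw [mul_zero] at hlim
  refine tendsto_integral_of_lintegral_enorm_sub ((hβ.integrable_comp hw).bdd_mul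
    hχ.1.continuous.aestronglyMeasurable (Eventually.of_forall hχ1)) (fun n =>
      hχ.1.continuous.aestronglyMeasurable.mul
        (hβ.integrable_comp ((hM n).integrable_mollify hw)).1) hlim fun n => ?_
  rw [← lintegral_const_mul' _ _ (by simp)]
  refine lintegral_mono fun x => ?_
  rw [← mul_sub, enorm_mul]
  refine (mul_le_of_le_one_left zero_le ?_).trans (enorm_entropy_sub_le hβ _ _)
  rw [← ofReal_norm]
  exact ENNReal.ofReal_le_one.2 (hχ1 x)

/-- The localized energy estimate, with the mollification removed: dominated convergence in time for
the transport term, and Fatou's lemma for the dissipation. -/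
lemma lintegral_sobolevConst_mul_le [Nonempty (Fin d)]
    (h : IsRenormalizable α r r' v δ ψ t₀ t₁)
    (hr : r⁻¹ + r'⁻¹ = 1) (hα : 0 < α) (hα2 : α ≤ 2) (hβ : IsEntropy β b F L c)
    {μ : ℕ → Measure (EuclideanSpace ℝ (Fin d))} (hμ : IsLevyApprox α μ)
    (hη : IsTestFun η) (hη1 : ∀ x, |η x ^ 2| ≤ 1) {C : ℝ} (hC : ∀ s ∈ Icc t₀ t₁, ∫ x, |ψ s x| ≤ C)
    {k N κ : ℝ} (hk : 0 < k)
    (hN0 : 0 ≤ N) (hN : ∀ m x, ∫ y, (η x - η (x + y)) ^ 2 ∂(μ m) ≤ N)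
    (hκ : ∀ x, |fracLaplacian α (fun x => η x ^ 2) x| ≤ κ) :
    Integrable (fun s => (∫ x, β (ψ s x) * fderiv ℝ (fun x => η x ^ 2) x (v s x)) -
        ∫ x, η x ^ 2 * ((ψ s x * b (ψ s x) - β (ψ s x)) * δ s x))
        (volume.restrict (Ioc t₀ t₁)) ∧
    0 ≤ (∫ s in Ioc t₀ t₁, ((∫ x, β (ψ s x) * fderiv ℝ (fun x => η x ^ 2) x (v s x)) -
          ∫ x, η x ^ 2 * ((ψ s x * b (ψ s x) - β (ψ s x)) * δ s x))) -
        ((∫ x, η x ^ 2 * β (ψ t₁ x)) - ∫ x, η x ^ 2 * β (ψ t₀ x)) +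
        (t₁ - t₀) * (L * C * (κ + 2 / k * N)) ∧
    ∫⁻ s in Ioc t₀ t₁, 2 * (sobolevConst d (α / 2) *
      eLpNorm (fun x => η x * F (ψ s x))
      (ENNReal.ofReal (2 * d / (d - 2 * (α / 2)))) volume ^ 2) ≤
      ENNReal.ofReal ((1 + k) * ((∫ s in Ioc t₀ t₁,
          ((∫ x, β (ψ s x) * fderiv ℝ (fun x => η x ^ 2) x (v s x)) -
          ∫ x, η x ^ 2 * ((ψ s x * b (ψ s x) - β (ψ s x)) * δ s x))) -
        ((∫ x, η x ^ 2 * β (ψ t₁ x)) - ∫ x, η x ^ 2 * β (ψ t₀ x)) +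
        (t₁ - t₀) * (L * C * (κ + 2 / k * N)))) := by
  obtain ⟨M, hM⟩ := exists_isMollifier d
  have hmain := h.lintegral_sobolevConst_mul_mollify_le hr hα hα2 hβ hμ hη hη1 hC hk hN0 hN hκ
  obtain ⟨γ, hγm, hγ, hle⟩ := h.exists_enorm_integral_mul_mollifiedTransport_le hr hβ hη.sq hη1
  have hAm := fun n =>
    h.aestronglyMeasurable_integral_mul_mollifiedTransport (hM n) hβ hη.sq
  have hAlim : ∀ᵐ s ∂((volume : Measure ℝ).restrict (Ioc t₀ t₁)),
      Tendsto (fun n => ∫ x, η x ^ 2 * b (mollify (mollifier d n) (ψ s) x) *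
          mollifiedTransport (mollifier d n) (ψ s) (v s) x) atTop
        (𝓝 ((∫ x, β (ψ s x) * fderiv ℝ (fun x => η x ^ 2) x (v s x)) -
          ∫ x, η x ^ 2 * ((ψ s x * b (ψ s x) - β (ψ s x)) * δ s x))) := by
    filter_upwards [h.commutator_tendsto, h.ae_memLp_field, h.ae_memLp_div, h.weakDiv, ae_mem_Icc]
      with s hs hv hδ hdiv hm
    exact tendsto_integral_mul_mollifiedTransport hr hβ (h.memLp hm) hdiv hv hδ hη.sq hη1 hs
  have hγi : Integrable (fun s => (γ s).toReal) (volume.restrict (Ioc t₀ t₁)) :=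
    integrable_toReal_of_lintegral_ne_top hγm hγ.ne
  have hγt := ae_lt_top' hγm hγ.ne
  have hbd : ∀ n, ∀ᵐ s ∂((volume : Measure ℝ).restrict (Ioc t₀ t₁)),
      ‖∫ x, η x ^ 2 * b (mollify (mollifier d n) (ψ s) x) *
          mollifiedTransport (mollifier d n) (ψ s) (v s) x‖ ≤ (γ s).toReal := by
    intro n
    filter_upwards [hle, hγt] with s hs ht
    rw [← ENNReal.ofReal_le_iff_le_toReal ht.ne, ofReal_norm]
    exact hs n
  have hI := tendsto_integral_of_dominated_convergence _ hAm hγi hbd hAlim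
  have hZ := ((hI.sub ((tendsto_integral_mul_entropy_mollify hβ hη.sq hη1
    (h.integrable ⟨h.le, le_rfl⟩)).sub (tendsto_integral_mul_entropy_mollify hβ hη.sq hη1
    (h.integrable ⟨le_rfl, h.le⟩)))).add_const ((t₁ - t₀) * (L * C * (κ + 2 / k * N))))
  refine ⟨?_, ge_of_tendsto' hZ fun n => (hmain n).1, ?_⟩
  · refine hγi.mono' (aestronglyMeasurable_of_tendsto_ae _ hAm hAlim) ?_
    filter_upwards [hAlim, ae_all_iff.2 hbd] with s hs hb
    exact le_of_tendsto' hs.norm hb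
  · have hZ2 := (ENNReal.continuous_ofReal.tendsto _).comp (hZ.const_mul (1 + k))
    set p := ENNReal.ofReal (2 * d / (d - 2 * (α / 2)))
    set S := sobolevConst d (α / 2)
    have hFm : ∀ n, AEMeasurable (fun s => 2 * (S *
        eLpNorm (fun x => η x * F (mollify (mollifier d n) (ψ s) x)) p volume ^ 2))
        (volume.restrict (Ioc t₀ t₁)) := by
      intro n
      refine AEMeasurable.const_mul (AEMeasurable.const_mul (AEMeasurable.pow_const ?_ 2) S) 2
      exact aemeasurable_eLpNorm_of_prod
        (f := fun s x => η x * F (mollify (mollifier d n) (ψ s) x))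
        ((hη.1.continuous.aestronglyMeasurable.comp_snd).mul
          (hβ.continuous_root.comp_aestronglyMeasurable
            (aestronglyMeasurable_mollify_prod h.measurable (hM n).continuous))) p
    calc ∫⁻ s in Ioc t₀ t₁, 2 * (S * eLpNorm (fun x => η x * F (ψ s x)) p volume ^ 2)
        ≤ ∫⁻ s in Ioc t₀ t₁, liminf (fun n => 2 * (S *
          eLpNorm (fun x => η x * F (mollify (mollifier d n) (ψ s) x)) p volume ^ 2)) atTop := by
          refine lintegral_mono_ae ?_
          filter_upwards [ae_mem_Icc] with s hm
          have hfat := Lp.eLpNorm_lim_le_liminf_eLpNorm (p := p)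
            (μ := (volume : Measure (EuclideanSpace ℝ (Fin d))))
            (f := fun n x => η x * F (mollify (mollifier d n) (ψ s) x)) (fun n =>
              (hη.1.continuous.mul (hβ.continuous_root.comp ((hM n).contDiff_mollify
                (h.integrable hm).locallyIntegrable).continuous)).aestronglyMeasurable)
            (fun x => η x * F (ψ s x)) (by
              filter_upwards [ae_tendsto_mollify (h.integrable hm).locallyIntegrable] with x hx
              exact ((hβ.continuous_root.tendsto _).comp hx).const_mul _)
          set f : ℕ → ℝ≥0∞ := fun n =>
            eLpNorm (fun x => η x * F (mollify (mollifier d n) (ψ s) x)) p volume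
          have hsq : eLpNorm (fun x => η x * F (ψ s x)) p volume ^ 2 ≤
              liminf (fun n => f n ^ 2) atTop := by
            rw [sq]
            refine (mul_le_mul' hfat hfat).trans ?_
            have := ENNReal.le_liminf_mul (f := atTop) (u := f) (v := f)
            refine this.trans (le_of_eq ?_)
            congr 1
            funext n
            exact (sq _).symm
          have h2 := ENNReal.le_liminf_mul (f := (atTop : Filter ℕ)) (u := fun _ => 2 * S)
            (v := fun n => f n ^ 2)
          rw [liminf_const] at h2
          simp_rw [← mul_assoc]
          exact (mul_le_mul_right hsq _).trans h2
      _ ≤ liminf (fun n => ∫⁻ s in Ioc t₀ t₁, 2 * (S *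
          eLpNorm (fun x => η x * F (mollify (mollifier d n) (ψ s) x)) p volume ^ 2)) atTop :=
          lintegral_liminf_le' hFm
      _ ≤ _ := by
          rw [← hZ2.liminf_eq]
          exact liminf_le_liminf (Eventually.of_forall fun n => (hmain n).2)

end IsRenormalizable

end CutoffEnergy

/-! ### Controlling the cutoff and the negative divergence -/

section CutoffRemoval

variable {α : ℝ} {r r' : ℝ≥0∞} {v : ℝ → EuclideanSpace ℝ (Fin d) → EuclideanSpace ℝ (Fin d)}
  {δ ψ : ℝ → EuclideanSpace ℝ (Fin d) → ℝ} {t₀ t₁ : ℝ}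
  {η : EuclideanSpace ℝ (Fin d) → ℝ} {β b F : ℝ → ℝ} {L c : ℝ}

lemma ofReal_integral_le_lintegral_ofReal {X : Type*} [MeasurableSpace X] {μ : Measure X}
    (f : X → ℝ) : ENNReal.ofReal (∫ x, f x ∂μ) ≤ ∫⁻ x, ENNReal.ofReal (f x) ∂μ := by
  by_cases hf : Integrable f μ
  · have h1 : ∫ x, f x ∂μ ≤ ∫ x, max (f x) 0 ∂μ :=
      integral_mono hf hf.pos_part fun x => le_max_left _ _
    refine (ENNReal.ofReal_le_ofReal h1).trans ?_
    rw [ofReal_integral_eq_lintegral_ofReal hf.pos_part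
      (Eventually.of_forall fun x => le_max_right _ _)]
    refine lintegral_mono fun x => ?_
    rcases le_total (f x) 0 with h | h
    · simp [max_eq_right h]
    · simp [max_eq_left h]
  · simp [integral_undef hf]

/-- By Hölder's inequality the negative part of the divergence is absorbed by the norm in the
Sobolev inequality. -/
lemma ofReal_neg_integral_defect_le (hα : 0 < α) (hd : α < d) (hβ : IsEntropy β b F L c)
    (hη : Continuous η) {w D : EuclideanSpace ℝ (Fin d) → ℝ} (hw : AEStronglyMeasurable w volume)
    (hD : AEStronglyMeasurable D volume) {S : ℝ≥0∞}
    (hS : ENNReal.ofReal c *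
      eLpNorm (fun x => max (-(D x)) 0) (ENNReal.ofReal (d / α)) volume ≤ S) :
    ENNReal.ofReal (-∫ x, η x ^ 2 * ((w x * b (w x) - β (w x)) * D x)) ≤
      S * eLpNorm (fun x => η x * F (w x)) (ENNReal.ofReal (2 * d / (d - 2 * (α / 2))))
        volume ^ 2 := by
  have hd0 : 0 < (d : ℝ) := hα.trans hd
  have hda : 0 < (d : ℝ) - α := sub_pos.2 hd
  have hexp : (ENNReal.ofReal (d / (d - α)))⁻¹ + (ENNReal.ofReal (d / α))⁻¹ = 1 := by
    rw [← ENNReal.ofReal_inv_of_pos (by positivity), ← ENNReal.ofReal_inv_of_pos (by positivity),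
      ← ENNReal.ofReal_add (by positivity) (by positivity), ← ENNReal.ofReal_one]
    congr 1
    field_simp
    ring
  have hm : AEStronglyMeasurable (fun x => η x * F (w x)) volume :=
    hη.aestronglyMeasurable.mul (hβ.continuous_root.comp_aestronglyMeasurable hw)
  have hDm : AEStronglyMeasurable (fun x => max (-(D x)) 0) volume :=
    hD.neg.sup aestronglyMeasurable_const
  have hnorm : eLpNorm (fun x => ‖η x * F (w x)‖ ^ (2 : ℝ)) (ENNReal.ofReal (d / (d - α))) volume =
      eLpNorm (fun x => η x * F (w x)) (ENNReal.ofReal (2 * d / (d - 2 * (α / 2))))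
        volume ^ 2 := by
    rw [eLpNorm_norm_rpow _ (by norm_num), ← ENNReal.ofReal_mul (by positivity)]
    have e : (d : ℝ) / (d - α) * 2 = 2 * d / (d - 2 * (α / 2)) := by
      rw [mul_div_cancel₀ _ (two_ne_zero' ℝ)]
      ring
    rw [e]
    exact ENNReal.rpow_ofNat _ 2
  rw [← integral_neg]
  refine (ofReal_integral_le_lintegral_ofReal _).trans ?_
  calc ∫⁻ x, ENNReal.ofReal (-(η x ^ 2 * ((w x * b (w x) - β (w x)) * D x)))
      ≤ ∫⁻ x, ENNReal.ofReal c * (‖‖η x * F (w x)‖ ^ (2 : ℝ)‖ₑ * ‖max (-(D x)) 0‖ₑ) := by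
        refine lintegral_mono fun x => ?_
        have h1 := hβ.defect_nonneg (w x)
        have h2 := hβ.defect_le (w x)
        have e1 : ‖‖η x * F (w x)‖ ^ (2 : ℝ)‖ₑ = ENNReal.ofReal ((η x * F (w x)) ^ 2) := by
          rw [← ofReal_norm, Real.rpow_ofNat, Real.norm_eq_abs, Real.norm_eq_abs, sq_abs, abs_sq]
        have e2 : ‖max (-(D x)) 0‖ₑ = ENNReal.ofReal (max (-(D x)) 0) := by
          rw [← ofReal_norm, Real.norm_of_nonneg (le_max_right _ _)]
        rw [e1, e2, ← ENNReal.ofReal_mul (sq_nonneg _), ← ENNReal.ofReal_mul' (by positivity)]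
        refine ENNReal.ofReal_le_ofReal ?_
        have h3 : 0 ≤ max (-(D x)) 0 := le_max_right _ _
        calc -(η x ^ 2 * ((w x * b (w x) - β (w x)) * D x)) =
            η x ^ 2 * ((w x * b (w x) - β (w x)) * (-(D x))) := by ring
          _ ≤ η x ^ 2 * ((w x * b (w x) - β (w x)) * max (-(D x)) 0) := by
              gcongr
              exact le_max_left _ _
          _ ≤ η x ^ 2 * ((c * F (w x) ^ 2) * max (-(D x)) 0) := by gcongr
          _ = _ := by ring
    _ = ENNReal.ofReal c * ∫⁻ x, ‖‖η x * F (w x)‖ ^ (2 : ℝ)‖ₑ * ‖max (-(D x)) 0‖ₑ :=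
        lintegral_const_mul' _ _ (by simp)
    _ ≤ ENNReal.ofReal c * (eLpNorm (fun x => η x * F (w x))
          (ENNReal.ofReal (2 * d / (d - 2 * (α / 2)))) volume ^ 2 *
          eLpNorm (fun x => max (-(D x)) 0) (ENNReal.ofReal (d / α)) volume) := by
        rw [← hnorm]
        exact mul_le_mul_right (lintegral_enorm_mul_enorm_le hexp
          ((continuous_norm.rpow_const (fun _ => Or.inr (by norm_num))).comp_aestronglyMeasurable hm)
          hDm) _
    _ ≤ _ := by
        rw [mul_left_comm, mul_comm]
        exact mul_le_mul_left hS _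

namespace IsRenormalizable

/-- The localized energy estimate after absorption of the divergence. The dissipation is available
with the factor `2 / (1 + k)` and the divergence consumes it once, which leaves
`2 / (1 + k) - 1 = (1 - k) / (1 + k)`. -/
lemma cutoff_energy_le [Nonempty (Fin d)] (h : IsRenormalizable α r r' v δ ψ t₀ t₁)
    (hr : r⁻¹ + r'⁻¹ = 1) (hα : 0 < α) (hα2 : α ≤ 2) (hd : α < d) (hβ : IsEntropy β b F L c)
    (hsmall : ∀ᵐ s ∂((volume : Measure ℝ).restrict (Ioc t₀ t₁)), ENNReal.ofReal c *
      eLpNorm (fun x => max (-(δ s x)) 0) (ENNReal.ofReal (d / α)) volume ≤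
        sobolevConst d (α / 2))
    {μ : ℕ → Measure (EuclideanSpace ℝ (Fin d))} (hμ : IsLevyApprox α μ)
    (hη : IsTestFun η) (hη1 : ∀ x, |η x ^ 2| ≤ 1) {C : ℝ} (hC : ∀ s ∈ Icc t₀ t₁, ∫ x, |ψ s x| ≤ C)
    {k N κ : ℝ} (hk : 0 < k) (hk1 : k ≤ 1)
    (hN0 : 0 ≤ N) (hN : ∀ m x, ∫ y, (η x - η (x + y)) ^ 2 ∂(μ m) ≤ N)
    (hκ : ∀ x, |fracLaplacian α (fun x => η x ^ 2) x| ≤ κ) {j : ℝ → ℝ≥0∞}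
    (hjm : AEMeasurable j (volume.restrict (Ioc t₀ t₁))) (hjt : ∫⁻ s in Ioc t₀ t₁, j s < ∞)
    (hj : ∀ᵐ s ∂((volume : Measure ℝ).restrict (Ioc t₀ t₁)),
      ∫⁻ x, ‖β (ψ s x) * fderiv ℝ (fun x => η x ^ 2) x (v s x)‖ₑ ≤ j s) :
    ENNReal.ofReal ((1 - k) / (1 + k)) * (∫⁻ s in Ioc t₀ t₁, sobolevConst d (α / 2) *
      eLpNorm (fun x => η x * F (ψ s x))
      (ENNReal.ofReal (2 * d / (d - 2 * (α / 2)))) volume ^ 2) +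
      ENNReal.ofReal (∫ x, η x ^ 2 * β (ψ t₁ x)) ≤
    ENNReal.ofReal (∫ x, η x ^ 2 * β (ψ t₀ x)) + ((∫⁻ s in Ioc t₀ t₁, j s) +
      ENNReal.ofReal ((t₁ - t₀) * (L * C * (κ + 2 / k * N)))) := by
  obtain ⟨hAi, hZ0, hle⟩ :=
    h.lintegral_sobolevConst_mul_le hr hα hα2 hβ hμ hη hη1 hC hk hN0 hN hκ
  rw [lintegral_const_mul' _ _ (by simp)] at hle
  have hL := hβ.bound_nonneg
  have hC0 : 0 ≤ C := (integral_nonneg fun x => abs_nonneg _).trans (hC t₀ ⟨le_rfl, h.le⟩)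
  have hκ0 : 0 ≤ κ := (abs_nonneg _).trans (hκ 0)
  set e := (t₁ - t₀) * (L * C * (κ + 2 / k * N)) with he
  have he0 : 0 ≤ e := mul_nonneg (sub_nonneg.2 h.le) (by positivity)
  set P := ∫ x, η x ^ 2 * β (ψ t₁ x)
  set Q := ∫ x, η x ^ 2 * β (ψ t₀ x)
  have hP : 0 ≤ P := integral_nonneg fun x => mul_nonneg (sq_nonneg _) (hβ.nonneg _)
  have hQ : 0 ≤ Q := integral_nonneg fun x => mul_nonneg (sq_nonneg _) (hβ.nonneg _)
  set A : ℝ → ℝ := fun s => (∫ x, β (ψ s x) * fderiv ℝ (fun x => η x ^ 2) x (v s x)) -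
    ∫ x, η x ^ 2 * ((ψ s x * b (ψ s x) - β (ψ s x)) * δ s x) with hA
  set y := ∫⁻ s in Ioc t₀ t₁, sobolevConst d (α / 2) * eLpNorm (fun x => η x * F (ψ s x))
      (ENNReal.ofReal (2 * d / (d - 2 * (α / 2)))) volume ^ 2 with hy
  -- finiteness of the dissipation is what permits its absorption below
  have hyt : y ≠ ∞ := by
    intro ht
    rw [ht] at hle
    simp at hle
  have hAle : ENNReal.ofReal (∫ s in Ioc t₀ t₁, A s) ≤ (∫⁻ s in Ioc t₀ t₁, j s) + y := by
    refine (ofReal_integral_le_lintegral_ofReal _).trans ?_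
    rw [hy, ← lintegral_add_left' hjm]
    refine lintegral_mono_ae ?_
    filter_upwards [hj, hsmall, h.weakDiv, ae_mem_Icc] with s hs hS hdiv hm
    have h1 : A s ≤ |∫ x, β (ψ s x) * fderiv ℝ (fun x => η x ^ 2) x (v s x)| +
        -∫ x, η x ^ 2 * ((ψ s x * b (ψ s x) - β (ψ s x)) * δ s x) := by
      simp only [hA, sub_eq_add_neg]
      gcongr
      exact le_abs_self _
    refine (ENNReal.ofReal_le_ofReal h1).trans (ENNReal.ofReal_add_le.trans (add_le_add ?_ ?_))
    · rw [← Real.norm_eq_abs, ofReal_norm]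
      exact (enorm_integral_le_lintegral_enorm _).trans hs
    · exact ofReal_neg_integral_defect_le hα hd hβ hη.1.continuous (h.integrable hm).1
        hdiv.2.1.aestronglyMeasurable hS
  set a := ∫ s in Ioc t₀ t₁, A s
  set J := ∫⁻ s in Ioc t₀ t₁, j s
  have ha : a ≤ J.toReal + y.toReal := by
    rw [← ENNReal.toReal_add hjt.ne hyt]
    exact (ENNReal.ofReal_le_iff_le_toReal (ENNReal.add_ne_top.2 ⟨hjt.ne, hyt⟩)).1 hAle
  have hy2 : 2 * y.toReal ≤ (1 + k) * (a - (P - Q) + e) := by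
    have h1 := ENNReal.toReal_mono (by simp) hle
    rwa [ENNReal.toReal_mul, ENNReal.toReal_ofReal (mul_nonneg (by positivity) hZ0),
      ENNReal.toReal_ofNat] at h1
  have hreal : (1 - k) / (1 + k) * y.toReal + P ≤ Q + (J.toReal + e) := by
    have h1k : 0 < 1 + k := by positivity
    have h2 : (1 - k) * y.toReal ≤ (1 + k) * (J.toReal + Q + e - P) := by nlinarith
    have h3 : (1 - k) / (1 + k) * y.toReal ≤ J.toReal + Q + e - P := by
      rw [div_mul_eq_mul_div, div_le_iff₀ h1k, mul_comm _ (1 + k)]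
      exact h2
    linarith
  have h0 : 0 ≤ (1 - k) / (1 + k) := div_nonneg (by linarith) (by positivity)
  rw [← ENNReal.ofReal_toReal hyt, ← ENNReal.ofReal_toReal hjt.ne, ← ENNReal.ofReal_mul h0,
    ← ENNReal.ofReal_add (by positivity) hP, ← ENNReal.ofReal_add (by positivity) he0,
    ← ENNReal.ofReal_add hQ (by positivity)]
  exact ENNReal.ofReal_le_ofReal hreal

end IsRenormalizable

end CutoffRemoval

/-! ### The entropy inequality on a time interval -/

section EntropyInequality

variable {α : ℝ} {r r' : ℝ≥0∞} {v : ℝ → EuclideanSpace ℝ (Fin d) → EuclideanSpace ℝ (Fin d)}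
  {δ ψ : ℝ → EuclideanSpace ℝ (Fin d) → ℝ} {t₀ t₁ : ℝ} {β b F : ℝ → ℝ} {L c : ℝ}

/-- A cutoff whose dilations have derivatives which decay like `1 / (1 + |x|)`, uniformly in the
scale, and live away from the origin. -/
lemma exists_cutoff (d : ℕ) : ∃ (η : EuclideanSpace ℝ (Fin d) → ℝ) (K : ℝ), 0 ≤ K ∧ IsTestFun η ∧
    (∀ x, 0 ≤ η x ∧ η x ≤ 1) ∧ (∀ x, ‖x‖ ≤ 1 → η x = 1) ∧
    ∀ l : ℝ, 0 < l → l ≤ 1 → ∀ x, ‖fderiv ℝ (fun y => η (l • y) ^ 2) x‖ * (1 + ‖x‖) ≤ K ∧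
      (l * ‖x‖ < 1 → fderiv ℝ (fun y => η (l • y) ^ 2) x = 0) := by
  set f : ContDiffBump (0 : EuclideanSpace ℝ (Fin d)) := ⟨1, 2, one_pos, one_lt_two⟩ with hf
  have hη : IsTestFun (f : EuclideanSpace ℝ (Fin d) → ℝ) := ⟨f.contDiff, f.hasCompactSupport⟩
  have hone : ∀ x : EuclideanSpace ℝ (Fin d), ‖x‖ ≤ 1 → f x = 1 := fun x hx =>
    f.one_of_mem_closedBall (by simpa [hf] using hx)
  set χ : EuclideanSpace ℝ (Fin d) → ℝ := fun x => f x ^ 2 with hχ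
  obtain ⟨K, hK⟩ := (hη.sq.2.fderiv ℝ).exists_bound_of_continuous
    (hη.sq.1.continuous_fderiv (by simp))
  have hK0 : 0 ≤ K := (norm_nonneg _).trans (hK 0)
  have hfar : ∀ x : EuclideanSpace ℝ (Fin d), 2 < ‖x‖ → fderiv ℝ χ x = 0 := by
    intro x hx
    have : x ∉ tsupport χ := by
      intro hmem
      have h1 : tsupport χ ⊆ tsupport (f : EuclideanSpace ℝ (Fin d) → ℝ) :=
        closure_mono fun y hy => by
          simp only [hχ, Function.mem_support] at hy ⊢
          exact fun h0 => hy (by simp [h0])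
      have h2 := h1 hmem
      rw [f.tsupport_eq] at h2
      have h3 : ‖x‖ ≤ 2 := by simpa [hf] using h2
      linarith
    exact image_eq_zero_of_notMem_tsupport fun hmem => this (tsupport_fderiv_subset ℝ hmem)
  have hnear : ∀ x : EuclideanSpace ℝ (Fin d), ‖x‖ < 1 → fderiv ℝ χ x = 0 := by
    intro x hx
    have : χ =ᶠ[𝓝 x] fun _ => 1 := by
      filter_upwards [(continuous_norm.tendsto x).eventually (gt_mem_nhds hx)] with y hy
      simp [hχ, hone y hy.le]
    rw [this.fderiv_eq]
    simp
  refine ⟨f, 3 * K, by positivity, hη, fun x => ⟨f.nonneg, f.le_one⟩, hone,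
    fun l hl hl1 x => ?_⟩
  have e : fderiv ℝ (fun y => f (l • y) ^ 2) x = l • fderiv ℝ χ (l • x) :=
    fderiv_comp_smul (f := χ) (c := l) (x := x)
  have hnx : ‖l • x‖ = l * ‖x‖ := by rw [norm_smul, Real.norm_of_nonneg hl.le]
  rw [e]
  refine ⟨?_, fun h => by rw [hnear _ (by rwa [hnx]), smul_zero]⟩
  rw [norm_smul, Real.norm_of_nonneg hl.le]
  by_cases h2 : 2 < ‖l • x‖
  · rw [hfar _ h2]
    simp only [norm_zero, mul_zero, zero_mul]
    positivity
  · rw [not_lt, hnx] at h2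
    calc l * ‖fderiv ℝ χ (l • x)‖ * (1 + ‖x‖) = ‖fderiv ℝ χ (l • x)‖ * (l + l * ‖x‖) := by ring
      _ ≤ K * (1 + 2) := by
          gcongr
          exact hK _
      _ = 3 * K := by ring

/-- The entropy inequality: the cutoff in space is removed with the growth condition on the field
and the decay of the nonlocal errors under dilation. -/
theorem IsRenormalizable.entropy_le [Nonempty (Fin d)]
    (h : IsRenormalizable α r r' v δ ψ t₀ t₁)
    (hr : r⁻¹ + r'⁻¹ = 1) (hα : 0 < α) (hα2 : α ≤ 2) (hd : α < d) (hβ : IsEntropy β b F L c)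
    (hsmall : ∀ᵐ s ∂((volume : Measure ℝ).restrict (Ioc t₀ t₁)), ENNReal.ofReal c *
      eLpNorm (fun x => max (-(δ s x)) 0) (ENNReal.ofReal (d / α)) volume ≤
        sobolevConst d (α / 2)) :
    (∫⁻ s in Ioc t₀ t₁, sobolevConst d (α / 2) * eLpNorm (fun x => F (ψ s x))
      (ENNReal.ofReal (2 * d / (d - 2 * (α / 2)))) volume ^ 2) +
      ∫⁻ x, ENNReal.ofReal (β (ψ t₁ x)) ≤ ∫⁻ x, ENNReal.ofReal (β (ψ t₀ x)) := by
  obtain ⟨μ, hμ⟩ := exists_isLevyApprox d hα hα2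
  obtain ⟨η, K, hK0, hη, hη01, hηone, hηD⟩ := exists_cutoff d
  obtain ⟨N, hN0, hN⟩ := hμ.exists_integral_sq_sub_comp_smul_le hα hα2 hη
  obtain ⟨κ, hκ0, hκ⟩ := exists_abs_fracLaplacian_comp_smul_le hα hα2 hη.sq
  obtain ⟨C, hC⟩ := h.bounded
  obtain ⟨g, hgm, hgi, hg⟩ := h.growth
  have hL := hβ.bound_nonneg
  have hCi : ∀ s ∈ Icc t₀ t₁, ∫ x, |ψ s x| ≤ (C : ℝ) := by
    intro s hs
    have h1 := (hC s hs).2.1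
    rw [eLpNorm_one_eq_lintegral_enorm, ← ofReal_integral_norm_eq_lintegral_enorm
      (h.integrable hs)] at h1
    have h2 := ENNReal.toReal_mono (by simp) h1
    rwa [ENNReal.toReal_ofReal (integral_nonneg fun x => norm_nonneg _)] at h2
  -- The scales of the cutoff, and the parameter of Young's inequality. The cutoff costs `l ^ α / k`,
  -- so with `k = l ^ (α / 2)` both the cost and the loss of dissipation vanish in the limit.
  set l : ℕ → ℝ := fun m => ((m : ℝ) + 1)⁻¹ with hl
  have hl0 : ∀ m, 0 < l m := fun m => by simp only [hl]; positivity
  have hl1 : ∀ m, l m ≤ 1 := fun m => inv_le_one_of_one_le₀ (by linarith [m.cast_nonneg (α := ℝ)])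
  have hlt : Tendsto l atTop (𝓝 0) := tendsto_scale
  set k : ℕ → ℝ := fun m => l m ^ (α / 2) with hk
  have hk0 : ∀ m, 0 < k m := fun m => Real.rpow_pos_of_pos (hl0 m) _
  have hk1 : ∀ m, k m ≤ 1 := fun m => Real.rpow_le_one (hl0 m).le (hl1 m) (by positivity)
  have hkt : Tendsto k atTop (𝓝 0) := by
    have := hlt.rpow_const (p := α / 2) (Or.inr (by positivity))
    rwa [Real.zero_rpow (by positivity)] at this
  have hkk : ∀ m, l m ^ α = k m * k m := fun m => by
    rw [hk, ← Real.rpow_add (hl0 m)]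
    ring_nf
  set ν := ((volume : Measure ℝ).restrict (Ioc t₀ t₁)).prod
    (volume : Measure (EuclideanSpace ℝ (Fin d))) with hν
  -- the transport through the cutoff only sees the region `A m`, which escapes to infinity
  set A : ℕ → Set (ℝ × EuclideanSpace ℝ (Fin d)) := fun m => {z | 1 ≤ l m * ‖z.2‖} with hA
  have hAm : ∀ m, MeasurableSet (A m) := fun m =>
    measurableSet_le measurable_const (by fun_prop)
  set G : ℝ × EuclideanSpace ℝ (Fin d) → ℝ≥0∞ := fun z =>
    ENNReal.ofReal (L * K) * (‖ψ z.1 z.2‖ₑ * g z.1 z.2) with hG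
  have hGm : AEMeasurable G ν := (h.measurable.enorm.mul hgm).const_mul _
  have hGi : ∫⁻ z, G z ∂ν ≠ ∞ := by
    rw [hG, lintegral_const_mul' _ _ (by simp)]
    exact ENNReal.mul_ne_top (by simp) hgi.ne
  set j : ℕ → ℝ → ℝ≥0∞ := fun m s => ∫⁻ x, (A m).indicator G (s, x) with hj
  have hJ : ∀ m, ∫⁻ s in Ioc t₀ t₁, j m s = ∫⁻ z, (A m).indicator G z ∂ν := fun m =>
    (lintegral_prod _ (hGm.indicator (hAm m))).symm
  have hJlim : Tendsto (fun m => ∫⁻ s in Ioc t₀ t₁, j m s) atTop (𝓝 0) := by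
    simp_rw [hJ]
    have := tendsto_lintegral_of_dominated_convergence' (μ := ν)
      (F := fun m z => (A m).indicator G z) (f := fun _ => 0) G
      (fun m => hGm.indicator (hAm m))
      (fun m => Eventually.of_forall fun z => indicator_le_self _ _ z) hGi
      (Eventually.of_forall fun z => ?_)
    · simpa using this
    · have h1 : Tendsto (fun m => l m * ‖z.2‖) atTop (𝓝 0) := by simpa using hlt.mul_const ‖z.2‖
      refine tendsto_const_nhds.congr' ?_
      filter_upwards [h1.eventually (gt_mem_nhds one_pos)] with m hm
      rw [indicator_of_notMem]
      simpa [hA] using hm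
  have hηm : ∀ m, IsTestFun fun x => η (l m • x) := fun m => hη.comp_smul (hl0 m).ne'
  have hbd : ∀ m, ∀ᵐ s ∂((volume : Measure ℝ).restrict (Ioc t₀ t₁)),
      ∫⁻ x, ‖β (ψ s x) * fderiv ℝ (fun x => η (l m • x) ^ 2) x (v s x)‖ₑ ≤ j m s := by
    intro m
    filter_upwards [Measure.ae_ae_of_ae_prod hg] with s hs
    refine lintegral_mono_ae ?_
    filter_upwards [hs] with x hx
    obtain ⟨h1, h2⟩ := hηD (l m) (hl0 m) (hl1 m) x
    by_cases hmem : 1 ≤ l m * ‖x‖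
    · have : (s, x) ∈ A m := hmem
      rw [indicator_of_mem this, enorm_mul]
      have e1 : ‖fderiv ℝ (fun x => η (l m • x) ^ 2) x (v s x)‖ₑ ≤ ENNReal.ofReal K * g s x := by
        calc ‖fderiv ℝ (fun x => η (l m • x) ^ 2) x (v s x)‖ₑ
            ≤ ENNReal.ofReal ‖fderiv ℝ (fun x => η (l m • x) ^ 2) x‖ * ‖v s x‖ₑ := by
              rw [← ofReal_norm, ← ofReal_norm (v s x), ← ENNReal.ofReal_mul (norm_nonneg _)]
              exact ENNReal.ofReal_le_ofReal (ContinuousLinearMap.le_opNorm _ _)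
          _ ≤ ENNReal.ofReal ‖fderiv ℝ (fun x => η (l m • x) ^ 2) x‖ *
              (ENNReal.ofReal (1 + ‖x‖) * g s x) := mul_le_mul_right hx _
          _ ≤ _ := by
              rw [← mul_assoc, ← ENNReal.ofReal_mul (norm_nonneg _)]
              exact mul_le_mul_left (ENNReal.ofReal_le_ofReal h1) _
      refine (mul_le_mul' (enorm_entropy_le hβ _) e1).trans (le_of_eq ?_)
      simp only [hG]
      rw [ENNReal.ofReal_mul hL]
      ring
    · rw [h2 (not_le.1 hmem)]
      simp
  have key : ∀ m, ENNReal.ofReal ((1 - k m) / (1 + k m)) *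
      (∫⁻ s in Ioc t₀ t₁, sobolevConst d (α / 2) * eLpNorm (fun x => η (l m • x) * F (ψ s x))
        (ENNReal.ofReal (2 * d / (d - 2 * (α / 2)))) volume ^ 2) +
      ENNReal.ofReal (∫ x, η (l m • x) ^ 2 * β (ψ t₁ x)) ≤
      (∫⁻ x, ENNReal.ofReal (β (ψ t₀ x))) + ((∫⁻ s in Ioc t₀ t₁, j m s) +
      ENNReal.ofReal ((t₁ - t₀) * (L * C * (κ * (k m * k m) + 2 * N * k m)))) := by
    intro m
    have h1 := h.cutoff_energy_le hr hα hα2 hd hβ hsmall hμ (hηm m)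
      (fun x => by
        rw [abs_of_nonneg (sq_nonneg _)]
        exact pow_le_one₀ (hη01 _).1 (hη01 _).2) hCi (hk0 m) (hk1 m)
      (N := N * l m ^ α) (mul_nonneg hN0 (Real.rpow_nonneg (hl0 m).le _))
      (hN (l m) (hl0 m)) (hκ (l m) (hl0 m)) (j := j m)
      (hGm.indicator (hAm m)).lintegral_prod_right' (by
        rw [hJ]
        exact (lintegral_mono fun z => indicator_le_self _ _ z).trans_lt hGi.lt_top) (hbd m)
    have e1 : κ * l m ^ α + 2 / k m * (N * l m ^ α) = κ * (k m * k m) + 2 * N * k m := by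
      rw [hkk]
      field_simp [(hk0 m).ne']
    rw [e1] at h1
    refine h1.trans (add_le_add ?_ le_rfl)
    rw [← ofReal_integral_eq_lintegral_ofReal (hβ.integrable_comp (h.integrable ⟨le_rfl, h.le⟩))
      (Eventually.of_forall fun x => hβ.nonneg _)]
    refine ENNReal.ofReal_le_ofReal (integral_mono_of_nonneg
      (Eventually.of_forall fun x => mul_nonneg (sq_nonneg _) (hβ.nonneg _))
      (hβ.integrable_comp (h.integrable ⟨le_rfl, h.le⟩)) (Eventually.of_forall fun x => ?_))
    exact mul_le_of_le_one_left (hβ.nonneg _) (pow_le_one₀ (hη01 _).1 (hη01 _).2)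
  -- passage to the limit
  have hηlim : ∀ x : EuclideanSpace ℝ (Fin d), ∀ᶠ m in atTop, η (l m • x) = 1 := by
    intro x
    have h1 : Tendsto (fun m => l m * ‖x‖) atTop (𝓝 0) := by simpa using hlt.mul_const ‖x‖
    filter_upwards [h1.eventually (gt_mem_nhds one_pos)] with m hm
    refine hηone _ ?_
    rw [norm_smul, Real.norm_of_nonneg (hl0 m).le]
    exact hm.le
  have hPlim : Tendsto (fun m => ENNReal.ofReal (∫ x, η (l m • x) ^ 2 * β (ψ t₁ x))) atTop
      (𝓝 (∫⁻ x, ENNReal.ofReal (β (ψ t₁ x)))) := by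
    have hi := hβ.integrable_comp (h.integrable ⟨h.le, le_rfl⟩)
    rw [← ofReal_integral_eq_lintegral_ofReal hi (Eventually.of_forall fun x => hβ.nonneg _)]
    refine (ENNReal.continuous_ofReal.tendsto _).comp
      (tendsto_integral_of_dominated_convergence (fun x => β (ψ t₁ x)) (fun m =>
        (hηm m).sq.1.continuous.aestronglyMeasurable.mul hi.1) hi (fun m =>
        Eventually.of_forall fun x => ?_) (Eventually.of_forall fun x => ?_))
    · rw [Real.norm_of_nonneg (mul_nonneg (sq_nonneg _) (hβ.nonneg _))]
      exact mul_le_of_le_one_left (hβ.nonneg _) (pow_le_one₀ (hη01 _).1 (hη01 _).2)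
    · refine tendsto_const_nhds.congr' ?_
      filter_upwards [hηlim x] with m hm
      simp [hm]
  have hPfin : (∫⁻ x, ENNReal.ofReal (β (ψ t₁ x))) ≠ ∞ := by
    rw [← ofReal_integral_eq_lintegral_ofReal (hβ.integrable_comp (h.integrable ⟨h.le, le_rfl⟩))
      (Eventually.of_forall fun x => hβ.nonneg _)]
    simp
  have hRlim : Tendsto (fun m => (∫⁻ x, ENNReal.ofReal (β (ψ t₀ x))) +
      ((∫⁻ s in Ioc t₀ t₁, j m s) +
      ENNReal.ofReal ((t₁ - t₀) * (L * C * (κ * (k m * k m) + 2 * N * k m))))) atTop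
      (𝓝 (∫⁻ x, ENNReal.ofReal (β (ψ t₀ x)))) := by
    have h1 := (((((hkt.mul hkt).const_mul κ).add (hkt.const_mul (2 * N))).const_mul
      (L * (C : ℝ))).const_mul (t₁ - t₀))
    have h2 := (ENNReal.continuous_ofReal.tendsto _).comp h1
    have h3 := (tendsto_const_nhds (x := ∫⁻ x, ENNReal.ofReal (β (ψ t₀ x)))).add (hJlim.add h2)
    simpa using h3
  have hθ : Tendsto (fun m => ENNReal.ofReal ((1 - k m) / (1 + k m))) atTop (𝓝 1) := by
    have h1 := (hkt.const_sub 1).div (hkt.const_add 1) (by norm_num)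
    have h2 : Tendsto (fun m => ENNReal.ofReal ((1 - k m) / (1 + k m))) atTop
        (𝓝 (ENNReal.ofReal ((1 - 0) / (1 + 0)))) := (ENNReal.continuous_ofReal.tendsto _).comp h1
    simpa using h2
  set p := ENNReal.ofReal (2 * d / (d - 2 * (α / 2)))
  set S := sobolevConst d (α / 2)
  set y : ℕ → ℝ≥0∞ := fun m => ∫⁻ s in Ioc t₀ t₁,
    S * eLpNorm (fun x => η (l m • x) * F (ψ s x)) p volume ^ 2 with hy
  have hFatou : (∫⁻ s in Ioc t₀ t₁, S * eLpNorm (fun x => F (ψ s x)) p volume ^ 2) ≤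
      liminf y atTop := by
    have hFm : ∀ m, AEMeasurable (fun s => S *
        eLpNorm (fun x => η (l m • x) * F (ψ s x)) p volume ^ 2)
        (volume.restrict (Ioc t₀ t₁)) := by
      intro m
      refine AEMeasurable.const_mul (AEMeasurable.pow_const ?_ 2) S
      exact aemeasurable_eLpNorm_of_prod (f := fun s x => η (l m • x) * F (ψ s x))
        (((hηm m).1.continuous.aestronglyMeasurable.comp_snd).mul
          (hβ.continuous_root.comp_aestronglyMeasurable h.measurable)) p
    refine le_trans (lintegral_mono_ae ?_) (lintegral_liminf_le' hFm)
    filter_upwards [ae_mem_Icc] with s hm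
    have hfat := Lp.eLpNorm_lim_le_liminf_eLpNorm (p := p)
      (μ := (volume : Measure (EuclideanSpace ℝ (Fin d))))
      (f := fun m x => η (l m • x) * F (ψ s x)) (fun m =>
        (hηm m).1.continuous.aestronglyMeasurable.mul
          (hβ.continuous_root.comp_aestronglyMeasurable (h.integrable hm).1))
      (fun x => F (ψ s x)) (Eventually.of_forall fun x => by
        refine tendsto_const_nhds.congr' ?_
        filter_upwards [hηlim x] with m hm
        simp [hm])
    set f : ℕ → ℝ≥0∞ := fun m => eLpNorm (fun x => η (l m • x) * F (ψ s x)) p volume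
    have hsq : eLpNorm (fun x => F (ψ s x)) p volume ^ 2 ≤ liminf (fun m => f m ^ 2) atTop := by
      rw [sq]
      refine (mul_le_mul' hfat hfat).trans ?_
      refine (ENNReal.le_liminf_mul (f := atTop) (u := f) (v := f)).trans (le_of_eq ?_)
      congr 1
      funext m
      exact (sq _).symm
    have h2 := ENNReal.le_liminf_mul (f := (atTop : Filter ℕ)) (u := fun _ => S)
      (v := fun m => f m ^ 2)
    rw [liminf_const] at h2
    exact (mul_le_mul_right hsq _).trans h2
  have hyle : ∀ m, ENNReal.ofReal ((1 - k m) / (1 + k m)) * y m ≤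
      ((∫⁻ x, ENNReal.ofReal (β (ψ t₀ x))) + ((∫⁻ s in Ioc t₀ t₁, j m s) +
      ENNReal.ofReal ((t₁ - t₀) * (L * C * (κ * (k m * k m) + 2 * N * k m))))) -
      ENNReal.ofReal (∫ x, η (l m • x) ^ 2 * β (ψ t₁ x)) := fun m =>
    ENNReal.le_sub_of_add_le_right ENNReal.ofReal_ne_top (key m)
  have hsub := ENNReal.Tendsto.sub hRlim hPlim (Or.inr hPfin)
  have hPQ : (∫⁻ x, ENNReal.ofReal (β (ψ t₁ x))) ≤ ∫⁻ x, ENNReal.ofReal (β (ψ t₀ x)) :=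
    le_of_tendsto_of_tendsto' hPlim hRlim fun m => le_add_self.trans (key m)
  have hfin : (∫⁻ s in Ioc t₀ t₁, S * eLpNorm (fun x => F (ψ s x)) p volume ^ 2) ≤
      (∫⁻ x, ENNReal.ofReal (β (ψ t₀ x))) - ∫⁻ x, ENNReal.ofReal (β (ψ t₁ x)) := by
    have h1 := ENNReal.le_liminf_mul (f := (atTop : Filter ℕ))
      (u := fun m => ENNReal.ofReal ((1 - k m) / (1 + k m))) (v := y)
    rw [hθ.liminf_eq, one_mul] at h1
    refine (hFatou.trans h1).trans ?_
    rw [← hsub.liminf_eq]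
    exact liminf_le_liminf (Eventually.of_forall hyle)
  exact (add_le_add_left hfin _).trans (le_of_eq (tsub_add_cancel_of_le hPQ))

end EntropyInequality

/-! ### From weak solutions to the entropy inequality -/

section WeakSolutions

variable {α : ℝ} {T r r' : ℝ≥0∞} {v : ℝ → EuclideanSpace ℝ (Fin d) → EuclideanSpace ℝ (Fin d)}
  {δ ψ : ℝ → EuclideanSpace ℝ (Fin d) → ℝ} {ψ₀ : EuclideanSpace ℝ (Fin d) → ℝ} {t₀ t₁ : ℝ}

lemma mem_timeInterval_of_le {s t : ℝ} (hs : 0 ≤ s) (hst : s ≤ t) (ht : t ∈ timeInterval T) :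
    s ∈ timeInterval T :=
  ⟨hs, (ENNReal.ofReal_le_ofReal hst).trans ht.2⟩

lemma Ioc_subset_timeInterval (h0 : 0 ≤ t₀) (ht : t₁ ∈ timeInterval T) :
    Ioc t₀ t₁ ⊆ timeInterval T := fun _ hs =>
  mem_timeInterval_of_le (h0.trans hs.1.le) hs.2 ht

lemma prod_restrict_absolutelyContinuous_spaceTime (h0 : 0 ≤ t₀) (ht : t₁ ∈ timeInterval T) :
    ((volume : Measure ℝ).restrict (Ioc t₀ t₁)).prod
      (volume : Measure (EuclideanSpace ℝ (Fin d))) ≪ spaceTime d T :=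
  (Measure.restrict_mono (Ioc_subset_timeInterval h0 ht) le_rfl).absolutelyContinuous.prod
    Measure.AbsolutelyContinuous.rfl

lemma ae_restrict_Ioc_of_ae_timeInterval {P : ℝ → Prop} (h0 : 0 ≤ t₀) (ht : t₁ ∈ timeInterval T)
    (h : ∀ᵐ s ∂((volume : Measure ℝ).restrict (timeInterval T)), P s) :
    ∀ᵐ s ∂((volume : Measure ℝ).restrict (Ioc t₀ t₁)), P s :=
  ae_restrict_of_ae_restrict_of_subset (Ioc_subset_timeInterval h0 ht) h

lemma lintegral_Ioc_lt_top_of_zero {f : ℝ → ℝ≥0∞} (h0 : 0 ≤ t₀)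
    (h : ∫⁻ s in Ioc 0 t₁, f s < ∞) : ∫⁻ s in Ioc t₀ t₁, f s < ∞ :=
  (lintegral_mono_set (Ioc_subset_Ioc_left h0)).trans_lt h

lemma IsTransportField.lintegral_eLpNorm_ball_lt_top (hv : IsTransportField T r' v δ) (hr1 : 1 ≤ r')
    (ht : t₁ ∈ timeInterval T) (R : ℝ) :
    ∫⁻ s in Ioc 0 t₁, eLpNorm (v s) r' (volume.restrict (Metric.ball 0 R)) < ∞ := by
  obtain ⟨a, b, ⟨ham, ha⟩, ⟨hbm, hb⟩, hab⟩ := hv.growth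
  have hac := prod_restrict_absolutelyContinuous_spaceTime (d := d) le_rfl ht
  set B := Metric.ball (0 : EuclideanSpace ℝ (Fin d)) R with hB
  set V := volume B ^ (1 / r'.toReal - 1 / (∞ : ℝ≥0∞).toReal) with hV
  have hVt : V ≠ ∞ := by
    refine ENNReal.rpow_ne_top_of_nonneg ?_ measure_ball_lt_top.ne
    simp
  have hbound : ∀ᵐ s ∂((volume : Measure ℝ).restrict (Ioc 0 t₁)),
      eLpNorm (v s) r' (volume.restrict B) ≤ ENNReal.ofReal (1 + R) *
        (V * eLpNorm (a s) ∞ volume + eLpNorm (b s) r' volume) := by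
    filter_upwards [Measure.ae_ae_of_ae_prod (hac.ae_le hab), (ham.mono_ac hac).prodMk_left,
      (hbm.mono_ac hac).prodMk_left] with s hs has hbs
    have h1 : eLpNorm (v s) r' (volume.restrict B) ≤
        ENNReal.ofReal (1 + R) * eLpNorm (fun x => a s x + b s x) r' (volume.restrict B) := by
      refine eLpNorm_le_mul_eLpNorm_of_ae_le_mul ?_ _
      filter_upwards [ae_restrict_of_ae hs,
        ae_restrict_mem (Metric.isOpen_ball.measurableSet : MeasurableSet B)] with x hx hxB
      rw [hx, norm_smul, Real.norm_of_nonneg (by positivity)]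
      rw [hB, mem_ball_zero_iff] at hxB
      gcongr
    refine h1.trans (mul_le_mul_right ((eLpNorm_add_le has.restrict hbs.restrict hr1).trans
      (add_le_add ?_ (eLpNorm_mono_measure _ Measure.restrict_le_self))) _)
    refine (eLpNorm_le_eLpNorm_mul_rpow_measure_univ le_top has.restrict).trans ?_
    rw [Measure.restrict_apply_univ, mul_comm]
    exact mul_le_mul_right (eLpNorm_mono_measure _ Measure.restrict_le_self) _
  refine (lintegral_mono_ae hbound).trans_lt ?_
  rw [lintegral_const_mul' _ _ (by simp), lintegral_add_right' _
    (aemeasurable_eLpNorm_of_prod (hbm.mono_ac hac) r'), lintegral_const_mul' _ _ hVt]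
  exact ENNReal.mul_lt_top (by simp) (ENNReal.add_lt_top.2
    ⟨ENNReal.mul_lt_top hVt.lt_top (ha t₁ ht), hb t₁ ht⟩)

lemma IsWeakSolution.integrableOn_integral_mul (hv : IsTransportField T r' v δ)
    (hr : r⁻¹ + r'⁻¹ = 1) (hα : 0 < α) (hα2 : α ≤ 2)
    (hψ : IsWeakSolution α T r v ψ₀ ψ) (ht : t₁ ∈ timeInterval T)
    {φ : EuclideanSpace ℝ (Fin d) → ℝ} (hφ : IsTestFun φ) :
    IntegrableOn (fun τ => ∫ x, ψ τ x * (fderiv ℝ φ x (v τ x) - fracLaplacian α φ x))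
      (Ioc 0 t₁) volume := by
  have hac := prod_restrict_absolutelyContinuous_spaceTime (d := d) le_rfl ht
  obtain ⟨C, hC⟩ := hψ.bounded t₁ ht
  obtain ⟨A, hA0, hA⟩ := exists_abs_fracLaplacian_le α φ
  obtain ⟨K, hK⟩ := (hφ.2.fderiv ℝ).exists_bound_of_continuous (hφ.1.continuous_fderiv (by simp))
  obtain ⟨R, -, hR⟩ := exists_forall_lt_norm_eq_zero (hφ.2.fderiv ℝ)
  have hΛ := continuous_fracLaplacian hα hα2 hφ
  have hvm := hv.measurable.mono_ac hac
  have hψm := hψ.measurable.mono_ac hac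
  refine ⟨AEStronglyMeasurable.integral_prod_right'
    (f := fun z : ℝ × EuclideanSpace ℝ (Fin d) =>
      ψ z.1 z.2 * (fderiv ℝ φ z.2 (v z.1 z.2) - fracLaplacian α φ z.2))
    (hψm.mul ((aestronglyMeasurable_clm_apply
      ((hφ.1.continuous_fderiv (by simp)).aestronglyMeasurable.comp_snd) hvm).sub
      hΛ.aestronglyMeasurable.comp_snd)), ?_⟩
  have hbound : ∀ᵐ s ∂((volume : Measure ℝ).restrict (Ioc 0 t₁)),
      ‖∫ x, ψ s x * (fderiv ℝ φ x (v s x) - fracLaplacian α φ x)‖ₑ ≤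
        C * (ENNReal.ofReal K * eLpNorm (v s) r' (volume.restrict (Metric.ball 0 (R + 1)))) +
          C * ENNReal.ofReal A := by
    filter_upwards [hvm.prodMk_left, ae_restrict_mem measurableSet_Ioc] with s hvs hs
    have hs' : s ∈ Icc 0 t₁ := Ioc_subset_Icc_self hs
    have hψs := hψ.measurable_slice s (mem_timeInterval_of_le hs'.1 hs'.2 ht)
    have hDv : AEStronglyMeasurable (fun x => fderiv ℝ φ x (v s x)) volume :=
      aestronglyMeasurable_clm_apply (hφ.1.continuous_fderiv (by simp)).aestronglyMeasurable hvs
    have h1 : eLpNorm (fun x => fderiv ℝ φ x (v s x)) r' volume ≤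
        ENNReal.ofReal K * eLpNorm (v s) r' (volume.restrict (Metric.ball 0 (R + 1))) := by
      rw [← eLpNorm_indicator_ball]
      refine eLpNorm_le_mul_eLpNorm_of_ae_le_mul (Eventually.of_forall fun x => ?_) _
      by_cases hx : x ∈ Metric.ball (0 : EuclideanSpace ℝ (Fin d)) (R + 1)
      · rw [indicator_of_mem hx]
        exact ((fderiv ℝ φ x).le_opNorm _).trans
          (mul_le_mul_of_nonneg_right (hK x) (norm_nonneg _))
      · rw [mem_ball_zero_iff, not_lt] at hx
        rw [hR x (by linarith)]
        simpa using mul_nonneg ((norm_nonneg _).trans (hK 0)) (norm_nonneg _)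
    have h2 : eLpNorm (fracLaplacian α φ) ∞ volume ≤ ENNReal.ofReal A := by
      rw [eLpNorm_exponent_top]
      exact eLpNormEssSup_le_of_ae_bound (Eventually.of_forall hA)
    calc ‖∫ x, ψ s x * (fderiv ℝ φ x (v s x) - fracLaplacian α φ x)‖ₑ
        ≤ ∫⁻ x, (‖ψ s x‖ₑ * ‖fderiv ℝ φ x (v s x)‖ₑ + ‖ψ s x‖ₑ * ‖fracLaplacian α φ x‖ₑ) := by
          refine (enorm_integral_le_lintegral_enorm _).trans (lintegral_mono fun x => ?_)
          rw [enorm_mul, ← mul_add]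
          exact mul_le_mul_right enorm_sub_le _
      _ = (∫⁻ x, ‖ψ s x‖ₑ * ‖fderiv ℝ φ x (v s x)‖ₑ) +
          ∫⁻ x, ‖ψ s x‖ₑ * ‖fracLaplacian α φ x‖ₑ :=
          lintegral_add_left' (hψs.enorm.mul hDv.enorm) _
      _ ≤ _ := add_le_add
          ((lintegral_enorm_mul_enorm_le hr hψs hDv).trans (mul_le_mul' (hC s hs').2 h1))
          ((lintegral_enorm_mul_enorm_le (r := 1) (r' := ∞) (by simp) hψs
            hΛ.aestronglyMeasurable).trans (mul_le_mul' (hC s hs').1 h2))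
  refine (lintegral_mono_ae hbound).trans_lt ?_
  rw [lintegral_add_right' _ aemeasurable_const, lintegral_const_mul' _ _ (by simp),
    lintegral_const_mul' _ _ (by simp), lintegral_const]
  exact ENNReal.add_lt_top.2 ⟨ENNReal.mul_lt_top (by simp) (ENNReal.mul_lt_top (by simp)
    (hv.lintegral_eLpNorm_ball_lt_top (one_le_of_inv_add_inv (by rwa [add_comm])) ht _)),
    ENNReal.mul_lt_top
      (ENNReal.mul_lt_top (by simp) (by simp)) (by simp)⟩

/-- A weak solution is renormalizable on `[t₀, t₁]` as soon as the commutators are controlled. -/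
lemma IsWeakSolution.isRenormalizable (hv : IsTransportField T r' v δ)
    (hr : r⁻¹ + r'⁻¹ = 1) (hα : 0 < α) (hα2 : α ≤ 2)
    (hψ : IsWeakSolution α T r v ψ₀ ψ) (h0 : 0 ≤ t₀) (h01 : t₀ ≤ t₁) (ht : t₁ ∈ timeInterval T)
    (hlim : ∀ᵐ s ∂((volume : Measure ℝ).restrict (Ioc t₀ t₁)), ∀ R : ℝ,
      Tendsto (fun n => ∫⁻ x in Metric.ball 0 R,
        ‖transportCommutator (mollifier d n) (ψ s) (v s) x + ψ s x * δ s x‖ₑ) atTop (𝓝 0))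
    (hle : ∀ R : ℝ, ∃ D : ℝ → ℝ≥0∞,
      AEMeasurable D ((volume : Measure ℝ).restrict (Ioc t₀ t₁)) ∧ ∫⁻ s in Ioc t₀ t₁, D s < ∞ ∧
      ∀ᵐ s ∂((volume : Measure ℝ).restrict (Ioc t₀ t₁)), ∀ n,
        ∫⁻ x in Metric.ball 0 R, ‖transportCommutator (mollifier d n) (ψ s) (v s) x‖ₑ ≤ D s) :
    IsRenormalizable α r r' v δ ψ t₀ t₁ := by
  have hac := prod_restrict_absolutelyContinuous_spaceTime (d := d) h0 ht
  have hsub : Icc t₀ t₁ ⊆ Icc 0 t₁ := Icc_subset_Icc_left h0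
  refine
    { le := h01
      measurable := hψ.measurable.mono_ac hac
      measurable_field := hv.measurable.mono_ac hac
      measurable_div := hv.div_mem.1.mono_ac hac
      bounded := ?_
      equation := ?_
      field_lt_top := fun R =>
        lintegral_Ioc_lt_top_of_zero h0 (hv.lintegral_eLpNorm_ball_lt_top
      (one_le_of_inv_add_inv (by rwa [add_comm])) ht R)
      div_lt_top := fun R => lintegral_Ioc_lt_top_of_zero h0 (hv.div_mem.2 t₁ ht R)
      weakDiv := ae_restrict_Ioc_of_ae_timeInterval h0 ht hv.weakDiv
      commutator_tendsto := hlim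
      commutator_le := hle
      growth := ?_ }
  · obtain ⟨C, hC⟩ := hψ.bounded t₁ ht
    exact ⟨C, fun s hs => ⟨hψ.measurable_slice s (mem_timeInterval_of_le (hsub hs).1 hs.2 ht),
      hC s (hsub hs)⟩⟩
  · intro φ hφ s hs
    have hint := hψ.integrableOn_integral_mul hv hr hα hα2 ht hφ
    have hi : ∀ u ∈ Icc 0 t₁, IntervalIntegrable
        (fun τ => ∫ x, ψ τ x * (fderiv ℝ φ x (v τ x) - fracLaplacian α φ x)) volume 0 u :=
      fun u hu => (intervalIntegrable_iff_integrableOn_Ioc_of_le hu.1).2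
        (hint.mono_set (Ioc_subset_Ioc_right hu.2))
    rw [hψ.equation φ hφ s (mem_timeInterval_of_le (hsub hs).1 hs.2 ht),
      hψ.equation φ hφ t₀ (mem_timeInterval_of_le h0 h01 ht), add_assoc,
      ← intervalIntegral.integral_interval_sub_left (hi s (hsub hs)) (hi t₀ ⟨h0, h01⟩),
      add_sub_cancel]
  · obtain ⟨a, b, ⟨ham, ha⟩, ⟨hbm, hb⟩, hab⟩ := hv.growth
    obtain ⟨C, hC⟩ := hψ.bounded t₁ ht
    have ham' := ham.mono_ac hac
    have hbm' := hbm.mono_ac hac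
    have hψm := hψ.measurable.mono_ac hac
    refine ⟨fun s x => ‖a s x‖ₑ + ‖b s x‖ₑ, ham'.enorm.add hbm'.enorm, ?_, ?_⟩
    · have hm : AEMeasurable (fun z : ℝ × EuclideanSpace ℝ (Fin d) =>
          ‖ψ z.1 z.2‖ₑ * (‖a z.1 z.2‖ₑ + ‖b z.1 z.2‖ₑ))
          (((volume : Measure ℝ).restrict (Ioc t₀ t₁)).prod volume) :=
        hψm.enorm.mul (ham'.enorm.add hbm'.enorm)
      simp only
      rw [lintegral_prod _ hm]
      refine lt_of_le_of_lt (lintegral_mono_ae (g := fun s => C * eLpNorm (a s) ∞ volume +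
        C * eLpNorm (b s) r' volume) ?_) ?_
      · filter_upwards [ham'.prodMk_left, hbm'.prodMk_left, hψm.prodMk_left,
          ae_restrict_mem measurableSet_Ioc] with s has hbs hψs hs
        have hs' := hsub (Ioc_subset_Icc_self hs)
        have hm1 : AEMeasurable (fun x => ‖ψ s x‖ₑ * ‖a s x‖ₑ) volume := hψs.enorm.mul has.enorm
        simp only [mul_add]
        rw [lintegral_add_left' hm1]
        exact add_le_add
          ((lintegral_enorm_mul_enorm_le (r := 1) (r' := ∞) (by simp) hψs has).trans
            (mul_le_mul_left (hC s hs').1 _))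
          ((lintegral_enorm_mul_enorm_le hr hψs hbs).trans (mul_le_mul_left (hC s hs').2 _))
      · rw [lintegral_add_right' _ ((aemeasurable_eLpNorm_of_prod hbm' r').const_mul _),
          lintegral_const_mul' _ _ (by simp), lintegral_const_mul' _ _ (by simp)]
        exact ENNReal.add_lt_top.2
          ⟨ENNReal.mul_lt_top (by simp) (lintegral_Ioc_lt_top_of_zero h0 (ha t₁ ht)),
            ENNReal.mul_lt_top (by simp) (lintegral_Ioc_lt_top_of_zero h0 (hb t₁ ht))⟩
    · filter_upwards [hac.ae_le hab] with z hz
      rw [hz, enorm_smul, ← ofReal_norm (1 + ‖z.2‖), Real.norm_of_nonneg (by positivity)]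
      exact mul_le_mul_right (enorm_add_le _ _) _

/-- A Sobolev field makes the commutators vanish from the initial time on. -/
lemma IsSobolevField.isRenormalizable (hs : IsSobolevField T r' v)
    (hv : IsTransportField T r' v δ)
    (hr : r⁻¹ + r'⁻¹ = 1) (hα : 0 < α) (hα2 : α ≤ 2)
    (hψ : IsWeakSolution α T r v ψ₀ ψ) (h0 : 0 ≤ t₀) (h01 : t₀ ≤ t₁) (ht : t₁ ∈ timeInterval T) :
    IsRenormalizable α r r' v δ ψ t₀ t₁ := by
  obtain ⟨Dv, ⟨hDm, hDi⟩, hD⟩ := hs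
  obtain ⟨M, hM⟩ := exists_isMollifier d
  obtain ⟨C, hC⟩ := hψ.bounded t₁ ht
  have hac := prod_restrict_absolutelyContinuous_spaceTime (d := d) h0 ht
  have hvL := ae_forall_memLp_ball (hv.measurable.mono_ac hac) fun R =>
    lintegral_Ioc_lt_top_of_zero h0 (hv.lintegral_eLpNorm_ball_lt_top
      (one_le_of_inv_add_inv (by rwa [add_comm])) ht R)
  have hDL := ae_forall_memLp_ball (hDm.mono_ac hac) fun R =>
    lintegral_Ioc_lt_top_of_zero h0 (hDi t₁ ht R)
  have key : ∀ᵐ s ∂((volume : Measure ℝ).restrict (Ioc t₀ t₁)), ∀ R : ℝ,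
      Tendsto (fun n => ∫⁻ x in Metric.ball 0 R,
        ‖transportCommutator (mollifier d n) (ψ s) (v s) x + ψ s x * δ s x‖ₑ) atTop (𝓝 0) ∧
      ∀ n, ∫⁻ x in Metric.ball 0 R, ‖transportCommutator (mollifier d n) (ψ s) (v s) x‖ₑ ≤
        M * (C * eLpNorm (Dv s) r' (volume.restrict (Metric.ball 0 (R + 1)))) := by
    filter_upwards [hvL, hDL, ae_restrict_Ioc_of_ae_timeInterval h0 ht hD,
      ae_restrict_Ioc_of_ae_timeInterval h0 ht hv.weakDiv, ae_restrict_mem measurableSet_Ioc]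
      with s hvs hDs hDw hdiv hs R
    have hs' : s ∈ Icc 0 t₁ := ⟨h0.trans hs.1.le, hs.2⟩
    have hw : MemLp (ψ s) r volume :=
      ⟨hψ.measurable_slice s (mem_timeInterval_of_le hs'.1 hs'.2 ht),
        (hC s hs').2.trans_lt ENNReal.coe_lt_top⟩
    obtain ⟨h1, h2⟩ := commutator_sobolev hr hM hw hdiv hDw hvs hDs R
    exact ⟨h1, fun n => (h2 n).trans
      (mul_le_mul_right (mul_le_mul_left (hC s hs').2 _) _)⟩
  refine hψ.isRenormalizable hv hr hα hα2 h0 h01 ht (key.mono fun s hs R => (hs R).1)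
    fun R => ⟨_, ((aemeasurable_eLpNorm_ball (hDm.mono_ac hac) r' (R + 1)).const_mul _).const_mul _,
      ?_, key.mono fun s hs => (hs R).2⟩
  rw [lintegral_const_mul' _ _ (by simp), lintegral_const_mul' _ _ (by simp)]
  exact ENNReal.mul_lt_top (by simp) (ENNReal.mul_lt_top (by simp)
    (lintegral_Ioc_lt_top_of_zero h0 (hDi t₁ ht _)))

/-- A regular solution makes the commutators vanish away from the initial time. -/
lemma IsRegularSolution.isRenormalizable (hs : IsRegularSolution T r ψ₀ ψ)
    (hv : IsTransportField T r' v δ)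
    (hr : r⁻¹ + r'⁻¹ = 1) (hα : 0 < α) (hα2 : α ≤ 2)
    (hψ : IsWeakSolution α T r v ψ₀ ψ) (h0 : 0 < t₀) (h01 : t₀ ≤ t₁) (ht : t₁ ∈ timeInterval T) :
    IsRenormalizable α r r' v δ ψ t₀ t₁ := by
  obtain ⟨⟨Dψ, hDm, hD, hDb⟩, -⟩ := hs
  obtain ⟨M, hM⟩ := exists_isMollifier d
  obtain ⟨C, hC⟩ := hψ.bounded t₁ ht
  choose K hK using fun n : ℕ => hDb t₀ h0 t₁ ht n
  have hac := prod_restrict_absolutelyContinuous_spaceTime (d := d) h0.le ht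
  have hvL := ae_forall_memLp_ball (hv.measurable.mono_ac hac) fun R =>
    lintegral_Ioc_lt_top_of_zero h0.le (hv.lintegral_eLpNorm_ball_lt_top
      (one_le_of_inv_add_inv (by rwa [add_comm])) ht R)
  have hδL := ae_forall_memLp_ball (hv.div_mem.1.mono_ac hac) fun R =>
    lintegral_Ioc_lt_top_of_zero h0.le (hv.div_mem.2 t₁ ht R)
  have hK' : ∀ᵐ s ∂((volume : Measure ℝ).restrict (Ioc t₀ t₁)), ∀ n : ℕ,
      eLpNorm (Dψ s) r (volume.restrict (Metric.ball 0 n)) ≤ K n :=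
    ae_all_iff.2 fun n => ae_restrict_of_ae_restrict_of_subset Ioc_subset_Icc_self (hK n)
  have key : ∀ᵐ s ∂((volume : Measure ℝ).restrict (Ioc t₀ t₁)), ∀ R : ℝ,
      Tendsto (fun n => ∫⁻ x in Metric.ball 0 R,
        ‖transportCommutator (mollifier d n) (ψ s) (v s) x + ψ s x * δ s x‖ₑ) atTop (𝓝 0) ∧
      ∀ n, ∫⁻ x in Metric.ball 0 R, ‖transportCommutator (mollifier d n) (ψ s) (v s) x‖ₑ ≤
        2 * (K ⌈R + 1⌉₊ * eLpNorm (v s) r' (volume.restrict (Metric.ball 0 (R + 1)))) +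
          C * eLpNorm (δ s) r' (volume.restrict (Metric.ball 0 (R + 1))) := by
    filter_upwards [hvL, hδL, hK', (hDm.mono_ac hac).prodMk_left,
      ae_restrict_Ioc_of_ae_timeInterval h0.le ht hD,
      ae_restrict_Ioc_of_ae_timeInterval h0.le ht hv.weakDiv, ae_restrict_mem measurableSet_Ioc]
      with s hvs hδs hKs hDms hDw hdiv hs R
    have hs' : s ∈ Icc 0 t₁ := ⟨h0.le.trans hs.1.le, hs.2⟩
    have hw : MemLp (ψ s) r volume :=
      ⟨hψ.measurable_slice s (mem_timeInterval_of_le hs'.1 hs'.2 ht),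
        (hC s hs').2.trans_lt ENNReal.coe_lt_top⟩
    have hDle : ∀ R : ℝ, eLpNorm (Dψ s) r (volume.restrict (Metric.ball 0 R)) ≤ K ⌈R⌉₊ :=
      fun R => (eLpNorm_mono_measure _ (Measure.restrict_mono
        (Metric.ball_subset_ball (Nat.le_ceil R)) le_rfl)).trans (hKs _)
    obtain ⟨h1, h2⟩ := commutator_regular hr hM hw hDw hdiv hvs hδs
      (fun R => ⟨hDms.restrict, (hDle R).trans_lt ENNReal.coe_lt_top⟩) R
    exact ⟨h1, fun n => (h2 n).trans (add_le_add
      (mul_le_mul_right (mul_le_mul_left (hDle _) _) _) (mul_le_mul_left (hC s hs').2 _))⟩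
  have hvm := aemeasurable_eLpNorm_ball (hv.measurable.mono_ac hac) r'
  have hδm := aemeasurable_eLpNorm_ball (hv.div_mem.1.mono_ac hac) r'
  refine hψ.isRenormalizable hv hr hα hα2 h0.le h01 ht (key.mono fun s hs R => (hs R).1)
    fun R => ⟨_, (((hvm (R + 1)).const_mul _).const_mul _).add ((hδm (R + 1)).const_mul _),
      ?_, key.mono fun s hs => (hs R).2⟩
  simp only [Pi.add_apply]
  rw [lintegral_add_right' _ ((hδm (R + 1)).const_mul _), lintegral_const_mul' _ _ (by simp),
    lintegral_const_mul' _ _ (by simp), lintegral_const_mul' _ _ (by simp)]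
  exact ENNReal.add_lt_top.2 ⟨ENNReal.mul_lt_top (by simp) (ENNReal.mul_lt_top (by simp)
    (lintegral_Ioc_lt_top_of_zero h0.le (hv.lintegral_eLpNorm_ball_lt_top
      (one_le_of_inv_add_inv (by rwa [add_comm])) ht _))),
    ENNReal.mul_lt_top (by simp) (lintegral_Ioc_lt_top_of_zero h0.le (hv.div_mem.2 t₁ ht _))⟩

/-- The initial value is attained almost everywhere, by the weak formulation at time `0`. -/
lemma IsWeakSolution.ae_eq_initial (hψ : IsWeakSolution α T r v ψ₀ ψ) (hψ₀ : MemLp ψ₀ 1 volume) :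
    ψ 0 =ᵐ[volume] ψ₀ := by
  have h0 : (0 : ℝ) ∈ timeInterval T := ⟨le_rfl, by simp⟩
  obtain ⟨C, hC⟩ := hψ.bounded 0 h0
  have hi : Integrable (ψ 0) := memLp_one_iff_integrable.1
    ⟨hψ.measurable_slice 0 h0, (hC 0 ⟨le_rfl, le_rfl⟩).1.trans_lt ENNReal.coe_lt_top⟩
  refine ae_eq_of_integral_contDiff_smul_eq hi.locallyIntegrable
    (memLp_one_iff_integrable.1 hψ₀).locallyIntegrable fun g hg hgc => ?_
  have := hψ.equation g ⟨hg, hgc⟩ 0 h0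
  rw [intervalIntegral.integral_same, add_zero] at this
  simpa [mul_comm] using this

variable {β b F : ℝ → ℝ} {L c : ℝ}

/-- The entropy inequality for weak solutions, up to the initial time. For a regular solution it
holds on `[e, t]` with `e > 0`, and the convergence to the initial value in `L^1` permits `e → 0`,
as the entropy is Lipschitz. -/
theorem IsWeakSolution.entropy_le [Nonempty (Fin d)] (hv : IsTransportField T r' v δ)
    (hr : r⁻¹ + r'⁻¹ = 1) (hα : 0 < α) (hα2 : α ≤ 2) (hd : α < d)
    (hψ : IsWeakSolution α T r v ψ₀ ψ) (hψ₀ : MemLp ψ₀ 1 volume)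
    (hreg : IsSobolevField T r' v ∨ IsRegularSolution T r ψ₀ ψ) (hβ : IsEntropy β b F L c)
    (hsmall : ∀ᵐ s ∂((volume : Measure ℝ).restrict (timeInterval T)), ENNReal.ofReal c *
      eLpNorm (fun x => max (-(δ s x)) 0) (ENNReal.ofReal (d / α)) volume ≤
        sobolevConst d (α / 2)) {t : ℝ} (ht : t ∈ timeInterval T) :
    (∫⁻ s in Ioc 0 t, sobolevConst d (α / 2) * eLpNorm (fun x => F (ψ s x))
      (ENNReal.ofReal (2 * d / (d - 2 * (α / 2)))) volume ^ 2) +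
      ∫⁻ x, ENNReal.ofReal (β (ψ t x)) ≤ ∫⁻ x, ENNReal.ofReal (β (ψ₀ x)) := by
  have hinit : ∫⁻ x, ENNReal.ofReal (β (ψ 0 x)) = ∫⁻ x, ENNReal.ofReal (β (ψ₀ x)) :=
    lintegral_congr_ae ((hψ.ae_eq_initial hψ₀).mono fun x hx => by simp only [hx])
  rcases hreg with hs | hs
  · rw [← hinit]
    exact (hs.isRenormalizable hv hr hα hα2 hψ le_rfl ht.1 ht).entropy_le hr hα hα2 hd hβ
      (ae_restrict_Ioc_of_ae_timeInterval le_rfl ht hsmall)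
  rcases ht.1.eq_or_lt with rfl | ht0
  · simp [hinit]
  set e : ℕ → ℝ := fun n => t / ((n : ℝ) + 1) with he
  have he0 : ∀ n, 0 < e n := fun n => by simp only [he]; positivity
  have het : ∀ n, e n ≤ t := fun n => div_le_self ht0.le (by simp)
  have hea : Antitone e := fun m n hmn => by
    simp only [he]
    gcongr
  have helim : Tendsto e atTop (𝓝 0) := by
    have := tendsto_scale.const_mul t
    simpa [he, div_eq_mul_inv] using this
  set y : ℝ → ℝ≥0∞ := fun s => sobolevConst d (α / 2) * eLpNorm (fun x => F (ψ s x))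
      (ENNReal.ofReal (2 * d / (d - 2 * (α / 2)))) volume ^ 2 with hy
  have hdiff : Tendsto (fun n => eLpNorm (fun x => ψ (e n) x - ψ₀ x) 1 volume) atTop (𝓝 0) :=
    hs.2.comp (tendsto_nhdsWithin_iff.2 ⟨helim, Eventually.of_forall fun n =>
      mem_timeInterval_of_le (he0 n).le (het n) ht⟩)
  have hn : ∀ n, (∫⁻ s in Ioc (e n) t, y s) + ∫⁻ x, ENNReal.ofReal (β (ψ t x)) ≤
      (∫⁻ x, ENNReal.ofReal (β (ψ₀ x))) +
        ENNReal.ofReal L * eLpNorm (fun x => ψ (e n) x - ψ₀ x) 1 volume := by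
    intro n
    refine ((hs.isRenormalizable hv hr hα hα2 hψ (he0 n) (het n) ht).entropy_le hr hα hα2 hd hβ
      (ae_restrict_Ioc_of_ae_timeInterval (he0 n).le ht hsmall)).trans ?_
    rw [eLpNorm_one_eq_lintegral_enorm, ← lintegral_const_mul' _ _ (by simp),
      ← lintegral_add_left' (hβ.continuous.comp_aestronglyMeasurable
        hψ₀.1).aemeasurable.ennreal_ofReal]
    refine lintegral_mono fun x => ?_
    have h1 : β (ψ (e n) x) ≤ β (ψ₀ x) + L * ‖ψ (e n) x - ψ₀ x‖ := by
      have := (le_abs_self _).trans (hβ.abs_sub_le (ψ (e n) x) (ψ₀ x))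
      rw [Real.norm_eq_abs]
      linarith
    refine (ENNReal.ofReal_le_ofReal h1).trans (ENNReal.ofReal_add_le.trans ?_)
    rw [ENNReal.ofReal_mul hβ.bound_nonneg, ofReal_norm]
  have hlim : Tendsto (fun n => (∫⁻ x, ENNReal.ofReal (β (ψ₀ x))) +
      ENNReal.ofReal L * eLpNorm (fun x => ψ (e n) x - ψ₀ x) 1 volume) atTop
      (𝓝 (∫⁻ x, ENNReal.ofReal (β (ψ₀ x)))) := by
    have h1 := ENNReal.Tendsto.const_mul hdiff (Or.inr (ENNReal.ofReal_ne_top (r := L)))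
    rw [mul_zero] at h1
    simpa using (tendsto_const_nhds (x := ∫⁻ x, ENNReal.ofReal (β (ψ₀ x)))).add h1
  have hun : Ioc 0 t = ⋃ n, Ioc (e n) t := by
    ext s
    simp only [mem_Ioc, mem_iUnion]
    constructor
    · rintro ⟨h1, h2⟩
      obtain ⟨n, hn⟩ := (helim.eventually (gt_mem_nhds h1)).exists
      exact ⟨n, hn, h2⟩
    · rintro ⟨n, h1, h2⟩
      exact ⟨(he0 n).trans h1, h2⟩
  have hmono : Monotone fun n => Ioc (e n) t := fun m n hmn => Ioc_subset_Ioc_left (hea hmn)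
  rw [hun, setLIntegral_iUnion_of_directed _ hmono.directed_le, ENNReal.iSup_add]
  refine iSup_le fun n => ge_of_tendsto hlim ?_
  filter_upwards [eventually_ge_atTop n] with m hm
  exact (add_le_add_left (lintegral_mono_set (hmono hm)) _).trans (hn m)

end WeakSolutions

/-! ### Truncated powers as entropies -/

section TruncatedPowers

lemma rpow_add_one_of_nonneg {x a : ℝ} (hx : 0 ≤ x) (ha : 0 ≤ a) : x ^ (a + 1) = x ^ a * x := by
  rw [Real.rpow_add_of_nonneg hx ha zero_le_one, Real.rpow_one]

/-- The tangent line inequality for the convex power `x ^ m`, which is Bernoulli's inequality. -/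
lemma rpow_add_mul_sub_le_rpow {m A B : ℝ} (hm : 1 ≤ m) (hA : 0 ≤ A) (hB : 0 ≤ B) :
    A ^ m + m * A ^ (m - 1) * (B - A) ≤ B ^ m := by
  rcases hA.eq_or_lt with rfl | hA
  · rcases hm.eq_or_lt with rfl | hm
    · simp
    · rw [Real.zero_rpow (by linarith), Real.zero_rpow (by linarith)]
      simpa using Real.rpow_nonneg hB m
  · have h := one_add_mul_self_le_rpow_one_add (s := B / A - 1)
      (by have : 0 ≤ B / A := by positivity
          linarith) hm
    have h2 := mul_le_mul_of_nonneg_left h (Real.rpow_nonneg hA.le m)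
    have e1 : A ^ m * (1 + m * (B / A - 1)) = A ^ m + m * A ^ (m - 1) * (B - A) := by
      rw [Real.rpow_sub_one hA.ne']
      field_simp
    have e2 : A ^ m * (1 + (B / A - 1)) ^ m = B ^ m := by
      rw [← Real.mul_rpow hA.le (by simpa using by positivity)]
      congr 1
      field_simp
      ring
    rwa [e1, e2] at h2

/-- The Stroock-Varopoulos inequality for nonnegative numbers, with the constant `2 / q` in place of
the optimal `4 (q - 1) / q ^ 2`. -/
lemma two_mul_sq_rpow_sub_le {q A B : ℝ} (hq : 2 ≤ q) (hA : 0 ≤ A) (hB : 0 ≤ B) :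
    2 * (A ^ (q / 2) - B ^ (q / 2)) ^ 2 ≤ q * ((A ^ (q - 1) - B ^ (q - 1)) * (A - B)) := by
  wlog hBA : B ≤ A generalizing A B
  · have := this hB hA (le_of_not_ge hBA)
    linarith
  have h1 := rpow_add_mul_sub_le_rpow (m := q / 2) (by linarith) hA hB
  have hsplit : ∀ x : ℝ, 0 ≤ x → x ^ (q - 1) = x ^ (q / 2 - 1) * x ^ (q / 2) := by
    intro x hx
    rw [← Real.rpow_add_of_nonneg hx (by linarith) (by linarith)]
    ring_nf
  have h2 : A ^ (q / 2 - 1) * (A ^ (q / 2) - B ^ (q / 2)) ≤ A ^ (q - 1) - B ^ (q - 1) := by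
    rw [hsplit A hA, hsplit B hB, mul_sub]
    have := mul_le_mul_of_nonneg_right (Real.rpow_le_rpow hB hBA (by linarith : 0 ≤ q / 2 - 1))
      (Real.rpow_nonneg hB (q / 2))
    linarith
  have h3 : 0 ≤ A ^ (q / 2) - B ^ (q / 2) :=
    sub_nonneg.2 (Real.rpow_le_rpow hB hBA (by linarith))
  have h4 := mul_le_mul_of_nonneg_left h2 (mul_nonneg (by linarith : (0 : ℝ) ≤ q)
    (sub_nonneg.2 hBA))
  nlinarith [mul_le_mul_of_nonneg_left h1 h3]

/-- The derivative of `|u|^q`. -/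
def powDeriv (q u : ℝ) : ℝ := q * |u| ^ (q - 2) * u

/-- The projection of `u` to the interval `[-k, k]`. -/
def clamp (k u : ℝ) : ℝ := max (-k) (min u k)

variable {q k : ℝ}

lemma abs_rpow_sub_two_mul_abs (hq : 2 ≤ q) (u : ℝ) : |u| ^ (q - 2) * |u| = |u| ^ (q - 1) := by
  rw [← rpow_add_one_of_nonneg (abs_nonneg u) (by linarith)]
  ring_nf

lemma abs_rpow_sub_two_mul_sq (hq : 2 ≤ q) (u : ℝ) : |u| ^ (q - 2) * (u * u) = |u| ^ q := by
  rw [← abs_mul_abs_self, ← mul_assoc, abs_rpow_sub_two_mul_abs hq,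
    ← rpow_add_one_of_nonneg (abs_nonneg u) (by linarith)]
  ring_nf

lemma powDeriv_mul_self (hq : 2 ≤ q) (u : ℝ) : powDeriv q u * u = q * |u| ^ q := by
  rw [powDeriv, ← abs_rpow_sub_two_mul_sq hq u]
  ring

lemma abs_powDeriv (hq : 2 ≤ q) (u : ℝ) : |powDeriv q u| = q * |u| ^ (q - 1) := by
  rw [powDeriv, abs_mul, abs_mul, abs_of_nonneg (by linarith : 0 ≤ q),
    abs_of_nonneg (Real.rpow_nonneg (abs_nonneg u) _), mul_assoc, abs_rpow_sub_two_mul_abs hq]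

lemma abs_rpow_add_powDeriv_mul_sub_le (hq : 2 ≤ q) (x y : ℝ) :
    |y| ^ q + powDeriv q y * (x - y) ≤ |x| ^ q := by
  have h1 := rpow_add_mul_sub_le_rpow (m := q) (by linarith) (abs_nonneg y) (abs_nonneg x)
  have h2 : powDeriv q y * x ≤ q * |y| ^ (q - 1) * |x| := by
    rw [← abs_powDeriv hq, ← abs_mul]
    exact le_abs_self _
  have h3 : |y| ^ (q - 1) * |y| = |y| ^ q := by
    rw [← rpow_add_one_of_nonneg (abs_nonneg y) (by linarith)]
    ring_nf
  have h4 := powDeriv_mul_self hq y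
  have h5 : q * |y| ^ (q - 1) * |y| = q * |y| ^ q := by rw [mul_assoc, h3]
  rw [mul_sub]
  rw [mul_sub] at h1
  linarith

/-- The Stroock-Varopoulos inequality for numbers of any sign. -/
lemma two_mul_sq_abs_rpow_sub_le (hq : 2 ≤ q) (x y : ℝ) :
    2 * (|x| ^ (q / 2) - |y| ^ (q / 2)) ^ 2 ≤ (powDeriv q x - powDeriv q y) * (x - y) := by
  have h1 := two_mul_sq_rpow_sub_le hq (abs_nonneg x) (abs_nonneg y)
  have hx := abs_rpow_sub_two_mul_abs hq x
  have hy := abs_rpow_sub_two_mul_abs hq y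
  have hxy : x * y ≤ |x| * |y| := by rw [← abs_mul]; exact le_abs_self _
  have h2 : 0 ≤ q * (|x| ^ (q - 2) + |y| ^ (q - 2)) := by
    have := Real.rpow_nonneg (abs_nonneg x) (q - 2)
    have := Real.rpow_nonneg (abs_nonneg y) (q - 2)
    have : 0 ≤ q := by linarith
    positivity
  have h3 := mul_le_mul_of_nonneg_left hxy h2
  have e1 : (powDeriv q x - powDeriv q y) * (x - y) =
      q * (|x| ^ (q - 2) * (|x| * |x|) + |y| ^ (q - 2) * (|y| * |y|)) -
        q * (|x| ^ (q - 2) + |y| ^ (q - 2)) * (x * y) := by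
    rw [abs_mul_abs_self, abs_mul_abs_self, powDeriv, powDeriv]
    ring
  have e2 : q * ((|x| ^ (q - 1) - |y| ^ (q - 1)) * (|x| - |y|)) =
      q * (|x| ^ (q - 2) * (|x| * |x|) + |y| ^ (q - 2) * (|y| * |y|)) -
        q * (|x| ^ (q - 2) + |y| ^ (q - 2)) * (|x| * |y|) := by
    rw [← hx, ← hy]
    ring
  linarith

lemma powDeriv_mono (hq : 2 ≤ q) {x y : ℝ} (h : x ≤ y) : powDeriv q x ≤ powDeriv q y := by
  rcases h.eq_or_lt with rfl | h
  · exact le_rfl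
  · have h1 := two_mul_sq_abs_rpow_sub_le hq y x
    have h2 : 0 ≤ (powDeriv q y - powDeriv q x) * (y - x) := le_trans (by positivity) h1
    exact sub_nonneg.1 (nonneg_of_mul_nonneg_left h2 (sub_pos.2 h))

lemma continuous_powDeriv (hq : 2 ≤ q) : Continuous (powDeriv q) :=
  (continuous_const.mul (continuous_abs.rpow_const fun _ => Or.inr (by linarith))).mul continuous_id

lemma continuous_clamp (k : ℝ) : Continuous (clamp k) := by
  unfold clamp
  fun_prop

lemma abs_clamp_le (hk : 0 ≤ k) (u : ℝ) : |clamp k u| ≤ k :=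
  abs_le.2 ⟨le_max_left _ _, max_le (by linarith) (min_le_right _ _)⟩

lemma clamp_of_abs_le {u : ℝ} (h : |u| ≤ k) : clamp k u = u := by
  rw [clamp, min_eq_left (abs_le.1 h).2, max_eq_right (abs_le.1 h).1]

lemma clamp_of_le {u : ℝ} (hk : 0 ≤ k) (h : k ≤ u) : clamp k u = k := by
  rw [clamp, min_eq_right h, max_eq_right (by linarith)]

lemma clamp_of_le_neg {u : ℝ} (hk : 0 ≤ k) (h : u ≤ -k) : clamp k u = -k := by
  rw [clamp, min_eq_left (by linarith), max_eq_left h]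

lemma clamp_cases (hk : 0 ≤ k) (u : ℝ) :
    clamp k u = u ∨ (clamp k u = k ∧ k ≤ u) ∨ (clamp k u = -k ∧ u ≤ -k) := by
  rcases le_total u k with h1 | h1
  · rcases le_total (-k) u with h2 | h2
    · exact Or.inl (clamp_of_abs_le (abs_le.2 ⟨h2, h1⟩))
    · exact Or.inr (Or.inr ⟨clamp_of_le_neg hk h2, h2⟩)
  · exact Or.inr (Or.inl ⟨clamp_of_le hk h1, h1⟩)

lemma abs_clamp (hk : 0 ≤ k) (u : ℝ) : |clamp k u| = min |u| k := by
  rcases clamp_cases hk u with h | ⟨h, h2⟩ | ⟨h, h2⟩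
  · rw [h, min_eq_left]
    rw [← h]
    exact abs_clamp_le hk u
  · rw [h, abs_of_nonneg hk, min_eq_right (h2.trans (le_abs_self _))]
  · rw [h, abs_neg, abs_of_nonneg hk, min_eq_right (by linarith [neg_le_abs u])]

lemma clamp_sub_le {u v : ℝ} (h : v ≤ u) : 0 ≤ clamp k u - clamp k v ∧
    clamp k u - clamp k v ≤ u - v := by
  constructor
  · exact sub_nonneg.2 (max_le_max le_rfl (min_le_min h le_rfl))
  · have h1 : min u k ≤ min v k + (u - v) := by
      rw [← min_add_add_right]
      exact le_min (by linarith [min_le_left u k]) (by linarith [min_le_right u k])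
    have h2 : max (-k) (min u k) ≤ max (-k) (min v k) + (u - v) :=
      max_le (by linarith [le_max_left (-k) (min v k)])
        (by linarith [le_max_right (-k) (min v k)])
    simp only [clamp]
    linarith

/-- The power `|u|^q` for `|u| ≤ k`, continued linearly to a `C¹` function. -/
def truncPow (q k u : ℝ) : ℝ := |clamp k u| ^ q + powDeriv q (clamp k u) * (u - clamp k u)

lemma powDeriv_clamp_mul_le (hq : 2 ≤ q) (hk : 0 ≤ k) {y : ℝ} (hy : |y| ≤ k) (u : ℝ) :
    powDeriv q y * (u - clamp k u) ≤ powDeriv q (clamp k u) * (u - clamp k u) := by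
  rcases clamp_cases hk u with h | ⟨h, h2⟩ | ⟨h, h2⟩
  · simp [h]
  · rw [h]
    exact mul_le_mul_of_nonneg_right (powDeriv_mono hq (abs_le.1 hy).2) (by linarith)
  · rw [h]
    exact mul_le_mul_of_nonpos_right (powDeriv_mono hq (abs_le.1 hy).1) (by linarith)

lemma truncPow_convex (hq : 2 ≤ q) (hk : 0 ≤ k) (u v : ℝ) :
    truncPow q k v + powDeriv q (clamp k v) * (u - v) ≤ truncPow q k u := by
  have h1 := abs_rpow_add_powDeriv_mul_sub_le hq (clamp k u) (clamp k v)
  have h2 := powDeriv_clamp_mul_le hq hk (abs_clamp_le hk v) u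
  simp only [truncPow]
  nlinarith

lemma truncPow_le (hq : 2 ≤ q) (k u : ℝ) : truncPow q k u ≤ |u| ^ q :=
  abs_rpow_add_powDeriv_mul_sub_le hq u (clamp k u)

lemma abs_clamp_rpow_le_truncPow (hq : 2 ≤ q) (hk : 0 ≤ k) (u : ℝ) :
    |clamp k u| ^ q ≤ truncPow q k u := by
  have h := powDeriv_clamp_mul_le hq hk (y := 0) (by simpa using hk) u
  have h0 : powDeriv q 0 = 0 := by simp [powDeriv]
  rw [h0, zero_mul] at h
  simp only [truncPow]
  linarith

/-- A continuous selection of subgradients of a convex function is its derivative. -/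
lemma hasDerivAt_of_convex {β b : ℝ → ℝ} (hb : Continuous b)
    (h : ∀ u v, β v + b v * (u - v) ≤ β u) (u : ℝ) : HasDerivAt β (b u) u := by
  rw [hasDerivAt_iff_isLittleO]
  have h1 : (fun x => b x - b u) =o[𝓝 u] fun _ => (1 : ℝ) := by
    rw [Asymptotics.isLittleO_one_iff]
    simpa using (hb.tendsto u).sub_const (b u)
  have h2 := h1.mul_isBigO (Asymptotics.isBigO_refl (fun x => x - u) (𝓝 u))
  simp only [one_mul] at h2
  refine Asymptotics.IsBigO.trans_isLittleO (Asymptotics.IsBigO.of_bound 1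
    (Eventually.of_forall fun x => ?_)) h2
  have c1 := h x u
  have c2 := h u x
  rw [one_mul, Real.norm_eq_abs, Real.norm_eq_abs, smul_eq_mul, mul_comm (x - u)]
  refine abs_le_abs_of_nonneg (by linarith) ?_
  nlinarith

/-- Truncated powers are entropies with square root `|clamp k u|^(q/2)`, and their defect has the
constant `q - 1` of the smallness condition: the defect of `|u|^q` is `(q - 1) |u|^q`, and the
linear continuation leaves the defect unchanged for `|u| ≥ k`. -/
theorem isEntropy_truncPow (hq : 2 ≤ q) (hk : 0 < k) :
    IsEntropy (truncPow q k) (fun u => powDeriv q (clamp k u)) (fun u => |clamp k u| ^ (q / 2))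
      (q * k ^ (q - 1)) (q - 1) where
  hasDerivAt := hasDerivAt_of_convex ((continuous_powDeriv hq).comp (continuous_clamp k))
    (truncPow_convex hq hk.le)
  continuous_deriv := (continuous_powDeriv hq).comp (continuous_clamp k)
  abs_deriv_le u := by
    rw [abs_powDeriv hq]
    exact mul_le_mul_of_nonneg_left (Real.rpow_le_rpow (abs_nonneg _) (abs_clamp_le hk.le u)
      (by linarith)) (by linarith)
  convex := truncPow_convex hq hk.le
  nonneg u := (Real.rpow_nonneg (abs_nonneg _) q).trans (abs_clamp_rpow_le_truncPow hq hk.le u)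
  map_zero := by
    have : clamp k 0 = 0 := clamp_of_abs_le (by simpa using hk.le)
    rw [truncPow, this, abs_zero, Real.zero_rpow (by linarith)]
    simp
  continuous_root := (continuous_clamp k).abs.rpow_const fun _ => Or.inr (by linarith)
  sq_root_le u := by
    have h1 : |clamp k u| ≤ |u| := by rw [abs_clamp hk.le]; exact min_le_left _ _
    have h2 : |clamp k u| ^ (q - 1) ≤ k ^ (q - 1) :=
      Real.rpow_le_rpow (abs_nonneg _) (abs_clamp_le hk.le u) (by linarith)
    have e : (|clamp k u| ^ (q / 2)) ^ 2 = |clamp k u| ^ (q - 1) * |clamp k u| := by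
      rw [← Real.rpow_mul_natCast (abs_nonneg _),
        ← rpow_add_one_of_nonneg (abs_nonneg _) (by linarith)]
      congr 1
      push_cast
      ring
    rw [e]
    refine (mul_le_mul h2 h1 (abs_nonneg _) (Real.rpow_nonneg hk.le _)).trans ?_
    refine mul_le_mul_of_nonneg_right ?_ (abs_nonneg _)
    exact le_mul_of_one_le_left (Real.rpow_nonneg hk.le _) (by linarith)
  two_mul_sq_sub_le u v := by
    refine (two_mul_sq_abs_rpow_sub_le hq (clamp k u) (clamp k v)).trans ?_
    rcases le_total v u with h | h
    · obtain ⟨h1, h2⟩ := clamp_sub_le (k := k) h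
      exact mul_le_mul_of_nonneg_left h2 (sub_nonneg.2 (powDeriv_mono hq (sub_nonneg.1 h1)))
    · obtain ⟨h1, h2⟩ := clamp_sub_le (k := k) h
      refine mul_le_mul_of_nonpos_left (by linarith)
        (sub_nonpos.2 (powDeriv_mono hq (sub_nonneg.1 h1)))
  defect_le u := by
    have e : (|clamp k u| ^ (q / 2)) ^ 2 = |clamp k u| ^ q := by
      rw [← Real.rpow_mul_natCast (abs_nonneg _)]
      congr 1
      push_cast
      ring
    have h := powDeriv_mul_self hq (clamp k u)
    rw [e]
    simp only [truncPow]
    linarith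

end TruncatedPowers

/-! ### Recovering Lebesgue norms from truncated powers -/

section LebesgueNormComparison

variable {X : Type*} [MeasurableSpace X] {μ : Measure X} {f g : X → ℝ}

lemma eLpNorm_ofReal_rpow {q : ℝ} (hq : 0 < q) (f : X → ℝ) :
    eLpNorm f (ENNReal.ofReal q) μ ^ q = ∫⁻ x, ‖f x‖ₑ ^ q ∂μ := by
  rw [eLpNorm_eq_lintegral_rpow_enorm_toReal (by simpa using hq) ENNReal.ofReal_ne_top,
    ENNReal.toReal_ofReal hq.le, ← ENNReal.rpow_mul, one_div, inv_mul_cancel₀ hq.ne',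
    ENNReal.rpow_one]

lemma abs_clamp_le_abs {k : ℝ} (hk : 0 ≤ k) (u : ℝ) : |clamp k u| ≤ |u| := by
  rw [abs_clamp hk]
  exact min_le_left _ _

lemma monotone_eLpNorm_clamp (f : X → ℝ) (m : ℝ≥0∞) :
    Monotone fun n : ℕ => eLpNorm (fun x => clamp ((n : ℝ) + 1) (f x)) m μ := fun a b hab => by
  refine eLpNorm_mono fun x => ?_
  rw [Real.norm_eq_abs, Real.norm_eq_abs, abs_clamp (by positivity), abs_clamp (by positivity)]
  gcongr

lemma tendsto_eLpNorm_clamp (hf : AEStronglyMeasurable f μ) (m : ℝ≥0∞) :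
    Tendsto (fun n : ℕ => eLpNorm (fun x => clamp ((n : ℝ) + 1) (f x)) m μ) atTop
      (𝓝 (eLpNorm f m μ)) := by
  have h1 := tendsto_atTop_iSup (monotone_eLpNorm_clamp (μ := μ) f m)
  have h2 := Lp.eLpNorm_lim_le_liminf_eLpNorm (p := m) (μ := μ)
    (f := fun (n : ℕ) x => clamp ((n : ℝ) + 1) (f x))
    (fun n => (continuous_clamp _).comp_aestronglyMeasurable hf) f
    (Eventually.of_forall fun x => by
      refine tendsto_const_nhds.congr' ?_
      obtain ⟨n, hn⟩ := exists_nat_ge |f x|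
      filter_upwards [eventually_ge_atTop n] with k hk
      have : (n : ℝ) ≤ k := by exact_mod_cast hk
      exact (clamp_of_abs_le (by linarith)).symm)
  rw [h1.liminf_eq] at h2
  convert h1 using 2
  refine le_antisymm h2 (iSup_le fun n => eLpNorm_mono fun x => ?_)
  exact abs_clamp_le_abs (by positivity) _

lemma truncPow_two {k : ℝ} (hk : 0 ≤ k) (u : ℝ) :
    truncPow 2 k u = 2 * min |u| k * |u| - min |u| k ^ 2 := by
  have h2 : clamp k u * u = |clamp k u| * |u| := by
    rw [← abs_mul, eq_comm, abs_eq_self]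
    rcases clamp_cases hk u with h | ⟨h, h2⟩ | ⟨h, h2⟩
    · rw [h]; exact mul_self_nonneg u
    · rw [h]; exact mul_nonneg hk (hk.trans h2)
    · rw [h]; exact mul_nonneg_of_nonpos_of_nonpos (by linarith) (by linarith)
  have h3 : powDeriv 2 (clamp k u) = 2 * clamp k u := by simp [powDeriv]
  rw [truncPow, h3, ← abs_clamp hk, Real.rpow_ofNat, mul_sub, mul_assoc, h2, mul_assoc 2 (clamp k u),
    ← abs_mul_abs_self (clamp k u)]
  ring

lemma truncPow_two_of_le {k u : ℝ} (hk : 0 ≤ k) (h : k ≤ |u|) :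
    truncPow 2 k u = 2 * k * |u| - k ^ 2 := by
  rw [truncPow_two hk, min_eq_right h]

lemma truncPow_two_of_abs_le {k u : ℝ} (hk : 0 ≤ k) (h : |u| ≤ k) :
    truncPow 2 k u = |u| ^ 2 := by
  rw [truncPow_two hk, min_eq_left h]
  ring

lemma truncPow_two_nonneg {k : ℝ} (hk : 0 ≤ k) (u : ℝ) : 0 ≤ truncPow 2 k u :=
  (Real.rpow_nonneg (abs_nonneg _) _).trans (abs_clamp_rpow_le_truncPow le_rfl hk u)

lemma continuous_truncPow_two_uncurry :
    Continuous fun p : ℝ × ℝ => truncPow 2 p.2 p.1 := by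
  have h3 : ∀ y : ℝ, powDeriv 2 y = 2 * y := fun y => by simp [powDeriv]
  simp only [truncPow, h3, Real.rpow_ofNat, clamp]
  fun_prop

/-- Comparison of the `L^1` norms: after division by `2 k`, the square truncated at the level `k`
tends to `|u|` as `k → 0`. -/
lemma lintegral_enorm_le_of_truncPow (hf : AEStronglyMeasurable f μ)
    (h : ∀ k : ℝ, 0 < k → ∫⁻ x, ENNReal.ofReal (truncPow 2 k (f x)) ∂μ ≤
      ∫⁻ x, ENNReal.ofReal (truncPow 2 k (g x)) ∂μ) :
    ∫⁻ x, ‖f x‖ₑ ∂μ ≤ ∫⁻ x, ‖g x‖ₑ ∂μ := by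
  set k : ℕ → ℝ := fun n => ((n : ℝ) + 1)⁻¹ with hk
  have hk0 : ∀ n, 0 < k n := fun n => by simp only [hk]; positivity
  have hupper : ∀ n u, truncPow 2 (k n) u ≤ 2 * k n * |u| := fun n u => by
    have := (isEntropy_truncPow le_rfl (hk0 n)).le_mul_abs u
    norm_num at this
    exact this
  have hlower : ∀ n u, 2 * k n * |u| - k n ^ 2 ≤ truncPow 2 (k n) u := fun n u => by
    rcases le_total (k n) |u| with h1 | h1
    · rw [truncPow_two_of_le (hk0 n).le h1]
    · rw [truncPow_two_of_abs_le (hk0 n).le h1]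
      nlinarith [sq_nonneg (|u| - k n)]
  have hlim : ∀ u, Tendsto (fun n => truncPow 2 (k n) u / (2 * k n)) atTop (𝓝 |u|) := by
    intro u
    have h1 : Tendsto (fun n => |u| - k n / 2) atTop (𝓝 |u|) := by
      simpa using (tendsto_scale.div_const 2).const_sub |u|
    refine tendsto_of_tendsto_of_tendsto_of_le_of_le h1 tendsto_const_nhds (fun n => ?_) fun n => ?_
    · rw [le_div_iff₀ (by linarith [hk0 n])]
      refine le_trans (le_of_eq ?_) (hlower n u)
      ring
    · rw [div_le_iff₀ (by linarith [hk0 n])]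
      linarith [hupper n u]
  have hmeas : ∀ n, AEMeasurable (fun x => ENNReal.ofReal (truncPow 2 (k n) (f x) / (2 * k n))) μ :=
    fun n => (((isEntropy_truncPow le_rfl (hk0 n)).continuous.comp_aestronglyMeasurable
      hf).aemeasurable.div_const _).ennreal_ofReal
  have hn : ∀ n, ∫⁻ x, ENNReal.ofReal (truncPow 2 (k n) (f x) / (2 * k n)) ∂μ ≤
      ∫⁻ x, ‖g x‖ₑ ∂μ := by
    intro n
    have hc : 0 < 2 * k n := by linarith [hk0 n]
    have e : ∀ w : X → ℝ, ∫⁻ x, ENNReal.ofReal (truncPow 2 (k n) (w x) / (2 * k n)) ∂μ =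
        (∫⁻ x, ENNReal.ofReal (truncPow 2 (k n) (w x)) ∂μ) * ENNReal.ofReal (2 * k n)⁻¹ := by
      intro w
      rw [← lintegral_mul_const' _ _ ENNReal.ofReal_ne_top]
      refine lintegral_congr fun x => ?_
      rw [← ENNReal.ofReal_mul (truncPow_two_nonneg (hk0 n).le _), div_eq_mul_inv]
    rw [e]
    refine (mul_le_mul_left (h (k n) (hk0 n)) _).trans ?_
    rw [← e]
    refine lintegral_mono fun x => ?_
    rw [← ofReal_norm, Real.norm_eq_abs]
    refine ENNReal.ofReal_le_ofReal ?_
    rw [div_le_iff₀ hc]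
    linarith [hupper n (g x)]
  calc ∫⁻ x, ‖f x‖ₑ ∂μ = ∫⁻ x, liminf (fun n =>
        ENNReal.ofReal (truncPow 2 (k n) (f x) / (2 * k n))) atTop ∂μ := by
        refine lintegral_congr fun x => ?_
        have h1 : Tendsto (fun n => ENNReal.ofReal (truncPow 2 (k n) (f x) / (2 * k n))) atTop
            (𝓝 (ENNReal.ofReal |f x|)) := (ENNReal.continuous_ofReal.tendsto _).comp (hlim (f x))
        rw [h1.liminf_eq, ← ofReal_norm, Real.norm_eq_abs]
    _ ≤ liminf (fun n => ∫⁻ x, ENNReal.ofReal (truncPow 2 (k n) (f x) / (2 * k n)) ∂μ) atTop :=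
        lintegral_liminf_le' hmeas
    _ ≤ _ := by
        refine (liminf_le_liminf (Eventually.of_forall hn)).trans ?_
        rw [liminf_const]

/-- For `1 < q < 2` the power `|u|^q` is a superposition of truncated squares, with a weight in the
truncation level that is integrable at both ends for this range of `q`. -/
lemma lintegral_truncPow_mul_rpow {q : ℝ} (hq1 : 1 < q) (hq2 : q < 2) (u : ℝ) :
    ∫⁻ k in Ioi (0 : ℝ), ENNReal.ofReal (truncPow 2 k u * k ^ (q - 3)) =
      ENNReal.ofReal (2 / (q - 1) - 1 / q + 1 / (2 - q)) * ‖u‖ₑ ^ q := by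
  rcases eq_or_ne u 0 with rfl | hu
  · have : ∀ k ∈ Ioi (0 : ℝ), ENNReal.ofReal (truncPow 2 k 0 * k ^ (q - 3)) = 0 := by
      intro k hk
      rw [truncPow_two_of_abs_le (le_of_lt hk) (by simpa using (le_of_lt hk))]
      simp
    rw [setLIntegral_congr_fun measurableSet_Ioi this]
    simp [ENNReal.zero_rpow_of_pos (by linarith : 0 < q)]
  set x := |u| with hx
  have hx0 : 0 < x := abs_pos.2 hu
  have hun : Ioi (0 : ℝ) = Ioc 0 x ∪ Ioi x := (Ioc_union_Ioi_eq_Ioi hx0.le).symm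
  have hdis : Disjoint (Ioc 0 x) (Ioi x) := Ioc_disjoint_Ioi le_rfl
  rw [hun, lintegral_union measurableSet_Ioi hdis]
  have i1 : IntervalIntegrable (fun k : ℝ => 2 * x * k ^ (q - 2)) volume 0 x :=
    (intervalIntegral.intervalIntegrable_rpow' (by linarith)).const_mul _
  have i2 : IntervalIntegrable (fun k : ℝ => k ^ (q - 1)) volume 0 x :=
    intervalIntegral.intervalIntegrable_rpow' (by linarith)
  have hI1 : ∫ k in (0 : ℝ)..x, (2 * x * k ^ (q - 2) - k ^ (q - 1)) =
      (2 / (q - 1) - 1 / q) * x ^ q := by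
    rw [intervalIntegral.integral_sub i1 i2, intervalIntegral.integral_const_mul,
      integral_rpow (Or.inl (by linarith)), integral_rpow (Or.inl (by linarith)),
      Real.zero_rpow (by linarith), Real.zero_rpow (by linarith)]
    have e1 : x ^ (q - 2 + 1) * x = x ^ q := by
      rw [← rpow_add_one_of_nonneg hx0.le (by linarith)]
      ring_nf
    have e2 : x ^ (q - 1 + 1) = x ^ q := by ring_nf
    have e3 : q - 2 + 1 = q - 1 := by ring
    have hq0 : q ≠ 0 := by linarith
    have hq10 : q - 1 ≠ 0 := by linarith
    rw [e2, ← e1, e3, sub_add_cancel]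
    field_simp
    ring
  have hI2 : ∫ k in Ioi x, x ^ 2 * k ^ (q - 3) = 1 / (2 - q) * x ^ q := by
    rw [integral_const_mul, integral_Ioi_rpow_of_lt (by linarith) hx0]
    have e1 : x ^ q = x ^ (q - 3 + 1) * x ^ 2 := by
      rw [← Real.rpow_natCast x 2, ← Real.rpow_add hx0]
      congr 1
      push_cast
      ring
    rw [e1]
    have h2 : q - 3 + 1 ≠ 0 := by linarith
    have h3 : 2 - q ≠ 0 := by linarith
    field_simp
    ring
  have l1 : ∫⁻ k in Ioc 0 x, ENNReal.ofReal (truncPow 2 k u * k ^ (q - 3)) =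
      ENNReal.ofReal ((2 / (q - 1) - 1 / q) * x ^ q) := by
    rw [← hI1, intervalIntegral.integral_of_le hx0.le, ofReal_integral_eq_lintegral_ofReal
      ((intervalIntegrable_iff_integrableOn_Ioc_of_le hx0.le).1 (i1.sub i2))]
    · refine setLIntegral_congr_fun measurableSet_Ioc fun k hk => ?_
      rw [truncPow_two_of_le hk.1.le hk.2]
      congr 1
      have e1 : k ^ (q - 2) = k ^ (q - 3) * k := by
        rw [← Real.rpow_add_one hk.1.ne']
        ring_nf
      have e2 : k ^ (q - 1) = k ^ (q - 3) * k * k := by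
        rw [← e1, ← Real.rpow_add_one hk.1.ne']
        ring_nf
      rw [e1, e2]
      ring
    · filter_upwards [ae_restrict_mem measurableSet_Ioc] with k hk
      have e2 : k ^ (q - 1) = k ^ (q - 2) * k := by
        rw [← Real.rpow_add_one hk.1.ne']
        ring_nf
      have h1 := Real.rpow_nonneg hk.1.le (q - 2)
      simp only [Pi.zero_apply]
      rw [e2]
      nlinarith [hk.1, hk.2]
  have l2 : ∫⁻ k in Ioi x, ENNReal.ofReal (truncPow 2 k u * k ^ (q - 3)) =
      ENNReal.ofReal (1 / (2 - q) * x ^ q) := by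
    rw [← hI2, ofReal_integral_eq_lintegral_ofReal
      ((integrableOn_Ioi_rpow_of_lt (by linarith) hx0).const_mul _)]
    · refine setLIntegral_congr_fun measurableSet_Ioi fun k hk => ?_
      rw [truncPow_two_of_abs_le (hx0.trans hk).le (le_of_lt hk)]
    · filter_upwards [ae_restrict_mem measurableSet_Ioi] with k hk
      have := Real.rpow_nonneg (hx0.trans hk).le (q - 3)
      simp only [Pi.zero_apply]
      positivity
  have hc : 0 ≤ 2 / (q - 1) - 1 / q := by
    rw [sub_nonneg, div_le_div_iff₀ (by linarith) (by linarith)]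
    linarith
  have hc2 : 0 ≤ 1 / (2 - q) := div_nonneg zero_le_one (by linarith)
  have hxq := Real.rpow_nonneg hx0.le q
  rw [l1, l2, ← ENNReal.ofReal_add (by positivity) (by positivity), ← add_mul,
    ENNReal.ofReal_mul (by positivity), ← ofReal_norm, Real.norm_eq_abs,
    ENNReal.ofReal_rpow_of_nonneg hx0.le (by linarith)]

lemma measurable_truncPow_two_mul_rpow (q : ℝ) :
    Measurable fun p : ℝ × ℝ => ENNReal.ofReal (truncPow 2 p.2 p.1 * p.2 ^ (q - 3)) :=
  (continuous_truncPow_two_uncurry.measurable.mul (measurable_snd.pow_const _)).ennreal_ofReal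

lemma aemeasurable_comp_prodMk {ν : Measure ℝ} [SFinite μ] [SFinite ν] {G : ℝ × ℝ → ℝ≥0∞}
    (hG : Measurable G) (hf : AEStronglyMeasurable f μ) :
    AEMeasurable (fun z : X × ℝ => G (f z.1, z.2)) (μ.prod ν) :=
  hG.comp_aemeasurable (hf.aemeasurable.comp_fst.prodMk measurable_snd.aemeasurable)

lemma aemeasurable_truncPow_two_mul_rpow_prod [SFinite μ] (hf : AEStronglyMeasurable f μ) (q : ℝ) :
    AEMeasurable (fun z : X × ℝ => ENNReal.ofReal (truncPow 2 z.2 (f z.1) * z.2 ^ (q - 3)))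
      (μ.prod (volume.restrict (Ioi (0 : ℝ)))) :=
  aemeasurable_comp_prodMk (measurable_truncPow_two_mul_rpow q) hf

lemma lintegral_lintegral_truncPow_two [SFinite μ] (hf : AEStronglyMeasurable f μ) {q : ℝ}
    (hq1 : 1 < q) (hq2 : q < 2) :
    ENNReal.ofReal (2 / (q - 1) - 1 / q + 1 / (2 - q)) * ∫⁻ x, ‖f x‖ₑ ^ q ∂μ =
      ∫⁻ k in Ioi (0 : ℝ), ENNReal.ofReal (k ^ (q - 3)) *
        ∫⁻ x, ENNReal.ofReal (truncPow 2 k (f x)) ∂μ := by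
  rw [← lintegral_const_mul' _ _ ENNReal.ofReal_ne_top]
  have h1 : ∀ x, ENNReal.ofReal (2 / (q - 1) - 1 / q + 1 / (2 - q)) * ‖f x‖ₑ ^ q =
      ∫⁻ k in Ioi (0 : ℝ), ENNReal.ofReal (truncPow 2 k (f x) * k ^ (q - 3)) :=
    fun x => (lintegral_truncPow_mul_rpow hq1 hq2 (f x)).symm
  rw [lintegral_congr h1, lintegral_lintegral_swap (aemeasurable_truncPow_two_mul_rpow_prod hf q)]
  refine setLIntegral_congr_fun measurableSet_Ioi fun k hk => ?_
  rw [← lintegral_const_mul' _ _ ENNReal.ofReal_ne_top]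
  refine lintegral_congr fun x => ?_
  rw [mul_comm, ENNReal.ofReal_mul (Real.rpow_nonneg (le_of_lt hk) _)]

lemma lintegral_enorm_rpow_le_of_truncPow [SFinite μ] (hf : AEStronglyMeasurable f μ)
    (hg : AEStronglyMeasurable g μ)
    (h : ∀ k : ℝ, 0 < k → ∫⁻ x, ENNReal.ofReal (truncPow 2 k (f x)) ∂μ ≤
      ∫⁻ x, ENNReal.ofReal (truncPow 2 k (g x)) ∂μ) {q : ℝ} (hq1 : 1 < q) (hq2 : q < 2) :
    ∫⁻ x, ‖f x‖ₑ ^ q ∂μ ≤ ∫⁻ x, ‖g x‖ₑ ^ q ∂μ := by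
  have hC0 : 0 < 2 / (q - 1) - 1 / q + 1 / (2 - q) := by
    have h1 : 0 ≤ 2 / (q - 1) - 1 / q := by
      rw [sub_nonneg, div_le_div_iff₀ (by linarith) (by linarith)]
      linarith
    have h2 : 0 < 1 / (2 - q) := div_pos one_pos (by linarith)
    positivity
  refine (ENNReal.mul_le_mul_iff_right (ENNReal.ofReal_pos.2 hC0).ne' ENNReal.ofReal_ne_top).1 ?_
  rw [lintegral_lintegral_truncPow_two hf hq1 hq2, lintegral_lintegral_truncPow_two hg hq1 hq2]
  exact setLIntegral_mono' measurableSet_Ioi fun k hk => mul_le_mul_right (h k hk) _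

/-- Bounds in `L^n` for all `n` pass to `L^∞`. By Chebyshev's inequality the measure of
`{B ≤ |f|}` is at most `(A / B) ^ n (‖g‖₁ / B)` with `A = ‖g‖_∞ < B`, for every `n`. -/
lemma eLpNorm_top_le_of_forall_nat (hf : AEStronglyMeasurable f μ) (hg : MemLp g 1 μ)
    (h : ∀ n : ℕ, 2 ≤ n → ∫⁻ x, ‖f x‖ₑ ^ n ∂μ ≤ ∫⁻ x, ‖g x‖ₑ ^ n ∂μ) :
    eLpNorm f ∞ μ ≤ eLpNorm g ∞ μ := by
  rw [eLpNorm_exponent_top (f := f)]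
  set A := eLpNorm g ∞ μ with hA
  refine le_of_forall_gt_imp_ge_of_dense fun B hB => ?_
  rcases eq_or_ne B ∞ with rfl | hBt
  · exact le_top
  have hB0 : B ≠ 0 := (bot_le.trans_lt hB).ne'
  set G := ∫⁻ x, ‖g x‖ₑ ∂μ with hG
  have hGt : G ≠ ∞ := by
    rw [hG, ← eLpNorm_one_eq_lintegral_enorm]
    exact hg.2.ne
  have hgA : ∀ᵐ x ∂μ, ‖g x‖ₑ ≤ A := by
    rw [hA, eLpNorm_exponent_top]
    exact enorm_ae_le_eLpNormEssSup g μ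
  have hAB : A / B < 1 := (ENNReal.div_lt_iff (Or.inl hB0) (Or.inl hBt)).2 (by rwa [one_mul])
  have hn : ∀ n : ℕ, 1 ≤ n → μ {x | B ≤ ‖f x‖ₑ} ≤ (A / B) ^ n * (G / B) := by
    intro n hn
    have h1 : B ^ (n + 1) * μ {x | B ^ (n + 1) ≤ ‖f x‖ₑ ^ (n + 1)} ≤ ∫⁻ x, ‖f x‖ₑ ^ (n + 1) ∂μ :=
      mul_meas_ge_le_lintegral₀ (hf.enorm.pow_const _) _
    have h2 : ∫⁻ x, ‖g x‖ₑ ^ (n + 1) ∂μ ≤ A ^ n * G := by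
      rw [hG, ← lintegral_const_mul'' _ hg.1.enorm]
      refine lintegral_mono_ae (hgA.mono fun x hx => ?_)
      rw [pow_succ]
      gcongr
    have hset : {x | B ^ (n + 1) ≤ ‖f x‖ₑ ^ (n + 1)} = {x | B ≤ ‖f x‖ₑ} := by
      ext x
      exact ENNReal.pow_le_pow_left_iff n.succ_ne_zero
    rw [hset] at h1
    have h3 := h1.trans ((h (n + 1) (by omega)).trans h2)
    have hBn : B ^ (n + 1) ≠ 0 := pow_ne_zero _ hB0
    have hBnt : B ^ (n + 1) ≠ ∞ := ENNReal.pow_ne_top hBt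
    rw [mul_comm, ← ENNReal.le_div_iff_mul_le (Or.inl hBn) (Or.inl hBnt)] at h3
    refine h3.trans (le_of_eq ?_)
    rw [ENNReal.div_eq_inv_mul, ENNReal.div_eq_inv_mul, ENNReal.div_eq_inv_mul, mul_pow, pow_succ,
      ENNReal.mul_inv (Or.inr hBt) (Or.inr hB0), ← ENNReal.inv_pow]
    ring
  have hlim : Tendsto (fun n => (A / B) ^ n * (G / B)) atTop (𝓝 0) := by
    have h1 := ENNReal.Tendsto.mul_const (ENNReal.tendsto_pow_atTop_nhds_zero_of_lt_one hAB)
      (b := G / B) (Or.inr (ENNReal.div_ne_top hGt hB0))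
    rwa [zero_mul] at h1
  have h0 : μ {x | B ≤ ‖f x‖ₑ} = 0 := le_antisymm (ge_of_tendsto hlim (by
    filter_upwards [eventually_ge_atTop 1] with n hn1 using hn n hn1)) zero_le
  refine essSup_le_of_ae_le _ ?_
  have : ∀ᵐ x ∂μ, ¬ B ≤ ‖f x‖ₑ := by
    rwa [ae_iff, show {x | ¬¬B ≤ ‖f x‖ₑ} = {x | B ≤ ‖f x‖ₑ} by simp]
  exact this.mono fun x hx => (not_le.1 hx).le

end LebesgueNormComparison

/-! ### Bounds for weak solutions -/

section Conclusions

variable {α : ℝ} {T r r' : ℝ≥0∞} {v : ℝ → EuclideanSpace ℝ (Fin d) → EuclideanSpace ℝ (Fin d)}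
  {δ : ℝ → EuclideanSpace ℝ (Fin d) → ℝ} {ψ₀ : EuclideanSpace ℝ (Fin d) → ℝ}
  {ψ : ℝ → EuclideanSpace ℝ (Fin d) → ℝ}

lemma iSup_eLpNorm_clamp_rpow {X : Type*} [MeasurableSpace X] {μ : Measure X} {f : X → ℝ}
    (hf : AEStronglyMeasurable f μ) (m : ℝ≥0∞) {q : ℝ} (hq : 0 ≤ q) :
    ⨆ n : ℕ, eLpNorm (fun x => clamp ((n : ℝ) + 1) (f x)) m μ ^ q = eLpNorm f m μ ^ q := by
  have h1 : Monotone fun n : ℕ => eLpNorm (fun x => clamp ((n : ℝ) + 1) (f x)) m μ ^ q :=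
    fun a b hab => ENNReal.rpow_le_rpow (monotone_eLpNorm_clamp f m hab) hq
  have h2 : Tendsto (fun n : ℕ => eLpNorm (fun x => clamp ((n : ℝ) + 1) (f x)) m μ ^ q) atTop
      (𝓝 (eLpNorm f m μ ^ q)) :=
    ((ENNReal.continuous_rpow_const).tendsto _).comp (tendsto_eLpNorm_clamp hf m)
  exact tendsto_nhds_unique (tendsto_atTop_iSup h1) h2

/-- The norm in the Sobolev inequality of the square root of the entropy is the norm with exponent
`d q / (d - α)` of the truncated solution. -/
lemma eLpNorm_abs_clamp_rpow_sq {q : ℝ} (hd : α < d) (hq : 2 ≤ q) (k : ℝ)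
    (f : EuclideanSpace ℝ (Fin d) → ℝ) :
    eLpNorm (fun x => |clamp k (f x)| ^ (q / 2))
      (ENNReal.ofReal (2 * d / (d - 2 * (α / 2)))) volume ^ 2 =
      eLpNorm (fun x => clamp k (f x)) (ENNReal.ofReal (d * q / (d - α))) volume ^ q := by
  have h0 : 0 ≤ 2 * (d : ℝ) / (d - 2 * (α / 2)) := div_nonneg (by positivity) (by linarith)
  have h1 := eLpNorm_norm_rpow (p := ENNReal.ofReal (2 * d / (d - 2 * (α / 2)))) (μ := volume)
    (fun x => clamp k (f x)) (by linarith : 0 < q / 2)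
  simp only [Real.norm_eq_abs] at h1
  rw [h1, ← ENNReal.rpow_natCast, ← ENNReal.rpow_mul, ← ENNReal.ofReal_mul h0]
  congr 1
  · congr 2
    have : (d : ℝ) - α ≠ 0 := by linarith
    rw [mul_div_cancel₀ α (two_ne_zero)]
    field_simp
  · push_cast
    ring

/-- The `L^q` balance with dissipation, obtained from the truncated powers by letting the
truncation level tend to infinity. -/
theorem IsWeakSolution.eLpNorm_rpow_le [Nonempty (Fin d)] (hv : IsTransportField T r' v δ)
    (hr : r⁻¹ + r'⁻¹ = 1) (hα : 0 < α) (hα2 : α ≤ 2) (hd : α < d)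
    (hψ : IsWeakSolution α T r v ψ₀ ψ) (hψ₀ : MemLp ψ₀ 1 volume)
    (hreg : IsSobolevField T r' v ∨ IsRegularSolution T r ψ₀ ψ) {q : ℝ} (hq : 2 ≤ q)
    (hsmall : ∀ᵐ s ∂((volume : Measure ℝ).restrict (timeInterval T)), ENNReal.ofReal (q - 1) *
      eLpNorm (fun x => max (-(δ s x)) 0) (ENNReal.ofReal (d / α)) volume ≤
        sobolevConst d (α / 2)) {t : ℝ} (ht : t ∈ timeInterval T) :
    (∫⁻ s in Ioc 0 t, sobolevConst d (α / 2) *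
      eLpNorm (ψ s) (ENNReal.ofReal (d * q / (d - α))) volume ^ q) +
      eLpNorm (ψ t) (ENNReal.ofReal q) volume ^ q ≤
      eLpNorm ψ₀ (ENNReal.ofReal q) volume ^ q := by
  have hq0 : 0 < q := by linarith
  have hψm := hψ.measurable.mono_ac
    (prod_restrict_absolutelyContinuous_spaceTime (d := d) le_rfl ht)
  set σ := ENNReal.ofReal (d * q / (d - α)) with hσ
  have hmono : ∀ (f : EuclideanSpace ℝ (Fin d) → ℝ) (m : ℝ≥0∞),
      Monotone fun n : ℕ => eLpNorm (fun x => clamp ((n : ℝ) + 1) (f x)) m volume ^ q :=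
    fun f m a b hab => ENNReal.rpow_le_rpow (monotone_eLpNorm_clamp f m hab) hq0.le
  have hX : ∫⁻ s in Ioc 0 t, sobolevConst d (α / 2) * eLpNorm (ψ s) σ volume ^ q =
      ⨆ n : ℕ, ∫⁻ s in Ioc 0 t, sobolevConst d (α / 2) *
        eLpNorm (fun x => clamp ((n : ℝ) + 1) (ψ s x)) σ volume ^ q := by
    rw [← lintegral_iSup']
    · refine setLIntegral_congr_fun measurableSet_Ioc fun s hs => ?_
      rw [← iSup_eLpNorm_clamp_rpow
        (hψ.measurable_slice s (mem_timeInterval_of_le hs.1.le hs.2 ht)) σ hq0.le,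
        ENNReal.mul_iSup]
    · intro n
      have h1 : AEStronglyMeasurable
          (Function.uncurry fun (s : ℝ) x => clamp ((n : ℝ) + 1) (ψ s x))
          (((volume : Measure ℝ).restrict (Ioc 0 t)).prod volume) :=
        (continuous_clamp _).comp_aestronglyMeasurable hψm
      exact ((aemeasurable_eLpNorm_of_prod h1 σ).pow_const q).const_mul _
    · exact Eventually.of_forall fun s a b hab => mul_le_mul_right (hmono (ψ s) σ hab) _
  rw [hX, ← iSup_eLpNorm_clamp_rpow (hψ.measurable_slice t ht) (ENNReal.ofReal q) hq0.le,
    ENNReal.iSup_add_iSup_of_monotone (fun a b hab => lintegral_mono fun s =>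
      mul_le_mul_right (hmono (ψ s) σ hab) _) (hmono (ψ t) _)]
  refine iSup_le fun n => ?_
  have hk : (0 : ℝ) < (n : ℝ) + 1 := by positivity
  have h1 := hψ.entropy_le hv hr hα hα2 hd hψ₀ hreg (isEntropy_truncPow hq hk) hsmall ht
  simp only [eLpNorm_abs_clamp_rpow_sq hd hq] at h1
  refine (add_le_add le_rfl ?_).trans (h1.trans ?_)
  · rw [eLpNorm_ofReal_rpow hq0]
    refine lintegral_mono fun x => ?_
    rw [← ofReal_norm, Real.norm_eq_abs, ENNReal.ofReal_rpow_of_nonneg (abs_nonneg _) hq0.le]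
    exact ENNReal.ofReal_le_ofReal (abs_clamp_rpow_le_truncPow hq hk.le _)
  · rw [eLpNorm_ofReal_rpow hq0]
    refine lintegral_mono fun x => ?_
    rw [← ofReal_norm, Real.norm_eq_abs, ENNReal.ofReal_rpow_of_nonneg (abs_nonneg _) hq0.le]
    exact ENNReal.ofReal_le_ofReal (truncPow_le hq _ _)

/-- Monotonicity of the finite Lebesgue norms. For `q < 2` the weight `q - 1` in the smallness
condition degenerates, and the truncated squares give the bound from the condition with weight
`1`. -/
theorem IsWeakSolution.eLpNorm_le [Nonempty (Fin d)] (hv : IsTransportField T r' v δ)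
    (hr : r⁻¹ + r'⁻¹ = 1) (hα : 0 < α) (hα2 : α ≤ 2) (hd : α < d)
    (hψ : IsWeakSolution α T r v ψ₀ ψ) (hψ₀ : MemLp ψ₀ 1 volume)
    (hreg : IsSobolevField T r' v ∨ IsRegularSolution T r ψ₀ ψ) {q : ℝ} (hq : 1 ≤ q)
    (hsmall : ∀ᵐ s ∂((volume : Measure ℝ).restrict (timeInterval T)),
      ENNReal.ofReal (max q 2 - 1) *
      eLpNorm (fun x => max (-(δ s x)) 0) (ENNReal.ofReal (d / α)) volume ≤
        sobolevConst d (α / 2)) {t : ℝ} (ht : t ∈ timeInterval T) :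
    eLpNorm (ψ t) (ENNReal.ofReal q) volume ≤ eLpNorm ψ₀ (ENNReal.ofReal q) volume := by
  have hq0 : 0 < q := by linarith
  rcases le_total 2 q with h2 | h2
  · rw [max_eq_left h2] at hsmall
    exact (ENNReal.rpow_le_rpow_iff hq0).1
      (le_add_self.trans (hψ.eLpNorm_rpow_le hv hr hα hα2 hd hψ₀ hreg h2 hsmall ht))
  rw [max_eq_right h2] at hsmall
  have hm := hψ.measurable_slice t ht
  have htrunc : ∀ k : ℝ, 0 < k → ∫⁻ x, ENNReal.ofReal (truncPow 2 k (ψ t x)) ≤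
      ∫⁻ x, ENNReal.ofReal (truncPow 2 k (ψ₀ x)) := fun k hk =>
    le_add_self.trans (hψ.entropy_le hv hr hα hα2 hd hψ₀ hreg
      (isEntropy_truncPow le_rfl hk) hsmall ht)
  rcases hq.eq_or_lt with rfl | h1
  · rw [ENNReal.ofReal_one, eLpNorm_one_eq_lintegral_enorm, eLpNorm_one_eq_lintegral_enorm]
    exact lintegral_enorm_le_of_truncPow hm htrunc
  rcases h2.eq_or_lt with rfl | h2
  · exact (ENNReal.rpow_le_rpow_iff hq0).1
      (le_add_self.trans (hψ.eLpNorm_rpow_le hv hr hα hα2 hd hψ₀ hreg le_rfl hsmall ht))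
  rw [← ENNReal.rpow_le_rpow_iff hq0, eLpNorm_ofReal_rpow hq0, eLpNorm_ofReal_rpow hq0]
  exact lintegral_enorm_rpow_le_of_truncPow hm hψ₀.1 htrunc h1 h2

/-- When the divergence is nonnegative, every `L^q` norm with `1 ≤ q ≤ ∞` is nonincreasing. -/
theorem IsWeakSolution.eLpNorm_le_of_div_nonneg [Nonempty (Fin d)]
    (hv : IsTransportField T r' v δ)
    (hr : r⁻¹ + r'⁻¹ = 1) (hα : 0 < α) (hα2 : α ≤ 2) (hd : α < d)
    (hψ : IsWeakSolution α T r v ψ₀ ψ) (hψ₀ : MemLp ψ₀ 1 volume)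
    (hreg : IsSobolevField T r' v ∨ IsRegularSolution T r ψ₀ ψ)
    (hδ : ∀ᵐ z ∂(spaceTime d T), 0 ≤ δ z.1 z.2) {q : ℝ≥0∞} (hq : 1 ≤ q)
    {t : ℝ} (ht : t ∈ timeInterval T) :
    eLpNorm (ψ t) q volume ≤ eLpNorm ψ₀ q volume := by
  have hzero : ∀ᵐ s ∂((volume : Measure ℝ).restrict (timeInterval T)),
      eLpNorm (fun x => max (-(δ s x)) 0) (ENNReal.ofReal (d / α)) volume = 0 := by
    filter_upwards [Measure.ae_ae_of_ae_prod hδ] with s hs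
    have h1 : (fun x => max (-(δ s x)) 0) =ᵐ[volume] 0 :=
      hs.mono fun x hx => max_eq_right (neg_nonpos.2 hx)
    rw [eLpNorm_congr_ae h1, eLpNorm_zero]
  have hsmall : ∀ c : ℝ, ∀ᵐ s ∂((volume : Measure ℝ).restrict (timeInterval T)),
      ENNReal.ofReal c * eLpNorm (fun x => max (-(δ s x)) 0) (ENNReal.ofReal (d / α)) volume ≤
        sobolevConst d (α / 2) := fun c =>
    hzero.mono fun s hs => by rw [hs, mul_zero]; exact zero_le
  rcases eq_or_ne q ∞ with rfl | hqt
  · refine eLpNorm_top_le_of_forall_nat (hψ.measurable_slice t ht) hψ₀ fun n hn => ?_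
    have hn2 : (2 : ℝ) ≤ n := by exact_mod_cast hn
    have h1 := le_add_self.trans
      (hψ.eLpNorm_rpow_le hv hr hα hα2 hd hψ₀ hreg hn2 (hsmall _) ht)
    rw [eLpNorm_ofReal_rpow (by linarith), eLpNorm_ofReal_rpow (by linarith)] at h1
    simpa only [ENNReal.rpow_natCast] using h1
  · rw [← ENNReal.ofReal_toReal hqt]
    exact hψ.eLpNorm_le hv hr hα hα2 hd hψ₀ hreg
      (ENNReal.toReal_one ▸ ENNReal.toReal_mono hqt hq) (hsmall _) ht

end Conclusions

end

theorem proposition3p3 (d : ℕ) (α : ℝ) (hα : 0 < α) (hα2 : α ≤ 2) (hd : α < d)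
    (p : ℝ) (hp : 2 ≤ p) (hp2 : α < 2 → ∃ n : ℕ, p = 2 ^ n)
    (T : ℝ≥0∞) (r r' : ℝ≥0∞) (hr : r⁻¹ + r'⁻¹ = 1)
    (v : ℝ → EuclideanSpace ℝ (Fin d) → EuclideanSpace ℝ (Fin d))
    (δ : ℝ → EuclideanSpace ℝ (Fin d) → ℝ) (hv : IsTransportField T r' v δ)
    (hsmall : ENNReal.ofReal (p - 1) *
        essSup (fun s => eLpNorm (fun x => max (-(δ s x)) 0) (ENNReal.ofReal (d / α)) volume)
          (volume.restrict (timeInterval T))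
      ≤ sobolevConst d (α / 2))
    (ψ₀ : EuclideanSpace ℝ (Fin d) → ℝ) (hψ₀1 : MemLp ψ₀ 1 volume)
    (hψ₀p : MemLp ψ₀ (ENNReal.ofReal p) volume)
    (ψ : ℝ → EuclideanSpace ℝ (Fin d) → ℝ) (hψ : IsWeakSolution α T r v ψ₀ ψ)
    (hreg : IsSobolevField T r' v ∨ IsRegularSolution T r ψ₀ ψ) :
    (∀ s ∈ timeInterval T,
      eLpNorm (ψ s) (ENNReal.ofReal p) volume ^ p +
        sobolevConst d (α / 2) *
          ∫⁻ τ in Ioc 0 s, eLpNorm (ψ τ) (ENNReal.ofReal (d * p / (d - α))) volume ^ p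
      ≤ eLpNorm ψ₀ (ENNReal.ofReal p) volume ^ p) ∧
    (∀ q : ℝ≥0∞, 1 ≤ q → q ≤ ENNReal.ofReal p → ∀ s ∈ timeInterval T,
      eLpNorm (ψ s) q volume ≤ eLpNorm ψ₀ q volume) ∧
    ((∀ᵐ z ∂(spaceTime d T), 0 ≤ δ z.1 z.2) →
      ∀ q : ℝ≥0∞, 1 ≤ q → ∀ s ∈ timeInterval T,
        eLpNorm (ψ s) q volume ≤ eLpNorm ψ₀ q volume) := by
  have : Nonempty (Fin d) := by
    rcases Nat.eq_zero_or_pos d with rfl | h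
    · norm_num at hd
      linarith
    · exact ⟨⟨0, h⟩⟩
  have hsm : ∀ c ≤ p - 1, ∀ᵐ s ∂((volume : Measure ℝ).restrict (timeInterval T)),
      ENNReal.ofReal c * eLpNorm (fun x => max (-(δ s x)) 0) (ENNReal.ofReal (d / α)) volume ≤
        sobolevConst d (α / 2) := by
    intro c hc
    filter_upwards [ENNReal.ae_le_essSup fun s =>
      eLpNorm (fun x => max (-(δ s x)) 0) (ENNReal.ofReal (d / α)) volume] with s hs
    exact (mul_le_mul' (ENNReal.ofReal_le_ofReal hc) hs).trans hsmall
  refine ⟨fun s hs => ?_, fun q hq1 hqp s hs => ?_, fun hδ q hq s hs =>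
    hψ.eLpNorm_le_of_div_nonneg hv hr hα hα2 hd hψ₀1 hreg hδ hq hs⟩
  · have hψm := hψ.measurable.mono_ac
      (prod_restrict_absolutelyContinuous_spaceTime (d := d) le_rfl hs)
    rw [← lintegral_const_mul'' _ ((aemeasurable_eLpNorm_of_prod hψm _).pow_const p), add_comm]
    exact hψ.eLpNorm_rpow_le hv hr hα hα2 hd hψ₀1 hreg hp (hsm _ le_rfl) hs
  · have hqt : q ≠ ∞ := (hqp.trans_lt ENNReal.ofReal_lt_top).ne
    have hqp' : q.toReal ≤ p := ENNReal.toReal_le_of_le_ofReal (by linarith) hqp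
    rw [← ENNReal.ofReal_toReal hqt]
    exact hψ.eLpNorm_le hv hr hα hα2 hd hψ₀1 hreg (ENNReal.toReal_one ▸ ENNReal.toReal_mono hqt hq1)
      (hsm _ (sub_le_sub_right (max_le hqp' hp) 1)) hs
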